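/- For $N\ge 1$ let $d\mu(\Phi)=\pi^{-N^2}e^{-\mathrm{Tr}\,\Phi^\star\Phi}\prod_{i,j}d\,\Re\Phi_{ij}\,d\,\Im\Phi_{ij}$ be the normalized Gaussian measure on complex $N\times N$ matrices with covariance $\langle\bar\Phi_{ij}\Phi_{kl}\rangle=\delta_{ik}\delta_{jl}$, $\langle\Phi_{ij}\Phi_{kl}\rangle=0$, and let $$Z(\lambda,N)=\int e^{-\frac{\lambda}{N}\mathrm{Tr}\,\Phi^\star\Phi\Phi^\star\Phi}\,d\mu(\Phi).$$ For $R>0$ put $D_R=\{\lambda\in\mathbb C:\ \mathrm{Re}\,\lambda^{-1}>1/R\}$. A family $(f_N)_{N\ge1}$ is called Borel summable in $\lambda$ uniformly in $N$ if there are $R>0$ and $\sigma\ge0$ independent of $N$, constants $A_N\ge0$, and coefficients $a_{N,k}\in\mathbb C$ such that every $f_N$ is analytic in $D_R$ and $$\Big|f_N(\lambda)-\sum_{k=0}^{r-1}a_{N,k}\lambda^k\Big|\le A_N\,\sigma^r\,r!\,|\lambda|^r\qquad\text{for all }r\ge0,\ \lambda\in D_R .$$ For a Hermitian $N\times N$ matrix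 $\sigma$ let $H(\sigma)=\sqrt{2\lambda/N}\,\sigma$ (principal root) and $V(\sigma)=-\mathrm{Tr}\log(1\otimes1+1\otimes iH(\sigma))$ (principal logarithm). The tree series is $$F_N(\lambda)=\sum_{n\ge1}\frac1{n!}\sum_T\Big\{\prod_{\ell\in T}\int_0^1dw_\ell\Big\}\int d\nu_T(\{\sigma^v\},\{w\})\ \Big\{\prod_{\ell\in T}\sum_{i,j}\frac{\partial}{\partial\sigma^{v(\ell)}_{ij}}\frac{\partial}{\partial\sigma^{v'(\ell)}_{ji}}\Big\}\prod_{v=1}^nV(\sigma^v),$$ where $T$ runs over the labelled trees on $\{1,\dots,n\}$, the line $\ell$ of $T$ joins the vertices $v(\ell)$ and $v'(\ell)$, and $\nu_T$ is the centered Gaussian measure on $n$-tuples of Hermitian $N\times N$ matrices with covariance $\langle\sigma^v_{ij}\sigma^{v'}_{kl}\rangle=\delta_{il}\delta_{jk}\,w^T(v,v')$, with $w^T(v,v)=1$ and, for $v\ne v'$, $w^T(v,v')$ the minimum of $w_\ell$ over the lines $\ell$ of the path from $v$ to $v'$ in $T$. Then: 1. The family $Z(\cdot,N)$, $N\ge1$,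 is Borel summable in $\lambda$ uniformly in $N$. 2. Its logarithm is given by the tree series and is Borel summable uniformly in $N$, with $A_N=KN^2$. Precisely, there are $R>0$, $\sigma\ge0$ and $K\ge0$, independent of $N$, such that for every $N\ge1$: for all $\lambda\in D_R$ all the integrals in the tree series exist, the series over $n$ and $T$ converges absolutely, and $e^{F_N(\lambda)}=Z(\lambda,N)$; $F_N(\lambda)\to0$ as $\lambda\to0$ in $D_R$; $F_N$ is analytic in $D_R$; and there are coefficients $a_{N,k}$ with $$\Big|F_N(\lambda)-\sum_{k=0}^{r-1}a_{N,k}\lambda^k\Big|\le K\,N^2\,\sigma^r\,r!\,|\lambda|^r\qquad\text{for all }r\ge0,\ \lambda\in D_R .$$ -/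

import Mathlib

open MeasureTheory ProbabilityTheory Filter Topology
open scoped Kronecker Nat Matrix

noncomputable section

/-! ### Uniform Borel summability -/

/-- The open disk `{z | Re z⁻¹ > 1 / R}`, tangent to the imaginary axis at the origin
(for `R > 0` the point `0` does not belong to it). -/
def borelDisk (R : ℝ) : Set ℂ := {z | 1 / R < (z⁻¹).re}

/-- Every `f N`, `N ≥ 1`, is analytic in `borelDisk R` and has an asymptotic power series whose
remainders satisfy `|R_{N,r}(z)| ≤ A N * s ^ r * r! * |z| ^ r`, uniformly in `r` and
`z ∈ borelDisk R`. -/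
def HasBorelBounds (f : ℕ → ℂ → ℂ) (R s : ℝ) (A : ℕ → ℝ) : Prop :=
  ∀ N : ℕ, 1 ≤ N →
    AnalyticOnNhd ℂ (f N) (borelDisk R) ∧
    ∃ a : ℕ → ℂ, ∀ r : ℕ, ∀ z ∈ borelDisk R,
      ‖f N z - ∑ k ∈ Finset.range r, a k * z ^ k‖ ≤ A N * s ^ r * (r ! : ℝ) * ‖z‖ ^ r

/-- Borel summability of a family `f N`, `N ≥ 1`, uniformly in `N`: the disk and the constant `s`
do not depend on `N`, while the constants `A N` may. -/
def UniformlyBorelSummable (f : ℕ → ℂ → ℂ) : Prop :=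
  ∃ R : ℝ, 0 < R ∧ ∃ s : ℝ, 0 ≤ s ∧ ∃ A : ℕ → ℝ, (∀ N, 0 ≤ A N) ∧ HasBorelBounds f R s A

/-! ### The quartic complex matrix model -/

/-- The normalized Gaussian measure `π ^ (-N²) exp (-Tr Φ* Φ) ∏ d(Re Φ i j) d(Im Φ i j)` on
complex `N × N` matrices, whose covariance is `⟨conj (Φ i j) Φ k l⟩ = δ i k δ j l`,
`⟨Φ i j Φ k l⟩ = 0`. -/
def complexMatrixGaussian (N : ℕ) : Measure (Fin N → Fin N → ℂ) :=
  (volume : Measure (Fin N → Fin N → ℂ)).withDensity fun Φ =>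
    ENNReal.ofReal ((Real.pi ^ (N ^ 2))⁻¹ *
      Real.exp (-(Matrix.trace ((Matrix.of Φ)ᴴ * Matrix.of Φ)).re))

/-- The partition function `Z(z, N) = ∫ exp (-(z / N) Tr Φ* Φ Φ* Φ) dμ(Φ)`. -/
def partitionFunction (N : ℕ) (z : ℂ) : ℂ :=
  ∫ Φ, Complex.exp (-(z / (N : ℂ)) * Matrix.trace
    ((Matrix.of Φ)ᴴ * Matrix.of Φ * (Matrix.of Φ)ᴴ * Matrix.of Φ)) ∂(complexMatrixGaussian N)

/-! ### Loop vertices -/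

/-- `Tr log A`, with the principal logarithm: the sum of `log μ` over the eigenvalues `μ` of `A`,
counted with algebraic multiplicity. -/
def traceLog {m : Type*} [Fintype m] [DecidableEq m] (A : Matrix m m ℂ) : ℂ :=
  (A.charpoly.roots.map Complex.log).sum

/-- `H(σ) = √(2 z / N) σ`, the intermediate field insertion (principal square root). -/
def fieldInsertion (N : ℕ) (z : ℂ) (σ : Matrix (Fin N) (Fin N) ℂ) : Matrix (Fin N) (Fin N) ℂ :=
  Complex.sqrt (2 * z / (N : ℂ)) • σ

/-- The loop vertex `V(σ) = -Tr log (1 ⊗ 1 + 1 ⊗ i H(σ))`, a function of the matrix `σ`. -/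
def loopVertex (N : ℕ) (z : ℂ) (σ : Matrix (Fin N) (Fin N) ℂ) : ℂ :=
  -traceLog ((1 : Matrix (Fin N) (Fin N) ℂ) ⊗ₖ (1 : Matrix (Fin N) (Fin N) ℂ) +
    (1 : Matrix (Fin N) (Fin N) ℂ) ⊗ₖ (Complex.I • fieldInsertion N z σ))

/-- The partial derivative `∂ / ∂ (σ v i j)` of a function of `n` matrices, the entries of the
matrices being treated as independent complex variables. -/
def fieldDeriv {n N : ℕ} (v : Fin n) (i j : Fin N)
    (F : (Fin n → Matrix (Fin N) (Fin N) ℂ) → ℂ) : (Fin n → Matrix (Fin N) (Fin N) ℂ) → ℂ :=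
  fun σ => lineDeriv ℂ F σ (Pi.single v (Matrix.single i j 1))

/-- The operator of a tree line joining `e.1` and `e.2`:
`∑_{i j k l} δ i l δ j k ∂ / ∂ (σ e.1 i j) ∂ / ∂ (σ e.2 k l)`. -/
def lineOperator {n N : ℕ} (e : Fin n × Fin n)
    (F : (Fin n → Matrix (Fin N) (Fin N) ℂ) → ℂ) : (Fin n → Matrix (Fin N) (Fin N) ℂ) → ℂ :=
  fun σ => ∑ i : Fin N, ∑ j : Fin N, fieldDeriv e.1 i j (fieldDeriv e.2 j i F) σ

open Classical in
/-- The lines of the graph `T`, each listed once (as the pair of its endpoints in increasing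
order). -/
def lineList {n : ℕ} (T : SimpleGraph (Fin n)) : List (Fin n × Fin n) :=
  (Finset.univ.filter fun e : Fin n × Fin n => e.1 < e.2 ∧ T.Adj e.1 e.2).toList

/-- The product of the line operators of all lines of `T`, applied to `∏ v, V(σ v)`. -/
def treeIntegrand (N : ℕ) (z : ℂ) {n : ℕ} (T : SimpleGraph (Fin n)) :
    (Fin n → Matrix (Fin N) (Fin N) ℂ) → ℂ :=
  (lineList T).foldr (fun e F => lineOperator e F) (fun σ => ∏ v, loopVertex N z (σ v))

/-! ### The interpolated Gaussian measure -/

open Classical in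
/-- `w^T(v, v')`: equal to `1` if `v = v'`, and otherwise the infimum of `w ℓ` over the lines `ℓ`
of the path from `v` to `v'` in the tree `T`. -/
def treeWeight {n : ℕ} (T : SimpleGraph (Fin n)) (w : T.edgeSet → ℝ) :
    Matrix (Fin n) (Fin n) ℝ :=
  Matrix.of fun v v' => if v = v' then 1 else
    sInf (w '' {ℓ : T.edgeSet | ∃ p : T.Walk v v', p.IsPath ∧ (ℓ : Sym2 (Fin n)) ∈ p.edges})

/-- Real coordinates on Hermitian matrices, one real number per matrix entry:
`σ i j = ((1 + i) x i j + (1 - i) x j i) / 2`. This is a linear bijection from real `N × N`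
arrays onto Hermitian matrices with `Tr σ² = ∑ i j, (x i j)²`; independent standard Gaussian
`x i j` give the covariance `⟨σ i j σ k l⟩ = δ i l δ j k`. -/
def hermitianOfCoords {N : ℕ} (x : Fin N × Fin N → ℝ) : Matrix (Fin N) (Fin N) ℂ :=
  Matrix.of fun i j => ((1 + Complex.I) * (x (i, j) : ℂ) + (1 - Complex.I) * (x (j, i) : ℂ)) / 2

/-- The `n` Hermitian matrices with coordinates `x`. -/
def fieldsOfCoords {n N : ℕ} (x : EuclideanSpace ℝ (Fin n × (Fin N × Fin N))) :
    Fin n → Matrix (Fin N) (Fin N) ℂ :=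
  fun v => hermitianOfCoords fun ij => x (v, ij)

/-- The centered Gaussian measure of the `n` Hermitian fields `σ v` with covariance
`⟨σ v i j σ v' k l⟩ = δ i l δ j k w^T(v, v')`, in the coordinates of `fieldsOfCoords`, where its
covariance matrix is `w^T ⊗ 1`. -/
def treeGaussian (N : ℕ) {n : ℕ} (T : SimpleGraph (Fin n)) (w : T.edgeSet → ℝ) :
    Measure (EuclideanSpace ℝ (Fin n × (Fin N × Fin N))) :=
  multivariateGaussian 0 (treeWeight T w ⊗ₖ (1 : Matrix (Fin N × Fin N) (Fin N × Fin N) ℝ))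

/-! ### The tree series -/

/-- The Gaussian expectation of the integrand of the tree `T` at the parameters `w`. -/
def treeExpectation (N : ℕ) (z : ℂ) {n : ℕ} (T : SimpleGraph (Fin n)) (w : T.edgeSet → ℝ) : ℂ :=
  ∫ x, treeIntegrand N z T (fieldsOfCoords x) ∂(treeGaussian N T w)

open Classical in
/-- The contribution of the tree `T`: the expectation integrated over all `w ℓ ∈ [0, 1]`. -/
def treeAmplitude (N : ℕ) (z : ℂ) {n : ℕ} (T : SimpleGraph (Fin n)) : ℂ :=
  ∫ w in Set.Icc (0 : T.edgeSet → ℝ) 1, treeExpectation N z T w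

open Classical in
/-- The labelled trees on `n` vertices. -/
def treesOn (n : ℕ) : Finset (SimpleGraph (Fin n)) :=
  Finset.univ.filter fun T => T.IsTree

open Classical in
/-- All the integrals in the tree series exist, and the sum over `n` and over trees is absolutely
convergent. -/
def TreeSeriesConverges (N : ℕ) (z : ℂ) : Prop :=
  (∀ n : ℕ, ∀ T ∈ treesOn n,
    (∀ w ∈ Set.Icc (0 : T.edgeSet → ℝ) 1,
      Integrable (fun x => treeIntegrand N z T (fieldsOfCoords x)) (treeGaussian N T w)) ∧
    IntegrableOn (fun w => treeExpectation N z T w) (Set.Icc (0 : T.edgeSet → ℝ) 1)) ∧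
  Summable fun n : ℕ => ((n ! : ℝ))⁻¹ * ∑ T ∈ treesOn n, ‖treeAmplitude N z T‖

/-- The sum of the tree series `∑_{n ≥ 1} (1 / n!) ∑_T (amplitude of T)`; there is no tree on `0`
vertices, so the term `n = 0` vanishes. -/
def treeSeries (N : ℕ) (z : ℂ) : ℂ :=
  ∑' n : ℕ, ((n ! : ℂ))⁻¹ * ∑ T ∈ treesOn n, treeAmplitude N z T

end

/-!
# Constructive loop vertex expansion of the quartic matrix model

The quartic interaction is first linearized. Since `exp (-(g² / 2) Tr A²)` is the characteristic
function of a Hermitian Gaussian field `σ`, with `g = √(2 z / N)` and `A = Φ* Φ`, exchanging the two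
Gaussian integrals leaves a Gaussian integral over `Φ` that is an inverse determinant. This gives
`Z = ⟨exp V(σ)⟩` with `V(σ) = -N Tr log (1 + i g σ)` for positive couplings, and for all couplings
with `Re z > 0` by analytic continuation (`partitionFunction_eq`). On the half-plane `Re z > 0` the
coupling `g` lies in the sector `‖g‖ ≤ 2 Re g`, where the resolvents of Hermitian matrices are
bounded by `2`, so that `V` grows at most linearly in `σ`.

The logarithm is found by the replica method. The heat equation for Gaussian expectations
(`fieldMean_sub`) turns a change of covariance into line operators, and iterating it gives the
forest formula (`sum_forestAmplitude`): the expectation with fields identified along the classes of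
a colouring is a sum over the forests that respect the colouring. Summed over all colourings by `k`
colours, each forest is weighted by `k` to the number of its trees; hence the coefficients of
`(∑ ⟨V ^ n⟩ x ^ n / n!) ^ k` are polynomials in `k`, whose linear coefficients are the sums over
trees. This is the logarithmic derivative equation of `sum_treeAmplitude_recursion`, which
determines the exponential once the series over trees converges (`exp_treeSeries`).

For the convergence a tree is grown from a root. Every new vertex replaces one resolvent `R_p` of a
trace of a product of resolvents by `R_p R_v R_p`; hence the derivatives along the `m` lines of a
tree leave `N (-2 z) ^ m` times a sum of traces of products of `2 m` resolvents, one for each word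
that is read off by walking around the tree (`lineOperators_growth`). The number of words is at most
`∏ k_x!`, with `k_x` the number of children of the vertex `x`, and the sum of these products over
all trees is at most `4 ^ m m!` (`sum_childWeight_treeParent_le`), which the `1 / n!` of the series
absorbs. The contribution of the trees with `m` lines is thus of order `N ² (C ‖z‖) ^ m`.

The expansion in `z` of a single tree comes from a Taylor expansion in `g`. At fixed fields the
trace of a product of resolvents is holomorphic in `g` in a disk of radius of order `1 / ‖σ‖`, and
its remainder of order `2 r` is bounded by `(C ‖g‖ ‖σ‖) ^ (2 r)`. Because the norm of the field is
of order `√N`, `⟨‖σ‖ ^ (2 r)⟩` is at most `75 (50 N) ^ r r!` (`integral_norm_pow_le`); the power of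
`N` cancels against `g² = 2 z / N`, and what remains is the factor `r!`, uniform in `N`. Odd orders
vanish by the symmetry `σ → -σ` (`FieldFamily.exists_expansion`). The tree `T` with `m` lines carries
an explicit factor `z ^ m`, so these expansions can be added (`exists_asymptotic_tsum`,
`treeSeries_expansion`).

The bounds on `Z` itself need no such expansion: the Taylor remainder of `exp` in the left
half-plane is at most the first omitted term, whose Gaussian expectation is bounded by `16 ^ r r!`
times a constant that depends on `N` (`hasBorelBounds_partitionFunction`).
-/

noncomputable section
/-! ### Gaussian integrals -/

/-- The law of a family of independent standard real Gaussian variables. -/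
abbrev stdGaussianPi (κ : Type*) [Fintype κ] : Measure (κ → ℝ) :=
  Measure.pi fun _ => gaussianReal 0 1

/-- Polynomial growth of a function on a normed space. -/
def PolyGrowth {E F : Type*} [NormedAddCommGroup E] [NormedAddCommGroup F] (f : E → F) : Prop :=
  ∃ C : ℝ, ∃ k : ℕ, ∀ x, ‖f x‖ ≤ C * (1 + ‖x‖) ^ k

theorem PolyGrowth.exists_nonneg {E F : Type*} [NormedAddCommGroup E] [NormedAddCommGroup F]
    {f : E → F} (h : PolyGrowth f) : ∃ C : ℝ, 0 ≤ C ∧ ∃ k : ℕ, ∀ x, ‖f x‖ ≤ C * (1 + ‖x‖) ^ k := by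
  obtain ⟨C, k, h⟩ := h
  refine ⟨|C|, abs_nonneg _, k, fun x => (h x).trans ?_⟩
  gcongr
  exact le_abs_self C

theorem PolyGrowth.mul {E : Type*} [NormedAddCommGroup E] {f g : E → ℂ}
    (hf : PolyGrowth f) (hg : PolyGrowth g) : PolyGrowth fun x => f x * g x := by
  obtain ⟨C, hC, k, hf⟩ := hf.exists_nonneg
  obtain ⟨D, hD, l, hg⟩ := hg.exists_nonneg
  refine ⟨C * D, k + l, fun x => ?_⟩
  rw [norm_mul, pow_add]
  calc ‖f x‖ * ‖g x‖ ≤ (C * (1 + ‖x‖) ^ k) * (D * (1 + ‖x‖) ^ l) := by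
        gcongr
        · exact hf x
        · exact hg x
    _ = _ := by ring

theorem PolyGrowth.comp_linear {E E' F : Type*} [NormedAddCommGroup E] [NormedAddCommGroup F]
    [NormedAddCommGroup E'] {f : E → F} (hf : PolyGrowth f) {A : E' → E} {a : ℝ}
    (hA : ∀ x, ‖A x‖ ≤ a * ‖x‖) : PolyGrowth fun x => f (A x) := by
  obtain ⟨C, hC, k, hf⟩ := hf.exists_nonneg
  refine ⟨C * (1 + |a|) ^ k, k, fun x => (hf _).trans ?_⟩
  rw [mul_assoc, ← mul_pow]
  gcongr
  have := hA x
  have h2 := le_abs_self a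
  nlinarith [norm_nonneg x, abs_nonneg a]

theorem integrable_exp_norm_stdGaussianPi {κ : Type*} [Fintype κ] (a : ℝ) :
    Integrable (fun x : κ → ℝ => Real.exp (a * ‖x‖)) (stdGaussianPi κ) := by
  have h1 : Integrable (fun x : κ → ℝ => ∏ i, (Real.exp (|a| * x i) + Real.exp (-|a| * x i)))
      (stdGaussianPi κ) :=
    Integrable.fintype_prod (f := fun (_ : κ) (y : ℝ) => Real.exp (|a| * y) + Real.exp (-|a| * y))
      fun i => (integrable_exp_mul_gaussianReal _).add (integrable_exp_mul_gaussianReal _)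
  refine h1.mono' (by fun_prop) (Eventually.of_forall fun x => ?_)
  rw [Real.norm_eq_abs, Real.abs_exp]
  have h1 : ∀ i, 1 ≤ Real.exp (|a| * x i) + Real.exp (-|a| * x i) := fun i => by
    rcases le_total 0 (x i) with h | h
    · have := Real.one_le_exp (mul_nonneg (abs_nonneg a) h)
      linarith [Real.exp_pos (-|a| * x i)]
    · have : 0 ≤ -|a| * x i := by nlinarith [abs_nonneg a]
      have := Real.one_le_exp this
      linarith [Real.exp_pos (|a| * x i)]
  rcases isEmpty_or_nonempty κ with hκ | hκ
  · simp [Subsingleton.elim x 0]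
  obtain ⟨i, hi⟩ : ∃ i, ‖x‖ = ‖x i‖ := by
    obtain ⟨i, hi⟩ := Finite.exists_max fun i => ‖x i‖
    refine ⟨i, le_antisymm ?_ (norm_le_pi_norm x i)⟩
    exact (pi_norm_le_iff_of_nonneg (norm_nonneg _)).2 hi
  have h2 : Real.exp (a * ‖x‖) ≤ Real.exp (|a| * x i) + Real.exp (-|a| * x i) := by
    have : a * ‖x‖ ≤ |a| * |x i| := by
      rw [hi, Real.norm_eq_abs]; gcongr; exact le_abs_self a
    refine (Real.exp_le_exp.2 this).trans ?_
    rcases abs_cases (x i) with ⟨h, -⟩ | ⟨h, -⟩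
    · rw [h]; linarith [Real.exp_pos (-|a| * x i)]
    · rw [h, mul_neg, ← neg_mul]; linarith [Real.exp_pos (|a| * x i)]
  refine h2.trans ?_
  classical
  rw [← Finset.mul_prod_erase _ _ (Finset.mem_univ i)]
  refine le_mul_of_one_le_right (by positivity) ?_
  calc (1 : ℝ) = ∏ j ∈ Finset.univ.erase i, 1 := by simp
    _ ≤ _ := Finset.prod_le_prod (fun _ _ => zero_le_one) fun j _ => h1 j

theorem one_add_pow_le_exp (k : ℕ) {y : ℝ} (hy : 0 ≤ y) :
    (1 + y) ^ k ≤ k ! * Real.exp 1 * Real.exp y := by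
  have := Real.pow_div_factorial_le_exp (1 + y) (by positivity) k
  rw [div_le_iff₀ (by positivity), Real.exp_add] at this
  linarith

theorem integrable_pow_stdGaussianPi {κ : Type*} [Fintype κ] (k : ℕ) :
    Integrable (fun x : κ → ℝ => (1 + ‖x‖) ^ k) (stdGaussianPi κ) := by
  refine ((integrable_exp_norm_stdGaussianPi 1).const_mul (k ! * Real.exp 1)).mono' (by fun_prop)
    (Eventually.of_forall fun x => ?_)
  rw [Real.norm_of_nonneg (by positivity), one_mul]
  exact one_add_pow_le_exp k (norm_nonneg x)

theorem PolyGrowth.integrable {κ F : Type*} [Fintype κ] [NormedAddCommGroup F]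
    {f : (κ → ℝ) → F} (hf : PolyGrowth f) (hm : AEStronglyMeasurable f (stdGaussianPi κ)) :
    Integrable f (stdGaussianPi κ) := by
  obtain ⟨C, k, h⟩ := hf
  exact ((integrable_pow_stdGaussianPi k).const_mul C).mono' hm (Eventually.of_forall h)

/-- Resampling one coordinate preserves a product of probability measures. -/
theorem measurePreserving_update {κ : Type*} [Fintype κ] [DecidableEq κ] (μ : Measure ℝ)
    [IsProbabilityMeasure μ] (k : κ) :
    MeasurePreserving (fun p : (κ → ℝ) × ℝ => Function.update p.1 k p.2)
      ((Measure.pi fun _ => μ).prod μ) (Measure.pi fun _ => μ) := by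
  have hm : Measurable (fun p : (κ → ℝ) × ℝ => Function.update p.1 k p.2) := by
    refine measurable_pi_iff.2 fun i => ?_
    by_cases h : i = k
    · subst h; simpa using measurable_snd
    · simp only [Function.update_of_ne h]; fun_prop
  refine ⟨hm, (Measure.pi_eq fun s hs => ?_).symm⟩
  rw [Measure.map_apply hm (MeasurableSet.univ_pi hs)]
  have : (fun p : (κ → ℝ) × ℝ => Function.update p.1 k p.2) ⁻¹' (Set.univ.pi s) =
      (Set.univ.pi (Function.update s k Set.univ)) ×ˢ s k := by
    ext ⟨x, y⟩
    simp only [Set.mem_preimage, Set.mem_pi, Set.mem_univ, forall_true_left, Set.mem_prod]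
    constructor
    · intro h
      refine ⟨fun i => ?_, by simpa using h k⟩
      by_cases hi : i = k
      · subst hi; simp
      · simpa [hi] using h i
    · rintro ⟨h1, h2⟩ i
      by_cases hi : i = k
      · subst hi; simpa using h2
      · simpa [hi] using h1 i
  rw [this, Measure.prod_prod, Measure.pi_pi]
  rw [← Finset.mul_prod_erase _ _ (Finset.mem_univ k),
    ← Finset.mul_prod_erase (a := k) (f := fun i => μ (s i)) _ (Finset.mem_univ k)]
  simp only [Function.update_self, measure_univ, one_mul]
  rw [mul_comm]
  congr 1
  refine Finset.prod_congr rfl fun i hi => ?_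
  rw [Function.update_of_ne (Finset.ne_of_mem_erase hi)]

theorem integral_update_eq {κ F : Type*} [Fintype κ] [DecidableEq κ] [NormedAddCommGroup F]
    [NormedSpace ℝ F] (μ : Measure ℝ) [IsProbabilityMeasure μ] (k : κ) {f : (κ → ℝ) → F}
    (hf : Integrable f (Measure.pi fun _ => μ)) :
    ∫ x, f x ∂(Measure.pi fun _ => μ) =
      ∫ x, ∫ s, f (Function.update x k s) ∂μ ∂(Measure.pi fun _ => μ) := by
  have h := measurePreserving_update (κ := κ) μ k
  have hi : Integrable (fun p : (κ → ℝ) × ℝ => f (Function.update p.1 k p.2))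
      ((Measure.pi fun _ => μ).prod μ) := by
    rw [← h.map_eq] at hf
    exact hf.comp_measurable h.measurable
  rw [← integral_prod _ hi]
  conv_lhs => rw [← h.map_eq]
  rw [integral_map h.measurable.aemeasurable]
  rw [h.map_eq]; exact hf.aestronglyMeasurable

theorem integrable_gaussianReal_iff {f : ℝ → ℂ} :
    Integrable f (gaussianReal 0 1) ↔
      Integrable (fun x => gaussianPDFReal 0 1 x • f x) volume := by
  rw [gaussianReal_of_var_ne_zero _ one_ne_zero, integrable_withDensity_iff_integrable_smul']
  · simp [gaussianPDF, ENNReal.toReal_ofReal, gaussianPDFReal_nonneg]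
  · exact measurable_gaussianPDF 0 1
  · exact Eventually.of_forall fun x => by simp [gaussianPDF]

theorem hasDerivAt_gaussianPDFReal (x : ℝ) :
    HasDerivAt (gaussianPDFReal 0 1) (-x * gaussianPDFReal 0 1 x) x := by
  rw [gaussianPDFReal_def]
  have h : HasDerivAt (fun x : ℝ => -(x - 0) ^ 2 / (2 * ((1 : NNReal) : ℝ))) (-x) x := by
    have := (((hasDerivAt_id x).sub_const 0).pow 2).neg.div_const (2 * ((1 : NNReal) : ℝ))
    convert! this using 1
    simp; ring
  convert! (h.exp.const_mul (√(2 * Real.pi * ((1 : NNReal) : ℝ)))⁻¹) using 1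
  ring

/-- One-dimensional Gaussian integration by parts. -/
theorem integral_mul_gaussianReal {f f' : ℝ → ℂ} (hf : ∀ x, HasDerivAt f (f' x) x)
    (h0 : Integrable f (gaussianReal 0 1)) (h1 : Integrable f' (gaussianReal 0 1))
    (h2 : Integrable (fun x : ℝ => (x : ℂ) * f x) (gaussianReal 0 1)) :
    ∫ x : ℝ, (x : ℂ) * f x ∂(gaussianReal 0 1) = ∫ x, f' x ∂(gaussianReal 0 1) := by
  rw [integral_gaussianReal_eq_integral_smul one_ne_zero,
    integral_gaussianReal_eq_integral_smul one_ne_zero]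
  rw [integrable_gaussianReal_iff] at h0 h1 h2
  have hp : ∀ x, HasDerivAt (fun x => (gaussianPDFReal 0 1 x : ℂ))
      ((-x * gaussianPDFReal 0 1 x : ℝ) : ℂ) x := fun x =>
    (hasDerivAt_gaussianPDFReal x).ofReal_comp
  have := integral_mul_deriv_eq_deriv_mul_of_integrable (u := f)
    (v := fun x => (gaussianPDFReal 0 1 x : ℂ)) (u' := f')
    (v' := fun x => ((-x * gaussianPDFReal 0 1 x : ℝ) : ℂ)) (fun x _ => hf x) (fun x _ => hp x)
    ?_ ?_ ?_
  · have h3 : ∀ x, gaussianPDFReal 0 1 x • ((x : ℂ) * f x) =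
        - (f x * ((-x * gaussianPDFReal 0 1 x : ℝ) : ℂ)) := fun x => by
      rw [Complex.real_smul]; push_cast; ring
    simp_rw [h3]
    rw [integral_neg, this, neg_neg]
    refine integral_congr_ae (Eventually.of_forall fun x => ?_)
    simp only [Complex.real_smul]; ring
  · refine h2.neg.congr (Eventually.of_forall fun x => ?_)
    simp only [Pi.mul_apply, Pi.neg_apply, Complex.real_smul]; push_cast; ring
  · refine h1.congr (Eventually.of_forall fun x => ?_)
    simp only [Pi.mul_apply, Complex.real_smul]; ring
  · refine h0.congr (Eventually.of_forall fun x => ?_)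
    simp only [Pi.mul_apply, Complex.real_smul]; ring

theorem PolyGrowth.update {κ : Type*} [Fintype κ] [DecidableEq κ] {f : (κ → ℝ) → ℂ}
    (hf : PolyGrowth f) (x : κ → ℝ) (k : κ) :
    PolyGrowth fun s : ℝ => f (Function.update x k s) := by
  obtain ⟨C, hC, m, hf⟩ := hf.exists_nonneg
  refine ⟨C * (1 + ‖x‖) ^ m, m, fun s => (hf _).trans ?_⟩
  rw [mul_assoc, ← mul_pow]
  gcongr
  have : ‖Function.update x k s‖ ≤ ‖x‖ + ‖s‖ := by
    refine (pi_norm_le_iff_of_nonneg (by positivity)).2 fun i => ?_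
    by_cases h : i = k
    · subst h; simp
    · rw [Function.update_of_ne h]
      linarith [norm_le_pi_norm x i, norm_nonneg s]
  nlinarith [norm_nonneg x, norm_nonneg s]

theorem PolyGrowth.integrable_real {f : ℝ → ℂ} (hf : PolyGrowth f) (hc : Continuous f) :
    Integrable f (gaussianReal 0 1) := by
  obtain ⟨C, hC, k, h⟩ := hf.exists_nonneg
  have h1 : Integrable (fun x : ℝ => C * (k ! * Real.exp 1) * (Real.exp (1 * x) + Real.exp (-1 * x)))
      (gaussianReal 0 1) :=
    ((integrable_exp_mul_gaussianReal _).add (integrable_exp_mul_gaussianReal _)).const_mul _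
  refine h1.mono' hc.aestronglyMeasurable (Eventually.of_forall fun x => (h x).trans ?_)
  rw [mul_assoc]
  gcongr
  refine (one_add_pow_le_exp k (norm_nonneg x)).trans ?_
  gcongr
  rw [Real.norm_eq_abs]
  rcases abs_cases x with ⟨h, -⟩ | ⟨h, -⟩ <;> rw [h]
  · simp [Real.exp_nonneg]
  · simp [Real.exp_nonneg]

theorem polyGrowth_coord {κ : Type*} [Fintype κ] (k : κ) :
    PolyGrowth fun x : κ → ℝ => (x k : ℂ) :=
  ⟨1, 1, fun x => by
    have := norm_le_pi_norm x k
    rw [Complex.norm_real]; linarith⟩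

/-- Gaussian integration by parts in one of several independent coordinates. -/
theorem integral_mul_stdGaussianPi {κ : Type*} [Fintype κ] [DecidableEq κ] {f f' : (κ → ℝ) → ℂ}
    (k : κ) (hf : ∀ x, HasDerivAt (fun s => f (Function.update x k s)) (f' x) (x k))
    (hc : Continuous f) (hc' : Continuous f') (h0 : PolyGrowth f) (h1 : PolyGrowth f') :
    ∫ x, (x k : ℂ) * f x ∂(stdGaussianPi κ) = ∫ x, f' x ∂(stdGaussianPi κ) := by
  have hk : Continuous fun x : κ → ℝ => (x k : ℂ) * f x := by fun_prop
  have hg : PolyGrowth fun x : κ → ℝ => (x k : ℂ) * f x := (polyGrowth_coord k).mul h0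
  rw [integral_update_eq _ k (hg.integrable hk.aestronglyMeasurable),
    integral_update_eq _ k (h1.integrable hc'.aestronglyMeasurable)]
  refine integral_congr_ae (Eventually.of_forall fun x => ?_)
  have hu : Continuous fun s : ℝ => Function.update x k s := by fun_prop
  simp only [Function.update_self]
  refine integral_mul_gaussianReal (fun s => ?_) ((h0.update x k).integrable_real (hc.comp hu))
    ((h1.update x k).integrable_real (hc'.comp hu)) ?_
  · simpa using hf (Function.update x k s)
  · have := (hg.update x k).integrable_real (hk.comp hu)
    simpa using this

end

noncomputable section

/-! ### The heat equation for Gaussian expectations -/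

/-- `f'` lists the partial derivatives of `f`; all functions are continuous and of polynomial
growth. -/
structure HasGradient {ι : Type*} [Fintype ι] (f : (ι → ℝ) → ℂ) (f' : ι → (ι → ℝ) → ℂ) :
    Prop where
  hasFDerivAt : ∀ x, HasFDerivAt f
    (∑ a, (ContinuousLinearMap.proj a : (ι → ℝ) →L[ℝ] ℝ).smulRight (f' a x)) x
  growth : PolyGrowth f
  continuous_grad : ∀ a, Continuous (f' a)
  growth_grad : ∀ a, PolyGrowth (f' a)

theorem HasGradient.continuous {ι : Type*} [Fintype ι] {f : (ι → ℝ) → ℂ} {f' : ι → (ι → ℝ) → ℂ}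
    (h : HasGradient f f') : Continuous f :=
  continuous_iff_continuousAt.2 fun x => (h.hasFDerivAt x).continuousAt

theorem norm_mulVec_le_sum {ι κ : Type*} [Fintype ι] [Fintype κ] (A : Matrix ι κ ℝ) (ξ : κ → ℝ) :
    ‖A *ᵥ ξ‖ ≤ (∑ a, ∑ k, |A a k|) * ‖ξ‖ := by
  refine (pi_norm_le_iff_of_nonneg (by positivity)).2 fun a => ?_
  calc ‖(A *ᵥ ξ) a‖ ≤ ∑ k, ‖A a k * ξ k‖ := norm_sum_le _ _
    _ ≤ ∑ k, |A a k| * ‖ξ‖ := by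
        refine Finset.sum_le_sum fun k _ => ?_
        rw [norm_mul, Real.norm_eq_abs]
        gcongr
        exact norm_le_pi_norm ξ k
    _ = (∑ k, |A a k|) * ‖ξ‖ := (Finset.sum_mul _ _ _).symm
    _ ≤ _ := by
        gcongr
        exact Finset.single_le_sum (f := fun a => ∑ k, |A a k|)
          (fun _ _ => Finset.sum_nonneg fun _ _ => abs_nonneg _) (Finset.mem_univ a)

/-- Integration by parts for a function of a linear image of the Gaussian vector. -/
theorem integral_mul_comp_mulVec {ι κ : Type*} [Fintype ι] [Fintype κ] [DecidableEq κ]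
    {f : (ι → ℝ) → ℂ} {f' : ι → (ι → ℝ) → ℂ} (h : HasGradient f f') (A : Matrix ι κ ℝ) (k : κ) :
    ∫ ξ, (ξ k : ℂ) * f (A *ᵥ ξ) ∂(stdGaussianPi κ) =
      ∑ b, (A b k : ℂ) * ∫ ξ, f' b (A *ᵥ ξ) ∂(stdGaussianPi κ) := by
  have hA : Continuous fun ξ : κ → ℝ => A *ᵥ ξ := by fun_prop
  have hG : ∀ b, PolyGrowth fun ξ : κ → ℝ => f' b (A *ᵥ ξ) := fun b =>
    (h.growth_grad b).comp_linear (norm_mulVec_le_sum A)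
  have hI : ∀ b, Integrable (fun ξ : κ → ℝ => f' b (A *ᵥ ξ)) (stdGaussianPi κ) := fun b =>
    (hG b).integrable ((h.continuous_grad b).comp hA).aestronglyMeasurable
  rw [integral_mul_stdGaussianPi (f := fun ξ => f (A *ᵥ ξ))
    (f' := fun ξ => ∑ b, (A b k : ℂ) * f' b (A *ᵥ ξ)) k]
  · rw [integral_finsetSum _ fun b _ => (hI b).const_mul _]
    simp_rw [integral_const_mul]
  · intro ξ
    have h1 : HasDerivAt (fun s : ℝ => A *ᵥ Function.update ξ k s) (fun b => A b k) (ξ k) := by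
      have h2 : ∀ s : ℝ, A *ᵥ Function.update ξ k s = A *ᵥ ξ + (s - ξ k) • fun b => A b k := by
        intro s
        have : Function.update ξ k s = ξ + Pi.single k (s - ξ k) := by
          ext i
          by_cases hi : i = k
          · subst hi; simp
          · simp [hi]
        rw [this, Matrix.mulVec_add]
        congr 1
        ext b
        simp [mul_comm]
      simp_rw [h2]
      simpa using (((hasDerivAt_id (ξ k)).sub_const (ξ k)).smul_const
        (fun b => A b k)).const_add (A *ᵥ ξ)
    have h3 := (h.hasFDerivAt (A *ᵥ ξ))
    have h4 : A *ᵥ ξ = A *ᵥ Function.update ξ k (ξ k) := by simp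
    rw [h4] at h3
    have := h3.comp_hasDerivAt (ξ k) h1
    convert! this using 1
    simp
  · exact h.continuous.comp hA
  · exact continuous_finsetSum _ fun b _ => continuous_const.mul ((h.continuous_grad b).comp hA)
  · exact h.growth.comp_linear (norm_mulVec_le_sum A)
  · choose C hC m hm using fun b => (hG b).exists_nonneg
    refine ⟨∑ b, |A b k| * C b, ∑ b, m b, fun x => (norm_sum_le _ _).trans ?_⟩
    rw [Finset.sum_mul]
    refine Finset.sum_le_sum fun b _ => ?_
    rw [norm_mul, Complex.norm_real, Real.norm_eq_abs, mul_assoc]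
    gcongr
    refine (hm b x).trans ?_
    gcongr
    · exact hC b
    · linarith [norm_nonneg x]
    · exact Finset.single_le_sum (f := m) (fun _ _ => Nat.zero_le _) (Finset.mem_univ b)

theorem PolyGrowth.exists_bound_comp {ι κ : Type*} [Fintype ι] [Fintype κ] {f : (ι → ℝ) → ℂ}
    (hf : PolyGrowth f) (a : ℝ) : ∃ b : (κ → ℝ) → ℝ, Continuous b ∧ PolyGrowth b ∧ (∀ ξ, 0 ≤ b ξ) ∧
      ∀ A : Matrix ι κ ℝ, ∑ i, ∑ k, |A i k| ≤ a → ∀ ξ, ‖f (A *ᵥ ξ)‖ ≤ b ξ := by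
  obtain ⟨C, hC, m, h⟩ := hf.exists_nonneg
  refine ⟨fun ξ => C * (1 + |a|) ^ m * (1 + ‖ξ‖) ^ m, by fun_prop, ⟨C * (1 + |a|) ^ m, m, fun ξ => ?_⟩,
    fun ξ => by positivity, fun A hA ξ => (h _).trans ?_⟩
  · rw [Real.norm_of_nonneg (by positivity)]
  · change _ ≤ C * (1 + |a|) ^ m * (1 + ‖ξ‖) ^ m
    rw [mul_assoc, ← mul_pow]
    gcongr
    have h1 := norm_mulVec_le_sum A ξ
    have h2 := le_abs_self a
    nlinarith [norm_nonneg ξ, abs_nonneg a]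

/-- Differentiation of a Gaussian expectation along a rotation of two uncorrelated vectors. -/
theorem hasDerivAt_integral_rotation {ι κ : Type*} [Fintype ι] [Fintype κ] [DecidableEq κ]
    {f : (ι → ℝ) → ℂ} {f' : ι → (ι → ℝ) → ℂ} {f'' : ι → ι → (ι → ℝ) → ℂ}
    (h : HasGradient f f') (h' : ∀ a, HasGradient (f' a) (f'' a)) (A B : Matrix ι κ ℝ)
    (hAB : A * Bᵀ = 0) (θ : ℝ) :
    HasDerivAt (fun θ : ℝ => ∫ ξ, f ((Real.cos θ • A + Real.sin θ • B) *ᵥ ξ) ∂(stdGaussianPi κ))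
      (∑ a, ∑ b, ((Real.sin θ * Real.cos θ * (B * Bᵀ - A * Aᵀ) a b : ℝ) : ℂ) *
        ∫ ξ, f'' a b ((Real.cos θ • A + Real.sin θ • B) *ᵥ ξ) ∂(stdGaussianPi κ)) θ := by
  set M : ℝ → Matrix ι κ ℝ := fun θ => Real.cos θ • A + Real.sin θ • B with hM
  set M' : ℝ → Matrix ι κ ℝ := fun θ => (-Real.sin θ) • A + Real.cos θ • B with hM'
  set m : ℝ := ∑ i, ∑ k, (|A i k| + |B i k|) with hm
  have hMb : ∀ θ i k, |M θ i k| ≤ |A i k| + |B i k| := by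
    intro θ i k
    simp only [hM, Matrix.add_apply, Matrix.smul_apply, smul_eq_mul]
    refine (abs_add_le _ _).trans ?_
    rw [abs_mul, abs_mul]
    have h1 := mul_le_mul_of_nonneg_right (Real.abs_cos_le_one θ) (abs_nonneg (A i k))
    have h2 := mul_le_mul_of_nonneg_right (Real.abs_sin_le_one θ) (abs_nonneg (B i k))
    linarith
  have hMb' : ∀ θ i k, |M' θ i k| ≤ |A i k| + |B i k| := by
    intro θ i k
    simp only [hM', Matrix.add_apply, Matrix.smul_apply, smul_eq_mul]
    refine (abs_add_le _ _).trans ?_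
    rw [abs_mul, abs_mul, abs_neg]
    have h1 := mul_le_mul_of_nonneg_right (Real.abs_cos_le_one θ) (abs_nonneg (B i k))
    have h2 := mul_le_mul_of_nonneg_right (Real.abs_sin_le_one θ) (abs_nonneg (A i k))
    linarith
  have hMm : ∀ θ, ∑ i, ∑ k, |M θ i k| ≤ m := fun θ =>
    Finset.sum_le_sum fun i _ => Finset.sum_le_sum fun k _ => hMb θ i k
  have hMd : ∀ θ ξ, HasDerivAt (fun θ => M θ *ᵥ ξ) (M' θ *ᵥ ξ) θ := by
    intro θ ξ
    simp only [hM, hM', Matrix.add_mulVec, Matrix.smul_mulVec]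
    exact ((Real.hasDerivAt_cos θ).smul_const _).add ((Real.hasDerivAt_sin θ).smul_const _)
  -- the derivative of the integrand in the angle, by the chain rule
  set F' : ℝ → (κ → ℝ) → ℂ := fun θ ξ => ∑ a, ∑ k, (M' θ a k : ℂ) * ((ξ k : ℂ) * f' a (M θ *ᵥ ξ))
    with hF'
  have hd : ∀ θ ξ, HasDerivAt (fun θ => f (M θ *ᵥ ξ)) (F' θ ξ) θ := by
    intro θ ξ
    have := (h.hasFDerivAt (M θ *ᵥ ξ)).comp_hasDerivAt θ (hMd θ ξ)
    convert! this using 1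
    simp only [hF', sum_apply, ContinuousLinearMap.smulRight_apply,
      ContinuousLinearMap.proj_apply, Matrix.mulVec, dotProduct, Complex.real_smul]
    refine Finset.sum_congr rfl fun a _ => ?_
    push_cast
    rw [Finset.sum_mul]
    exact Finset.sum_congr rfl fun k _ => by ring
  choose b hbc hbg hb0 hb using fun a => (h.growth_grad a).exists_bound_comp (κ := κ) m
  have hMc : ∀ θ, Continuous fun ξ : κ → ℝ => M θ *ᵥ ξ := fun θ => by fun_prop
  have hint : ∀ a k θ, Integrable (fun ξ : κ → ℝ => (ξ k : ℂ) * f' a (M θ *ᵥ ξ)) (stdGaussianPi κ) :=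
    fun a k θ => ((polyGrowth_coord k).mul
      ((h.growth_grad a).comp_linear (norm_mulVec_le_sum (M θ)))).integrable
      (Continuous.aestronglyMeasurable
        (Continuous.mul (by fun_prop) ((h.continuous_grad a).comp (hMc θ))))
  have key := hasDerivAt_integral_of_dominated_loc_of_deriv_le (μ := stdGaussianPi κ)
    (F := fun θ ξ => f (M θ *ᵥ ξ)) (F' := F') (x₀ := θ) (s := Set.univ)
    (bound := fun ξ => ∑ a, ∑ k, (|A a k| + |B a k|) * (‖ξ k‖ * b a ξ)) univ_mem ?_ ?_ ?_ ?_ ?_ ?_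
  · convert! key.2 using 1
    simp only [hF']
    rw [integral_finsetSum _ fun a _ => integrable_finsetSum _ fun k _ => (hint a k θ).const_mul _]
    refine Finset.sum_congr rfl fun a _ => ?_
    rw [integral_finsetSum _ fun k _ => (hint a k θ).const_mul _]
    simp_rw [integral_const_mul, integral_mul_comp_mulVec (h' a), Finset.mul_sum]
    rw [Finset.sum_comm]
    refine Finset.sum_congr rfl fun c _ => ?_
    simp_rw [← mul_assoc]
    rw [← Finset.sum_mul]
    congr 1
    have e : (M' θ * (M θ)ᵀ) = (Real.sin θ * Real.cos θ) • (B * Bᵀ - A * Aᵀ) := by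
      have hBA : B * Aᵀ = 0 := by
        have := congrArg Matrix.transpose hAB
        simpa [Matrix.transpose_mul] using this
      simp only [hM, hM', Matrix.transpose_add, Matrix.transpose_smul, Matrix.add_mul,
        Matrix.mul_add, Matrix.smul_mul, Matrix.mul_smul, hAB, hBA]
      module
    have e2 := congrFun (congrFun e a) c
    rw [Matrix.smul_apply, smul_eq_mul, Matrix.mul_apply] at e2
    rw [← e2]
    push_cast
    rfl
  · exact Eventually.of_forall fun θ => (h.continuous.comp (hMc θ)).aestronglyMeasurable
  · exact (h.growth.comp_linear (norm_mulVec_le_sum (M θ))).integrable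
      (h.continuous.comp (hMc θ)).aestronglyMeasurable
  · exact (integrable_finsetSum _ fun a _ => integrable_finsetSum _ fun k _ =>
      (hint a k θ).const_mul _).aestronglyMeasurable
  · refine Eventually.of_forall fun ξ θ _ => ?_
    simp only [hF']
    refine (norm_sum_le _ _).trans (Finset.sum_le_sum fun a _ => (norm_sum_le _ _).trans
      (Finset.sum_le_sum fun k _ => ?_))
    rw [norm_mul, norm_mul, Complex.norm_real, Complex.norm_real, Real.norm_eq_abs (M' θ a k)]
    gcongr
    · exact hMb' θ a k
    · exact hb a _ (hMm θ) ξ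
  · refine integrable_finsetSum _ fun a _ => integrable_finsetSum _ fun k _ => Integrable.const_mul ?_ _
    have h1 : PolyGrowth fun ξ : κ → ℝ => (ξ k : ℂ) * (b a ξ : ℂ) := by
      refine (polyGrowth_coord k).mul ?_
      obtain ⟨C, n, hC⟩ := hbg a
      exact ⟨C, n, fun x => by simpa using hC x⟩
    have hbc' := hbc a
    have h2 := (h1.integrable (Continuous.aestronglyMeasurable (by fun_prop))).norm
    refine h2.congr (Eventually.of_forall fun ξ => ?_)
    simp only [norm_mul, Complex.norm_real]
    rw [Real.norm_of_nonneg (hb0 a ξ)]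
  · exact Eventually.of_forall fun ξ θ _ => hd θ ξ

/-- The expectation of `f` under the centered Gaussian law with covariance matrix `S`. -/
def gaussianMean {ι : Type*} [Fintype ι] [DecidableEq ι] (S : Matrix ι ι ℝ) (f : (ι → ℝ) → ℂ) : ℂ :=
  ∫ x, f x.ofLp ∂(multivariateGaussian 0 S)

/-- A linear image of a standard Gaussian vector is a Gaussian vector. -/
theorem map_mulVec_stdGaussianPi {ι κ : Type*} [Fintype ι] [DecidableEq ι] [Fintype κ]
    (A : Matrix ι κ ℝ) :
    (stdGaussianPi κ).map (fun ξ => WithLp.toLp 2 (A *ᵥ ξ)) =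
      multivariateGaussian 0 (A * Aᵀ) := by
  have hm : Measurable (fun ξ : κ → ℝ => (WithLp.toLp 2 (A *ᵥ ξ) : EuclideanSpace ℝ ι)) := by
    have : Continuous (fun ξ : κ → ℝ => A *ᵥ ξ) := by fun_prop
    fun_prop
  have : IsProbabilityMeasure ((stdGaussianPi κ).map
    (fun ξ => (WithLp.toLp 2 (A *ᵥ ξ) : EuclideanSpace ℝ ι))) :=
    Measure.isProbabilityMeasure_map hm.aemeasurable
  have hps : (A * Aᵀ).PosSemidef := by
    have := Matrix.posSemidef_self_mul_conjTranspose A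
    rwa [Matrix.conjTranspose_eq_transpose_of_trivial] at this
  apply Measure.ext_of_charFun
  ext t
  rw [charFun_multivariateGaussian hps, charFun_apply, integral_map hm.aemeasurable
    (Continuous.aestronglyMeasurable (by fun_prop))]
  have h1 : ∀ ξ : κ → ℝ, inner ℝ (WithLp.toLp 2 (A *ᵥ ξ) : EuclideanSpace ℝ ι) t =
      ∑ k, (Aᵀ *ᵥ t.ofLp) k * ξ k := by
    intro ξ
    rw [EuclideanSpace.inner_eq_star_dotProduct]
    simp only [star_trivial]
    rw [Matrix.dotProduct_mulVec, ← Matrix.mulVec_transpose]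
    rfl
  simp_rw [h1, Complex.ofReal_sum, Finset.sum_mul, Complex.exp_sum]
  rw [integral_fintype_prod_eq_prod (f := fun k (y : ℝ) =>
    Complex.exp ((((Aᵀ *ᵥ t.ofLp) k * y : ℝ) : ℂ) * Complex.I))]
  simp_rw [Complex.ofReal_mul, ← charFun_apply_real, charFun_gaussianReal, ← Complex.exp_sum]
  congr 1
  have h2 : t.ofLp ⬝ᵥ (A * Aᵀ) *ᵥ t.ofLp = ∑ k, (Aᵀ *ᵥ t.ofLp) k ^ 2 := by
    rw [← Matrix.mulVec_mulVec, Matrix.dotProduct_mulVec, ← Matrix.mulVec_transpose]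
    simp [dotProduct, pow_two]
  rw [h2]
  simp [Finset.sum_div]

theorem gaussianMean_mul_transpose {ι κ : Type*} [Fintype ι] [DecidableEq ι] [Fintype κ]
    (A : Matrix ι κ ℝ) {f : (ι → ℝ) → ℂ} (hf : Continuous f) :
    gaussianMean (A * Aᵀ) f = ∫ ξ, f (A *ᵥ ξ) ∂(stdGaussianPi κ) := by
  rw [gaussianMean, ← map_mulVec_stdGaussianPi, integral_map]
  · have : Continuous (fun ξ : κ → ℝ => A *ᵥ ξ) := by fun_prop
    fun_prop
  · exact Continuous.aestronglyMeasurable (by fun_prop)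

open scoped MatrixOrder in
theorem exists_eq_mul_transpose {ι : Type*} [Fintype ι] [DecidableEq ι] {S : Matrix ι ι ℝ}
    (hS : S.PosSemidef) : ∃ A : Matrix ι ι ℝ, S = A * Aᵀ := by
  refine ⟨CFC.sqrt S, ?_⟩
  have h1 : (CFC.sqrt S)ᵀ = CFC.sqrt S := by
    have := (CFC.sqrt_nonneg S).isSelfAdjoint
    rwa [IsSelfAdjoint, Matrix.star_eq_conjTranspose,
      Matrix.conjTranspose_eq_transpose_of_trivial] at this
  rw [h1, CFC.sqrt_mul_sqrt_self _ hS.nonneg]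

theorem integrable_multivariateGaussian {ι : Type*} [Fintype ι] [DecidableEq ι]
    {S : Matrix ι ι ℝ} (hS : S.PosSemidef) {f : (ι → ℝ) → ℂ} (hc : Continuous f)
    (hf : PolyGrowth f) :
    Integrable (fun x : EuclideanSpace ℝ ι => f x.ofLp) (multivariateGaussian 0 S) := by
  obtain ⟨A, rfl⟩ := exists_eq_mul_transpose hS
  have hA : Continuous (fun ξ : ι → ℝ => A *ᵥ ξ) := by fun_prop
  rw [← map_mulVec_stdGaussianPi, integrable_map_measure
    (Continuous.aestronglyMeasurable (by fun_prop)) (by fun_prop)]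
  exact (hf.comp_linear (norm_mulVec_le_sum A)).integrable (hc.comp hA).aestronglyMeasurable

theorem continuous_integral_rotation {ι κ : Type*} [Fintype ι] [Fintype κ] {f : (ι → ℝ) → ℂ}
    (hc : Continuous f) (hf : PolyGrowth f) (A B : Matrix ι κ ℝ) :
    Continuous fun θ : ℝ =>
      ∫ ξ, f ((Real.cos θ • A + Real.sin θ • B) *ᵥ ξ) ∂(stdGaussianPi κ) := by
  obtain ⟨b, hbc, hbg, hb0, hb⟩ := hf.exists_bound_comp (κ := κ) (∑ i, ∑ k, (|A i k| + |B i k|))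
  have hM : ∀ θ : ℝ, Continuous fun ξ : κ → ℝ => (Real.cos θ • A + Real.sin θ • B) *ᵥ ξ :=
    fun θ => by fun_prop
  refine continuous_of_dominated (bound := b) (fun θ => (hc.comp (hM θ)).aestronglyMeasurable)
    (fun θ => Eventually.of_forall fun ξ => hb _ ?_ ξ) (hbg.integrable hbc.aestronglyMeasurable)
    (Eventually.of_forall fun ξ => ?_)
  · refine Finset.sum_le_sum fun i _ => Finset.sum_le_sum fun k _ => ?_
    simp only [Matrix.add_apply, Matrix.smul_apply, smul_eq_mul]
    refine (abs_add_le _ _).trans ?_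
    rw [abs_mul, abs_mul]
    have h1 := mul_le_mul_of_nonneg_right (Real.abs_cos_le_one θ) (abs_nonneg (A i k))
    have h2 := mul_le_mul_of_nonneg_right (Real.abs_sin_le_one θ) (abs_nonneg (B i k))
    linarith
  · refine hc.comp ?_
    simp only [Matrix.add_mulVec, Matrix.smul_mulVec]
    fun_prop

theorem posSemidef_segment {ι : Type*} [Fintype ι] {S₀ S₁ : Matrix ι ι ℝ} (h₀ : S₀.PosSemidef)
    (h₁ : S₁.PosSemidef) {t : ℝ} (ht : t ∈ Set.Icc (0 : ℝ) 1) :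
    ((1 - t) • S₀ + t • S₁).PosSemidef :=
  (h₀.smul (by linarith [ht.2])).add (h₁.smul ht.1)

/-- The heat equation: the derivative of a Gaussian expectation with respect to the covariance
matrix is half the expectation of the corresponding second order differential operator.  The
segment between the covariance matrices `S₀` and `S₁` is traced by `cos θ X + sin θ Y` with
independent `X` and `Y` of covariances `S₀` and `S₁`, which is smooth in `θ` up to the end
points. -/
theorem gaussianMean_sub {ι : Type*} [Fintype ι] [DecidableEq ι] {f : (ι → ℝ) → ℂ}
    {f' : ι → (ι → ℝ) → ℂ} {f'' : ι → ι → (ι → ℝ) → ℂ}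
    (h : HasGradient f f') (h' : ∀ a, HasGradient (f' a) (f'' a)) {S₀ S₁ : Matrix ι ι ℝ}
    (h₀ : S₀.PosSemidef) (h₁ : S₁.PosSemidef) :
    (∀ a b, ContinuousOn (fun t : ℝ => gaussianMean ((1 - t) • S₀ + t • S₁) (f'' a b))
      (Set.Icc 0 1)) ∧
    gaussianMean S₁ f - gaussianMean S₀ f = ∫ t in (0 : ℝ)..1, (1 / 2 : ℂ) * ∑ a, ∑ b,
      ((S₁ - S₀) a b : ℂ) * gaussianMean ((1 - t) • S₀ + t • S₁) (f'' a b) := by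
  obtain ⟨L₀, hL₀⟩ := exists_eq_mul_transpose h₀
  obtain ⟨L₁, hL₁⟩ := exists_eq_mul_transpose h₁
  set A : Matrix ι (ι ⊕ ι) ℝ := Matrix.fromCols L₀ 0 with hA
  set B : Matrix ι (ι ⊕ ι) ℝ := Matrix.fromCols 0 L₁ with hB
  have hAA : A * Aᵀ = S₀ := by
    rw [hA, Matrix.transpose_fromCols, Matrix.fromCols_mul_fromRows, hL₀]; simp
  have hBB : B * Bᵀ = S₁ := by
    rw [hB, Matrix.transpose_fromCols, Matrix.fromCols_mul_fromRows, hL₁]; simp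
  have hAB : A * Bᵀ = 0 := by
    rw [hA, hB, Matrix.transpose_fromCols, Matrix.fromCols_mul_fromRows]; simp
  have hBA : B * Aᵀ = 0 := by
    rw [hA, hB, Matrix.transpose_fromCols, Matrix.fromCols_mul_fromRows]; simp
  set M : ℝ → Matrix ι (ι ⊕ ι) ℝ := fun θ => Real.cos θ • A + Real.sin θ • B with hM
  have hMM : ∀ θ, M θ * (M θ)ᵀ = (1 - Real.sin θ ^ 2) • S₀ + Real.sin θ ^ 2 • S₁ := by
    intro θ
    rw [← Real.cos_sq']
    simp only [hM, Matrix.transpose_add, Matrix.transpose_smul, Matrix.add_mul,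
        Matrix.mul_add, Matrix.smul_mul, Matrix.mul_smul, hAB, hBA, hAA, hBB]
    module
  have hmean : ∀ {q : (ι → ℝ) → ℂ}, Continuous q → ∀ θ,
      gaussianMean ((1 - Real.sin θ ^ 2) • S₀ + Real.sin θ ^ 2 • S₁) q =
        ∫ ξ, q (M θ *ᵥ ξ) ∂(stdGaussianPi (ι ⊕ ι)) := fun hq θ => by
    rw [← hMM, gaussianMean_mul_transpose _ hq]
  have hcont : ∀ a b, ContinuousOn (fun t : ℝ => gaussianMean ((1 - t) • S₀ + t • S₁) (f'' a b))
      (Set.Icc 0 1) := by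
    intro a b
    have h1 := (continuous_integral_rotation ((h' a).continuous_grad b) ((h' a).growth_grad b) A
      B).comp (Real.continuous_arcsin.comp Real.continuous_sqrt)
    refine h1.continuousOn.congr fun t ht => ?_
    have h2 : Real.sin (Real.arcsin √t) ^ 2 = t := by
      rw [Real.sin_arcsin (by linarith [Real.sqrt_nonneg t]) (Real.sqrt_le_one.2 ht.2),
        Real.sq_sqrt ht.1]
    have h3 := hmean ((h' a).continuous_grad b) (Real.arcsin √t)
    rw [h2] at h3
    exact h3
  refine ⟨hcont, ?_⟩
  set g : ℝ → ℂ := fun t => (1 / 2 : ℂ) * ∑ a, ∑ b,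
      ((S₁ - S₀) a b : ℂ) * gaussianMean ((1 - t) • S₀ + t • S₁) (f'' a b) with hg
  have hgc : ContinuousOn g (Set.Icc 0 1) :=
    continuousOn_const.mul (continuousOn_finsetSum _ fun a _ => continuousOn_finsetSum _ fun b _ =>
      continuousOn_const.mul (hcont a b))
  have hd : ∀ θ : ℝ, HasDerivAt (fun θ => ∫ ξ, f (M θ *ᵥ ξ) ∂(stdGaussianPi (ι ⊕ ι)))
      ((2 * Real.sin θ * Real.cos θ) • (g ∘ fun θ => Real.sin θ ^ 2) θ) θ := by
    intro θ
    convert! hasDerivAt_integral_rotation h h' A B hAB θ using 1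
    simp only [hg, Function.comp, Complex.real_smul, Finset.mul_sum, hAA, hBB]
    refine Finset.sum_congr rfl fun a _ => Finset.sum_congr rfl fun b _ => ?_
    rw [hmean ((h' a).continuous_grad b)]
    push_cast
    ring
  have hgs : Continuous fun θ : ℝ =>
      (2 * Real.sin θ * Real.cos θ) • (g ∘ fun θ => Real.sin θ ^ 2) θ := by
    have : Continuous (g ∘ fun θ : ℝ => Real.sin θ ^ 2) :=
      hgc.comp_continuous (by fun_prop) fun θ => ⟨sq_nonneg _, Real.sin_sq_le_one θ⟩
    have h2 : Continuous fun θ : ℝ => 2 * Real.sin θ * Real.cos θ := by fun_prop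
    exact h2.smul this
  have h1 := intervalIntegral.integral_eq_sub_of_hasDerivAt (a := 0) (b := Real.pi / 2)
    (fun θ _ => hd θ) (hgs.intervalIntegrable _ _)
  have h2 := intervalIntegral.integral_deriv_smul_comp''' (a := 0) (b := Real.pi / 2)
    (f := fun θ => Real.sin θ ^ 2) (f' := fun θ => 2 * Real.sin θ * Real.cos θ) (g := g)
    (by fun_prop) (fun θ _ => ?_) (hgc.mono ?_) ?_ hgs.integrableOn_uIcc
  · have e0 := hmean h.continuous 0
    have e1 := hmean h.continuous (Real.pi / 2)
    simp only [Real.sin_zero, Real.sin_pi_div_two] at e0 e1 h2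
    norm_num at e0 e1 h2
    rw [e0, e1, ← h2, ← h1]
    norm_num
  · have := ((Real.hasDerivAt_sin θ).pow 2).hasDerivWithinAt (s := Set.Ioi θ)
    convert! this using 1
    simp
  · rintro _ ⟨θ, -, rfl⟩
    exact ⟨sq_nonneg _, Real.sin_sq_le_one θ⟩
  · refine (hgc.integrableOn_Icc (μ := volume)).mono_set ?_
    rintro _ ⟨θ, -, rfl⟩
    exact ⟨sq_nonneg _, Real.sin_sq_le_one θ⟩

/-- Uniform bound of Gaussian expectations for covariance matrices with diagonal at most `1`. -/
theorem exists_bound_gaussianMean {ι : Type*} [Fintype ι] [DecidableEq ι] {f : (ι → ℝ) → ℂ}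
    (hc : Continuous f) (hf : PolyGrowth f) :
    ∃ K : ℝ, 0 ≤ K ∧ ∀ S : Matrix ι ι ℝ, S.PosSemidef → (∀ a, S a a ≤ 1) →
      ‖gaussianMean S f‖ ≤ K := by
  obtain ⟨b, hbc, hbg, hb0, hb⟩ := hf.exists_bound_comp (κ := ι) (∑ _i : ι, ∑ _k : ι, 1)
  refine ⟨∫ ξ, b ξ ∂(stdGaussianPi ι), integral_nonneg hb0, fun S hS hd => ?_⟩
  obtain ⟨A, rfl⟩ := exists_eq_mul_transpose hS
  rw [gaussianMean_mul_transpose A hc]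
  refine norm_integral_le_of_norm_le (hbg.integrable hbc.aestronglyMeasurable)
    (Eventually.of_forall fun ξ => hb A ?_ ξ)
  refine Finset.sum_le_sum fun i _ => Finset.sum_le_sum fun k _ => ?_
  have h1 := hd i
  rw [Matrix.mul_apply] at h1
  have h2 : A i k ^ 2 ≤ ∑ j, A i j * Aᵀ j i := by
    have := Finset.single_le_sum (f := fun j => A i j * Aᵀ j i) (s := Finset.univ)
      (fun j _ => by rw [Matrix.transpose_apply]; exact mul_self_nonneg _) (Finset.mem_univ k)
    simpa [pow_two] using this
  exact (sq_le_one_iff_abs_le_one _).1 (h2.trans h1)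

/-- Gaussian expectations depend continuously on the covariance matrix. -/
theorem continuousOn_gaussianMean {ι : Type*} [Fintype ι] [DecidableEq ι] {f : (ι → ℝ) → ℂ}
    {f' : ι → (ι → ℝ) → ℂ} {f'' : ι → ι → (ι → ℝ) → ℂ}
    (h : HasGradient f f') (h' : ∀ a, HasGradient (f' a) (f'' a)) :
    ContinuousOn (fun S => gaussianMean S f)
      {S : Matrix ι ι ℝ | S.PosSemidef ∧ ∀ a, S a a ≤ 1} := by
  choose K hK0 hK using fun a b => exists_bound_gaussianMean ((h' a).continuous_grad b)
    ((h' a).growth_grad b)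
  have key : ∀ S₀ S₁ : Matrix ι ι ℝ, S₀.PosSemidef → S₁.PosSemidef → (∀ a, S₀ a a ≤ 1) →
      (∀ a, S₁ a a ≤ 1) → ‖gaussianMean S₁ f - gaussianMean S₀ f‖ ≤
        ∑ a, ∑ b, |S₁ a b - S₀ a b| * K a b := by
    intro S₀ S₁ h₀ h₁ d₀ d₁
    rw [(gaussianMean_sub h h' h₀ h₁).2]
    have := intervalIntegral.norm_integral_le_of_norm_le_const (a := 0) (b := 1)
      (f := fun t : ℝ => (1 / 2 : ℂ) * ∑ a, ∑ b,
      ((S₁ - S₀) a b : ℂ) * gaussianMean ((1 - t) • S₀ + t • S₁) (f'' a b))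
      (C := ∑ a, ∑ b, |S₁ a b - S₀ a b| * K a b) ?_
    · simpa using this
    · intro t ht
      rw [Set.uIoc_of_le zero_le_one] at ht
      have ht' : t ∈ Set.Icc (0 : ℝ) 1 := ⟨ht.1.le, ht.2⟩
      rw [norm_mul]
      have hnn : 0 ≤ ∑ a, ∑ b, |S₁ a b - S₀ a b| * K a b := Finset.sum_nonneg fun a _ =>
        Finset.sum_nonneg fun b _ => mul_nonneg (abs_nonneg _) (hK0 a b)
      have h2 : ‖∑ a, ∑ b, ((S₁ - S₀) a b : ℂ) *
          gaussianMean ((1 - t) • S₀ + t • S₁) (f'' a b)‖ ≤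
          ∑ a, ∑ b, |S₁ a b - S₀ a b| * K a b := by
        refine (norm_sum_le _ _).trans (Finset.sum_le_sum fun a _ => (norm_sum_le _ _).trans
          (Finset.sum_le_sum fun b _ => ?_))
        rw [norm_mul, Complex.norm_real, Real.norm_eq_abs, Matrix.sub_apply]
        gcongr
        refine hK a b _ (posSemidef_segment h₀ h₁ ht') fun c => ?_
        simp only [Matrix.add_apply, Matrix.smul_apply, smul_eq_mul]
        nlinarith [d₀ c, d₁ c, ht'.1, ht'.2]
      have h3 : ‖(1 / 2 : ℂ)‖ ≤ 1 := by norm_num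
      nlinarith [norm_nonneg (1 / 2 : ℂ)]
  intro S₀ hS₀
  rw [ContinuousWithinAt, tendsto_iff_norm_sub_tendsto_zero]
  have hz : Tendsto (fun S : Matrix ι ι ℝ => ∑ a, ∑ b, |S a b - S₀ a b| * K a b)
      (𝓝[{S : Matrix ι ι ℝ | S.PosSemidef ∧ ∀ a, S a a ≤ 1}] S₀) (𝓝 0) := by
    have hc : Continuous fun S : Matrix ι ι ℝ => ∑ a, ∑ b, |S a b - S₀ a b| * K a b := by fun_prop
    have := (hc.tendsto S₀).mono_left
      (nhdsWithin_le_nhds (s := {S | S.PosSemidef ∧ ∀ a, S a a ≤ 1}))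
    simpa using this
  refine squeeze_zero' (Eventually.of_forall fun _ => norm_nonneg _) ?_ hz
  filter_upwards [self_mem_nhdsWithin] with S hS
  exact key S₀ S hS₀.1 hS.1 hS₀.2 hS.2

end

noncomputable section
open scoped ContDiff

/-! ### Functions holomorphic near a real subspace -/

section Tame

variable {E : Type*} [NormedAddCommGroup E] [NormedSpace ℂ E]

/-- `F` is holomorphic on the `ε`-neighbourhood of `K` (typically a real form of `E`), and of
polynomial growth on every smaller neighbourhood. -/
structure Tame (K : Set E) (ε : ℝ) (F : E → ℂ) : Prop where
  contDiffOn : ContDiffOn ℂ ∞ F (Metric.thickening ε K)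
  growth : ∀ δ < ε, ∃ C : ℝ, ∃ k : ℕ, ∀ x ∈ Metric.thickening δ K, ‖F x‖ ≤ C * (1 + ‖x‖) ^ k

variable {K : Set E} {ε : ℝ} {F G : E → ℂ}

theorem Tame.growth_nonneg (h : Tame K ε F) {δ : ℝ} (hδ : δ < ε) :
    ∃ C : ℝ, 0 ≤ C ∧ ∃ k : ℕ, ∀ x ∈ Metric.thickening δ K, ‖F x‖ ≤ C * (1 + ‖x‖) ^ k := by
  obtain ⟨C, k, h⟩ := h.growth δ hδ
  refine ⟨|C|, abs_nonneg _, k, fun x hx => (h x hx).trans ?_⟩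
  gcongr
  exact le_abs_self C

theorem tame_const (c : ℂ) : Tame K ε fun _ => c where
  contDiffOn := contDiffOn_const
  growth _ _ := ⟨‖c‖, 0, fun x _ => by simp⟩

theorem Tame.add (hF : Tame K ε F) (hG : Tame K ε G) : Tame K ε fun x => F x + G x where
  contDiffOn := hF.contDiffOn.add hG.contDiffOn
  growth δ hδ := by
    obtain ⟨C, hC, k, h⟩ := hF.growth_nonneg hδ
    obtain ⟨D, hD, l, h'⟩ := hG.growth_nonneg hδ
    refine ⟨C + D, k + l, fun x hx => (norm_add_le _ _).trans ?_⟩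
    have h1 : (1 : ℝ) ≤ 1 + ‖x‖ := by linarith [norm_nonneg x]
    have h2 := h x hx
    have h3 := h' x hx
    have h4 : (1 + ‖x‖) ^ k ≤ (1 + ‖x‖) ^ (k + l) := pow_le_pow_right₀ h1 (by omega)
    have h5 : (1 + ‖x‖) ^ l ≤ (1 + ‖x‖) ^ (k + l) := pow_le_pow_right₀ h1 (by omega)
    nlinarith

theorem Tame.mul (hF : Tame K ε F) (hG : Tame K ε G) : Tame K ε fun x => F x * G x where
  contDiffOn := hF.contDiffOn.mul hG.contDiffOn
  growth δ hδ := by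
    obtain ⟨C, hC, k, h⟩ := hF.growth_nonneg hδ
    obtain ⟨D, hD, l, h'⟩ := hG.growth_nonneg hδ
    refine ⟨C * D, k + l, fun x hx => ?_⟩
    rw [norm_mul, pow_add]
    calc ‖F x‖ * ‖G x‖ ≤ (C * (1 + ‖x‖) ^ k) * (D * (1 + ‖x‖) ^ l) := by
          gcongr
          · exact h x hx
          · exact h' x hx
      _ = _ := by ring

theorem Tame.sum {ι : Type*} {s : Finset ι} {F : ι → E → ℂ} (h : ∀ i ∈ s, Tame K ε (F i)) :
    Tame K ε fun x => ∑ i ∈ s, F i x := by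
  classical
  induction s using Finset.induction_on with
  | empty => simpa using tame_const 0
  | insert i s hi ih =>
    simp only [Finset.sum_insert hi]
    exact (h i (Finset.mem_insert_self i s)).add
      (ih fun j hj => h j (Finset.mem_insert_of_mem hj))

theorem Tame.prod {ι : Type*} {s : Finset ι} {F : ι → E → ℂ} (h : ∀ i ∈ s, Tame K ε (F i)) :
    Tame K ε fun x => ∏ i ∈ s, F i x := by
  classical
  induction s using Finset.induction_on with
  | empty => simpa using tame_const 1
  | insert i s hi ih =>
    simp only [Finset.prod_insert hi]
    exact (h i (Finset.mem_insert_self i s)).mul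
      (ih fun j hj => h j (Finset.mem_insert_of_mem hj))

theorem Tame.contDiffAt (h : Tame K ε F) {x : E} (hx : x ∈ Metric.thickening ε K) :
    ContDiffAt ℂ ∞ F x :=
  h.contDiffOn.contDiffAt (Metric.isOpen_thickening.mem_nhds hx)

theorem Tame.differentiableAt (h : Tame K ε F) {x : E} (hx : x ∈ Metric.thickening ε K) :
    DifferentiableAt ℂ F x :=
  (h.contDiffAt hx).differentiableAt (by simp)

theorem Tame.lineDeriv_eq (h : Tame K ε F) {x : E} (hx : x ∈ Metric.thickening ε K) (H : E) :
    lineDeriv ℂ F x H = fderiv ℂ F x H :=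
  (h.differentiableAt hx).lineDeriv_eq_fderiv

/-- A directional derivative of a tame function is tame, by Cauchy's estimate. -/
theorem Tame.lineDeriv (h : Tame K ε F) (H : E) : Tame K ε fun x => lineDeriv ℂ F x H where
  contDiffOn := by
    have h1 : ContDiffOn ℂ ∞ (fun x => fderiv ℂ F x H) (Metric.thickening ε K) :=
      (h.contDiffOn.fderiv_of_isOpen Metric.isOpen_thickening (by simp)).clm_apply contDiffOn_const
    exact h1.congr fun x hx => h.lineDeriv_eq hx H
  growth δ hδ := by
    obtain ⟨C, hC, k, hb⟩ := h.growth_nonneg (show (δ + ε) / 2 < ε by linarith)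
    set r : ℝ := (ε - δ) / (2 * (‖H‖ + 1)) with hr
    have hr0 : 0 < r := div_pos (by linarith) (by positivity)
    have hrH : r * ‖H‖ < (ε - δ) / 2 := by
      rw [hr, div_mul_eq_mul_div, div_lt_div_iff₀ (by positivity) (by positivity)]
      nlinarith [norm_nonneg H]
    refine ⟨C * (1 + (ε - δ)) ^ k / r, k, fun x hx => ?_⟩
    have hmem : ∀ t : ℂ, ‖t‖ ≤ r → x + t • H ∈ Metric.thickening ((δ + ε) / 2) K := by
      intro t ht
      obtain ⟨y, hy, hxy⟩ := Metric.mem_thickening_iff.1 hx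
      refine Metric.mem_thickening_iff.2 ⟨y, hy, ?_⟩
      calc dist (x + t • H) y ≤ dist (x + t • H) x + dist x y := dist_triangle _ _ _
        _ < (ε - δ) / 2 + δ := by
            rw [dist_eq_norm, add_sub_cancel_left, norm_smul]
            have : ‖t‖ * ‖H‖ ≤ r * ‖H‖ := by gcongr
            linarith
        _ = (δ + ε) / 2 := by ring
    have hd : DifferentiableOn ℂ (fun t : ℂ => F (x + t • H)) (Metric.closedBall 0 r) := by
      intro t ht
      have h1 := h.differentiableAt (Metric.thickening_mono (by linarith) K
        (hmem t (by simpa using ht)))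
      have h2 : DifferentiableAt ℂ (fun t : ℂ => x + t • H) t := by fun_prop
      exact (h1.comp t h2).differentiableWithinAt
    have h3 := Complex.norm_deriv_le_of_forall_mem_sphere_norm_le (c := 0) (R := r)
      (C := C * (1 + (ε - δ)) ^ k * (1 + ‖x‖) ^ k) (f := fun t : ℂ => F (x + t • H)) hr0
      ⟨hd.mono Metric.ball_subset_closedBall, by
        rw [closure_ball _ hr0.ne']; exact hd.continuousOn⟩ ?_
    · rw [div_mul_eq_mul_div]
      exact h3
    · intro t ht
      have ht' : ‖t‖ = r := by simpa using ht
      refine (hb _ (hmem t ht'.le)).trans ?_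
      rw [mul_assoc, ← mul_pow]
      gcongr
      have : ‖x + t • H‖ ≤ ‖x‖ + (ε - δ) := by
        refine (norm_add_le _ _).trans ?_
        rw [norm_smul, ht']
        linarith
      nlinarith [norm_nonneg x]

theorem Tame.lineDeriv_comm (h : Tame K ε F) {x : E} (hx : x ∈ Metric.thickening ε K) (H H' : E) :
    _root_.lineDeriv ℂ (fun y => _root_.lineDeriv ℂ F y H) x H' =
      _root_.lineDeriv ℂ (fun y => _root_.lineDeriv ℂ F y H') x H := by
  have hdd : DifferentiableAt ℂ (fderiv ℂ F) x :=
    ((h.contDiffAt hx).fderiv_right (m := 1) (by rw [one_add_one_eq_two]; exact show ((2 : ℕ∞) : WithTop ℕ∞) ≤ ∞ from WithTop.coe_le_coe.2 le_top)).differentiableAt (by simp)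
  have key : ∀ A B : E, _root_.lineDeriv ℂ (fun y => _root_.lineDeriv ℂ F y A) x B =
      fderiv ℂ (fderiv ℂ F) x B A := by
    intro A B
    rw [(h.lineDeriv A).lineDeriv_eq hx]
    have he : (fun y => _root_.lineDeriv ℂ F y A) =ᶠ[𝓝 x] fun y => fderiv ℂ F y A := by
      filter_upwards [Metric.isOpen_thickening.mem_nhds hx] with y hy using h.lineDeriv_eq hy A
    rw [he.fderiv_eq, fderiv_clm_apply hdd (differentiableAt_const _)]
    simp
  rw [key, key]
  have := (h.contDiffAt hx).isSymmSndFDerivAt (by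
    rw [minSmoothness_of_isRCLikeNormedField]
    exact show ((2 : ℕ∞) : WithTop ℕ∞) ≤ ∞ from WithTop.coe_le_coe.2 le_top)
  exact this H' H

theorem lineDeriv_congr_on {F G : E → ℂ} {U : Set E} (hU : IsOpen U) (h : Set.EqOn F G U) (H : E) :
    Set.EqOn (fun x => lineDeriv ℂ F x H) (fun x => lineDeriv ℂ G x H) U := by
  intro x hx
  exact Filter.EventuallyEq.lineDeriv_eq (h.eventuallyEq_of_mem (hU.mem_nhds hx))

theorem Tame.lineDeriv_sum {ι : Type*} {s : Finset ι} {F : ι → E → ℂ}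
    (h : ∀ i ∈ s, Tame K ε (F i)) {x : E} (hx : x ∈ Metric.thickening ε K) (H : E) :
    _root_.lineDeriv ℂ (fun y => ∑ i ∈ s, F i y) x H =
      ∑ i ∈ s, _root_.lineDeriv ℂ (F i) x H := by
  rw [(Tame.sum h).lineDeriv_eq hx, fderiv_fun_sum fun i hi => (h i hi).differentiableAt hx]
  rw [sum_apply]
  exact Finset.sum_congr rfl fun i hi => ((h i hi).lineDeriv_eq hx H).symm

/-- The restriction of a tame function to the real form, in real coordinates, with its gradient. -/
theorem Tame.hasGradient {ι : Type*} [Fintype ι] [DecidableEq ι] (hε : 0 < ε) (h : Tame K ε F)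
    (Λ : (ι → ℝ) →L[ℝ] E) (hΛ : ∀ x, Λ x ∈ K) :
    HasGradient (fun x => F (Λ x)) fun a x => _root_.lineDeriv ℂ F (Λ x) (Λ (Pi.single a 1)) := by
  have hK : ∀ x, Λ x ∈ Metric.thickening ε K := fun x =>
    Metric.self_subset_thickening hε K (hΛ x)
  have hK' : ∀ x, Λ x ∈ Metric.thickening (ε / 2) K := fun x =>
    Metric.self_subset_thickening (by linarith) K (hΛ x)
  have hg : ∀ {G : E → ℂ}, Tame K ε G → PolyGrowth fun x => G (Λ x) := by
    intro G hG
    obtain ⟨C, hC, k, hb⟩ := hG.growth_nonneg (show ε / 2 < ε by linarith)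
    refine ⟨C * (1 + ‖Λ‖) ^ k, k, fun x => (hb _ (hK' x)).trans ?_⟩
    rw [mul_assoc, ← mul_pow]
    gcongr
    have := Λ.le_opNorm x
    nlinarith [norm_nonneg x, norm_nonneg Λ]
  refine ⟨fun x => ?_, hg h, fun a => ?_, fun a => hg (h.lineDeriv _)⟩
  · have h1 := ((h.differentiableAt (hK x)).hasFDerivAt.restrictScalars ℝ).comp x Λ.hasFDerivAt
    convert! h1 using 1
    ext y
    have hy : y = ∑ a, y a • (Pi.single a 1 : ι → ℝ) := by
      ext i; simp [Finset.sum_apply, Pi.single_apply]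
    conv_rhs => rw [hy]
    simp only [sum_apply, ContinuousLinearMap.smulRight_apply, ContinuousLinearMap.proj_apply,
      map_sum, map_smul]
    refine Finset.sum_congr rfl fun a _ => ?_
    rw [h.lineDeriv_eq (hK x)]
    rfl
  · exact ((h.lineDeriv _).contDiffOn.continuousOn).comp_continuous Λ.continuous hK

end Tame

end

noncomputable section
open scoped ContDiff Matrix.Norms.L2Operator

/-! ### Resolvents and the trace of the logarithm -/

section TraceLog

variable {m : Type*} [Fintype m] [DecidableEq m]

/-- The trace, as a continuous linear functional. -/
def traceCLM (m : Type*) [Fintype m] [DecidableEq m] : Matrix m m ℂ →L[ℂ] ℂ :=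
  LinearMap.toContinuousLinearMap (Matrix.traceLinearMap m ℂ ℂ)

@[simp] theorem traceCLM_apply (A : Matrix m m ℂ) : traceCLM m A = A.trace := rfl

theorem norm_entry_le (A : Matrix m m ℂ) (i j : m) : ‖A i j‖ ≤ ‖A‖ := by
  have h1 := Matrix.l2_opNorm_mulVec A (EuclideanSpace.single j 1)
  have h2 := PiLp.norm_apply_le ((EuclideanSpace.equiv m ℂ).symm
    (A.mulVec (EuclideanSpace.single j (1 : ℂ)).ofLp)) i
  simp at h1 h2
  exact h2.trans h1

theorem norm_trace_le (A : Matrix m m ℂ) : ‖A.trace‖ ≤ Fintype.card m * ‖A‖ := by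
  calc ‖A.trace‖ ≤ ∑ i, ‖A i i‖ := norm_sum_le _ _
    _ ≤ ∑ _i : m, ‖A‖ := Finset.sum_le_sum fun i _ => norm_entry_le A i i
    _ = _ := by simp

theorem inv_mul_cancel_of_isUnit {A : Matrix m m ℂ} (h : IsUnit A) : A⁻¹ * A = 1 :=
  Matrix.nonsing_inv_mul A ((Matrix.isUnit_iff_isUnit_det A).1 h)

theorem mul_inv_cancel_of_isUnit {A : Matrix m m ℂ} (h : IsUnit A) : A * A⁻¹ = 1 :=
  Matrix.mul_nonsing_inv A ((Matrix.isUnit_iff_isUnit_det A).1 h)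

/-- The numerical range of `1 + i g σ` stays away from `0`: rotating by the phase of `g` makes the
second term imaginary and keeps at least half of the first. -/
theorem half_le_norm_add_I_mul {g : ℂ} (hg : ‖g‖ ≤ 2 * g.re) {a : ℝ} (ha : 0 ≤ a) (q : ℝ) :
    a ≤ 2 * ‖(a : ℂ) + Complex.I * g * q‖ := by
  rcases eq_or_ne g 0 with rfl | h0
  · simp [abs_of_nonneg ha]; linarith
  have hp : 0 < ‖g‖ := norm_pos_iff.2 h0
  have h1 : a * g.re ≤ ‖g‖ * ‖(a : ℂ) + Complex.I * g * q‖ := by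
    rw [← Complex.norm_conj g, ← norm_mul]
    refine le_trans (le_of_eq ?_) (Complex.re_le_norm _)
    simp
    ring
  have h2 : a * ‖g‖ ≤ ‖g‖ * (2 * ‖(a : ℂ) + Complex.I * g * q‖) := by
    nlinarith
  rw [mul_comm] at h2
  exact le_of_mul_le_mul_left h2 hp

/-- Resolvents of Hermitian matrices are bounded, uniformly for `g` in a sector. -/
theorem norm_inv_one_add_le {g : ℂ} (hg : ‖g‖ ≤ 2 * g.re) {σ : Matrix m m ℂ}
    (hσ : σ.IsHermitian) :
    IsUnit (1 + (Complex.I * g) • σ) ∧ ‖(1 + (Complex.I * g) • σ)⁻¹‖ ≤ 2 := by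
  set A : Matrix m m ℂ := 1 + (Complex.I * g) • σ with hA
  have key : ∀ y : EuclideanSpace ℂ m, ‖y‖ ≤ 2 * ‖Matrix.toEuclideanCLM (𝕜 := ℂ) A y‖ := by
    intro y
    set S := Matrix.toEuclideanCLM (𝕜 := ℂ) σ with hS
    have h1 : Matrix.toEuclideanCLM (𝕜 := ℂ) A y = y + (Complex.I * g) • S y := by
      simp [hA, hS, map_add, map_smul, map_one]
    have hsym : (S : EuclideanSpace ℂ m →ₗ[ℂ] EuclideanSpace ℂ m).IsSymmetric := by
      rw [hS, Matrix.coe_toEuclideanCLM_eq_toEuclideanLin]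
      exact Matrix.isSymmetric_toEuclideanLin_iff.2 hσ
    have h2 : ((inner ℂ y (S y)).re : ℂ) = inner ℂ y (S y) :=
      Complex.conj_eq_iff_re.1 (by
        have := hsym y y
        simp only [ContinuousLinearMap.coe_coe] at this
        rw [inner_conj_symm, this])
    have h3 : inner ℂ y (Matrix.toEuclideanCLM (𝕜 := ℂ) A y) =
        ((‖y‖ ^ 2 : ℝ) : ℂ) + Complex.I * g * ((inner ℂ y (S y)).re : ℝ) := by
      rw [h1, inner_add_right, inner_smul_right, h2, inner_self_eq_norm_sq_to_K]
      push_cast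
      rfl
    have h4 := half_le_norm_add_I_mul hg (sq_nonneg ‖y‖) (inner ℂ y (S y)).re
    rw [← h3] at h4
    have h5 := norm_inner_le_norm (𝕜 := ℂ) y (Matrix.toEuclideanCLM (𝕜 := ℂ) A y)
    rcases (norm_nonneg y).eq_or_lt with h0 | h0
    · rw [← h0]; positivity
    · have : ‖y‖ * ‖y‖ ≤ ‖y‖ * (2 * ‖Matrix.toEuclideanCLM (𝕜 := ℂ) A y‖) := by nlinarith
      exact le_of_mul_le_mul_left this h0
  have hu : IsUnit A := by
    rw [← Matrix.mulVec_injective_iff_isUnit]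
    intro x y hxy
    have := key (WithLp.toLp 2 (x - y))
    rw [Matrix.toEuclideanCLM_toLp, Matrix.mulVec_sub, hxy, sub_self] at this
    simp only [WithLp.toLp_zero, norm_zero, mul_zero, norm_le_zero_iff] at this
    have h := congrArg WithLp.ofLp this
    simpa [sub_eq_zero] using h
  refine ⟨hu, ?_⟩
  rw [← Matrix.l2_opNorm_toEuclideanCLM]
  refine ContinuousLinearMap.opNorm_le_bound _ (by norm_num) fun x => ?_
  refine (key _).trans (le_of_eq ?_)
  rw [← mul_apply_eq_comp, ← map_mul, mul_inv_cancel_of_isUnit hu, map_one,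
    one_apply_eq_self]

/-- The matrices `A` such that the inverse of `1 + s A` is bounded by `2` for all `s ∈ [0, 1]`. -/
def resolventSet₂ (m : Type*) [Fintype m] [DecidableEq m] : Set (Matrix m m ℂ) :=
  {A | ∀ s ∈ Set.Icc (0 : ℝ) 1, IsUnit (1 + (s : ℂ) • A) ∧ ‖(1 + (s : ℂ) • A)⁻¹‖ ≤ 2}

/-- An open set of matrices around `resolventSet₂` on which `Tr log (1 + A)` is holomorphic. -/
def logDomain (m : Type*) [Fintype m] [DecidableEq m] : Set (Matrix m m ℂ) :=
  Metric.thickening (1 / 4) (resolventSet₂ m)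

theorem isOpen_logDomain : IsOpen (logDomain m) := Metric.isOpen_thickening

/-- Neumann series: the bound on the inverse survives a perturbation of size `1 / 4`. -/
theorem norm_inv_one_add_mul_le {A D : Matrix m m ℂ} (hA : IsUnit A) (h2 : ‖A⁻¹‖ ≤ 2)
    (hD : ‖D‖ ≤ 1 / 4) : IsUnit (A + D) ∧ ‖(A + D)⁻¹‖ ≤ 4 := by
  have h1 : A + D = A * (1 - (-(A⁻¹ * D))) := by
    rw [sub_neg_eq_add, mul_add, mul_one, ← mul_assoc, mul_inv_cancel_of_isUnit hA, one_mul]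
  have h3 : ‖A⁻¹ * D‖ ≤ 1 / 2 := (norm_mul_le _ _).trans (by nlinarith [norm_nonneg D])
  have hu : IsUnit (A + D) := by
    rw [h1]
    exact hA.mul (isUnit_one_sub_of_norm_lt_one (by rw [norm_neg]; linarith))
  refine ⟨hu, ?_⟩
  have h4 : (A + D)⁻¹ = A⁻¹ - A⁻¹ * D * (A + D)⁻¹ := by
    have : A⁻¹ * (A + D) * (A + D)⁻¹ = (A + D)⁻¹ + A⁻¹ * D * (A + D)⁻¹ := by
      rw [mul_add, inv_mul_cancel_of_isUnit hA, add_mul, one_mul]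
    rw [mul_assoc, mul_inv_cancel_of_isUnit hu, mul_one] at this
    exact eq_sub_of_add_eq this.symm
  have h5 : ‖(A + D)⁻¹‖ ≤ 2 + 1 / 2 * ‖(A + D)⁻¹‖ := by
    conv_lhs => rw [h4]
    refine (norm_sub_le _ _).trans (add_le_add h2 ((norm_mul_le _ _).trans ?_))
    gcongr
  linarith

theorem norm_inv_le_of_mem_logDomain {A : Matrix m m ℂ} (hA : A ∈ logDomain m) {s : ℝ}
    (hs : s ∈ Set.Icc (0 : ℝ) 1) :
    IsUnit (1 + (s : ℂ) • A) ∧ ‖(1 + (s : ℂ) • A)⁻¹‖ ≤ 4 := by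
  obtain ⟨A₀, h₀, hd⟩ := Metric.mem_thickening_iff.1 hA
  have := norm_inv_one_add_mul_le (D := (s : ℂ) • (A - A₀)) (h₀ s hs).1 (h₀ s hs).2 (by
    rw [norm_smul, Complex.norm_real, Real.norm_of_nonneg hs.1]
    rw [dist_eq_norm] at hd
    nlinarith [hs.2, norm_nonneg (A - A₀)])
  have e : 1 + (s : ℂ) • A₀ + (s : ℂ) • (A - A₀) = 1 + (s : ℂ) • A := by module
  rwa [e] at this

/-- Determinants of pencils as products over the eigenvalues, counted with multiplicity; no
diagonalizability is needed, so this applies to matrices near the Hermitian ones. -/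
theorem det_smul_one_add_smul (A : Matrix m m ℂ) (x y : ℂ) :
    (x • (1 : Matrix m m ℂ) + y • A).det = (A.charpoly.roots.map fun b => x + y * b).prod := by
  have hcard : A.charpoly.roots.card = Fintype.card m := by
    rw [← (IsAlgClosed.splits A.charpoly).natDegree_eq_card_roots, Matrix.charpoly_natDegree_eq_dim]
  rcases eq_or_ne y 0 with rfl | hy
  · simp [hcard]
  have h1 : x • (1 : Matrix m m ℂ) + y • A = (-y) • (Matrix.scalar m (-(x / y)) - A) := by
    rw [smul_sub, Matrix.scalar_apply, ← Matrix.smul_one_eq_diagonal, smul_smul]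
    rw [show -y * -(x / y) = x by field_simp]
    module
  rw [h1, Matrix.det_smul, ← Matrix.eval_charpoly]
  conv_lhs => rw [(IsAlgClosed.splits A.charpoly).eq_prod_roots_of_monic A.charpoly_monic]
  have h2 : ∀ b : ℂ, x + y * b = (-y) * (Polynomial.eval (-(x / y)) ∘ fun b =>
      Polynomial.X - Polynomial.C b) b := fun b => by
    simp only [Function.comp_apply, Polynomial.eval_sub, Polynomial.eval_X, Polynomial.eval_C]
    field_simp
    ring
  rw [Polynomial.eval_multiset_prod, Multiset.map_map, Multiset.map_congr rfl fun b _ => h2 b,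
    Multiset.prod_map_mul, Multiset.map_const', Multiset.prod_replicate, hcard]

theorem roots_charpoly_eq_of_det {A : Matrix m m ℂ} {s : Multiset ℂ}
    (h : ∀ t : ℂ, (t • (1 : Matrix m m ℂ) - A).det = (s.map fun b => t - b).prod) :
    A.charpoly.roots = s := by
  have : A.charpoly = (s.map fun b => Polynomial.X - Polynomial.C b).prod := by
    refine Polynomial.funext fun t => ?_
    rw [Matrix.eval_charpoly, Polynomial.eval_multiset_prod, Multiset.map_map]
    rw [Matrix.scalar_apply, ← Matrix.smul_one_eq_diagonal, h]
    simp
  rw [this, Polynomial.roots_multiset_prod_X_sub_C]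

theorem one_add_mul_ne_zero {A : Matrix m m ℂ} {s : ℂ} (h : IsUnit (1 + s • A)) {b : ℂ}
    (hb : b ∈ A.charpoly.roots) : 1 + s * b ≠ 0 := by
  have h1 := det_smul_one_add_smul A 1 s
  rw [one_smul] at h1
  intro h0
  have h2 : (1 + s • A).det = 0 := by
    rw [h1]
    exact Multiset.prod_eq_zero (Multiset.mem_map.2 ⟨b, hb, h0⟩)
  have h3 := (Matrix.isUnit_iff_isUnit_det _).1 h
  rw [h2] at h3
  exact not_isUnit_zero h3

theorem traceLog_one_add_smul (A : Matrix m m ℂ) (s : ℂ) :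
    traceLog (1 + s • A) = (A.charpoly.roots.map fun b => Complex.log (1 + s * b)).sum := by
  rw [traceLog, roots_charpoly_eq_of_det (s := A.charpoly.roots.map fun b => 1 + s * b),
    Multiset.map_map]
  · rfl
  · intro t
    have h1 : t • (1 : Matrix m m ℂ) - (1 + s • A) = (t - 1) • (1 : Matrix m m ℂ) + (-s) • A := by
      module
    rw [h1, det_smul_one_add_smul, Multiset.map_map]
    congr 1
    refine Multiset.map_congr rfl fun b _ => ?_
    simp only [Function.comp_apply]
    ring

/-- The trace of `(1 + s A)⁻¹ A`, as a sum over the eigenvalues of `A`. -/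
theorem trace_inv_one_add_smul_mul {A : Matrix m m ℂ} {s : ℂ} (h : IsUnit (1 + s • A)) :
    ((1 + s • A)⁻¹ * A).trace = (A.charpoly.roots.map fun b => b / (1 + s * b)).sum := by
  rw [Matrix.trace_eq_sum_roots_charpoly, roots_charpoly_eq_of_det
    (s := A.charpoly.roots.map fun b => b / (1 + s * b))]
  intro t
  have hdet : (1 + s • A).det ≠ 0 := ((Matrix.isUnit_iff_isUnit_det _).1 h).ne_zero
  refine mul_left_cancel₀ hdet ?_
  rw [← Matrix.det_mul]
  have h1 : (1 + s • A) * (t • (1 : Matrix m m ℂ) - (1 + s • A)⁻¹ * A) =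
      t • (1 : Matrix m m ℂ) + (t * s - 1) • A := by
    rw [mul_sub, ← mul_assoc, mul_inv_cancel_of_isUnit h, one_mul, Matrix.mul_smul, mul_one]
    module
  have h2 := det_smul_one_add_smul A 1 s
  rw [one_smul] at h2
  rw [h1, h2, det_smul_one_add_smul, Multiset.map_map, ← Multiset.prod_map_mul]
  congr 1
  refine Multiset.map_congr rfl fun b hb => ?_
  have := one_add_mul_ne_zero h hb
  simp only [Function.comp_apply]
  field_simp
  ring

/-- A segment that starts at `1` has to pass through `0` before it reaches the branch cut of the
logarithm. -/
theorem one_add_mul_mem_slitPlane {b : ℂ} (h : ∀ s ∈ Set.Icc (0 : ℝ) 1, 1 + (s : ℂ) * b ≠ 0) {s : ℝ}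
    (hs : s ∈ Set.Icc (0 : ℝ) 1) : 1 + (s : ℂ) * b ∈ Complex.slitPlane := by
  rw [Complex.mem_slitPlane_iff]
  by_contra! hc
  obtain ⟨h1, h2⟩ := hc
  simp only [Complex.add_re, Complex.one_re, Complex.mul_re, Complex.ofReal_re, Complex.ofReal_im,
    zero_mul, sub_zero, Complex.add_im, Complex.one_im, Complex.mul_im, add_zero, zero_add] at h1 h2
  have hs0 : s ≠ 0 := by rintro rfl; norm_num at h1
  have hsp : 0 < s := lt_of_le_of_ne hs.1 hs0.symm
  have him : b.im = 0 := by simpa [hs0] using h2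
  have hre : b.re ≤ -1 := by nlinarith [hs.2]
  refine h (-b.re)⁻¹ ⟨by rw [inv_nonneg]; linarith, inv_le_one_of_one_le₀ (by linarith)⟩ ?_
  have h0 : b.re ≠ 0 := by linarith
  apply Complex.ext
  · simp only [Complex.add_re, Complex.one_re, Complex.mul_re, Complex.ofReal_re,
      Complex.ofReal_im, Complex.zero_re]
    field_simp
    ring
  · simp [him]

theorem hasDerivAt_inv_one_add_smul {A : Matrix m m ℂ} {s : ℝ} (h : IsUnit (1 + (s : ℂ) • A)) :
    HasDerivAt (fun s : ℝ => (1 + (s : ℂ) • A)⁻¹)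
      (-((1 + (s : ℂ) • A)⁻¹ * A * (1 + (s : ℂ) • A)⁻¹)) s := by
  obtain ⟨u, hu⟩ := h
  have h1 : HasDerivAt (fun s : ℝ => 1 + (s : ℂ) • A) A s := by
    have := ((Complex.ofRealCLM.hasDerivAt (x := s)).smul_const A).const_add 1
    simpa using this
  have h2 := hasFDerivAt_ringInverse (𝕜 := ℝ) u
  rw [hu] at h2
  have h3 := h2.comp_hasDerivAt s h1
  simp_rw [Matrix.nonsing_inv_eq_ringInverse, ← hu, Ring.inverse_unit]
  convert! h3 using 1

theorem hasFDerivAt_inv_one_add_smul {A : Matrix m m ℂ} {s : ℂ} (h : IsUnit (1 + s • A)) :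
    HasFDerivAt (fun A : Matrix m m ℂ => (1 + s • A)⁻¹)
      (-(s • ContinuousLinearMap.mulLeftRight ℂ (Matrix m m ℂ) (1 + s • A)⁻¹ (1 + s • A)⁻¹)) A := by
  obtain ⟨u, hu⟩ := h
  have h1 : HasFDerivAt (fun A : Matrix m m ℂ => 1 + s • A)
      (s • ContinuousLinearMap.id ℂ (Matrix m m ℂ)) A :=
    ((hasFDerivAt_id A).const_smul s).const_add 1
  have h2 := hasFDerivAt_ringInverse (𝕜 := ℂ) u
  rw [hu] at h2
  have h3 := h2.comp A h1
  simp_rw [Matrix.nonsing_inv_eq_ringInverse, ← hu, Ring.inverse_unit]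
  convert! h3 using 1
  ext E : 1
  simp

/-- `Tr log (1 + A) = ∫₀¹ Tr ((1 + s A)⁻¹ A) ds`. -/
theorem traceLog_eq_integral {A : Matrix m m ℂ}
    (h : ∀ s ∈ Set.Icc (0 : ℝ) 1, IsUnit (1 + (s : ℂ) • A)) :
    traceLog (1 + A) = ∫ s in (0 : ℝ)..1, ((1 + (s : ℂ) • A)⁻¹ * A).trace := by
  have hd : ∀ s ∈ Set.Icc (0 : ℝ) 1, HasDerivAt
      (fun s : ℝ => (A.charpoly.roots.map fun b => Complex.log (1 + s * b)).sum)
      ((1 + (s : ℂ) • A)⁻¹ * A).trace s := by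
    intro s hs
    rw [trace_inv_one_add_smul_mul (h s hs)]
    have hb : ∀ b ∈ A.charpoly.roots, 1 + (s : ℂ) * b ∈ Complex.slitPlane := fun b hb =>
      one_add_mul_mem_slitPlane (fun s hs => one_add_mul_ne_zero (h s hs) hb) hs
    generalize A.charpoly.roots = r at hb
    induction r using Multiset.induction_on with
    | empty => simpa using hasDerivAt_const s (0 : ℂ)
    | cons b r ih =>
      simp only [Multiset.map_cons, Multiset.sum_cons]
      refine HasDerivAt.add ?_ (ih fun c hc => hb c (Multiset.mem_cons_of_mem hc))
      have h1 : HasDerivAt (fun s : ℂ => 1 + s * b) b (s : ℂ) := by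
        simpa using ((hasDerivAt_id (s : ℂ)).mul_const b).const_add 1
      exact (h1.clog (hb b (Multiset.mem_cons_self b r))).comp_ofReal
  have hc : ContinuousOn (fun s : ℝ => ((1 + (s : ℂ) • A)⁻¹ * A).trace) (Set.uIcc 0 1) := by
    rw [Set.uIcc_of_le zero_le_one]
    intro s hs
    have h1 := (hasDerivAt_inv_one_add_smul (h s hs)).continuousAt
    exact ((traceCLM m).continuous.continuousAt.comp
      (h1.mul continuousAt_const)).continuousWithinAt
  rw [intervalIntegral.integral_eq_sub_of_hasDerivAt (fun s hs => hd s (by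
    rwa [Set.uIcc_of_le zero_le_one] at hs)) hc.intervalIntegrable]
  have h1 := traceLog_one_add_smul A 1
  rw [one_smul] at h1
  rw [h1]
  simp

/-- The functional `E ↦ Tr (B E)`. -/
def traceMul (B : Matrix m m ℂ) : Matrix m m ℂ →L[ℂ] ℂ :=
  (traceCLM m).comp (ContinuousLinearMap.mul ℂ (Matrix m m ℂ) B)

@[simp] theorem traceMul_apply (B E : Matrix m m ℂ) : traceMul B E = (B * E).trace := rfl

/-- The derivative of `Tr log (1 + A)` is the trace against the resolvent. -/
theorem hasFDerivAt_traceLog {A : Matrix m m ℂ} (hA : A ∈ logDomain m) :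
    HasFDerivAt (fun A : Matrix m m ℂ => traceLog (1 + A)) (traceMul (1 + A)⁻¹) A := by
  set R : ℝ → Matrix m m ℂ → Matrix m m ℂ := fun s A => (1 + (s : ℂ) • A)⁻¹ with hR
  have hU : ∀ B ∈ logDomain m, ∀ s ∈ Set.Icc (0 : ℝ) 1, IsUnit (1 + (s : ℂ) • B) :=
    fun B hB s hs => (norm_inv_le_of_mem_logDomain hB hs).1
  have hsAR : ∀ B ∈ logDomain m, ∀ s ∈ Set.Icc (0 : ℝ) 1, R s B - (s : ℂ) • (R s B * B * R s B) =
      R s B * R s B := by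
    intro B hB s hs
    have h1 : R s B = 1 - R s B * ((s : ℂ) • B) := by
      have := inv_mul_cancel_of_isUnit (hU B hB s hs)
      rw [mul_add, mul_one] at this
      exact eq_sub_of_add_eq this
    calc R s B - (s : ℂ) • (R s B * B * R s B) = (1 - R s B * ((s : ℂ) • B)) * R s B := by
          rw [sub_mul, one_mul, Matrix.mul_smul, Matrix.smul_mul]
      _ = _ := by rw [← h1]
  have hRc : ∀ B ∈ logDomain m, ContinuousOn (fun s => R s B) (Set.Icc 0 1) := fun B hB s hs =>
    (hasDerivAt_inv_one_add_smul (hU B hB s hs)).continuousAt.continuousWithinAt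
  have hFc : ∀ B ∈ logDomain m, ContinuousOn (fun s => (R s B * B).trace) (Set.Icc 0 1) :=
    fun B hB => (traceCLM m).continuous.comp_continuousOn ((hRc B hB).mul continuousOn_const)
  have hTc : Continuous (traceMul : Matrix m m ℂ → _) :=
    ((ContinuousLinearMap.compL ℂ (Matrix m m ℂ) (Matrix m m ℂ) ℂ (traceCLM m)).comp
      (ContinuousLinearMap.mul ℂ (Matrix m m ℂ))).continuous
  have hF'c : ContinuousOn (fun s => traceMul (R s A * R s A)) (Set.Icc 0 1) :=
    hTc.comp_continuousOn ((hRc A hA).mul (hRc A hA))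
  have key := hasFDerivAt_integral_of_dominated_of_fderiv_le (𝕜 := ℂ)
    (μ := volume.restrict (Set.Ioc (0 : ℝ) 1)) (s := logDomain m)
    (F := fun B s => (R s B * B).trace) (F' := fun B s => traceMul (R s B * R s B)) (x₀ := A)
    (bound := fun _ => Fintype.card m * 16) (isOpen_logDomain.mem_nhds hA) ?_ ?_ ?_ ?_ ?_ ?_
  · have hint : ∫ s in Set.Ioc (0 : ℝ) 1, traceMul (R s A * R s A) = traceMul (1 + A)⁻¹ := by
      have hd : ∀ s ∈ Set.uIcc (0 : ℝ) 1, HasDerivAt (fun s : ℝ => (s : ℂ) • traceMul (R s A))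
          (traceMul (R s A * R s A)) s := by
        intro s hs
        rw [Set.uIcc_of_le zero_le_one] at hs
        have h1 := hasDerivAt_inv_one_add_smul (hU A hA s hs)
        have h2 : HasDerivAt (fun s : ℝ => (s : ℂ) • R s A)
            ((s : ℂ) • (-(R s A * A * R s A)) + (1 : ℂ) • R s A) s := by
          have h3 : HasDerivAt (fun s : ℝ => (s : ℂ)) 1 s := Complex.ofRealCLM.hasDerivAt
          exact h3.smul h1
        have e : (s : ℂ) • (-(R s A * A * R s A)) + (1 : ℂ) • R s A = R s A * R s A := by
          rw [← hsAR A hA s hs]; module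
        rw [e] at h2
        have h4 := (((ContinuousLinearMap.compL ℂ (Matrix m m ℂ) (Matrix m m ℂ) ℂ
          (traceCLM m)).comp (ContinuousLinearMap.mul ℂ (Matrix m m ℂ))).restrictScalars
          ℝ).hasFDerivAt.comp_hasDerivAt s h2
        convert! h4 using 1
        ext s E
        simp [traceMul]
      rw [← intervalIntegral.integral_of_le zero_le_one,
        intervalIntegral.integral_eq_sub_of_hasDerivAt hd]
      · simp only [Complex.ofReal_one, Complex.ofReal_zero, hR, one_smul]
        ext E
        simp
      · rw [← Set.uIcc_of_le zero_le_one] at hF'c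
        exact hF'c.intervalIntegrable
    rw [hint] at key
    refine key.congr_of_eventuallyEq ?_
    filter_upwards [isOpen_logDomain.mem_nhds hA] with B hB
    rw [traceLog_eq_integral (hU B hB), intervalIntegral.integral_of_le zero_le_one]
  · filter_upwards [isOpen_logDomain.mem_nhds hA] with B hB
    exact ((hFc B hB).mono Set.Ioc_subset_Icc_self).aestronglyMeasurable measurableSet_Ioc
  · have := (hFc A hA).integrableOn_Icc (μ := volume)
    exact this.mono_set Set.Ioc_subset_Icc_self
  · exact (hF'c.mono Set.Ioc_subset_Icc_self).aestronglyMeasurable measurableSet_Ioc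
  · refine (ae_restrict_iff' measurableSet_Ioc).2 (Eventually.of_forall fun s hs B hB => ?_)
    have h4 := (norm_inv_le_of_mem_logDomain hB (Set.Ioc_subset_Icc_self hs)).2
    refine ContinuousLinearMap.opNorm_le_bound _ (by positivity) fun E => ?_
    rw [traceMul_apply]
    have h5 : ‖R s B * R s B‖ ≤ 16 := (norm_mul_le _ _).trans (by
      nlinarith [norm_nonneg (R s B)])
    calc ‖(R s B * R s B * E).trace‖ ≤ Fintype.card m * ‖R s B * R s B * E‖ := norm_trace_le _
      _ ≤ Fintype.card m * (16 * ‖E‖) := by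
          gcongr
          exact (norm_mul_le _ _).trans (by gcongr)
      _ = _ := by ring
  · exact integrable_const _
  · refine (ae_restrict_iff' measurableSet_Ioc).2 (Eventually.of_forall fun s hs B hB => ?_)
    have hs' := Set.Ioc_subset_Icc_self hs
    have h1 := hasFDerivAt_inv_one_add_smul (hU B hB s hs')
    have h2 := h1.mul' (hasFDerivAt_id B)
    have h3 := (traceCLM m).hasFDerivAt.comp B h2
    refine h3.congr_fderiv ?_
    ext E
    rw [traceMul_apply, ← hsAR B hB s hs', sub_mul, Matrix.trace_sub, Matrix.smul_mul,
      Matrix.trace_smul]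
    have e : (R s B * B * R s B * E).trace = (R s B * E * R s B * B).trace := by
      rw [mul_assoc (R s B * B), Matrix.trace_mul_comm, mul_assoc (R s B * E)]
    rw [e]
    simp [hR, sub_eq_add_neg]

theorem contDiffOn_inv_one_add :
    ContDiffOn ℂ ∞ (fun A : Matrix m m ℂ => (1 + A)⁻¹) (logDomain m) := by
  intro A hA
  obtain ⟨u, hu⟩ := (norm_inv_le_of_mem_logDomain hA (s := 1) (by simp)).1
  have h1 := contDiffAt_ringInverse ℂ (n := ∞) u
  have h2 : ContDiffAt ℂ ∞ (fun A : Matrix m m ℂ => 1 + A) A := by fun_prop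
  have e : (u : Matrix m m ℂ) = 1 + A := by rw [hu]; simp
  rw [e] at h1
  have h3 := h1.comp A h2
  refine ContDiffAt.contDiffWithinAt ?_
  convert! h3 using 1
  ext A
  simp [Matrix.nonsing_inv_eq_ringInverse]

theorem contDiffOn_traceLog :
    ContDiffOn ℂ ∞ (fun A : Matrix m m ℂ => traceLog (1 + A)) (logDomain m) := by
  rw [contDiffOn_infty_iff_fderiv_of_isOpen isOpen_logDomain]
  refine
    ⟨fun A hA => (hasFDerivAt_traceLog hA).differentiableAt.differentiableWithinAt, ?_⟩
  have h1 : ContDiffOn ℂ ∞ (fun A : Matrix m m ℂ => (traceMul (1 + A)⁻¹ : Matrix m m ℂ →L[ℂ] ℂ))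
      (logDomain m) :=
    (((ContinuousLinearMap.compL ℂ (Matrix m m ℂ) (Matrix m m ℂ) ℂ (traceCLM m)).comp
      (ContinuousLinearMap.mul ℂ (Matrix m m ℂ))).contDiff (n := ∞)).comp_contDiffOn
      contDiffOn_inv_one_add
  exact h1.congr fun A hA => (hasFDerivAt_traceLog hA).fderiv

/-- The trace of the logarithm grows at most linearly. -/
theorem norm_traceLog_le {A : Matrix m m ℂ} {c : ℝ}
    (h : ∀ s ∈ Set.Icc (0 : ℝ) 1, IsUnit (1 + (s : ℂ) • A) ∧ ‖(1 + (s : ℂ) • A)⁻¹‖ ≤ c) :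
    ‖traceLog (1 + A)‖ ≤ Fintype.card m * (c * ‖A‖) := by
  rw [traceLog_eq_integral fun s hs => (h s hs).1]
  have := intervalIntegral.norm_integral_le_of_norm_le_const (a := 0) (b := 1)
    (f := fun s : ℝ => ((1 + (s : ℂ) • A)⁻¹ * A).trace) (C := Fintype.card m * (c * ‖A‖)) ?_
  · simpa using this
  · intro s hs
    rw [Set.uIoc_of_le zero_le_one] at hs
    refine (norm_trace_le _).trans ?_
    gcongr
    refine (norm_mul_le _ _).trans ?_
    gcongr
    exact (h s (Set.Ioc_subset_Icc_self hs)).2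

/-- The Kronecker factor `1` multiplies the trace of the logarithm by its dimension. -/
theorem traceLog_one_kronecker {m' : Type*} [Fintype m'] [DecidableEq m'] (A : Matrix m m ℂ) :
    traceLog ((1 : Matrix m' m' ℂ) ⊗ₖ A) = Fintype.card m' * traceLog A := by
  rw [traceLog, roots_charpoly_eq_of_det (s := Fintype.card m' • A.charpoly.roots)]
  · rw [Multiset.map_nsmul, Multiset.sum_nsmul, traceLog, nsmul_eq_mul]
  · intro t
    have h1 : t • (1 : Matrix (m' × m) (m' × m) ℂ) - (1 : Matrix m' m' ℂ) ⊗ₖ A =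
        (1 : Matrix m' m' ℂ) ⊗ₖ (t • (1 : Matrix m m ℂ) + (-1 : ℂ) • A) := by
      rw [Matrix.kronecker_add, Matrix.kronecker_smul, Matrix.kronecker_smul,
        Matrix.one_kronecker_one]
      module
    rw [h1, Matrix.det_kronecker, det_smul_one_add_smul, Matrix.det_one, one_pow, one_mul,
      Multiset.map_nsmul, Multiset.prod_nsmul]
    congr 3
    ext b
    ring

theorem exp_traceLog {A : Matrix m m ℂ} (hA : IsUnit A) : Complex.exp (traceLog A) = A.det := by
  rw [Matrix.det_eq_prod_roots_charpoly, traceLog, Complex.exp_multiset_sum, Multiset.map_map]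
  congr 1
  conv_rhs => rw [← Multiset.map_id A.charpoly.roots]
  refine Multiset.map_congr rfl fun b hb => Complex.exp_log ?_
  rintro rfl
  have h1 : A.det = 0 := by
    rw [Matrix.det_eq_prod_roots_charpoly]; exact Multiset.prod_eq_zero hb
  have h2 := (Matrix.isUnit_iff_isUnit_det _).1 hA
  rw [h1] at h2
  exact not_isUnit_zero h2

end TraceLog

end

noncomputable section
open scoped ContDiff Matrix.Norms.L2Operator

/-! ### Vertices and line operators near Hermitian fields -/

/-- Tuples of Hermitian matrices. -/
def hermTuples (n N : ℕ) : Set (Fin n → Matrix (Fin N) (Fin N) ℂ) := {σ | ∀ v, (σ v).IsHermitian}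

/-- The resolvent `(1 + i g σ)⁻¹`. -/
def fieldResolvent (N : ℕ) (g : ℂ) (σ : Matrix (Fin N) (Fin N) ℂ) : Matrix (Fin N) (Fin N) ℂ :=
  (1 + (Complex.I * g) • σ)⁻¹

/-- The vertex `-N Tr log (1 + i g σ)`. -/
def vertex (N : ℕ) (g : ℂ) (σ : Matrix (Fin N) (Fin N) ℂ) : ℂ :=
  -((N : ℂ) * traceLog (1 + (Complex.I * g) • σ))

/-- The factor `1 ⊗` of the loop vertex only produces a factor `N`. -/
theorem loopVertex_eq (N : ℕ) (z : ℂ) (σ : Matrix (Fin N) (Fin N) ℂ) :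
    loopVertex N z σ = vertex N (Complex.sqrt (2 * z / (N : ℂ))) σ := by
  rw [loopVertex, vertex, ← Matrix.kronecker_add, traceLog_one_kronecker, fieldInsertion,
    smul_smul, Fintype.card_fin]

/-- The width of the complex neighbourhood of the Hermitian matrices on which all resolvents are
bounded by `4`. -/
def tubeRadius (g : ℂ) : ℝ := 1 / (4 * (‖g‖ + 1))

theorem tubeRadius_pos (g : ℂ) : 0 < tubeRadius g := by unfold tubeRadius; positivity

/-- The complex neighbourhood of the tuples of Hermitian matrices. -/
abbrev tube (n N : ℕ) (g : ℂ) : Set (Fin n → Matrix (Fin N) (Fin N) ℂ) :=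
  Metric.thickening (tubeRadius g) (hermTuples n N)

theorem isOpen_tube (n N : ℕ) (g : ℂ) : IsOpen (tube n N g) := Metric.isOpen_thickening

theorem mem_resolventSet₂ {N : ℕ} {g : ℂ} (hg : ‖g‖ ≤ 2 * g.re) {σ : Matrix (Fin N) (Fin N) ℂ}
    (hσ : σ.IsHermitian) : (Complex.I * g) • σ ∈ resolventSet₂ (Fin N) := by
  intro s hs
  have h1 : ‖(s : ℂ) * g‖ ≤ 2 * ((s : ℂ) * g).re := by
    rw [norm_mul, Complex.norm_real, Real.norm_of_nonneg hs.1, Complex.re_ofReal_mul]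
    nlinarith [hs.1]
  have h2 := norm_inv_one_add_le h1 hσ
  rwa [show (Complex.I * (s * g)) • σ = (s : ℂ) • (Complex.I * g) • σ by
    rw [smul_smul]; congr 1; ring] at h2

theorem mem_logDomain_of_mem_tube {n N : ℕ} {g : ℂ} (hg : ‖g‖ ≤ 2 * g.re)
    {σ : Fin n → Matrix (Fin N) (Fin N) ℂ} (hσ : σ ∈ tube n N g) (v : Fin n) :
    (Complex.I * g) • σ v ∈ logDomain (Fin N) := by
  obtain ⟨τ, hτ, hd⟩ := Metric.mem_thickening_iff.1 hσ
  refine Metric.mem_thickening_iff.2 ⟨(Complex.I * g) • τ v, mem_resolventSet₂ hg (hτ v), ?_⟩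
  rw [dist_eq_norm, ← smul_sub, norm_smul, norm_mul, Complex.norm_I, one_mul]
  have h1 : ‖σ v - τ v‖ < tubeRadius g := by
    rw [dist_eq_norm] at hd
    exact (norm_le_pi_norm (σ - τ) v).trans_lt hd
  have h2 : (‖g‖ + 1) * tubeRadius g = 1 / 4 := by
    unfold tubeRadius; field_simp
  have h3 := tubeRadius_pos g
  nlinarith [norm_nonneg g, norm_nonneg (σ v - τ v)]

theorem hermTuples_subset_tube (n N : ℕ) (g : ℂ) : hermTuples n N ⊆ tube n N g :=
  Metric.self_subset_thickening (tubeRadius_pos g) _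

theorem resolvent_bound {n N : ℕ} {g : ℂ} (hg : ‖g‖ ≤ 2 * g.re)
    {σ : Fin n → Matrix (Fin N) (Fin N) ℂ} (hσ : σ ∈ tube n N g) (v : Fin n) :
    IsUnit (1 + (Complex.I * g) • σ v) ∧ ‖fieldResolvent N g (σ v)‖ ≤ 4 := by
  have := norm_inv_le_of_mem_logDomain (mem_logDomain_of_mem_tube hg hσ v) (s := 1) (by simp)
  simpa [fieldResolvent] using this

theorem contDiffOn_resolvent {n N : ℕ} {g : ℂ} (hg : ‖g‖ ≤ 2 * g.re) (v : Fin n) :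
    ContDiffOn ℂ ∞ (fun σ : Fin n → Matrix (Fin N) (Fin N) ℂ => fieldResolvent N g (σ v))
      (tube n N g) := by
  have h1 : ContDiff ℂ ∞ fun σ : Fin n → Matrix (Fin N) (Fin N) ℂ => (Complex.I * g) • σ v := by
    fun_prop
  exact contDiffOn_inv_one_add.comp h1.contDiffOn fun σ hσ => mem_logDomain_of_mem_tube hg hσ v

theorem tame_vertex {n N : ℕ} {g : ℂ} (hg : ‖g‖ ≤ 2 * g.re) (v : Fin n) :
    Tame (hermTuples n N) (tubeRadius g) fun σ => vertex N g (σ v) where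
  contDiffOn := by
    have h1 : ContDiff ℂ ∞ fun σ : Fin n → Matrix (Fin N) (Fin N) ℂ => (Complex.I * g) • σ v := by
      fun_prop
    exact (contDiffOn_const.mul (contDiffOn_traceLog.comp h1.contDiffOn
      fun σ hσ => mem_logDomain_of_mem_tube hg hσ v)).neg
  growth δ hδ := by
    refine ⟨N * (N * (4 * ‖g‖)), 1, fun σ hσ => ?_⟩
    have h1 := norm_traceLog_le fun s hs => norm_inv_le_of_mem_logDomain
      (mem_logDomain_of_mem_tube hg (Metric.thickening_mono hδ.le _ hσ) v) hs
    rw [vertex, norm_neg, norm_mul, Complex.norm_natCast]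
    rw [Fintype.card_fin, norm_smul, norm_mul, Complex.norm_I, one_mul] at h1
    have h2 : ‖σ v‖ ≤ 1 + ‖σ‖ := by linarith [norm_le_pi_norm σ v]
    calc (N : ℝ) * ‖traceLog (1 + (Complex.I * g) • σ v)‖
        ≤ N * (N * (4 * (‖g‖ * (1 + ‖σ‖)))) := by gcongr; exact h1.trans (by gcongr)
      _ = N * (N * (4 * ‖g‖)) * (1 + ‖σ‖) ^ 1 := by ring

section LineOperator

variable {n N : ℕ} {ε : ℝ} {F G : (Fin n → Matrix (Fin N) (Fin N) ℂ) → ℂ}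

theorem Tame.fieldDeriv (h : Tame (hermTuples n N) ε F) (v : Fin n) (i j : Fin N) :
    Tame (hermTuples n N) ε (fieldDeriv v i j F) :=
  h.lineDeriv _

theorem Tame.lineOperator (h : Tame (hermTuples n N) ε F) (e : Fin n × Fin n) :
    Tame (hermTuples n N) ε (lineOperator e F) :=
  Tame.sum fun i _ => Tame.sum fun j _ => (h.fieldDeriv e.2 j i).fieldDeriv e.1 i j

theorem lineOperator_congr_on (h : Set.EqOn F G (Metric.thickening ε (hermTuples n N)))
    (e : Fin n × Fin n) :
    Set.EqOn (lineOperator e F) (lineOperator e G) (Metric.thickening ε (hermTuples n N)) := by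
  intro σ hσ
  refine Finset.sum_congr rfl fun i _ => Finset.sum_congr rfl fun j _ => ?_
  exact lineDeriv_congr_on Metric.isOpen_thickening
    (lineDeriv_congr_on Metric.isOpen_thickening h _) _ hσ

theorem lineOperator_sum {ι : Type*} {s : Finset ι}
    {F : ι → (Fin n → Matrix (Fin N) (Fin N) ℂ) → ℂ}
    (h : ∀ i ∈ s, Tame (hermTuples n N) ε (F i)) (e : Fin n × Fin n) :
    Set.EqOn (lineOperator e fun σ => ∑ i ∈ s, F i σ) (fun σ => ∑ i ∈ s, lineOperator e (F i) σ)
      (Metric.thickening ε (hermTuples n N)) := by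
  intro σ hσ
  have h0 : ∑ k ∈ s, lineOperator e (F k) σ = ∑ i, ∑ j, ∑ k ∈ s,
      _root_.fieldDeriv e.1 i j (_root_.fieldDeriv e.2 j i (F k)) σ := by
    simp only [lineOperator]
    rw [Finset.sum_comm]
    exact Finset.sum_congr rfl fun i _ => Finset.sum_comm
  refine Eq.trans (Finset.sum_congr rfl fun i _ => Finset.sum_congr rfl fun j _ => ?_) h0.symm
  have h1 : Set.EqOn (_root_.fieldDeriv e.2 j i fun σ => ∑ k ∈ s, F k σ)
      (fun σ => ∑ k ∈ s, _root_.fieldDeriv e.2 j i (F k) σ)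
      (Metric.thickening ε (hermTuples n N)) := fun τ hτ => Tame.lineDeriv_sum h hτ _
  refine (lineDeriv_congr_on Metric.isOpen_thickening h1 _ hσ).trans ?_
  exact Tame.lineDeriv_sum (fun k hk => (h k hk).fieldDeriv e.2 j i) hσ _

theorem lineDeriv_lineOperator (h : Tame (hermTuples n N) ε F) (e : Fin n × Fin n)
    (H : Fin n → Matrix (Fin N) (Fin N) ℂ) :
    Set.EqOn (fun σ => lineDeriv ℂ (lineOperator e F) σ H)
      (lineOperator e fun σ => lineDeriv ℂ F σ H) (Metric.thickening ε (hermTuples n N)) := by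
  intro σ hσ
  have h1 : ∀ i j, Tame (hermTuples n N) ε
      (_root_.fieldDeriv e.1 i j (_root_.fieldDeriv e.2 j i F)) := fun i j =>
    (h.fieldDeriv e.2 j i).fieldDeriv e.1 i j
  have h2 : lineDeriv ℂ (lineOperator e F) σ H = ∑ i, ∑ j,
      lineDeriv ℂ (_root_.fieldDeriv e.1 i j (_root_.fieldDeriv e.2 j i F)) σ H := by
    have := Tame.lineDeriv_sum (fun i (_ : i ∈ Finset.univ) =>
      Tame.sum fun j (_ : j ∈ Finset.univ) => h1 i j) hσ H
    refine this.trans (Finset.sum_congr rfl fun i _ => ?_)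
    exact Tame.lineDeriv_sum (fun j _ => h1 i j) hσ H
  refine h2.trans ?_
  refine Finset.sum_congr rfl fun i _ => Finset.sum_congr rfl fun j _ => ?_
  refine ((h.fieldDeriv e.2 j i).lineDeriv_comm hσ _ H).trans ?_
  exact lineDeriv_congr_on Metric.isOpen_thickening (fun τ hτ => h.lineDeriv_comm hτ _ H) _ hσ

/-- Line operators commute, so that the order of the lines of a tree is immaterial. -/
theorem lineOperator_comm (h : Tame (hermTuples n N) ε F) (e e' : Fin n × Fin n) :
    Set.EqOn (lineOperator e (lineOperator e' F)) (lineOperator e' (lineOperator e F))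
      (Metric.thickening ε (hermTuples n N)) := by
  intro σ hσ
  have h1 : ∀ i j, Set.EqOn (_root_.fieldDeriv e.1 i j (_root_.fieldDeriv e.2 j i
      (lineOperator e' F))) (lineOperator e' (_root_.fieldDeriv e.1 i j
        (_root_.fieldDeriv e.2 j i F))) (Metric.thickening ε (hermTuples n N)) := by
    intro i j τ hτ
    refine (lineDeriv_congr_on Metric.isOpen_thickening (lineDeriv_lineOperator h e' _) _ hτ).trans ?_
    exact lineDeriv_lineOperator (h.fieldDeriv e.2 j i) e' _ hτ
  have h2 : ∀ i j, Tame (hermTuples n N) ε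
      (_root_.fieldDeriv e.1 i j (_root_.fieldDeriv e.2 j i F)) := fun i j =>
    (h.fieldDeriv e.2 j i).fieldDeriv e.1 i j
  have h3 := lineOperator_sum (fun i (_ : i ∈ Finset.univ) =>
      Tame.sum fun j (_ : j ∈ Finset.univ) => h2 i j) e' hσ
  refine Eq.trans ?_ h3.symm
  refine Finset.sum_congr rfl fun i _ => ?_
  refine Eq.trans ?_ (lineOperator_sum (fun j (_ : j ∈ Finset.univ) => h2 i j) e' hσ).symm
  exact Finset.sum_congr rfl fun j _ => h1 i j hσ

theorem lineOperator_swap (h : Tame (hermTuples n N) ε F) (a b : Fin n) :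
    Set.EqOn (lineOperator (a, b) F) (lineOperator (b, a) F)
      (Metric.thickening ε (hermTuples n N)) := by
  intro σ hσ
  simp only [lineOperator]
  rw [Finset.sum_comm]
  exact Finset.sum_congr rfl fun j _ => Finset.sum_congr rfl fun i _ => h.lineDeriv_comm hσ _ _

/-- Successive application of line operators. -/
def lineOperators (L : List (Fin n × Fin n)) (F : (Fin n → Matrix (Fin N) (Fin N) ℂ) → ℂ) :
    (Fin n → Matrix (Fin N) (Fin N) ℂ) → ℂ :=
  L.foldr (fun e F => lineOperator e F) F

@[simp] theorem lineOperators_nil : lineOperators [] F = F := rfl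

@[simp] theorem lineOperators_cons (e : Fin n × Fin n) (L : List (Fin n × Fin n)) :
    lineOperators (e :: L) F = lineOperator e (lineOperators L F) := rfl

theorem Tame.lineOperators (h : Tame (hermTuples n N) ε F) (L : List (Fin n × Fin n)) :
    Tame (hermTuples n N) ε (lineOperators L F) := by
  induction L with
  | nil => exact h
  | cons e L ih => exact ih.lineOperator e

theorem lineOperators_perm (h : Tame (hermTuples n N) ε F) {L L' : List (Fin n × Fin n)}
    (hL : L.Perm L') : Set.EqOn (lineOperators L F) (lineOperators L' F)
      (Metric.thickening ε (hermTuples n N)) := by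
  induction hL with
  | nil => exact fun _ _ => rfl
  | cons e _ ih => exact lineOperator_congr_on ih e
  | swap e e' L => exact lineOperator_comm (h.lineOperators L) e' e
  | trans _ _ ih ih' => exact ih.trans ih'

/-- The orientation of the lines is immaterial. -/
theorem lineOperators_orient (h : Tame (hermTuples n N) ε F) (L : List (Fin n × Fin n))
    (o : Fin n × Fin n → Fin n × Fin n) (ho : ∀ e ∈ L, o e = e ∨ o e = e.swap) :
    Set.EqOn (lineOperators (L.map o) F) (lineOperators L F)
      (Metric.thickening ε (hermTuples n N)) := by
  induction L with
  | nil => exact fun _ _ => rfl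
  | cons e L ih =>
    rw [List.map_cons, lineOperators_cons, lineOperators_cons]
    have h1 := lineOperator_congr_on (ih fun e he => ho e (List.mem_cons_of_mem _ he)) (o e)
    refine h1.trans ?_
    rcases ho e List.mem_cons_self with h2 | h2
    · rw [h2]; exact fun _ _ => rfl
    · rw [h2]; exact lineOperator_swap (h.lineOperators L) e.2 e.1

end LineOperator

/-! ### Gaussian expectations of functions of Hermitian fields -/

/-- `fieldsOfCoords`, as a continuous linear map on coordinate arrays. -/
def fieldsCLM (n N : ℕ) :
    (Fin n × (Fin N × Fin N) → ℝ) →L[ℝ] (Fin n → Matrix (Fin N) (Fin N) ℂ) :=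
  LinearMap.toContinuousLinearMap
    { toFun := fun x v => hermitianOfCoords fun ij => x (v, ij)
      map_add' := fun x y => by
        ext v i j; simp [hermitianOfCoords]; ring
      map_smul' := fun c x => by
        ext v i j; simp [hermitianOfCoords]; ring }

theorem fieldsOfCoords_eq {n N : ℕ} (x : EuclideanSpace ℝ (Fin n × (Fin N × Fin N))) :
    fieldsOfCoords x = fieldsCLM n N x.ofLp := rfl

theorem isHermitian_hermitianOfCoords {N : ℕ} (x : Fin N × Fin N → ℝ) :
    (hermitianOfCoords x).IsHermitian := by
  ext i j
  simp [hermitianOfCoords, Matrix.conjTranspose_apply]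
  ring

theorem fieldsCLM_mem (n N : ℕ) (x : Fin n × (Fin N × Fin N) → ℝ) :
    fieldsCLM n N x ∈ hermTuples n N := fun _ => isHermitian_hermitianOfCoords _

/-- The expectation of `G` of Hermitian fields with covariance
`⟨σ v i j σ v' k l⟩ = δ i l δ j k S v v'`. -/
def fieldMean {n : ℕ} (N : ℕ) (S : Matrix (Fin n) (Fin n) ℝ)
    (G : (Fin n → Matrix (Fin N) (Fin N) ℂ) → ℂ) : ℂ :=
  ∫ x, G (fieldsOfCoords x) ∂(multivariateGaussian 0
    (S ⊗ₖ (1 : Matrix (Fin N × Fin N) (Fin N × Fin N) ℝ)))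

theorem fieldMean_eq {n : ℕ} (N : ℕ) (S : Matrix (Fin n) (Fin n) ℝ)
    (G : (Fin n → Matrix (Fin N) (Fin N) ℂ) → ℂ) :
    fieldMean N S G = gaussianMean (S ⊗ₖ (1 : Matrix (Fin N × Fin N) (Fin N × Fin N) ℝ))
      (fun x => G (fieldsCLM n N x)) := rfl

theorem fieldMean_congr {n N : ℕ} (S : Matrix (Fin n) (Fin n) ℝ)
    {F G : (Fin n → Matrix (Fin N) (Fin N) ℂ) → ℂ} (h : Set.EqOn F G (hermTuples n N)) :
    fieldMean N S F = fieldMean N S G := by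
  unfold fieldMean
  congr 1
  ext x
  exact h (fieldsCLM_mem n N _)

theorem posSemidef_kronecker_one {n N : ℕ} {S : Matrix (Fin n) (Fin n) ℝ} (hS : S.PosSemidef) :
    (S ⊗ₖ (1 : Matrix (Fin N × Fin N) (Fin N × Fin N) ℝ)).PosSemidef :=
  hS.kronecker Matrix.PosSemidef.one

section

variable {n N : ℕ} {ε : ℝ} {F G : (Fin n → Matrix (Fin N) (Fin N) ℂ) → ℂ}

theorem Tame.integrable (hε : 0 < ε) (h : Tame (hermTuples n N) ε G)
    {S : Matrix (Fin n) (Fin n) ℝ} (hS : S.PosSemidef) :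
    Integrable (fun x => G (fieldsOfCoords x)) (multivariateGaussian 0
    (S ⊗ₖ (1 : Matrix (Fin N × Fin N) (Fin N × Fin N) ℝ))) :=
  integrable_multivariateGaussian (posSemidef_kronecker_one hS)
    (h.hasGradient hε (fieldsCLM n N) (fieldsCLM_mem n N)).continuous
    (h.hasGradient hε (fieldsCLM n N) (fieldsCLM_mem n N)).growth

/-- A real coordinate direction is a complex combination of two matrix units; this makes the
real derivatives those of the entries treated as independent complex variables. -/
theorem fieldsCLM_single (v : Fin n) (i j : Fin N) :
    fieldsCLM n N (Pi.single (v, (i, j)) 1) =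
      ((1 + Complex.I) / 2) •
        (Pi.single v (Matrix.single i j (1 : ℂ)) : Fin n → Matrix (Fin N) (Fin N) ℂ) +
      ((1 - Complex.I) / 2) •
        (Pi.single v (Matrix.single j i (1 : ℂ)) : Fin n → Matrix (Fin N) (Fin N) ℂ) := by
  ext v' k l
  by_cases hv : v' = v
  · subst hv
    simp only [fieldsCLM, hermitianOfCoords, LinearMap.coe_toContinuousLinearMap', LinearMap.coe_mk,
      AddHom.coe_mk, Matrix.of_apply, Pi.add_apply, Pi.smul_apply, Pi.single_eq_same,
      Matrix.add_apply, Matrix.smul_apply, Matrix.single_apply, Pi.single_apply, smul_eq_mul,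
      Prod.mk.injEq, true_and]
    have e1 : (k = i ∧ l = j) ↔ (i = k ∧ j = l) := by
      constructor <;> rintro ⟨rfl, rfl⟩ <;> exact ⟨rfl, rfl⟩
    have e2 : (l = i ∧ k = j) ↔ (j = k ∧ i = l) := by
      constructor <;> rintro ⟨rfl, rfl⟩ <;> exact ⟨rfl, rfl⟩
    simp only [e1, e2]
    split_ifs <;> push_cast <;> ring
  · simp [fieldsCLM, hermitianOfCoords, hv]

/-- In real coordinates the line operator is the contraction of the partial derivatives. -/
theorem sum_lineDeriv_fieldsCLM (h : Tame (hermTuples n N) ε F)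
    {σ : Fin n → Matrix (Fin N) (Fin N) ℂ} (hσ : σ ∈ Metric.thickening ε (hermTuples n N))
    (v v' : Fin n) :
    ∑ p : Fin N × Fin N, lineDeriv ℂ (fun τ => lineDeriv ℂ F τ
      (fieldsCLM n N (Pi.single (v, p) 1))) σ (fieldsCLM n N (Pi.single (v', p) 1)) =
      lineOperator (v', v) F σ := by
  have hdd : DifferentiableAt ℂ (fderiv ℂ F) σ :=
    ((h.contDiffAt hσ).fderiv_right (m := 1) (by
      rw [one_add_one_eq_two]
      exact show ((2 : ℕ∞) : WithTop ℕ∞) ≤ ∞ from WithTop.coe_le_coe.2 le_top)).differentiableAt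
      (by simp)
  set B := fderiv ℂ (fderiv ℂ F) σ with hB
  have key : ∀ H H', lineDeriv ℂ (fun y => lineDeriv ℂ F y H) σ H' = B H' H := by
    intro H H'
    rw [(h.lineDeriv H).lineDeriv_eq hσ]
    have he : (fun y => lineDeriv ℂ F y H) =ᶠ[𝓝 σ] fun y => fderiv ℂ F y H := by
      filter_upwards [Metric.isOpen_thickening.mem_nhds hσ] with y hy using h.lineDeriv_eq hy H
    rw [he.fderiv_eq, fderiv_clm_apply hdd (differentiableAt_const _)]
    simp [hB]
  have h0 : lineOperator (v', v) F σ = ∑ i, ∑ j,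
      B (Pi.single v' (Matrix.single i j 1)) (Pi.single v (Matrix.single j i 1)) :=
    Finset.sum_congr rfl fun i _ => Finset.sum_congr rfl fun j _ => key _ _
  rw [h0]
  simp only [key]
  rw [Fintype.sum_prod_type]
  set E : Fin n → Fin N → Fin N → Fin n → Matrix (Fin N) (Fin N) ℂ :=
    fun v i j => Pi.single v (Matrix.single i j 1) with hE
  have h1 : ∀ i j, B (fieldsCLM n N (Pi.single (v', (i, j)) 1))
      (fieldsCLM n N (Pi.single (v, (i, j)) 1)) =
      (Complex.I / 2) * B (E v' i j) (E v i j) + 1 / 2 * B (E v' i j) (E v j i) +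
      1 / 2 * B (E v' j i) (E v i j) + (-Complex.I / 2) * B (E v' j i) (E v j i) := by
    intro i j
    rw [fieldsCLM_single, fieldsCLM_single]
    simp only [map_add, map_smul, add_apply, smul_apply, smul_eq_mul, hE]
    linear_combination
      (1 / 4 * B (Pi.single v' (Matrix.single i j 1)) (Pi.single v (Matrix.single i j 1))
      - 1 / 4 * B (Pi.single v' (Matrix.single i j 1)) (Pi.single v (Matrix.single j i 1))
      - 1 / 4 * B (Pi.single v' (Matrix.single j i 1)) (Pi.single v (Matrix.single i j 1))
      + 1 / 4 * B (Pi.single v' (Matrix.single j i 1)) (Pi.single v (Matrix.single j i 1)))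
      * Complex.I_sq
  simp_rw [h1, Finset.sum_add_distrib]
  have h2 : ∑ i, ∑ j, 1 / 2 * B (E v' j i) (E v i j) = ∑ i, ∑ j, 1 / 2 * B (E v' i j) (E v j i) :=
    Finset.sum_comm
  have h3 : ∑ i, ∑ j, -Complex.I / 2 * B (E v' j i) (E v j i) =
      ∑ i, ∑ j, -Complex.I / 2 * B (E v' i j) (E v i j) := Finset.sum_comm
  rw [h2, h3]
  simp_rw [← Finset.mul_sum]
  ring

theorem fieldMean_lineOperator (hε : 0 < ε) (h : Tame (hermTuples n N) ε G)
    {S : Matrix (Fin n) (Fin n) ℝ} (hS : S.PosSemidef) (v v' : Fin n) :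
    fieldMean N S (lineOperator (v, v') G) = ∑ p : Fin N × Fin N,
      gaussianMean (S ⊗ₖ (1 : Matrix (Fin N × Fin N) (Fin N × Fin N) ℝ)) fun x =>
        lineDeriv ℂ (fun τ => lineDeriv ℂ G τ (fieldsCLM n N (Pi.single (v, p) 1)))
          (fieldsCLM n N x) (fieldsCLM n N (Pi.single (v', p) 1)) := by
  unfold gaussianMean
  rw [← integral_finsetSum]
  · unfold fieldMean
    congr 1
    ext x
    have hx : fieldsCLM n N x.ofLp ∈ Metric.thickening ε (hermTuples n N) :=
      Metric.self_subset_thickening hε _ (fieldsCLM_mem n N _)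
    rw [sum_lineDeriv_fieldsCLM h hx]
    exact lineOperator_swap h v v' hx
  · exact fun p _ => ((h.lineDeriv _).lineDeriv _).integrable hε hS

/-- The heat equation for Hermitian fields: the derivative with respect to the covariance of two
fields is a line operator. -/
theorem fieldMean_sub (hε : 0 < ε) (h : Tame (hermTuples n N) ε G)
    {S₀ S₁ : Matrix (Fin n) (Fin n) ℝ} (h₀ : S₀.PosSemidef) (h₁ : S₁.PosSemidef) :
    (∀ v v', ContinuousOn (fun t : ℝ => fieldMean N ((1 - t) • S₀ + t • S₁)
      (lineOperator (v, v') G)) (Set.Icc 0 1)) ∧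
    fieldMean N S₁ G - fieldMean N S₀ G = ∫ t in (0 : ℝ)..1, (1 / 2 : ℂ) * ∑ v, ∑ v',
      ((S₁ - S₀) v v' : ℂ) * fieldMean N ((1 - t) • S₀ + t • S₁) (lineOperator (v, v') G) := by
  have hK : ∀ t : ℝ, ((1 - t) • S₀ + t • S₁) ⊗ₖ (1 : Matrix (Fin N × Fin N) (Fin N × Fin N) ℝ) =
      (1 - t) • (S₀ ⊗ₖ (1 : Matrix (Fin N × Fin N) (Fin N × Fin N) ℝ)) +
        t • (S₁ ⊗ₖ (1 : Matrix (Fin N × Fin N) (Fin N × Fin N) ℝ)) := fun t => by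
    rw [Matrix.add_kronecker, Matrix.smul_kronecker, Matrix.smul_kronecker]
  obtain ⟨hc, hs⟩ := gaussianMean_sub (h.hasGradient hε (fieldsCLM n N) (fieldsCLM_mem n N))
    (fun a => (h.lineDeriv (fieldsCLM n N (Pi.single a 1))).hasGradient hε (fieldsCLM n N)
      (fieldsCLM_mem n N)) (posSemidef_kronecker_one (N := N) h₀)
      (posSemidef_kronecker_one (N := N) h₁)
  constructor
  · intro v v'
    refine ContinuousOn.congr (f := fun t : ℝ => ∑ p : Fin N × Fin N,
      gaussianMean ((1 - t) • (S₀ ⊗ₖ (1 : Matrix (Fin N × Fin N) (Fin N × Fin N) ℝ)) +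
        t • (S₁ ⊗ₖ (1 : Matrix (Fin N × Fin N) (Fin N × Fin N) ℝ))) fun x =>
        lineDeriv ℂ (fun τ => lineDeriv ℂ G τ (fieldsCLM n N (Pi.single (v, p) 1)))
          (fieldsCLM n N x) (fieldsCLM n N (Pi.single (v', p) 1)))
      (continuousOn_finsetSum _ fun p _ => hc (v, p) (v', p)) fun t ht => ?_
    simp only [fieldMean_lineOperator hε h (posSemidef_segment h₀ h₁ ht) v v', hK]
  · rw [fieldMean_eq, fieldMean_eq, hs]
    refine intervalIntegral.integral_congr fun t ht => ?_
    rw [Set.uIcc_of_le zero_le_one] at ht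
    congr 1
    rw [Fintype.sum_prod_type]
    refine Finset.sum_congr rfl fun v _ => ?_
    rw [Finset.sum_comm, Fintype.sum_prod_type]
    refine Finset.sum_congr rfl fun v' _ => ?_
    rw [fieldMean_lineOperator hε h (posSemidef_segment h₀ h₁ ht) v v', Finset.mul_sum]
    refine Finset.sum_congr rfl fun p _ => ?_
    rw [Finset.sum_eq_single p, hK]
    · simp
    · intro q _ hq
      simp [hq]
    · simp

/-- Continuity in the covariance, including degenerate covariances. -/
theorem continuousOn_fieldMean (hε : 0 < ε) (h : Tame (hermTuples n N) ε G) :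
    ContinuousOn (fun S => fieldMean N S G)
      {S : Matrix (Fin n) (Fin n) ℝ | S.PosSemidef ∧ ∀ v, S v v ≤ 1} := by
  have h1 := continuousOn_gaussianMean (h.hasGradient hε (fieldsCLM n N) (fieldsCLM_mem n N))
    (fun a => (h.lineDeriv (fieldsCLM n N (Pi.single a 1))).hasGradient hε (fieldsCLM n N)
      (fieldsCLM_mem n N))
  refine h1.comp (f := fun S : Matrix (Fin n) (Fin n) ℝ =>
    S ⊗ₖ (1 : Matrix (Fin N × Fin N) (Fin N × Fin N) ℝ)) (Continuous.continuousOn ?_) ?_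
  · refine continuous_pi fun a => continuous_pi fun b => ?_
    change Continuous fun S : Matrix (Fin n) (Fin n) ℝ =>
      S a.1 b.1 * (1 : Matrix (Fin N × Fin N) (Fin N × Fin N) ℝ) a.2 b.2
    fun_prop
  · rintro S ⟨hS, hd⟩
    refine ⟨posSemidef_kronecker_one hS, fun a => ?_⟩
    simpa [Matrix.kronecker_apply] using hd a.1

theorem exists_bound_fieldMean (hε : 0 < ε) (h : Tame (hermTuples n N) ε G) :
    ∃ K : ℝ, 0 ≤ K ∧ ∀ S : Matrix (Fin n) (Fin n) ℝ, S.PosSemidef → (∀ v, S v v ≤ 1) →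
      ‖fieldMean N S G‖ ≤ K := by
  obtain ⟨K, hK, hb⟩ := exists_bound_gaussianMean
    (h.hasGradient hε (fieldsCLM n N) (fieldsCLM_mem n N)).continuous
    (h.hasGradient hε (fieldsCLM n N) (fieldsCLM_mem n N)).growth
  refine ⟨K, hK, fun S hS hd => hb _ (posSemidef_kronecker_one hS) fun a => ?_⟩
  simpa [Matrix.kronecker_apply] using hd a.1

end

end

noncomputable section

/-! ### Link weights -/

section LinkWeight

variable {V : Type*}

/-- The graph of all links of weight at least `s`. -/
def thresholdGraph (ω : Sym2 V → ℝ) (s : ℝ) : SimpleGraph V :=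
  SimpleGraph.fromEdgeSet {e | s ≤ ω e}

theorem thresholdGraph_mono {ω ω' : Sym2 V → ℝ} {s s' : ℝ} (h : ∀ e, s ≤ ω e → s' ≤ ω' e) :
    thresholdGraph ω s ≤ thresholdGraph ω' s' :=
  SimpleGraph.fromEdgeSet_mono fun e he => h e he

theorem isClosed_reachable_thresholdGraph [Finite V] (ω : Sym2 V → ℝ) (v v' : V) :
    IsClosed {s | (thresholdGraph ω s).Reachable v v'} := by
  have h : {s | (thresholdGraph ω s).Reachable v v'} =
      ⋃ H : {H : SimpleGraph V // H.Reachable v v'}, {s | ∀ e ∈ H.1.edgeSet, s ≤ ω e} := by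
    ext s
    simp only [Set.mem_ofPred_eq, Set.mem_iUnion]
    constructor
    · intro hs
      refine ⟨⟨_, hs⟩, fun e he => ?_⟩
      simp only [thresholdGraph, SimpleGraph.edgeSet_fromEdgeSet] at he
      exact he.1
    · rintro ⟨⟨H, hH⟩, hs⟩
      refine hH.mono fun a b hab => ?_
      exact (SimpleGraph.fromEdgeSet_adj _).2 ⟨hs _ hab, hab.ne⟩
  rw [h]
  refine isClosed_iUnion_of_finite fun H => ?_
  simp only [Set.ofPred_forall]
  exact isClosed_iInter fun e => isClosed_iInter fun _ => isClosed_Iic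

variable [Fintype V]

/-- The covariance `β(ω)(v, v')`: the largest `s ∈ [0, 1]` such that `v` and `v'` are joined by a
path all of whose links have weight at least `s`, and `0` if there is none. -/
def linkWeight (ω : Sym2 V → ℝ) : Matrix V V ℝ :=
  Matrix.of fun v v' => sSup ({0} ∪ {s | (thresholdGraph ω s).Reachable v v'} ∩ Set.Icc 0 1)

theorem linkWeight_mem (ω : Sym2 V → ℝ) (v v' : V) :
    linkWeight ω v v' ∈ ({0} ∪ {s | (thresholdGraph ω s).Reachable v v'} ∩ Set.Icc 0 1 : Set ℝ) :=
  IsCompact.sSup_mem (isCompact_singleton.union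
    (isCompact_Icc.inter_left (isClosed_reachable_thresholdGraph ω v v'))) ⟨0, by simp⟩

theorem linkWeight_mem_Icc (ω : Sym2 V → ℝ) (v v' : V) : linkWeight ω v v' ∈ Set.Icc (0 : ℝ) 1 := by
  rcases linkWeight_mem ω v v' with h | h
  · rw [Set.mem_singleton_iff.1 h]; simp
  · exact h.2

theorem le_linkWeight_iff {ω : Sym2 V → ℝ} {s : ℝ} (h0 : 0 < s) (h1 : s ≤ 1) (v v' : V) :
    s ≤ linkWeight ω v v' ↔ (thresholdGraph ω s).Reachable v v' := by
  constructor
  · intro h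
    rcases linkWeight_mem ω v v' with h' | h'
    · rw [Set.mem_singleton_iff.1 h'] at h; linarith
    · exact SimpleGraph.Reachable.mono (thresholdGraph_mono fun e he => h.trans he) h'.1
  · intro h
    refine le_csSup ⟨1, ?_⟩ (Or.inr ⟨h, h0.le, h1⟩)
    rintro x (hx | hx)
    · rw [Set.mem_singleton_iff.1 hx]; exact zero_le_one
    · exact hx.2.2

theorem eq_of_forall_le_iff_of_mem_Icc {x y : ℝ} (hx : x ∈ Set.Icc (0 : ℝ) 1)
    (hy : y ∈ Set.Icc (0 : ℝ) 1) (h : ∀ s, 0 < s → s ≤ 1 → (s ≤ x ↔ s ≤ y)) : x = y := by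
  apply le_antisymm
  · rcases hx.1.eq_or_lt with h0 | h0
    · rw [← h0]; exact hy.1
    · exact (h x h0 hx.2).1 le_rfl
  · rcases hy.1.eq_or_lt with h0 | h0
    · rw [← h0]; exact hx.1
    · exact (h y h0 hy.2).2 le_rfl

theorem linkWeight_eq_of_iff {ω : Sym2 V → ℝ} {v v' : V} {y : ℝ} (hy : y ∈ Set.Icc (0 : ℝ) 1)
    (h : ∀ s, 0 < s → s ≤ 1 → ((thresholdGraph ω s).Reachable v v' ↔ s ≤ y)) :
    linkWeight ω v v' = y :=
  eq_of_forall_le_iff_of_mem_Icc (linkWeight_mem_Icc ω v v') hy fun s h0 h1 => by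
    rw [le_linkWeight_iff h0 h1, h s h0 h1]

theorem linkWeight_self (ω : Sym2 V → ℝ) (v : V) : linkWeight ω v v = 1 :=
  linkWeight_eq_of_iff (by simp) fun s _ h1 => by simp [h1]

theorem linkWeight_comm (ω : Sym2 V → ℝ) (v v' : V) : linkWeight ω v v' = linkWeight ω v' v :=
  linkWeight_eq_of_iff (linkWeight_mem_Icc ω v' v) fun s h0 h1 => by
    rw [le_linkWeight_iff h0 h1]
    exact SimpleGraph.reachable_comm

theorem abs_linkWeight_sub_le {ω ω' : Sym2 V → ℝ} {δ : ℝ} (h : ∀ e, |ω e - ω' e| ≤ δ) (v v' : V) :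
    |linkWeight ω v v' - linkWeight ω' v v'| ≤ δ := by
  have key : ∀ {ω ω' : Sym2 V → ℝ}, (∀ e, |ω e - ω' e| ≤ δ) →
      linkWeight ω v v' - linkWeight ω' v v' ≤ δ := by
    intro ω ω' h
    by_contra! hlt
    have h0 := (linkWeight_mem_Icc ω' v v').1
    have h1 := (linkWeight_mem_Icc ω v v')
    have hδ : 0 ≤ δ := (abs_nonneg _).trans (h s(v, v'))
    have h2 := (le_linkWeight_iff (ω := ω) (by linarith) h1.2 v v').1 le_rfl
    have h3 : (thresholdGraph ω' (linkWeight ω v v' - δ)).Reachable v v' :=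
      h2.mono (thresholdGraph_mono fun e he => by linarith [(abs_le.1 (h e)).2])
    have h4 := (le_linkWeight_iff (ω := ω') (by linarith) (by linarith [h1.2]) v v').2 h3
    linarith
  refine abs_le.2 ⟨?_, key h⟩
  have := key (ω := ω') (ω' := ω) fun e => by rw [abs_sub_comm]; exact h e
  linarith

theorem continuous_linkWeight : Continuous (linkWeight : (Sym2 V → ℝ) → Matrix V V ℝ) := by
  refine continuous_pi fun v => continuous_pi fun v' => ?_
  refine (LipschitzWith.of_dist_le_mul (K := 1) fun ω ω' => ?_).continuous
  rw [NNReal.coe_one, one_mul, Real.dist_eq]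
  exact abs_linkWeight_sub_le (fun e => by
    rw [← Real.dist_eq]; exact dist_le_pi_dist ω ω' e) v v'

/-- The quadratic form of the indicator of an equivalence relation is a sum of squares. -/
theorem sum_reachable_nonneg (H : SimpleGraph V) (x : V → ℝ) :
    0 ≤ ∑ v, ∑ v', x v * x v' * Set.indicator {p : V × V | H.Reachable p.1 p.2} 1 (v, v') := by
  classical
  have h : ∑ v, ∑ v', x v * x v' * Set.indicator {p : V × V | H.Reachable p.1 p.2} 1 (v, v') =
      ∑ C : H.ConnectedComponent, (∑ v, if H.connectedComponentMk v = C then x v else 0) ^ 2 := by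
    simp_rw [sq, Finset.sum_mul_sum]
    refine Eq.trans ?_ Finset.sum_comm
    refine Finset.sum_congr rfl fun v _ => ?_
    refine Eq.trans ?_ Finset.sum_comm
    refine Finset.sum_congr rfl fun v' _ => ?_
    simp only [ite_mul, zero_mul, Finset.sum_ite_eq, Finset.mem_univ, if_true, mul_ite, mul_zero,
      Set.indicator_apply, Set.mem_ofPred_eq, Pi.one_apply, mul_one]
    refine if_congr ?_ rfl rfl
    rw [eq_comm, SimpleGraph.ConnectedComponent.eq]
    exact SimpleGraph.reachable_comm
  rw [h]
  positivity

/-- Level by level, `linkWeight` is the indicator of the equivalence relation of being joined by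
links above the level. -/
theorem posSemidef_linkWeight (ω : Sym2 V → ℝ) : (linkWeight ω).PosSemidef := by
  refine Matrix.PosSemidef.of_dotProduct_mulVec_nonneg ?_ fun x => ?_
  · ext v v'
    simpa using linkWeight_comm ω v' v
  · set b : V → V → ℝ := fun v v' => linkWeight ω v v' with hb
    have h1 : ∀ v v', IntervalIntegrable (fun s => Set.indicator {s | s ≤ b v v'} (fun _ => (1 : ℝ)) s)
        volume 0 1 := fun v v' => by
      have := (intervalIntegrable_const (μ := volume) (a := (0 : ℝ)) (b := 1) (c := (1 : ℝ)))
      exact ⟨this.1.indicator measurableSet_Iic, this.2.indicator measurableSet_Iic⟩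
    have h2 : ∀ v v', b v v' =
        ∫ s in (0 : ℝ)..1, Set.indicator {s | s ≤ b v v'} (fun _ => (1 : ℝ)) s := by
      intro v v'
      rw [intervalIntegral.integral_indicator (linkWeight_mem_Icc ω v v')]
      simp [hb]
    have h3 : star x ⬝ᵥ (linkWeight ω).mulVec x = ∫ s in (0 : ℝ)..1, ∑ v, ∑ v',
        x v * x v' * Set.indicator {s | s ≤ b v v'} (fun _ => (1 : ℝ)) s := by
      rw [intervalIntegral.integral_finsetSum fun v _ => by
        simpa only [Finset.sum_fn] using IntervalIntegrable.sum (f := fun v' s =>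
          x v * x v' * Set.indicator {s | s ≤ b v v'} (fun _ => (1 : ℝ)) s) Finset.univ
          fun v' _ => (h1 v v').const_mul _]
      simp only [dotProduct, Matrix.mulVec, star_trivial, Finset.mul_sum]
      refine Finset.sum_congr rfl fun v _ => ?_
      rw [intervalIntegral.integral_finsetSum fun v' _ => (h1 v v').const_mul _]
      refine Finset.sum_congr rfl fun v' _ => ?_
      rw [intervalIntegral.integral_const_mul, ← h2]
      simp only [hb]
      ring
    rw [h3, intervalIntegral.integral_of_le zero_le_one]
    refine setIntegral_nonneg measurableSet_Ioc fun s hs => ?_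
    refine (sum_reachable_nonneg (thresholdGraph ω s) x).trans_eq ?_
    refine Finset.sum_congr rfl fun v _ => Finset.sum_congr rfl fun v' _ => ?_
    congr 1
    have hiff := le_linkWeight_iff (ω := ω) hs.1 hs.2 v v'
    by_cases h : s ≤ linkWeight ω v v'
    · rw [Set.indicator_of_mem (show s ∈ {s | s ≤ b v v'} from h), Set.indicator_of_mem
        (show (v, v') ∈ {p : V × V | (thresholdGraph ω s).Reachable p.1 p.2} from hiff.1 h)]
      rfl
    · rw [Set.indicator_of_notMem (show s ∉ {s | s ≤ b v v'} from h), Set.indicator_of_notMem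
        (show (v, v') ∉ {p : V × V | (thresholdGraph ω s).Reachable p.1 p.2} from
          fun h' => h (hiff.2 h'))]

end LinkWeight

/-- The weights of the lines of `T`, extended by `0`. -/
def extendWeight {n : ℕ} (T : SimpleGraph (Fin n)) (w : T.edgeSet → ℝ) : Sym2 (Fin n) → ℝ := by
  classical exact fun e => if h : e ∈ T.edgeSet then w ⟨e, h⟩ else 0

/-- On a tree the covariance is the infimum of the weights along the path: two vertices are joined
by links of weight at least `s` precisely when all lines of the only path between them have weight at
least `s`. -/
theorem linkWeight_extendWeight {n : ℕ} {T : SimpleGraph (Fin n)} (hT : T.IsTree)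
    {w : T.edgeSet → ℝ} (hw : w ∈ Set.Icc (0 : T.edgeSet → ℝ) 1) :
    linkWeight (extendWeight T w) = treeWeight T w := by
  classical
  ext v v'
  by_cases hv : v = v'
  · subst hv; simp [linkWeight_self, treeWeight]
  have h1 : treeWeight T w v v' =
      sInf (w '' {ℓ : T.edgeSet | ∃ p : T.Walk v v', p.IsPath ∧ (ℓ : Sym2 (Fin n)) ∈ p.edges}) := by
    simp [treeWeight, hv]
  obtain ⟨p, hp⟩ := (hT.1.preconnected v v').exists_isPath
  have hu : ∀ q : T.Walk v v', q.IsPath → q = p := fun q hq => by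
    have := hT.2.subsingleton_path v v' |>.elim ⟨q, hq⟩ ⟨p, hp⟩
    exact congrArg Subtype.val this
  have hset : {ℓ : T.edgeSet | ∃ p : T.Walk v v', p.IsPath ∧ (ℓ : Sym2 (Fin n)) ∈ p.edges} =
      {ℓ : T.edgeSet | (ℓ : Sym2 (Fin n)) ∈ p.edges} := by
    ext ℓ
    constructor
    · rintro ⟨q, hq, h⟩
      rw [hu q hq] at h
      exact h
    · intro h; exact ⟨p, hp, h⟩
  rw [h1, hset]
  have hne : (w '' {ℓ : T.edgeSet | (ℓ : Sym2 (Fin n)) ∈ p.edges}).Nonempty := by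
    have : p.edges ≠ [] := by
      intro h
      have hl : p.length = 0 := by rw [← SimpleGraph.Walk.length_edges, h]; rfl
      exact hv (SimpleGraph.Walk.eq_of_length_eq_zero hl)
    obtain ⟨e, he⟩ := List.exists_mem_of_ne_nil _ this
    exact ⟨_, ⟨e, p.edges_subset_edgeSet he⟩, he, rfl⟩
  have hb : BddBelow (w '' {ℓ : T.edgeSet | (ℓ : Sym2 (Fin n)) ∈ p.edges}) := by
    refine ⟨0, ?_⟩
    rintro _ ⟨ℓ, _, rfl⟩
    exact hw.1 ℓ
  refine linkWeight_eq_of_iff ⟨?_, ?_⟩ fun s h0 h1' => ?_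
  · refine le_csInf hne ?_
    rintro _ ⟨ℓ, _, rfl⟩
    exact hw.1 ℓ
  · obtain ⟨x, hx⟩ := hne
    refine (csInf_le hb hx).trans ?_
    obtain ⟨ℓ, _, rfl⟩ := hx
    exact hw.2 ℓ
  · have hle : thresholdGraph (extendWeight T w) s ≤ T := by
      intro a b hab
      have := ((SimpleGraph.fromEdgeSet_adj _).1 hab).1
      simp only [Set.mem_ofPred_eq, extendWeight] at this
      split_ifs at this with h
      · exact h
      · linarith
    rw [le_csInf_iff hb hne]
    constructor
    · rintro h _ ⟨ℓ, hℓ, rfl⟩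
      obtain ⟨q, hq⟩ := h.exists_isPath
      have hq' := hu (q.mapLe hle) (hq.mapLe hle)
      simp only [Set.mem_ofPred_eq] at hℓ
      rw [← hq', SimpleGraph.Walk.edges_mapLe_eq_edges] at hℓ
      have h2 := q.edges_subset_edgeSet hℓ
      rw [thresholdGraph, SimpleGraph.edgeSet_fromEdgeSet] at h2
      have h3 := h2.1
      simpa [extendWeight, ℓ.2] using h3
    · intro h
      refine ⟨p.transfer _ fun e he => ?_⟩
      have heT := p.edges_subset_edgeSet he
      rw [thresholdGraph, SimpleGraph.edgeSet_fromEdgeSet]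
      refine ⟨?_, ?_⟩
      · have := h (w ⟨e, heT⟩) ⟨⟨e, heT⟩, he, rfl⟩
        simpa [extendWeight, heT] using this
      · exact fun hd => T.not_isDiag_of_mem_edgeSet heT hd

end

noncomputable section
open scoped ContDiff Matrix.Norms.L2Operator

/-! ### Forests and their interpolated covariances -/

section Forest

variable {n : ℕ} {κ : Type*}

open Classical in
/-- The lines of a graph, as pairs of end points in increasing order. -/
def lines (G : SimpleGraph (Fin n)) : Finset (Fin n × Fin n) :=
  Finset.univ.filter fun e : Fin n × Fin n => e.1 < e.2 ∧ G.Adj e.1 e.2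

theorem mem_lines {G : SimpleGraph (Fin n)} {p : Fin n × Fin n} :
    p ∈ lines G ↔ p.1 < p.2 ∧ G.Adj p.1 p.2 := by simp [lines]

theorem lineList_eq (G : SimpleGraph (Fin n)) : lineList G = (lines G).toList := rfl

open Classical in
/-- The forests all of whose lines join vertices of the same colour. -/
def forests (c : Fin n → κ) : Finset (SimpleGraph (Fin n)) :=
  Finset.univ.filter fun G => G.IsAcyclic ∧ ∀ a b, G.Adj a b → c a = c b

theorem mem_forests {c : Fin n → κ} {G : SimpleGraph (Fin n)} :
    G ∈ forests c ↔ G.IsAcyclic ∧ ∀ a b, G.Adj a b → c a = c b := by simp [forests]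

open Classical in
/-- The links between different trees of the forest `G` whose end points have the same colour. -/
def newLines (c : Fin n → κ) (G : SimpleGraph (Fin n)) : Finset (Fin n × Fin n) :=
  Finset.univ.filter fun p => p.1 < p.2 ∧ c p.1 = c p.2 ∧ ¬ G.Reachable p.1 p.2

theorem mem_newLines {c : Fin n → κ} {G : SimpleGraph (Fin n)} {p : Fin n × Fin n} :
    p ∈ newLines c G ↔ p.1 < p.2 ∧ c p.1 = c p.2 ∧ ¬ G.Reachable p.1 p.2 := by simp [newLines]

theorem sup_edge_mem_forests {c : Fin n → κ} {G : SimpleGraph (Fin n)} (hG : G ∈ forests c)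
    {p : Fin n × Fin n} (hp : p ∈ newLines c G) : G ⊔ SimpleGraph.edge p.1 p.2 ∈ forests c := by
  rw [mem_forests] at hG ⊢
  rw [mem_newLines] at hp
  refine ⟨hG.1.sup_edge_of_not_reachable hp.2.2, fun a b hab => ?_⟩
  rcases hab with hab | hab
  · exact hG.2 a b hab
  · rcases (SimpleGraph.edge_adj ..).1 hab with ⟨⟨rfl, rfl⟩ | ⟨rfl, rfl⟩, _⟩
    · exact hp.2.1
    · exact hp.2.1.symm

theorem not_adj_of_mem_newLines {c : Fin n → κ} {G : SimpleGraph (Fin n)} {p : Fin n × Fin n}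
    (hp : p ∈ newLines c G) : ¬ G.Adj p.1 p.2 := fun h => (mem_newLines.1 hp).2.2 h.reachable

theorem lines_sup_edge {c : Fin n → κ} {G : SimpleGraph (Fin n)} {p : Fin n × Fin n}
    (hp : p ∈ newLines c G) : lines (G ⊔ SimpleGraph.edge p.1 p.2) = insert p (lines G) := by
  ext q
  have h := mem_newLines.1 hp
  rw [Finset.mem_insert, mem_lines, mem_lines, SimpleGraph.sup_adj, SimpleGraph.edge_adj]
  constructor
  · rintro ⟨h1, h2 | ⟨⟨h3, h4⟩ | ⟨h3, h4⟩, h5⟩⟩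
    · exact Or.inr ⟨h1, h2⟩
    · exact Or.inl (Prod.ext h3 h4)
    · rw [h3, h4] at h1
      exact absurd h1 h.1.not_gt
  · rintro (rfl | h1)
    · exact ⟨h.1, Or.inr ⟨Or.inl ⟨rfl, rfl⟩, h.1.ne⟩⟩
    · exact ⟨h1.1, Or.inl h1.2⟩

/-- Summing over a forest and a link between two of its trees is the same as summing over a forest
and one of its lines. -/
theorem sum_newLines_eq_sum_lines {M : Type*} [AddCommMonoid M] (c : Fin n → κ)
    (X : SimpleGraph (Fin n) → Fin n × Fin n → M) :
    ∑ G ∈ forests c, ∑ p ∈ newLines c G, X (G ⊔ SimpleGraph.edge p.1 p.2) p =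
      ∑ G ∈ forests c, ∑ p ∈ lines G, X G p := by
  rw [Finset.sum_sigma', Finset.sum_sigma']
  refine Finset.sum_bij' (fun x _ => ⟨x.1 ⊔ SimpleGraph.edge x.2.1 x.2.2, x.2⟩)
    (fun x _ => ⟨x.1.deleteEdges {s(x.2.1, x.2.2)}, x.2⟩) ?_ ?_ ?_ ?_ ?_
  · rintro ⟨G, p⟩ hx
    rw [Finset.mem_sigma] at hx ⊢
    refine ⟨sup_edge_mem_forests hx.1 hx.2, ?_⟩
    rw [lines_sup_edge hx.2]
    exact Finset.mem_insert_self _ _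
  · rintro ⟨G, p⟩ hx
    rw [Finset.mem_sigma, mem_forests, mem_lines] at hx
    rw [Finset.mem_sigma, mem_forests, mem_newLines]
    refine ⟨⟨hx.1.1.anti (SimpleGraph.deleteEdges_le _), fun a b hab => hx.1.2 a b
      (SimpleGraph.deleteEdges_le _ hab)⟩, hx.2.1, hx.1.2 _ _ hx.2.2, ?_⟩
    exact SimpleGraph.isBridge_iff.1
      (SimpleGraph.isAcyclic_iff_forall_isBridge.1 hx.1.1 (e := s(p.1, p.2)) hx.2.2)
  · rintro ⟨G, p⟩ hx
    rw [Finset.mem_sigma] at hx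
    have h1 := not_adj_of_mem_newLines hx.2
    refine Sigma.ext ?_ HEq.rfl
    ext a b
    simp only [SimpleGraph.deleteEdges_adj, SimpleGraph.sup_adj, SimpleGraph.edge_adj,
      Set.mem_singleton_iff, Sym2.eq_iff]
    constructor
    · rintro ⟨h2 | ⟨h2, _⟩, h3⟩
      · exact h2
      · exact absurd h2 h3
    · intro h2
      refine ⟨Or.inl h2, ?_⟩
      rintro (⟨rfl, rfl⟩ | ⟨rfl, rfl⟩)
      · exact h1 h2
      · exact h1 h2.symm
  · rintro ⟨G, p⟩ hx
    rw [Finset.mem_sigma, mem_lines] at hx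
    refine Sigma.ext ?_ HEq.rfl
    ext a b
    simp only [SimpleGraph.deleteEdges_adj, SimpleGraph.sup_adj, SimpleGraph.edge_adj,
      Set.mem_singleton_iff, Sym2.eq_iff]
    constructor
    · rintro (h2 | ⟨⟨rfl, rfl⟩ | ⟨rfl, rfl⟩, _⟩)
      · exact h2.1
      · exact hx.2.2
      · exact hx.2.2.symm
    · intro h2
      by_cases h3 : (a = p.1 ∧ b = p.2 ∨ a = p.2 ∧ b = p.1)
      · exact Or.inr ⟨h3, h2.ne⟩
      · exact Or.inl ⟨h2, h3⟩
  · rintro ⟨G, p⟩ _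
    rfl

open Classical in
/-- The link weights interpolating between the forest `G` (`u = 0`) and the complete graphs on the
colours: `w e` for the lines of `G`, and `u` for all other links inside a colour. -/
def forestWeight (c : Fin n → κ) (G : SimpleGraph (Fin n)) (w : Sym2 (Fin n) → ℝ) (u : ℝ) :
    Sym2 (Fin n) → ℝ :=
  fun e => if e ∈ G.edgeSet then w e else if (e.map c).IsDiag then u else 0

theorem continuous_forestWeight (c : Fin n → κ) (G : SimpleGraph (Fin n)) :
    Continuous fun p : (Sym2 (Fin n) → ℝ) × ℝ => forestWeight c G p.1 p.2 := by
  refine continuous_pi fun e => ?_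
  simp only [forestWeight]
  split_ifs <;> fun_prop

/-- At the value `s` of the interpolation parameter, a link between two trees of the forest is the
same as a line of weight `s`. -/
theorem forestWeight_sup_edge {c : Fin n → κ} {G : SimpleGraph (Fin n)} {p : Fin n × Fin n}
    (hp : p ∈ newLines c G) (w : Sym2 (Fin n) → ℝ) (s : ℝ) :
    forestWeight c (G ⊔ SimpleGraph.edge p.1 p.2) (Function.update w s(p.1, p.2) s) s =
      forestWeight c G w s := by
  have h := mem_newLines.1 hp
  have h1 : s(p.1, p.2) ∉ G.edgeSet := not_adj_of_mem_newLines hp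
  ext e
  by_cases he : e = s(p.1, p.2)
  · subst he
    simp [forestWeight, h1, h.1.ne, h.2.1]
  · have h2 : e ∈ (G ⊔ SimpleGraph.edge p.1 p.2).edgeSet ↔ e ∈ G.edgeSet := by
      rw [SimpleGraph.edgeSet_sup, SimpleGraph.edgeSet_edge_of_ne h.1.ne]
      simp [he]
    simp only [forestWeight, Function.update_of_ne he]
    by_cases h3 : e ∈ G.edgeSet
    · rw [if_pos (h2.2 h3), if_pos h3]
    · rw [if_neg (mt h2.1 h3), if_neg h3]

theorem reachable_color_eq {c : Fin n → κ} {H : SimpleGraph (Fin n)}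
    (hH : ∀ a b, H.Adj a b → c a = c b) {v v' : Fin n} (h : H.Reachable v v') : c v = c v' := by
  obtain ⟨p⟩ := h
  induction p with
  | nil => rfl
  | cons hab _ ih => exact (hH _ _ hab).trans ih

theorem color_eq_of_thresholdGraph {c : Fin n → κ} {G : SimpleGraph (Fin n)} (hG : G ∈ forests c)
    {w : Sym2 (Fin n) → ℝ} {u s : ℝ} (hs : 0 < s) {a b : Fin n}
    (h : (thresholdGraph (forestWeight c G w u) s).Adj a b) : c a = c b := by
  have h1 := ((SimpleGraph.fromEdgeSet_adj _).1 h).1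
  simp only [Set.mem_ofPred_eq, forestWeight] at h1
  split_ifs at h1 with h2 h3
  · exact (mem_forests.1 hG).2 a b h2
  · simpa using h3
  · linarith

open Classical in
/-- Along the interpolation the covariance is affine in `u`, as long as `u` is below the weights of
the lines of `G`: exactly the entries joining different trees of equal colour are equal to `u`. -/
theorem linkWeight_forestWeight {c : Fin n → κ} {G : SimpleGraph (Fin n)} (hG : G ∈ forests c)
    {w : Sym2 (Fin n) → ℝ} {u : ℝ} (hu0 : 0 ≤ u) (hu1 : u ≤ 1) (hu : ∀ e ∈ G.edgeSet, u ≤ w e) :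
    linkWeight (forestWeight c G w u) = linkWeight (forestWeight c G w 0) +
      u • Matrix.of fun v v' => if c v = c v' ∧ ¬ G.Reachable v v' then (1 : ℝ) else 0 := by
  have hle : ∀ (t s : ℝ), 0 < s → t < s → thresholdGraph (forestWeight c G w t) s ≤ G := by
    intro t s hs hts a b hab
    have h1 := ((SimpleGraph.fromEdgeSet_adj _).1 hab).1
    simp only [Set.mem_ofPred_eq, forestWeight] at h1
    split_ifs at h1 with h2 h3
    · exact h2
    · linarith
    · linarith
  have hzero : ∀ v v', ¬ G.Reachable v v' → linkWeight (forestWeight c G w 0) v v' = 0 := by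
    intro v v' h
    refine linkWeight_eq_of_iff (by simp) fun s h0 h1 => ?_
    constructor
    · intro h2; exact absurd (h2.mono (hle 0 s h0 h0)) h
    · intro h2; linarith
  ext v v'
  rw [Matrix.add_apply, Matrix.smul_apply, Matrix.of_apply, smul_eq_mul]
  by_cases hD : c v = c v' ∧ ¬ G.Reachable v v'
  · rw [if_pos hD, hzero v v' hD.2, zero_add, mul_one]
    refine linkWeight_eq_of_iff ⟨hu0, hu1⟩ fun s h0 h1 => ?_
    constructor
    · intro h2
      by_contra! h3
      exact hD.2 (h2.mono (hle u s h0 h3))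
    · intro h2
      refine SimpleGraph.Adj.reachable ?_
      have hne : v ≠ v' := fun h => hD.2 (h ▸ SimpleGraph.Reachable.refl _)
      have hadj : s(v, v') ∉ G.edgeSet := fun h => hD.2 (SimpleGraph.Adj.reachable h)
      refine (SimpleGraph.fromEdgeSet_adj _).2 ⟨?_, hne⟩
      simpa [forestWeight, hadj, hD.1] using h2
  · rw [if_neg hD, mul_zero, add_zero]
    refine linkWeight_eq_of_iff (linkWeight_mem_Icc _ _ _) fun s h0 h1 => ?_
    rw [le_linkWeight_iff h0 h1]
    constructor
    · intro h2
      rcases lt_or_ge u s with h3 | h3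
      · refine h2.mono fun a b hab => ?_
        have h4 := hle u s h0 h3 hab
        have h5 := (SimpleGraph.fromEdgeSet_adj _).1 hab
        refine (SimpleGraph.fromEdgeSet_adj _).2 ⟨?_, h5.2⟩
        have h6 := h5.1
        have h7 : s(a, b) ∈ G.edgeSet := h4
        simpa [forestWeight, h7] using h6
      · have h4 := reachable_color_eq (fun a b hab => color_eq_of_thresholdGraph hG h0 hab) h2
        have h5 : G.Reachable v v' := by
          by_contra h6
          exact hD ⟨h4, h6⟩
        refine h5.mono fun a b hab => (SimpleGraph.fromEdgeSet_adj _).2 ⟨?_, hab.ne⟩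
        have h7 : s(a, b) ∈ G.edgeSet := hab
        have h8 := h3.trans (hu _ h7)
        simpa [forestWeight, h7] using h8
    · intro h2
      refine h2.mono (thresholdGraph_mono fun e he => ?_)
      simp only [forestWeight] at he ⊢
      split_ifs at he ⊢ with h3 h4
      · exact he
      · linarith
      · exact he

end Forest

section ForestMean

variable {n : ℕ} {κ : Type*} {N : ℕ} {ε : ℝ} {F : (Fin n → Matrix (Fin N) (Fin N) ℂ) → ℂ}

/-- The expectation of `F` differentiated along the lines of `G`, in the Gaussian measure
interpolated by `forestWeight`. -/
def forestMean (F : (Fin n → Matrix (Fin N) (Fin N) ℂ) → ℂ) (c : Fin n → κ)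
    (G : SimpleGraph (Fin n)) (w : Sym2 (Fin n) → ℝ) (u : ℝ) : ℂ :=
  fieldMean N (linkWeight (forestWeight c G w u)) (lineOperators (lineList G) F)

theorem continuous_fieldMean_linkWeight (hε : 0 < ε) (hF : Tame (hermTuples n N) ε F) :
    Continuous fun x : Sym2 (Fin n) → ℝ => fieldMean N (linkWeight x) F := by
  refine (continuousOn_fieldMean hε hF).comp_continuous continuous_linkWeight
    fun x => ⟨posSemidef_linkWeight x, fun v => (linkWeight_self x v).le⟩

theorem continuous_forestMean (hε : 0 < ε) (hF : Tame (hermTuples n N) ε F) (c : Fin n → κ)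
    (G : SimpleGraph (Fin n)) :
    Continuous fun p : (Sym2 (Fin n) → ℝ) × ℝ => forestMean F c G p.1 p.2 :=
  (continuous_fieldMean_linkWeight hε (hF.lineOperators _)).comp (continuous_forestWeight c G)

theorem exists_bound_forestMean (hε : 0 < ε) (hF : Tame (hermTuples n N) ε F) (c : Fin n → κ)
    (G : SimpleGraph (Fin n)) : ∃ K : ℝ, 0 ≤ K ∧ ∀ w u, ‖forestMean F c G w u‖ ≤ K := by
  obtain ⟨K, hK, h⟩ := exists_bound_fieldMean hε (hF.lineOperators (lineList G))
  exact ⟨K, hK, fun w u => h _ (posSemidef_linkWeight _) fun v => (linkWeight_self _ v).le⟩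

/-- Adding a line to the forest amounts to one more line operator. -/
theorem forestMean_sup_edge (hε : 0 < ε) (hF : Tame (hermTuples n N) ε F) {c : Fin n → κ}
    {G : SimpleGraph (Fin n)} {p : Fin n × Fin n} (hp : p ∈ newLines c G)
    (w : Sym2 (Fin n) → ℝ) (s : ℝ) :
    forestMean F c (G ⊔ SimpleGraph.edge p.1 p.2) (Function.update w s(p.1, p.2) s) s =
      fieldMean N (linkWeight (forestWeight c G w s))
        (lineOperator p (lineOperators (lineList G) F)) := by
  rw [forestMean, forestWeight_sup_edge hp]
  refine fieldMean_congr _ fun σ hσ => ?_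
  have hperm : (lineList (G ⊔ SimpleGraph.edge p.1 p.2)).Perm (p :: lineList G) := by
    rw [lineList_eq, lineList_eq, lines_sup_edge hp]
    exact Finset.toList_insert fun h => not_adj_of_mem_newLines hp (mem_lines.1 h).2
  exact lineOperators_perm hF hperm (Metric.self_subset_thickening hε _ hσ)

theorem sum_symm_eq_sum_lt {n : ℕ} (f : Fin n → Fin n → ℂ) (hs : ∀ a b, f a b = f b a)
    (hd : ∀ a, f a a = 0) :
    (1 / 2 : ℂ) * ∑ a, ∑ b, f a b = ∑ p ∈ Finset.univ.filter (fun p : Fin n × Fin n => p.1 < p.2),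
      f p.1 p.2 := by
  have h1 : ∑ a, ∑ b, f a b = ∑ p : Fin n × Fin n, f p.1 p.2 :=
    (Fintype.sum_prod_type fun p : Fin n × Fin n => f p.1 p.2).symm
  have h2 : ∑ p : Fin n × Fin n, f p.1 p.2 =
      ∑ p ∈ Finset.univ.filter (fun p : Fin n × Fin n => p.1 < p.2), f p.1 p.2 +
      ∑ p ∈ Finset.univ.filter (fun p : Fin n × Fin n => ¬ p.1 < p.2), f p.1 p.2 :=
    (Finset.sum_filter_add_sum_filter_not _ _ _).symm
  have h3 : ∑ p ∈ Finset.univ.filter (fun p : Fin n × Fin n => ¬ p.1 < p.2), f p.1 p.2 =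
      ∑ p ∈ Finset.univ.filter (fun p : Fin n × Fin n => p.2 < p.1), f p.1 p.2 := by
    refine (Finset.sum_subset (fun p hp => ?_) fun p hp hp' => ?_).symm
    · simp only [Finset.mem_filter, Finset.mem_univ, true_and] at hp ⊢
      exact hp.not_gt
    · simp only [Finset.mem_filter, Finset.mem_univ, true_and] at hp hp'
      rw [show p.1 = p.2 by omega]
      exact hd _
  have h4 : ∑ p ∈ Finset.univ.filter (fun p : Fin n × Fin n => p.2 < p.1), f p.1 p.2 =
      ∑ p ∈ Finset.univ.filter (fun p : Fin n × Fin n => p.1 < p.2), f p.1 p.2 := by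
    refine Finset.sum_nbij' Prod.swap Prod.swap ?_ ?_ ?_ ?_ ?_
    · intro p hp; simpa using hp
    · intro p hp; simpa using hp
    · intro p _; simp
    · intro p _; simp
    · intro p _; exact hs _ _
  rw [h1, h2, h3, h4]
  ring

/-- Taylor's formula with integral remainder along the interpolation of one forest: the derivative
adds one line to the forest. -/
theorem forestMean_zero_eq (hε : 0 < ε) (hF : Tame (hermTuples n N) ε F) {c : Fin n → κ}
    {G : SimpleGraph (Fin n)} (hG : G ∈ forests c) {w : Sym2 (Fin n) → ℝ} {m : ℝ} (h0 : 0 ≤ m)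
    (h1 : m ≤ 1) (hm : ∀ e ∈ G.edgeSet, m ≤ w e) :
    forestMean F c G w 0 = forestMean F c G w m - ∑ p ∈ newLines c G, ∫ s in (0 : ℝ)..m,
      forestMean F c (G ⊔ SimpleGraph.edge p.1 p.2) (Function.update w s(p.1, p.2) s) s := by
  classical
  set ψ := lineOperators (lineList G) F with hψ
  have hT : Tame (hermTuples n N) ε ψ := hF.lineOperators _
  set D : Matrix (Fin n) (Fin n) ℝ :=
    Matrix.of fun v v' => if c v = c v' ∧ ¬ G.Reachable v v' then (1 : ℝ) else 0 with hD
  set β := fun u => linkWeight (forestWeight c G w u) with hβ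
  have hβu : ∀ u, 0 ≤ u → u ≤ m → β u = β 0 + u • D := fun u hu0 hum =>
    linkWeight_forestWeight hG hu0 (hum.trans h1) fun e he => hum.trans (hm e he)
  obtain ⟨-, hs⟩ := fieldMean_sub hε hT (posSemidef_linkWeight (forestWeight c G w 0))
    (posSemidef_linkWeight (forestWeight c G w m))
  have hseg : ∀ t ∈ Set.Icc (0 : ℝ) 1, (1 - t) • β 0 + t • β m = β (m * t) := by
    intro t ht
    rw [hβu m h0 le_rfl, hβu (m * t) (mul_nonneg h0 ht.1) (mul_le_of_le_one_right h0 ht.2)]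
    ext v v'
    simp only [Matrix.add_apply, Matrix.smul_apply, smul_eq_mul]
    ring
  have hdiff : β m - β 0 = m • D := by rw [hβu m h0 le_rfl]; simp
  have key : forestMean F c G w m - forestMean F c G w 0 = ∫ s in (0 : ℝ)..m,
      ∑ p ∈ newLines c G, fieldMean N (β s) (lineOperator p ψ) := by
    refine hs.trans ?_
    have h2 : ∀ t ∈ Set.uIcc (0 : ℝ) 1, (1 / 2 : ℂ) * ∑ v, ∑ v',
        (((β m - β 0) v v' : ℝ) : ℂ) *
          fieldMean N ((1 - t) • β 0 + t • β m) (lineOperator (v, v') ψ) =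
        m • ∑ p ∈ newLines c G, fieldMean N (β (m * t)) (lineOperator p ψ) := by
      intro t ht
      rw [Set.uIcc_of_le zero_le_one] at ht
      rw [hseg t ht, hdiff, sum_symm_eq_sum_lt, newLines, Finset.smul_sum, Finset.sum_filter,
        Finset.sum_filter]
      · refine Finset.sum_congr rfl fun p _ => ?_
        by_cases h3 : p.1 < p.2
        · by_cases h4 : c p.1 = c p.2 ∧ ¬ G.Reachable p.1 p.2
          · simp [h3, h4, hD]
          · simp [h3, h4, hD]
        · simp [h3]
      · intro a b
        congr 1
        · simp only [Matrix.smul_apply, hD, Matrix.of_apply, eq_comm (a := c a),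
            SimpleGraph.reachable_comm (u := a)]
        · exact fieldMean_congr _ fun σ hσ =>
            lineOperator_swap hT a b (Metric.self_subset_thickening hε _ hσ)
      · intro a
        simp [hD]
    refine (intervalIntegral.integral_congr h2).trans ?_
    rw [intervalIntegral.integral_smul, intervalIntegral.smul_integral_comp_mul_left
      (f := fun s => ∑ p ∈ newLines c G, fieldMean N (β s) (lineOperator p ψ))]
    simp
  have hcont : ∀ p, Continuous fun s => fieldMean N (β s) (lineOperator p ψ) := fun p =>
    (continuous_fieldMean_linkWeight hε (hT.lineOperator p)).comp
      ((continuous_forestWeight c G).comp (continuous_const.prodMk continuous_id))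
  rw [intervalIntegral.integral_finsetSum fun p _ => (hcont p).intervalIntegrable _ _] at key
  have h3 : ∑ p ∈ newLines c G, ∫ s in (0 : ℝ)..m,
      forestMean F c (G ⊔ SimpleGraph.edge p.1 p.2) (Function.update w s(p.1, p.2) s) s =
      ∑ p ∈ newLines c G, ∫ s in (0 : ℝ)..m, fieldMean N (β s) (lineOperator p ψ) := by
    refine Finset.sum_congr rfl fun p hp => ?_
    refine intervalIntegral.integral_congr fun s _ => ?_
    exact forestMean_sup_edge hε hF hp w s
  rw [h3, ← key]
  ring

end ForestMean

end

noncomputable section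
open scoped ContDiff Matrix.Norms.L2Operator

/-! ### The forest formula -/

instance : IsProbabilityMeasure (volume.restrict (Set.Icc (0 : ℝ) 1)) := ⟨by simp⟩

/-- The uniform measure on `[0, 1]^ι`. -/
abbrev unitCube (ι : Type*) [Fintype ι] : Measure (ι → ℝ) :=
  Measure.pi fun _ => volume.restrict (Set.Icc (0 : ℝ) 1)

theorem ae_unitCube_mem (ι : Type*) [Fintype ι] : ∀ᵐ w ∂(unitCube ι), ∀ i, w i ∈ Set.Icc (0 : ℝ) 1 := by
  refine ae_all_iff.2 fun i => ?_
  exact (measurePreserving_eval (fun _ : ι => volume.restrict (Set.Icc (0 : ℝ) 1))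
    i).quasiMeasurePreserving.ae (ae_restrict_mem measurableSet_Icc)

/-- Almost surely all weights are different, so that a forest has a unique line of smallest weight. -/
theorem ae_unitCube_injective (ι : Type*) [Fintype ι] :
    ∀ᵐ w ∂(unitCube ι), Function.Injective w := by
  classical
  have h : ∀ i j : ι, ∀ᵐ w ∂(unitCube ι), i ≠ j → w i ≠ w j := by
    intro i j
    by_cases hij : i = j
    · simp [hij]
    have hmp := measurePreserving_update (κ := ι) (volume.restrict (Set.Icc (0 : ℝ) 1)) i
    have hms : MeasurableSet {w : ι → ℝ | w i = w j} :=
      measurableSet_eq_fun (measurable_pi_apply i) (measurable_pi_apply j)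
    have h0 : unitCube ι {w : ι → ℝ | w i = w j} = 0 := by
      rw [← hmp.measure_preimage hms.nullMeasurableSet, Measure.prod_apply (hmp.measurable hms)]
      refine lintegral_eq_zero_of_ae_eq_zero (Eventually.of_forall fun w => ?_)
      have h1 : Prod.mk w ⁻¹' ((fun p : (ι → ℝ) × ℝ => Function.update p.1 i p.2) ⁻¹'
          {w : ι → ℝ | w i = w j}) = {w j} := by
        ext s
        simp [Function.update_of_ne (Ne.symm hij)]
      simp only [h1]
      simp
    filter_upwards [measure_eq_zero_iff_ae_notMem.1 h0] with w hw _ using hw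
  have h' := ae_all_iff.2 fun i => ae_all_iff.2 fun j => h i j
  filter_upwards [h'] with w hw i j hij
  by_contra hne
  exact hw i j hne hij

section

variable {n : ℕ}

/-- The smallest weight of a line of `G`, or `1` if there are no lines. -/
def minWeight (G : SimpleGraph (Fin n)) (w : Sym2 (Fin n) → ℝ) : ℝ :=
  (lines G).fold min 1 fun p => w s(p.1, p.2)

theorem le_minWeight_iff {G : SimpleGraph (Fin n)} {w : Sym2 (Fin n) → ℝ} {s : ℝ} :
    s ≤ minWeight G w ↔ s ≤ 1 ∧ ∀ p ∈ lines G, s ≤ w s(p.1, p.2) :=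
  Finset.le_fold_min _

theorem minWeight_le_one (G : SimpleGraph (Fin n)) (w : Sym2 (Fin n) → ℝ) : minWeight G w ≤ 1 :=
  (le_minWeight_iff.1 le_rfl).1

theorem minWeight_nonneg (G : SimpleGraph (Fin n)) {w : Sym2 (Fin n) → ℝ}
    (hw : ∀ e, w e ∈ Set.Icc (0 : ℝ) 1) : 0 ≤ minWeight G w :=
  le_minWeight_iff.2 ⟨zero_le_one, fun _ _ => (hw _).1⟩

theorem minWeight_le {G : SimpleGraph (Fin n)} (w : Sym2 (Fin n) → ℝ) {e : Sym2 (Fin n)}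
    (he : e ∈ G.edgeSet) : minWeight G w ≤ w e := by
  induction e with
  | h a b =>
    have hadj : G.Adj a b := he
    rcases lt_trichotomy a b with h | h | h
    · exact (le_minWeight_iff.1 le_rfl).2 (a, b) (mem_lines.2 ⟨h, hadj⟩)
    · exact absurd h hadj.ne
    · rw [Sym2.eq_swap]
      exact (le_minWeight_iff.1 le_rfl).2 (b, a) (mem_lines.2 ⟨h, hadj.symm⟩)

theorem continuous_minWeight (G : SimpleGraph (Fin n)) : Continuous (minWeight G) := by
  classical
  unfold minWeight
  induction lines G using Finset.induction_on with
  | empty => simpa using continuous_const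
  | insert p S hp ih =>
    simp only [Finset.fold_insert hp]
    exact (continuous_apply _).min ih

theorem injOn_lines {p q : Fin n × Fin n} (hp : p.1 < p.2) (hq : q.1 < q.2)
    (h : s(p.1, p.2) = s(q.1, q.2)) : p = q := by
  rcases Sym2.eq_iff.1 h with ⟨h1, h2⟩ | ⟨h1, h2⟩
  · exact Prod.ext h1 h2
  · rw [h1, h2] at hp
    exact absurd hp hq.not_gt

theorem isClosed_argmin (G : SimpleGraph (Fin n)) (p : Fin n × Fin n) :
    IsClosed {w : Sym2 (Fin n) → ℝ | ∀ q ∈ lines G, w s(p.1, p.2) ≤ w s(q.1, q.2)} := by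
  simp only [Set.ofPred_forall]
  exact isClosed_iInter fun q => isClosed_iInter fun _ =>
    isClosed_le (continuous_apply _) (continuous_apply _)

variable {κ : Type*} {N : ℕ} {ε : ℝ} {F : (Fin n → Matrix (Fin N) (Fin N) ℂ) → ℂ}

/-- The integrated expectation of `F` differentiated along the lines of the forest `G`. -/
def forestAmplitude (F : (Fin n → Matrix (Fin N) (Fin N) ℂ) → ℂ) (G : SimpleGraph (Fin n)) : ℂ :=
  ∫ w, fieldMean N (linkWeight (extendWeight G fun e => w e))
    (lineOperators (lineList G) F) ∂(unitCube (Sym2 (Fin n)))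

theorem forestWeight_zero (c : Fin n → κ) (G : SimpleGraph (Fin n)) (w : Sym2 (Fin n) → ℝ) :
    forestWeight c G w 0 = extendWeight G fun e => w e := by
  classical
  ext e
  by_cases h : e ∈ G.edgeSet <;> simp [forestWeight, extendWeight, h]

/-- The part of the expectation of the forest `G` where the line `p` has the smallest weight, which
is also the weight of all the links between the trees of `G`. -/
def lineTerm (F : (Fin n → Matrix (Fin N) (Fin N) ℂ) → ℂ) (c : Fin n → κ)
    (G : SimpleGraph (Fin n)) (p : Fin n × Fin n) (w : Sym2 (Fin n) → ℝ) : ℂ :=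
  Set.indicator {w : Sym2 (Fin n) → ℝ | ∀ q ∈ lines G, w s(p.1, p.2) ≤ w s(q.1, q.2)}
    (fun w => forestMean F c G w (w s(p.1, p.2))) w

theorem integrable_forestMean (hε : 0 < ε) (hF : Tame (hermTuples n N) ε F) (c : Fin n → κ)
    (G : SimpleGraph (Fin n)) {m : (Sym2 (Fin n) → ℝ) → ℝ} (hm : Continuous m) :
    Integrable (fun w => forestMean F c G w (m w)) (unitCube (Sym2 (Fin n))) := by
  obtain ⟨K, _, hK⟩ := exists_bound_forestMean hε hF c G
  exact Integrable.of_bound ((continuous_forestMean hε hF c G).comp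
    (continuous_id.prodMk hm)).aestronglyMeasurable K (Eventually.of_forall fun w => hK _ _)

theorem integrable_lineTerm (hε : 0 < ε) (hF : Tame (hermTuples n N) ε F) (c : Fin n → κ)
    (G : SimpleGraph (Fin n)) (p : Fin n × Fin n) :
    Integrable (lineTerm F c G p) (unitCube (Sym2 (Fin n))) :=
  (integrable_forestMean hε hF c G (continuous_apply _)).indicator
    (isClosed_argmin G p).measurableSet

/-- Decomposition according to the line of smallest weight. -/
theorem integral_forestMean_minWeight (hε : 0 < ε) (hF : Tame (hermTuples n N) ε F)
    (c : Fin n → κ) {G : SimpleGraph (Fin n)} (hG : (lines G).Nonempty) :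
    ∫ w, forestMean F c G w (minWeight G w) ∂(unitCube (Sym2 (Fin n))) =
      ∑ p ∈ lines G, ∫ w, lineTerm F c G p w ∂(unitCube (Sym2 (Fin n))) := by
  rw [← integral_finsetSum _ fun p _ => integrable_lineTerm hε hF c G p]
  refine integral_congr_ae ?_
  filter_upwards [ae_unitCube_mem (Sym2 (Fin n)), ae_unitCube_injective (Sym2 (Fin n))]
    with w hw hinj
  obtain ⟨p, hp, hmin⟩ := (lines G).exists_min_image (fun q => w s(q.1, q.2)) hG
  rw [Finset.sum_eq_single_of_mem p hp]
  · rw [lineTerm, Set.indicator_of_mem (by exact hmin)]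
    congr 1
    exact le_antisymm (minWeight_le w (mem_lines.1 hp).2) (le_minWeight_iff.2 ⟨(hw _).2, hmin⟩)
  · intro q hq hne
    rw [lineTerm, Set.indicator_of_notMem]
    intro hq'
    have h1 : w s(q.1, q.2) = w s(p.1, p.2) := le_antisymm (hq' p hp) (hmin q hq)
    exact hne (injOn_lines (mem_lines.1 hq).1 (mem_lines.1 hp).1 (hinj h1))

/-- The remainder of Taylor's formula at the forest `G` for the link `p`: integrating the parameter
up to the smallest weight of `G` amounts to giving the line `p` a weight below all the others. -/
theorem integral_lineTerm {c : Fin n → κ}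
    {G : SimpleGraph (Fin n)} {p : Fin n × Fin n} (hp : p ∈ newLines c G) :
    (∀ᵐ w ∂(unitCube (Sym2 (Fin n))), (∫ s in (0 : ℝ)..(minWeight G w),
      forestMean F c (G ⊔ SimpleGraph.edge p.1 p.2) (Function.update w s(p.1, p.2) s) s) =
      ∫ s in Set.Icc (0 : ℝ) 1, lineTerm F c (G ⊔ SimpleGraph.edge p.1 p.2) p
        (Function.update w s(p.1, p.2) s)) := by
  filter_upwards [ae_unitCube_mem (Sym2 (Fin n))] with w hw
  have hm0 := minWeight_nonneg G hw
  have hm1 := minWeight_le_one G w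
  have h1 : ∀ s ∈ Set.Icc (0 : ℝ) 1, lineTerm F c (G ⊔ SimpleGraph.edge p.1 p.2) p
      (Function.update w s(p.1, p.2) s) = Set.indicator (Set.Iic (minWeight G w)) (fun s =>
        forestMean F c (G ⊔ SimpleGraph.edge p.1 p.2) (Function.update w s(p.1, p.2) s) s) s := by
    intro s hs
    have h2 : (∀ q ∈ lines (G ⊔ SimpleGraph.edge p.1 p.2),
        Function.update w s(p.1, p.2) s s(p.1, p.2) ≤ Function.update w s(p.1, p.2) s s(q.1, q.2)) ↔
        s ≤ minWeight G w := by
      rw [lines_sup_edge hp, le_minWeight_iff]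
      simp only [Function.update_self, Finset.forall_mem_insert, le_refl, true_and, hs.2]
      refine forall₂_congr fun q hq => ?_
      rw [Function.update_of_ne]
      intro h3
      have := injOn_lines (mem_lines.1 hq).1 (mem_newLines.1 hp).1 h3
      rw [this] at hq
      exact not_adj_of_mem_newLines hp (mem_lines.1 hq).2
    by_cases hs' : s ≤ minWeight G w
    · rw [lineTerm, Set.indicator_of_mem (by exact h2.2 hs'), Set.indicator_of_mem (by exact hs'),
        Function.update_self]
    · rw [lineTerm, Set.indicator_of_notMem (by exact fun h => hs' (h2.1 h)),
        Set.indicator_of_notMem (by exact hs')]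
  rw [setIntegral_congr_fun measurableSet_Icc h1, setIntegral_indicator measurableSet_Iic,
    intervalIntegral.integral_of_le hm0, ← integral_Icc_eq_integral_Ioc]
  congr 2
  ext s
  simp only [Set.mem_Icc, Set.mem_inter_iff, Set.mem_Iic]
  constructor
  · rintro ⟨a, b⟩; exact ⟨⟨a, b.trans hm1⟩, b⟩
  · rintro ⟨⟨a, _⟩, b⟩; exact ⟨a, b⟩

/-- Taylor's formula up to the smallest weight of `G`. The first term of `G` is cancelled by the
remainders of the forests that have one line less. -/
theorem forestAmplitude_eq (hε : 0 < ε) (hF : Tame (hermTuples n N) ε F) {c : Fin n → κ}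
    {G : SimpleGraph (Fin n)} (hG : G ∈ forests c) :
    forestAmplitude F G = ∫ w, forestMean F c G w (minWeight G w) ∂(unitCube (Sym2 (Fin n))) -
      ∑ p ∈ newLines c G, ∫ w, lineTerm F c (G ⊔ SimpleGraph.edge p.1 p.2) p w
        ∂(unitCube (Sym2 (Fin n))) := by
  have hi : ∀ p, Integrable (fun w => ∫ s in Set.Icc (0 : ℝ) 1,
      lineTerm F c (G ⊔ SimpleGraph.edge p.1 p.2) p (Function.update w s(p.1, p.2) s))
      (unitCube (Sym2 (Fin n))) := by
    intro p
    have h1 := integrable_lineTerm hε hF c (G ⊔ SimpleGraph.edge p.1 p.2) p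
    have h2 := measurePreserving_update (κ := Sym2 (Fin n)) (volume.restrict (Set.Icc (0 : ℝ) 1))
      s(p.1, p.2)
    exact ((h2.integrable_comp h1.aestronglyMeasurable).2 h1).integral_prod_left
  have h1 : forestAmplitude F G = ∫ w, (forestMean F c G w (minWeight G w) -
      ∑ p ∈ newLines c G, ∫ s in Set.Icc (0 : ℝ) 1,
        lineTerm F c (G ⊔ SimpleGraph.edge p.1 p.2) p (Function.update w s(p.1, p.2) s))
      ∂(unitCube (Sym2 (Fin n))) := by
    refine integral_congr_ae ?_
    have h2 := (Finset.eventually_all (newLines c G)).2 fun p hp => integral_lineTerm (F := F) hp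
    filter_upwards [ae_unitCube_mem (Sym2 (Fin n)), h2] with w hw hw2
    have h3 := forestMean_zero_eq hε hF hG (minWeight_nonneg G hw) (minWeight_le_one G w)
      fun e he => minWeight_le w he
    rw [forestMean, forestWeight_zero] at h3
    rw [h3]
    congr 1
    exact Finset.sum_congr rfl fun p hp => hw2 p hp
  rw [h1, integral_sub (integrable_forestMean hε hF c G (continuous_minWeight G))
    (integrable_finsetSum _ fun p _ => hi p), integral_finsetSum _ fun p _ => hi p]
  congr 1
  refine Finset.sum_congr rfl fun p _ => ?_
  exact (integral_update_eq (volume.restrict (Set.Icc (0 : ℝ) 1)) s(p.1, p.2)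
    (integrable_lineTerm hε hF c _ p)).symm

open Classical in
/-- The forest formula of Brydges, Kennedy, Abdesselam and Rivasseau: the expectation with fields
that are equal within each colour and independent between colours is the sum of the amplitudes of
all the forests that respect the colours. -/
theorem sum_forestAmplitude (hε : 0 < ε) (hF : Tame (hermTuples n N) ε F) (c : Fin n → κ) :
    ∑ G ∈ forests c, forestAmplitude F G =
      fieldMean N (Matrix.of fun v v' => if c v = c v' then (1 : ℝ) else 0) F := by
  -- after reindexing by forests with a distinguished line, the boundary terms of each forest with
  -- at least one line cancel against the remainders
  rw [Finset.sum_congr rfl fun G hG => forestAmplitude_eq hε hF hG, Finset.sum_sub_distrib,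
    sum_newLines_eq_sum_lines c fun G p => ∫ w, lineTerm F c G p w ∂(unitCube (Sym2 (Fin n))),
    ← Finset.sum_sub_distrib]
  have hbot : (⊥ : SimpleGraph (Fin n)) ∈ forests c :=
    mem_forests.2 ⟨SimpleGraph.isAcyclic_bot, fun a b h => absurd h (by simp)⟩
  have hlines : lines (⊥ : SimpleGraph (Fin n)) = ∅ := by
    ext p; simp [mem_lines]
  -- only the forest without lines survives, at the end of the interpolation
  rw [Finset.sum_eq_single_of_mem ⊥ hbot]
  · rw [hlines, Finset.sum_empty, sub_zero]
    have h1 : ∀ w, forestMean F c ⊥ w (minWeight ⊥ w) =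
        fieldMean N (Matrix.of fun v v' => if c v = c v' then (1 : ℝ) else 0) F := by
      intro w
      have h2 : minWeight ⊥ w = 1 := by rw [minWeight, hlines]; rfl
      have h3 : linkWeight (forestWeight c ⊥ w 1) =
          Matrix.of fun v v' => if c v = c v' then (1 : ℝ) else 0 := by
        ext v v'
        rw [Matrix.of_apply]
        refine linkWeight_eq_of_iff (by split_ifs <;> simp) fun s h0 h1 => ?_
        constructor
        · intro h
          rw [if_pos (reachable_color_eq (fun a b hab => color_eq_of_thresholdGraph hbot h0 hab) h)]
          exact h1
        · intro h
          by_cases hv : v = v'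
          · rw [hv]
          · refine SimpleGraph.Adj.reachable ((SimpleGraph.fromEdgeSet_adj _).2 ⟨?_, hv⟩)
            by_cases hc : c v = c v'
            · simpa [forestWeight, hc] using h1
            · rw [if_neg hc] at h; linarith
      rw [h2, forestMean, h3, lineList_eq, hlines]
      simp
    simp_rw [h1]
    simp
  · intro G hG hne
    have hl : (lines G).Nonempty := by
      by_contra h
      rw [Finset.not_nonempty_iff_eq_empty] at h
      refine hne (SimpleGraph.ext (funext fun a => funext fun b => ?_))
      simp only [SimpleGraph.bot_adj, eq_iff_iff, iff_false]
      intro hab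
      rcases lt_trichotomy a b with h' | h' | h'
      · exact absurd (mem_lines.2 ⟨h', hab⟩ : (a, b) ∈ lines G) (by simp [h])
      · exact hab.ne h'
      · exact absurd (mem_lines.2 ⟨h', hab.symm⟩ : (b, a) ∈ lines G) (by simp [h])
    rw [integral_forestMean_minWeight hε hF c hl, sub_self]

end

end

noncomputable section
open scoped ContDiff Matrix.Norms.L2Operator

/-! ### Cumulants by the replica method -/

section Replica

open PowerSeries in
/-- The shifted exponential generating function `∑ m (n + j) x ^ n / n!`, the `j`-th derivative of
`∑ m n x ^ n / n!`. -/
def egf (m : ℕ → ℂ) (j : ℕ) : PowerSeries ℂ := PowerSeries.mk fun n => m (n + j) / n !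

theorem derivative_egf (m : ℕ → ℂ) (j : ℕ) :
    PowerSeries.derivative ℂ (egf m j) = egf m (j + 1) := by
  ext n
  rw [PowerSeries.coeff_derivative, egf, egf, PowerSeries.coeff_mk, PowerSeries.coeff_mk,
    Nat.factorial_succ, show n + 1 + j = n + (j + 1) by ring]
  have h1 : (n ! : ℂ) ≠ 0 := by exact_mod_cast n.factorial_ne_zero
  have h2 : (n : ℂ) + 1 ≠ 0 := by exact_mod_cast n.succ_ne_zero
  push_cast
  field_simp

theorem derivative_prod_egf {κ : Type*} [DecidableEq κ] (m : ℕ → ℂ) (r : κ → ℕ) (s : Finset κ) :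
    PowerSeries.derivative ℂ (∏ a ∈ s, egf m (r a)) =
      ∑ a ∈ s, ∏ b ∈ s, egf m (Function.update r a (r a + 1) b) := by
  induction s using Finset.induction_on with
  | empty => simp
  | insert a s ha ih =>
    rw [Finset.prod_insert ha, Derivation.leibniz, ih, derivative_egf, Finset.sum_insert ha,
      Finset.prod_insert ha, Function.update_self, smul_eq_mul, smul_eq_mul, Finset.mul_sum]
    have h1 : ∏ b ∈ s, egf m (Function.update r a (r a + 1) b) = ∏ b ∈ s, egf m (r b) :=
      Finset.prod_congr rfl fun b hb => by
        rw [Function.update_of_ne (by rintro rfl; exact ha hb)]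
    have h2 : ∀ b ∈ s, ∏ b' ∈ insert a s, egf m (Function.update r b (r b + 1) b') =
        egf m (r a) * ∏ b' ∈ s, egf m (Function.update r b (r b + 1) b') := fun b hb => by
      rw [Finset.prod_insert ha, Function.update_of_ne (by rintro rfl; exact ha hb)]
    rw [h1, Finset.sum_congr rfl h2]
    ring

/-- The sum over all colourings of the products of the moments of the colour classes. -/
theorem sum_colorings {κ : Type*} [Fintype κ] [DecidableEq κ] (m : ℕ → ℂ) (n : ℕ) (r : κ → ℕ) :
    ∑ c : Fin n → κ, ∏ a, m (r a + (Finset.univ.filter fun v => c v = a).card) =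
      n ! * PowerSeries.coeff n (∏ a, egf m (r a)) := by
  induction n generalizing r with
  | zero =>
    rw [PowerSeries.coeff_zero_eq_constantCoeff, map_prod]
    simp [egf]
  | succ n ih =>
    have h1 := PowerSeries.coeff_derivative (∏ a, egf m (r a)) n
    rw [derivative_prod_egf, map_sum] at h1
    have h2 : ((n + 1)! : ℂ) * PowerSeries.coeff (n + 1) (∏ a, egf m (r a)) =
        n ! * ∑ a, PowerSeries.coeff n (∏ b, egf m (Function.update r a (r a + 1) b)) := by
      rw [h1, Nat.factorial_succ]; push_cast; ring
    rw [h2, Finset.mul_sum, ← (Fin.consEquiv fun _ => κ).sum_comp, Fintype.sum_prod_type]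
    refine Finset.sum_congr rfl fun a _ => ?_
    rw [← ih]
    refine Finset.sum_congr rfl fun c _ => Finset.prod_congr rfl fun b _ => ?_
    congr 1
    rw [Fin.card_filter_univ_succ]
    by_cases hab : a = b
    · subst hab
      simp [Fin.consEquiv]
      ring
    · simp [Fin.consEquiv, hab, Function.update_of_ne (Ne.symm hab)]

variable {N : ℕ}

/-- The moments of a function of one Hermitian field. -/
def fieldMoment (N : ℕ) (V : Matrix (Fin N) (Fin N) ℂ → ℂ) (j : ℕ) : ℂ :=
  ∫ x, V (hermitianOfCoords x) ^ j ∂(stdGaussianPi (Fin N × Fin N))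

theorem map_curry_stdGaussianPi (κ ι : Type*) [Fintype κ] [Fintype ι] :
    (stdGaussianPi (κ × ι)).map (MeasurableEquiv.curry κ ι ℝ) =
      Measure.pi fun _ : κ => stdGaussianPi ι := by
  have h := Measure.infinitePi_map_curry (ι := κ) (κ := ι) (fun _ _ => gaussianReal 0 1)
  simp only [Measure.infinitePi_eq_pi] at h
  exact h

/-- Fields that are equal within each colour and independent between colours: the expectation of
the product of the vertices factorizes over the colours. -/
theorem fieldMean_coloring {n k : ℕ} (c : Fin n → Fin k) {V : Matrix (Fin N) (Fin N) ℂ → ℂ}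
    (hV : Continuous fun x : Fin N × Fin N → ℝ => V (hermitianOfCoords x)) :
    fieldMean N (Matrix.of fun v v' => if c v = c v' then (1 : ℝ) else 0) (fun σ => ∏ v, V (σ v)) =
      ∏ a, fieldMoment N V (Finset.univ.filter fun v => c v = a).card := by
  set A : Matrix (Fin n) (Fin k) ℝ := Matrix.of fun v a => if c v = a then 1 else 0 with hA
  have h1 : (Matrix.of fun v v' => if c v = c v' then (1 : ℝ) else 0) = A * Aᵀ := by
    ext v v'
    simp [hA, Matrix.mul_apply, eq_comm]
  have h2 : (A * Aᵀ) ⊗ₖ (1 : Matrix (Fin N × Fin N) (Fin N × Fin N) ℝ) =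
      (A ⊗ₖ (1 : Matrix (Fin N × Fin N) (Fin N × Fin N) ℝ)) *
        (A ⊗ₖ (1 : Matrix (Fin N × Fin N) (Fin N × Fin N) ℝ))ᵀ := by
    rw [← Matrix.kroneckerMap_transpose, ← Matrix.mul_kronecker_mul, Matrix.transpose_one,
      Matrix.mul_one]
  have hcont : Continuous fun x : Fin n × (Fin N × Fin N) → ℝ => ∏ v, V (fieldsCLM n N x v) := by
    refine continuous_finsetProd _ fun v _ => ?_
    exact hV.comp (f := fun x : Fin n × (Fin N × Fin N) → ℝ => fun p => x (v, p)) (by fun_prop)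
  have h3 : ∀ x : Fin k × (Fin N × Fin N) → ℝ,
      fieldsCLM n N ((A ⊗ₖ (1 : Matrix (Fin N × Fin N) (Fin N × Fin N) ℝ)) *ᵥ x) =
        fun v => hermitianOfCoords fun p => x (c v, p) := by
    intro x
    funext v
    change hermitianOfCoords (fun p => ((A ⊗ₖ (1 : Matrix (Fin N × Fin N) (Fin N × Fin N) ℝ)) *ᵥ x)
      (v, p)) = _
    congr 1
    funext p
    rw [Matrix.mulVec, dotProduct, Fintype.sum_prod_type]
    simp [Matrix.one_apply, hA]
  rw [h1, fieldMean_eq, h2, gaussianMean_mul_transpose _ hcont]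
  simp_rw [h3]
  have h4 : ∀ x : Fin k × (Fin N × Fin N) → ℝ, ∏ v, V (hermitianOfCoords fun p => x (c v, p)) =
      ∏ a, V (hermitianOfCoords (MeasurableEquiv.curry (Fin k) (Fin N × Fin N) ℝ x a)) ^
        (Finset.univ.filter fun v => c v = a).card := by
    intro x
    rw [← Finset.prod_fiberwise (s := Finset.univ) (g := c)]
    refine Finset.prod_congr rfl fun a _ => ?_
    rw [← Finset.prod_const]
    refine Finset.prod_congr rfl fun v hv => ?_
    rw [← (Finset.mem_filter.1 hv).2]
    rfl
  simp_rw [h4]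
  have h5 := integral_map_equiv (μ := stdGaussianPi (Fin k × (Fin N × Fin N)))
    (MeasurableEquiv.curry (Fin k) (Fin N × Fin N) ℝ)
    (fun y => ∏ a, V (hermitianOfCoords (y a)) ^ (Finset.univ.filter fun v => c v = a).card)
  rw [← h5, map_curry_stdGaussianPi, integral_fintype_prod_eq_prod (f := fun a y =>
    V (hermitianOfCoords y) ^ (Finset.univ.filter fun v => c v = a).card)]
  rfl

open Classical in
/-- Colourings constant along the edges are colourings of the connected components. -/
theorem card_colorings {n k : ℕ} (G : SimpleGraph (Fin n)) :
    (Finset.univ.filter fun c : Fin n → Fin k => ∀ a b, G.Adj a b → c a = c b).card =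
      k ^ Fintype.card G.ConnectedComponent := by
  have h : Fintype.card (G.ConnectedComponent → Fin k) = k ^ Fintype.card G.ConnectedComponent := by
    simp
  rw [← h, ← Fintype.card_subtype]
  refine Fintype.card_congr
    { toFun := fun c C => C.lift c.1 fun v w p _ => reachable_color_eq c.2 p.reachable
      invFun := fun f => ⟨fun v => f (G.connectedComponentMk v), fun a b hab =>
        congrArg f (SimpleGraph.ConnectedComponent.eq.2 hab.reachable)⟩
      left_inv := fun c => rfl
      right_inv := fun f => by
        funext C
        induction C using SimpleGraph.ConnectedComponent.ind
        rfl }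

variable {ε : ℝ} {V : Matrix (Fin N) (Fin N) ℂ → ℂ}

open Classical in
/-- The generating polynomial of the forests by number of trees; its values at the natural numbers
`k` are the moments of the sum of `k` independent replicas of the vertex. -/
def forestPolynomial (N : ℕ) (V : Matrix (Fin N) (Fin N) ℂ → ℂ) (n : ℕ) : Polynomial ℂ :=
  ∑ G ∈ Finset.univ.filter (fun G : SimpleGraph (Fin n) => G.IsAcyclic),
    Polynomial.C (forestAmplitude (fun σ => ∏ v, V (σ v)) G) *
      Polynomial.X ^ Fintype.card G.ConnectedComponent

open Classical in
/-- At a natural number `k` the polynomial is a sum over colourings by `k` colours, by the forest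
formula for each colouring. -/
theorem eval_forestPolynomial {n : ℕ} (hε : 0 < ε)
    (hV : Continuous fun x : Fin N × Fin N → ℝ => V (hermitianOfCoords x))
    (hF : Tame (hermTuples n N) ε fun σ => ∏ v, V (σ v)) (k : ℕ) :
    (forestPolynomial N V n).eval (k : ℂ) =
      n ! * PowerSeries.coeff n (egf (fieldMoment N V) 0 ^ k) := by
  have h1 := sum_colorings (κ := Fin k) (fieldMoment N V) n fun _ => 0
  rw [Finset.prod_const, Finset.card_univ, Fintype.card_fin] at h1
  rw [← h1, forestPolynomial, Polynomial.eval_finsetSum]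
  have h2 : ∀ c : Fin n → Fin k, ∏ a, fieldMoment N V (0 + (Finset.univ.filter fun v => c v = a).card) =
      ∑ G ∈ forests c, forestAmplitude (fun σ => ∏ v, V (σ v)) G := by
    intro c
    simp only [zero_add]
    rw [← fieldMean_coloring c hV, sum_forestAmplitude hε hF c]
    congr!
  rw [Finset.sum_congr rfl fun c _ => h2 c]
  simp only [forests, Finset.sum_filter, ite_and]
  rw [Finset.sum_comm]
  refine Finset.sum_congr rfl fun G _ => ?_
  by_cases hG : G.IsAcyclic
  · simp only [hG, if_true]
    have h3 : ∑ x : Fin n → Fin k, (if ∀ a b, G.Adj a b → x a = x b then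
        forestAmplitude (fun σ => ∏ v, V (σ v)) G else 0) =
        (k : ℂ) ^ Fintype.card G.ConnectedComponent *
          forestAmplitude (fun σ => ∏ v, V (σ v)) G := by
      rw [← Finset.sum_filter, Finset.sum_const, card_colorings]
      simp
    refine Eq.trans ?_ (h3.symm.trans (by congr!))
    rw [Polynomial.eval_mul, Polynomial.eval_C, Polynomial.eval_pow, Polynomial.eval_X, mul_comm]
  · simp [hG]

/-- The forests with a single tree. -/
theorem coeff_one_forestPolynomial (n : ℕ) : (forestPolynomial N V n).coeff 1 =
    ∑ T ∈ treesOn n, forestAmplitude (fun σ => ∏ v, V (σ v)) T := by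
  classical
  rw [forestPolynomial, Polynomial.finsetSum_coeff, treesOn]
  simp only [Polynomial.coeff_C_mul, Polynomial.coeff_X_pow, Finset.sum_filter]
  refine Finset.sum_congr rfl fun G _ => ?_
  have h : G.IsTree ↔ G.IsAcyclic ∧ 1 = Fintype.card G.ConnectedComponent := by
    rw [SimpleGraph.isTree_iff, and_comm]
    refine and_congr_right fun _ => ?_
    rw [eq_comm, Fintype.card_eq_one_iff]
    constructor
    · intro h
      obtain ⟨v⟩ := h.nonempty
      refine ⟨G.connectedComponentMk v, fun C => ?_⟩
      induction C using SimpleGraph.ConnectedComponent.ind with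
      | h w => exact SimpleGraph.ConnectedComponent.eq.2 (h.preconnected w v)
    · rintro ⟨C, hC⟩
      have hne : Nonempty (Fin n) := by
        induction C using SimpleGraph.ConnectedComponent.ind with
        | h w => exact ⟨w⟩
      exact ⟨fun v w => SimpleGraph.ConnectedComponent.eq.1
        ((hC (G.connectedComponentMk v)).trans (hC (G.connectedComponentMk w)).symm)⟩
  simp only [h, ite_and]
  split_ifs <;> simp

/-- The linked cluster theorem: the sums over trees are the cumulants of the vertex. The generating
function of the `k`-th powers being a polynomial in `k`, its linear coefficient satisfies the
logarithmic derivative equation. -/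
theorem sum_treeAmplitude_recursion (hε : 0 < ε)
    (hV : Continuous fun x : Fin N × Fin N → ℝ => V (hermitianOfCoords x))
    (hF : ∀ n, Tame (hermTuples n N) ε fun σ => ∏ v, V (σ v)) (n : ℕ) :
    fieldMoment N V (n + 1) / (n ! : ℂ) = ∑ p ∈ Finset.HasAntidiagonal.antidiagonal n,
      ((p.1 + 1 : ℕ) : ℂ) * ((((p.1 + 1)! : ℂ))⁻¹ *
        ∑ T ∈ treesOn (p.1 + 1), forestAmplitude (fun σ => ∏ v, V (σ v)) T) *
      (fieldMoment N V p.2 / (p.2 ! : ℂ)) := by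
  set m := fieldMoment N V with hm
  set q : ℕ → Polynomial ℂ := fun n => Polynomial.C ((n ! : ℂ)⁻¹) * forestPolynomial N V n with hq
  have hfac : ∀ n : ℕ, (n ! : ℂ) ≠ 0 := fun n => by exact_mod_cast n.factorial_ne_zero
  have hqe : ∀ n k : ℕ, (q n).eval (k : ℂ) = PowerSeries.coeff n (egf m 0 ^ k) := fun n k => by
    rw [hq, Polynomial.eval_mul, Polynomial.eval_C, eval_forestPolynomial hε hV (hF n), ← hm,
      inv_mul_cancel_left₀ (hfac n)]
  have hd : ∀ k : ℕ, PowerSeries.derivative ℂ (egf m 0 ^ k) * egf m 0 =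
      PowerSeries.C (k : ℂ) * (egf m 1 * egf m 0 ^ k) := fun k => by
    rw [Derivation.leibniz_pow, derivative_egf]
    rcases k with _ | k
    · simp
    · simp only [smul_eq_mul, nsmul_eq_mul, Nat.add_sub_cancel, map_natCast]
      ring
  -- the coefficients of `hd k`, as an identity of polynomials in `k`: it holds at every natural number
  have hpoly : ∑ p ∈ Finset.HasAntidiagonal.antidiagonal n,
      Polynomial.C (((p.1 + 1 : ℕ) : ℂ) * (m p.2 / (p.2 ! : ℂ))) * q (p.1 + 1) = Polynomial.X * ∑ p ∈ Finset.HasAntidiagonal.antidiagonal n,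
        Polynomial.C (m (p.1 + 1) / (p.1 ! : ℂ)) * q p.2 := by
    refine Polynomial.eq_of_infinite_eval_eq _ _ ((Set.infinite_range_of_injective
      (Nat.cast_injective (R := ℂ))).mono ?_)
    rintro _ ⟨k, rfl⟩
    have h := congrArg (PowerSeries.coeff n) (hd k)
    rw [PowerSeries.coeff_mul, PowerSeries.coeff_C_mul, PowerSeries.coeff_mul] at h
    simp only [Set.mem_ofPred_eq, Polynomial.eval_finsetSum, Polynomial.eval_mul,
      Polynomial.eval_C, Polynomial.eval_X, hqe]
    refine Eq.trans (Finset.sum_congr rfl fun p _ => ?_) (h.trans ?_)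
    · rw [PowerSeries.coeff_derivative]
      simp only [egf, PowerSeries.coeff_mk, add_zero]
      push_cast
      ring
    · simp only [egf, PowerSeries.coeff_mk]
  -- comparison of the coefficients linear in `k`; on the right only `q 0 = 1` contributes
  have h1 := congrArg (fun P : Polynomial ℂ => P.coeff 1) hpoly
  simp only [Polynomial.finsetSum_coeff, Polynomial.coeff_C_mul, Polynomial.coeff_X_mul] at h1
  have hq0 : ∀ j, (q j).coeff 0 = if j = 0 then 1 else 0 := fun j => by
    have := hqe j 0
    rw [Nat.cast_zero, ← Polynomial.coeff_zero_eq_eval_zero, pow_zero, PowerSeries.coeff_one] at this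
    exact this
  have hq1 : ∀ j, (q j).coeff 1 = (j ! : ℂ)⁻¹ *
      ∑ T ∈ treesOn j, forestAmplitude (fun σ => ∏ v, V (σ v)) T := fun j => by
    rw [hq, Polynomial.coeff_C_mul, coeff_one_forestPolynomial]
  simp only [hq0, hq1] at h1
  rw [Finset.sum_eq_single_of_mem (s := Finset.HasAntidiagonal.antidiagonal n) (a := (n, 0))
    (f := fun p => m (p.1 + 1) / (p.1 ! : ℂ) * if p.2 = 0 then 1 else 0) (by simp)] at h1
  · rw [if_pos rfl, mul_one] at h1
    rw [← h1]
    refine Finset.sum_congr rfl fun p _ => ?_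
    ring
  · rintro ⟨i, j⟩ hij hne
    rw [Finset.HasAntidiagonal.mem_antidiagonal] at hij
    rw [if_neg, mul_zero]
    rintro rfl
    exact hne (by simp at hij; simp [hij])

end Replica

end

noncomputable section
open scoped ContDiff Matrix.Norms.L2Operator

/-! ### Exponentiation of the tree series -/

/-- Differentiation term by term of a power series with geometrically bounded coefficients. -/
theorem hasDerivAt_tsum_pow {a : ℕ → ℂ} {C θ ρ : ℝ} (ha : ∀ n, ‖a n‖ ≤ C * θ ^ n) (hθ : 0 ≤ θ)
    (hρ : 0 < ρ) (hρθ : ρ * θ < 1) {x : ℂ} (hx : x ∈ Metric.ball (0 : ℂ) ρ) :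
    HasDerivAt (fun x => ∑' n, a n * x ^ n) (∑' n, (n + 1 : ℕ) * a (n + 1) * x ^ n) x ∧
      (Summable fun n => ‖a n * x ^ n‖) ∧ Summable fun n => ‖(n + 1 : ℕ) * a (n + 1) * x ^ n‖ := by
  have hlt : ‖ρ * θ‖ < 1 := by rwa [Real.norm_of_nonneg (by positivity)]
  have hC : 0 ≤ C := by simpa using (norm_nonneg _).trans (ha 0)
  set u : ℕ → ℝ := fun n => C * ρ⁻¹ * (n ^ 1 * (ρ * θ) ^ n) with hu
  have hus : Summable u := (summable_pow_mul_geometric_of_norm_lt_one 1 hlt).mul_left _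
  have hbd : ∀ (n : ℕ) (y : ℂ), y ∈ Metric.ball (0 : ℂ) ρ → ‖a n * (n * y ^ (n - 1))‖ ≤ u n := by
    intro n y hy
    rw [mem_ball_zero_iff] at hy
    rcases n with _ | n
    · simp [hu]
    rw [norm_mul, norm_mul, norm_pow, Complex.norm_natCast]
    calc ‖a (n + 1)‖ * ((n + 1 : ℕ) * ‖y‖ ^ (n + 1 - 1))
        ≤ (C * θ ^ (n + 1)) * ((n + 1 : ℕ) * ρ ^ n) := by
          rw [Nat.add_sub_cancel]
          gcongr
          exact ha _
      _ = u (n + 1) := by simp only [hu]; field_simp; ring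
  have hs0 : ∀ y ∈ Metric.ball (0 : ℂ) ρ, Summable fun n => ‖a n * y ^ n‖ := by
    intro y hy
    rw [mem_ball_zero_iff] at hy
    refine Summable.of_nonneg_of_le (fun _ => norm_nonneg _) (fun n => ?_)
      ((summable_geometric_of_norm_lt_one hlt).mul_left C)
    rw [norm_mul, norm_pow, mul_pow]
    calc ‖a n‖ * ‖y‖ ^ n ≤ (C * θ ^ n) * ρ ^ n := by
          gcongr
          exact ha n
      _ = C * (ρ ^ n * θ ^ n) := by ring
  have hd := hasDerivAt_tsum_of_isPreconnected hus Metric.isOpen_ball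
    (convex_ball (0 : ℂ) ρ).isPreconnected
    (fun n y _ => (hasDerivAt_pow n y).const_mul (a n)) hbd hx (hs0 x hx).of_norm hx
  have hs1 : Summable fun n : ℕ => ‖a n * (n * x ^ (n - 1))‖ :=
    Summable.of_nonneg_of_le (fun _ => norm_nonneg _) (fun n => hbd n x hx) hus
  have hshift : ∀ n : ℕ, a (n + 1) * ((n + 1 : ℕ) * x ^ (n + 1 - 1)) =
      (n + 1 : ℕ) * a (n + 1) * x ^ n := fun n => by
    rw [Nat.add_sub_cancel]; ring
  refine ⟨?_, hs0 x hx, ?_⟩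
  · rw [hs1.of_norm.tsum_eq_zero_add] at hd
    simp only [hshift] at hd
    simpa using hd
  · have := (summable_nat_add_iff 1).2 hs1
    simpa only [hshift] using this

/-- A power series satisfying the logarithmic derivative equation is an exponential. -/
theorem exp_tsum_of_recursion {z l : ℕ → ℂ} {C C' θ : ℝ} (hz : ∀ n, ‖z n‖ ≤ C * θ ^ n)
    (hl : ∀ n, ‖l n‖ ≤ C' * θ ^ n) (h0 : 0 ≤ θ) (h1 : θ < 1) (hz0 : z 0 = 1) (hl0 : l 0 = 0)
    (hrec : ∀ n : ℕ, ((n + 1 : ℕ) : ℂ) * z (n + 1) =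
      ∑ p ∈ Finset.HasAntidiagonal.antidiagonal n, ((p.1 + 1 : ℕ) : ℂ) * l (p.1 + 1) * z p.2) :
    Complex.exp (∑' n, l n) = ∑' n, z n := by
  set ρ : ℝ := 2 / (1 + θ) with hρ
  have hρ0 : 0 < ρ := by positivity
  have hρ1 : 1 < ρ := by rw [hρ, lt_div_iff₀ (by positivity)]; linarith
  have hρθ : ρ * θ < 1 := by
    rw [hρ, div_mul_eq_mul_div, div_lt_one (by positivity)]; linarith
  set f : ℂ → ℂ := fun x => ∑' n, z n * x ^ n with hf
  set L : ℂ → ℂ := fun x => ∑' n, l n * x ^ n with hL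
  have hder : ∀ x ∈ Metric.ball (0 : ℂ) ρ, HasDerivAt (fun x => f x * Complex.exp (-L x)) 0 x := by
    intro x hx
    obtain ⟨hf', hfs, -⟩ := hasDerivAt_tsum_pow hz h0 hρ0 hρθ hx
    obtain ⟨hL', -, hLs⟩ := hasDerivAt_tsum_pow hl h0 hρ0 hρθ hx
    convert! hf'.mul hL'.neg.cexp using 1
    have hprod : ∑' n, ((n + 1 : ℕ) : ℂ) * z (n + 1) * x ^ n =
        (∑' n, ((n + 1 : ℕ) : ℂ) * l (n + 1) * x ^ n) * ∑' n, z n * x ^ n := by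
      rw [tsum_mul_tsum_eq_tsum_sum_antidiagonal_of_summable_norm hLs hfs]
      refine tsum_congr fun n => ?_
      rw [hrec, Finset.sum_mul]
      refine Finset.sum_congr rfl fun p hp => ?_
      rw [← Finset.HasAntidiagonal.mem_antidiagonal.1 hp, pow_add]
      ring
    rw [hprod]
    ring
  have hconst := Metric.isOpen_ball.is_const_of_deriv_eq_zero
    (convex_ball (0 : ℂ) ρ).isPreconnected
    (fun x hx => (hder x hx).differentiableAt.differentiableWithinAt) (fun x hx => (hder x hx).deriv)
    (show (1 : ℂ) ∈ Metric.ball (0 : ℂ) ρ by simpa using hρ1) (Metric.mem_ball_self hρ0)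
  have hf0 : f 0 = 1 := by
    rw [hf]
    simp only
    rw [tsum_eq_single 0 fun n hn => by simp [hn]]
    simp [hz0]
  have hL0 : L 0 = 0 := by
    rw [hL]
    simp only
    rw [tsum_eq_single 0 fun n hn => by simp [hn]]
    simp [hl0]
  have hf1 : f 1 = ∑' n, z n := by simp [hf]
  have hL1 : L 1 = ∑' n, l n := by simp [hL]
  simp only [hf0, hL0, hf1, hL1] at hconst
  rw [Complex.exp_neg] at hconst
  have := Complex.exp_ne_zero (∑' n, l n)
  field_simp at hconst
  simpa using hconst.symm

section TreeSeries

variable {N : ℕ} {g z : ℂ}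

theorem continuous_fieldsCLM_vertex (hg : ‖g‖ ≤ 2 * g.re) :
    Continuous fun x : Fin N × Fin N → ℝ => vertex N g (hermitianOfCoords x) := by
  have h1 := (tame_vertex (n := 1) (N := N) hg 0).hasGradient (tubeRadius_pos g) (fieldsCLM 1 N)
    (fieldsCLM_mem 1 N)
  exact h1.continuous.comp (f := fun (x : Fin N × Fin N → ℝ) (p : Fin 1 × (Fin N × Fin N)) => x p.2)
    (by fun_prop)

theorem norm_vertex_le (hg : ‖g‖ ≤ 2 * g.re) {σ : Matrix (Fin N) (Fin N) ℂ} (hσ : σ.IsHermitian) :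
    ‖vertex N g σ‖ ≤ 2 * N ^ 2 * (‖g‖ * ‖σ‖) := by
  have h1 := norm_traceLog_le (A := (Complex.I * g) • σ) (c := 2) fun s hs => by
    have h1 : ‖(s : ℂ) * g‖ ≤ 2 * ((s : ℂ) * g).re := by
      rw [norm_mul, Complex.norm_real, Real.norm_of_nonneg hs.1, Complex.re_ofReal_mul]
      nlinarith [hs.1]
    have h2 := norm_inv_one_add_le h1 hσ
    rwa [show (Complex.I * (s * g)) • σ = (s : ℂ) • (Complex.I * g) • σ by
      rw [smul_smul]; congr 1; ring] at h2
  rw [vertex, norm_neg, norm_mul, Complex.norm_natCast]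
  rw [Fintype.card_fin, norm_smul, norm_mul, Complex.norm_I, one_mul] at h1
  calc (N : ℝ) * ‖traceLog (1 + (Complex.I * g) • σ)‖ ≤ N * (N * (2 * (‖g‖ * ‖σ‖))) := by gcongr
    _ = _ := by ring

/-- The coordinates control the operator norm. -/
theorem exists_norm_hermitianOfCoords_le (N : ℕ) : ∃ C : ℝ, 0 ≤ C ∧
    ∀ x : Fin N × Fin N → ℝ, ‖hermitianOfCoords x‖ ≤ C * ‖x‖ := by
  refine ⟨‖fieldsCLM 1 N‖, norm_nonneg _, fun x => ?_⟩
  have h1 := (fieldsCLM 1 N).le_opNorm fun p => x p.2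
  have h2 : ‖(fun p : Fin 1 × (Fin N × Fin N) => x p.2)‖ ≤ ‖x‖ :=
    (pi_norm_le_iff_of_nonneg (norm_nonneg _)).2 fun p => norm_le_pi_norm x p.2
  have h3 := norm_le_pi_norm (fieldsCLM 1 N fun p => x p.2) 0
  exact h3.trans (h1.trans (by gcongr))

theorem integrable_exp_norm_vertex (hg : ‖g‖ ≤ 2 * g.re) (a : ℝ) (ha : 0 ≤ a) :
    Integrable (fun x => Real.exp (a * ‖vertex N g (hermitianOfCoords x)‖))
      (stdGaussianPi (Fin N × Fin N)) := by
  obtain ⟨C, hC0, hC⟩ := exists_norm_hermitianOfCoords_le N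
  have hc := continuous_fieldsCLM_vertex (N := N) hg
  refine (integrable_exp_norm_stdGaussianPi (a * (2 * N ^ 2 * (‖g‖ * C)))).mono'
    (Real.continuous_exp.comp (continuous_const.mul hc.norm)).aestronglyMeasurable
    (Eventually.of_forall fun x => ?_)
  rw [Real.norm_of_nonneg (Real.exp_pos _).le, Real.exp_le_exp]
  calc a * ‖vertex N g (hermitianOfCoords x)‖
      ≤ a * (2 * N ^ 2 * (‖g‖ * (C * ‖x‖))) := by
        gcongr
        exact (norm_vertex_le hg (isHermitian_hermitianOfCoords x)).trans (by gcongr; exact hC x)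
    _ = _ := by ring

theorem tame_prod_vertex (hg : ‖g‖ ≤ 2 * g.re) {n : ℕ} :
    Tame (hermTuples n N) (tubeRadius g) fun σ => ∏ v, vertex N g (σ v) :=
  Tame.prod fun v _ => tame_vertex hg v

theorem treeIntegrand_eq (hgz : g = Complex.sqrt (2 * z / (N : ℂ))) {n : ℕ}
    (T : SimpleGraph (Fin n)) :
    treeIntegrand N z T = lineOperators (lineList T) fun σ => ∏ v, vertex N g (σ v) := by
  simp only [treeIntegrand, lineOperators, loopVertex_eq, hgz]

theorem treeExpectation_eq (hgz : g = Complex.sqrt (2 * z / (N : ℂ))) {n : ℕ}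
    {T : SimpleGraph (Fin n)} (hT : T.IsTree) {w : T.edgeSet → ℝ}
    (hw : w ∈ Set.Icc (0 : T.edgeSet → ℝ) 1) :
    treeExpectation N z T w = fieldMean N (linkWeight (extendWeight T w))
      (lineOperators (lineList T) fun σ => ∏ v, vertex N g (σ v)) := by
  rw [linkWeight_extendWeight hT hw, ← treeIntegrand_eq hgz]
  rfl

theorem continuous_fieldMean_extendWeight (hg : ‖g‖ ≤ 2 * g.re) {n : ℕ} (T : SimpleGraph (Fin n)) :
    Continuous fun w : T.edgeSet → ℝ => fieldMean N (linkWeight (extendWeight T w))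
      (lineOperators (lineList T) fun σ => ∏ v, vertex N g (σ v)) := by
  classical
  refine (continuous_fieldMean_linkWeight (tubeRadius_pos g)
    ((tame_prod_vertex hg).lineOperators _)).comp (continuous_pi fun e => ?_)
  simp only [extendWeight]
  split_ifs <;> fun_prop

/-- The tree amplitude is the forest amplitude of the tree. -/
theorem treeAmplitude_eq (hg : ‖g‖ ≤ 2 * g.re) (hgz : g = Complex.sqrt (2 * z / (N : ℂ))) {n : ℕ}
    {T : SimpleGraph (Fin n)} (hT : T.IsTree) :
    treeAmplitude N z T = forestAmplitude (fun σ => ∏ v, vertex N g (σ v)) T := by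
  classical
  set Ψ : (T.edgeSet → ℝ) → ℂ := fun w => fieldMean N (linkWeight (extendWeight T w))
    (lineOperators (lineList T) fun σ => ∏ v, vertex N g (σ v)) with hΨ
  have h1 : treeAmplitude N z T = ∫ w in Set.Icc (0 : T.edgeSet → ℝ) 1, Ψ w :=
    setIntegral_congr_fun measurableSet_Icc fun w hw => treeExpectation_eq hgz hT hw
  have h2 : (volume : Measure (T.edgeSet → ℝ)).restrict (Set.Icc 0 1) = unitCube T.edgeSet := by
    rw [← Set.pi_univ_Icc, volume_pi, Measure.restrict_pi_pi]
    rfl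
  rw [h1, h2, forestAmplitude]
  have h3 : MeasurePreserving (fun (w : Sym2 (Fin n) → ℝ) (e : T.edgeSet) => w e)
      (unitCube (Sym2 (Fin n))) (unitCube T.edgeSet) := by
    have := (measurePreserving_fst (μ := unitCube T.edgeSet)
      (ν := Measure.pi fun _ : {e // ¬ e ∈ T.edgeSet} => volume.restrict (Set.Icc (0 : ℝ) 1))).comp
      (measurePreserving_piEquivPiSubtypeProd
        (fun _ : Sym2 (Fin n) => volume.restrict (Set.Icc (0 : ℝ) 1)) fun e => e ∈ T.edgeSet)
    exact this
  rw [← h3.map_eq, integral_map h3.measurable.aemeasurable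
    (continuous_fieldMean_extendWeight hg T).aestronglyMeasurable]

open Classical in
theorem treeExpectation_integrable (hg : ‖g‖ ≤ 2 * g.re)
    (hgz : g = Complex.sqrt (2 * z / (N : ℂ))) {n : ℕ} {T : SimpleGraph (Fin n)} (hT : T.IsTree) :
    (∀ w ∈ Set.Icc (0 : T.edgeSet → ℝ) 1,
      Integrable (fun x => treeIntegrand N z T (fieldsOfCoords x)) (treeGaussian N T w)) ∧
    IntegrableOn (fun w => treeExpectation N z T w) (Set.Icc (0 : T.edgeSet → ℝ) 1) := by
  classical
  constructor
  · intro w hw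
    rw [treeIntegrand_eq hgz, treeGaussian, ← linkWeight_extendWeight hT hw]
    exact ((tame_prod_vertex hg).lineOperators _).integrable (tubeRadius_pos g)
      (posSemidef_linkWeight _)
  · refine IntegrableOn.congr_fun ((continuous_fieldMean_extendWeight hg T).continuousOn
      |>.integrableOn_compact isCompact_Icc)
      (fun w hw => (treeExpectation_eq hgz hT hw).symm) measurableSet_Icc

/-- All exponential moments of the vertex exist, hence its moments divided by `n!` are smaller than
any geometric sequence. -/
theorem norm_fieldMoment_le (hg : ‖g‖ ≤ 2 * g.re) {θ : ℝ} (hθ : 0 < θ) (n : ℕ) :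
    ‖fieldMoment N (vertex N g) n / (n ! : ℂ)‖ ≤
      (∫ x, Real.exp (θ⁻¹ * ‖vertex N g (hermitianOfCoords x)‖)
        ∂(stdGaussianPi (Fin N × Fin N))) * θ ^ n := by
  rw [norm_div, Complex.norm_natCast, div_le_iff₀ (by positivity), fieldMoment,
    mul_assoc, ← integral_mul_const]
  refine norm_integral_le_of_norm_le
    ((integrable_exp_norm_vertex hg θ⁻¹ (by positivity)).mul_const _)
    (Eventually.of_forall fun x => ?_)
  have h1 := Real.pow_div_factorial_le_exp (θ⁻¹ * ‖vertex N g (hermitianOfCoords x)‖)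
    (by positivity) n
  rw [div_le_iff₀ (by positivity)] at h1
  rw [norm_pow]
  calc ‖vertex N g (hermitianOfCoords x)‖ ^ n
      = (θ⁻¹ * ‖vertex N g (hermitianOfCoords x)‖) ^ n * θ ^ n := by
        rw [← mul_pow]; field_simp
    _ ≤ (Real.exp (θ⁻¹ * ‖vertex N g (hermitianOfCoords x)‖) * n !) * θ ^ n := by gcongr
    _ = _ := by ring

/-- The power series of the moments, at the point `1`. -/
theorem tsum_fieldMoment (hg : ‖g‖ ≤ 2 * g.re) :
    ∑' n, fieldMoment N (vertex N g) n / (n ! : ℂ) =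
      ∫ x, Complex.exp (vertex N g (hermitianOfCoords x)) ∂(stdGaussianPi (Fin N × Fin N)) := by
  have hc := continuous_fieldsCLM_vertex (N := N) hg
  have h := hasSum_integral_of_dominated_convergence (μ := stdGaussianPi (Fin N × Fin N))
    (F := fun (n : ℕ) x => vertex N g (hermitianOfCoords x) ^ n / (n ! : ℂ))
    (f := fun x => Complex.exp (vertex N g (hermitianOfCoords x)))
    (fun n x => ‖vertex N g (hermitianOfCoords x)‖ ^ n / n !)
    (fun n => ((hc.pow n).div_const _).aestronglyMeasurable)
    (fun n => Eventually.of_forall fun x => by simp)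
    (Eventually.of_forall fun x => Real.summable_pow_div_factorial _)
    (by
      have h1 := integrable_exp_norm_vertex (N := N) hg 1 zero_le_one
      refine h1.congr (Eventually.of_forall fun x => ?_)
      simp only [one_mul]
      rw [Real.exp_eq_exp_ℝ, NormedSpace.exp_eq_tsum_div])
    (Eventually.of_forall fun x => by
      rw [Complex.exp_eq_exp_ℂ]
      exact NormedSpace.expSeries_div_hasSum_exp _)
  rw [← h.tsum_eq]
  refine tsum_congr fun n => ?_
  rw [integral_div, fieldMoment]

theorem treesOn_zero : treesOn 0 = ∅ := by
  ext T
  simp only [treesOn, Finset.mem_filter, Finset.mem_univ, true_and, Finset.notMem_empty, iff_false]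
  intro hT
  exact hT.1.nonempty.elim fun v => v.elim0

/-- If the tree series converges geometrically, its exponential is the integral over one field. -/
theorem exp_treeSeries (hg : ‖g‖ ≤ 2 * g.re) (hgz : g = Complex.sqrt (2 * z / (N : ℂ))) {C θ : ℝ}
    (h0 : 0 < θ) (h1 : θ < 1)
    (hb : ∀ n : ℕ, ‖((n ! : ℂ))⁻¹ * ∑ T ∈ treesOn n, treeAmplitude N z T‖ ≤ C * θ ^ n) :
    Complex.exp (treeSeries N z) =
      ∫ x, Complex.exp (vertex N g (hermitianOfCoords x)) ∂(stdGaussianPi (Fin N × Fin N)) := by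
  rw [← tsum_fieldMoment hg]
  have hamp : ∀ n : ℕ, ∑ T ∈ treesOn n, treeAmplitude N z T =
      ∑ T ∈ treesOn n, forestAmplitude (fun σ => ∏ v, vertex N g (σ v)) T := fun n =>
    Finset.sum_congr rfl fun T hT => treeAmplitude_eq hg hgz (by
      simpa [treesOn] using hT)
  refine exp_tsum_of_recursion (norm_fieldMoment_le hg h0) hb h0.le h1 ?_ ?_ fun n => ?_
  · simp [fieldMoment]
  · simp [treesOn_zero]
  · have hrec := sum_treeAmplitude_recursion (N := N) (V := vertex N g) (tubeRadius_pos g)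
      (continuous_fieldsCLM_vertex hg) (fun n => tame_prod_vertex hg) n
    have hn : ((n + 1 : ℕ) : ℂ) ≠ 0 := by exact_mod_cast n.succ_ne_zero
    have hn' : (n ! : ℂ) ≠ 0 := by exact_mod_cast n.factorial_ne_zero
    have : ((n + 1 : ℕ) : ℂ) * (fieldMoment N (vertex N g) (n + 1) / ((n + 1)! : ℂ)) =
        fieldMoment N (vertex N g) (n + 1) / (n ! : ℂ) := by
      rw [Nat.factorial_succ]
      push_cast at hn ⊢
      field_simp
    rw [this, hrec]
    simp only [hamp]

end TreeSeries

end

noncomputable section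
open scoped ContDiff Matrix.Norms.L2Operator

/-! ### Holomorphic dependence on parameters -/

/-- An integral of holomorphic functions with an integrable bound is holomorphic. -/
theorem differentiableOn_integral_of_dominated {α : Type*} [MeasurableSpace α] {μ : Measure α}
    {U : Set ℂ} (hU : IsOpen U) {F : ℂ → α → ℂ} {bound : α → ℝ}
    (hm : ∀ z ∈ U, AEStronglyMeasurable (F z) μ) (hb : ∀ᵐ a ∂μ, ∀ z ∈ U, ‖F z a‖ ≤ bound a)
    (hi : Integrable bound μ) (hd : ∀ᵐ a ∂μ, DifferentiableOn ℂ (fun z => F z a) U) :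
    DifferentiableOn ℂ (fun z => ∫ a, F z a ∂μ) U := by
  intro z₀ hz₀
  obtain ⟨r, hr, hrU⟩ := Metric.isOpen_iff.1 hU z₀ hz₀
  have hsub : ∀ z ∈ Metric.ball z₀ (r / 2), Metric.closedBall z (r / 3) ⊆ U := by
    intro z hz w hw
    refine hrU ?_
    rw [Metric.mem_ball] at hz ⊢
    rw [Metric.mem_closedBall] at hw
    linarith [dist_triangle w z z₀]
  have hder : ∀ᵐ a ∂μ, ∀ z ∈ Metric.ball z₀ (r / 2), HasDerivAt (fun z => F z a)
      (deriv (fun z => F z a) z) z := hd.mono fun a hda z hz =>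
    (hda.differentiableAt (hU.mem_nhds (hsub z hz (Metric.mem_closedBall_self (by positivity))))).hasDerivAt
  refine (hasDerivAt_integral_of_dominated_loc_of_deriv_le (μ := μ) (F := F) (x₀ := z₀)
    (F' := fun z a => deriv (fun z => F z a) z) (bound := fun a => bound a / (r / 3))
    (Metric.ball_mem_nhds z₀ (half_pos hr)) ?_ ?_ ?_ ?_ (hi.div_const _)
    hder).2.differentiableAt.differentiableWithinAt
  · filter_upwards [hU.mem_nhds hz₀] with z hz using hm z hz
  · exact hi.mono' (hm z₀ hz₀) (hb.mono fun a h => h z₀ hz₀)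
  · set t : ℕ → ℂ := fun k => ((r / (k + 2) : ℝ) : ℂ) with ht
    have ht0 : ∀ k, t k ≠ 0 := fun k => Complex.ofReal_ne_zero.2 (by positivity)
    have hlim : Tendsto t atTop (𝓝[≠] 0) := by
      refine tendsto_nhdsWithin_iff.2 ⟨?_, Eventually.of_forall ht0⟩
      have h1 : Tendsto (fun k : ℕ => r / ((k : ℝ) + 2)) atTop (𝓝 0) :=
        tendsto_const_nhds.div_atTop
          (tendsto_atTop_add_const_right _ _ tendsto_natCast_atTop_atTop)
      have h2 := (Complex.continuous_ofReal.tendsto 0).comp h1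
      rw [Complex.ofReal_zero] at h2
      exact h2
    have htU : ∀ k, z₀ + t k ∈ U := fun k => by
      refine hrU ?_
      rw [Metric.mem_ball, dist_eq_norm, add_sub_cancel_left, ht, Complex.norm_real,
        Real.norm_of_nonneg (by positivity), div_lt_iff₀ (by positivity)]
      have : (0 : ℝ) ≤ k := k.cast_nonneg
      nlinarith
    refine aestronglyMeasurable_of_tendsto_ae atTop
      (f := fun k a => (t k)⁻¹ • (F (z₀ + t k) a - F z₀ a)) (fun k => ?_)
      (hder.mono fun a hda => ?_)
    · exact ((hm _ (htU k)).sub (hm _ hz₀)).const_smul ((t k)⁻¹)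
    · exact (hda z₀ (Metric.mem_ball_self (half_pos hr))).tendsto_slope_zero.comp hlim
  · filter_upwards [hb, hd] with a hba hda z hz
    refine Complex.norm_deriv_le_of_forall_mem_sphere_norm_le (by positivity) ?_ fun w hw => ?_
    · refine DifferentiableOn.diffContOnCl ?_
      exact hda.mono ((Metric.closure_ball_subset_closedBall).trans (hsub z hz))
    · exact hba w (hsub z hz (Metric.sphere_subset_closedBall hw))

/-! ### The intermediate field representation -/

section IntermediateField

variable {N : ℕ}

/-- `Tr σ A` is a linear form in the coordinates of `σ`; its coefficients have `Tr A²` as their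
sum of squares. -/
theorem exists_trace_hermitianOfCoords_mul {A : Matrix (Fin N) (Fin N) ℂ} (hA : A.IsHermitian) :
    ∃ a : Fin N × Fin N → ℝ,
      (∀ x, (hermitianOfCoords x * A).trace = ((∑ p, a p * x p : ℝ) : ℂ)) ∧
      (A * A).trace = ((∑ p, a p ^ 2 : ℝ) : ℂ) := by
  have hA' : ∀ i j, A j i = starRingEnd ℂ (A i j) := fun i j => (hA.apply j i).symm
  set a : Fin N × Fin N → ℝ := fun p => (A p.1 p.2).re + (A p.1 p.2).im with ha
  refine ⟨a, fun x => ?_, ?_⟩ <;> rw [Complex.ofReal_sum]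
  · have e1 : (hermitianOfCoords x * A).trace = ∑ i, ∑ j, ((1 + Complex.I) / 2 * x (i, j) * A j i +
        (1 - Complex.I) / 2 * x (j, i) * A j i) := by
      rw [Matrix.trace]
      refine Finset.sum_congr rfl fun i _ => ?_
      rw [Matrix.diag_apply, Matrix.mul_apply]
      refine Finset.sum_congr rfl fun j _ => ?_
      simp only [hermitianOfCoords, Matrix.of_apply]
      ring
    have e2 : ∑ i, ∑ j, (1 - Complex.I) / 2 * x (j, i) * A j i =
        ∑ i, ∑ j, (1 - Complex.I) / 2 * x (i, j) * A i j := Finset.sum_comm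
    rw [e1, Fintype.sum_prod_type]
    simp_rw [Finset.sum_add_distrib]
    rw [e2]
    simp_rw [← Finset.sum_add_distrib]
    refine Finset.sum_congr rfl fun i _ => Finset.sum_congr rfl fun j _ => ?_
    rw [hA' i j]
    apply Complex.ext
    · simp [ha]; ring
    · simp [ha]; ring
  · have e1 : (A * A).trace = ∑ i, ∑ j, (((A i j).re ^ 2 + (A i j).im ^ 2 : ℝ) : ℂ) := by
      rw [Matrix.trace]
      refine Finset.sum_congr rfl fun i _ => ?_
      rw [Matrix.diag_apply, Matrix.mul_apply]
      refine Finset.sum_congr rfl fun j _ => ?_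
      rw [hA' i j, Complex.mul_conj, Complex.normSq_apply]
      congr 1; ring
    have e2 : ∑ i, ∑ j, (((A i j).re * (A i j).im : ℝ) : ℂ) = 0 := by
      have : ∑ i, ∑ j, (((A i j).re * (A i j).im : ℝ) : ℂ) =
          -∑ i, ∑ j, (((A i j).re * (A i j).im : ℝ) : ℂ) := by
        conv_rhs => rw [Finset.sum_comm]
        simp_rw [← Finset.sum_neg_distrib]
        refine Finset.sum_congr rfl fun i _ => Finset.sum_congr rfl fun j _ => ?_
        rw [hA' i j]
        simp
      linear_combination (1 / 2 : ℂ) * this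
    rw [e1, Fintype.sum_prod_type]
    have e3 : ∀ i j, ((a (i, j) ^ 2 : ℝ) : ℂ) = (((A i j).re ^ 2 + (A i j).im ^ 2 : ℝ) : ℂ) +
        2 * (((A i j).re * (A i j).im : ℝ) : ℂ) := by
      intro i j
      simp only [ha]
      push_cast
      ring
    simp_rw [e3, Finset.sum_add_distrib, ← Finset.mul_sum]
    rw [e2]
    simp
/-- A linear form of independent standard Gaussian variables is Gaussian. -/
theorem map_sum_stdGaussianPi {κ : Type*} [Fintype κ] (a : κ → ℝ) :
    (stdGaussianPi κ).map (fun x => ∑ p, a p * x p) =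
      gaussianReal 0 (Real.toNNReal (∑ p, a p ^ 2)) := by
  have hm : Measurable fun x : κ → ℝ => ∑ p, a p * x p := by fun_prop
  have : IsProbabilityMeasure ((stdGaussianPi κ).map (fun x => ∑ p, a p * x p)) :=
    Measure.isProbabilityMeasure_map hm.aemeasurable
  refine Measure.ext_of_charFun ?_
  ext t
  rw [charFun_gaussianReal, charFun_apply_real, integral_map hm.aemeasurable (by fun_prop)]
  have h3 : ∀ x : κ → ℝ, Complex.exp (t * ((∑ p, a p * x p : ℝ) : ℂ) * Complex.I) =
      ∏ p, Complex.exp (((t * a p : ℝ) : ℂ) * (x p : ℂ) * Complex.I) := by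
    intro x
    rw [← Complex.exp_sum, Complex.ofReal_sum, Finset.mul_sum, Finset.sum_mul]
    congr 1
    refine Finset.sum_congr rfl fun p _ => ?_
    push_cast
    ring
  simp_rw [h3]
  rw [stdGaussianPi, integral_fintype_prod_eq_prod (f := fun p (y : ℝ) =>
    Complex.exp (((t * a p : ℝ) : ℂ) * (y : ℂ) * Complex.I))]
  simp_rw [← charFun_apply_real, charFun_gaussianReal]
  rw [← Complex.exp_sum, Real.coe_toNNReal _ (by positivity)]
  congr 1
  rw [Complex.ofReal_zero, mul_zero, zero_mul, zero_sub, Complex.ofReal_sum, Finset.sum_mul, Finset.sum_div, ← Finset.sum_neg_distrib]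
  refine Finset.sum_congr rfl fun p _ => ?_
  push_cast
  ring

/-- The characteristic function of the Hermitian Gaussian field: `⟨exp (-i g Tr σ A)⟩ =
exp (-g² Tr A² / 2)`. -/
theorem integral_exp_trace_mul (g : ℝ) {A : Matrix (Fin N) (Fin N) ℂ} (hA : A.IsHermitian) :
    ∫ x, Complex.exp (-(Complex.I * g) * (hermitianOfCoords x * A).trace)
      ∂(stdGaussianPi (Fin N × Fin N)) = Complex.exp (-(g ^ 2 / 2) * (A * A).trace) := by
  obtain ⟨a, h1, h2⟩ := exists_trace_hermitianOfCoords_mul hA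
  have h3 : ∫ y : ℝ, Complex.exp ((-g : ℝ) * (y : ℂ) * Complex.I)
      ∂((stdGaussianPi (Fin N × Fin N)).map fun x => ∑ p, a p * x p) =
      Complex.exp (-(g ^ 2 / 2) * (A * A).trace) := by
    rw [map_sum_stdGaussianPi, ← charFun_apply_real, charFun_gaussianReal, h2,
      Real.coe_toNNReal _ (by positivity)]
    congr 1
    push_cast
    ring
  rw [← h3, integral_map (Measurable.aemeasurable (by fun_prop)) (by fun_prop)]
  congr 1
  ext x
  rw [h1]
  congr 1
  push_cast
  ring

/-- The squared Hilbert-Schmidt norm. -/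
def hsNormSq (Φ : Fin N → Fin N → ℂ) : ℝ := ∑ i, ∑ j, ‖Φ i j‖ ^ 2

theorem hsNormSq_nonneg (Φ : Fin N → Fin N → ℂ) : 0 ≤ hsNormSq Φ := by unfold hsNormSq; positivity

theorem continuous_hsNormSq : Continuous (hsNormSq : (Fin N → Fin N → ℂ) → ℝ) := by
  unfold hsNormSq; fun_prop

theorem trace_conjTranspose_mul_diagonal (Φ : Fin N → Fin N → ℂ) (d : Fin N → ℂ) :
    (Matrix.diagonal d * ((Matrix.of Φ)ᴴ * Matrix.of Φ)).trace =
      ∑ i, ∑ j, d j * ((‖Φ i j‖ ^ 2 : ℝ) : ℂ) := by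
  rw [Finset.sum_comm, Matrix.trace]
  refine Finset.sum_congr rfl fun j _ => ?_
  rw [Matrix.diag_apply, Matrix.diagonal_mul, Matrix.mul_apply, Finset.mul_sum]
  refine Finset.sum_congr rfl fun i _ => ?_
  rw [Matrix.conjTranspose_apply, Matrix.of_apply, RCLike.star_def, Complex.conj_mul']
  push_cast
  rfl

theorem trace_conjTranspose_mul (Φ : Fin N → Fin N → ℂ) :
    ((Matrix.of Φ)ᴴ * Matrix.of Φ).trace = (hsNormSq Φ : ℂ) := by
  have h := trace_conjTranspose_mul_diagonal Φ 1
  rw [show Matrix.diagonal (1 : Fin N → ℂ) = 1 from Matrix.diagonal_one, one_mul] at h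
  rw [h, hsNormSq]
  push_cast
  simp

/-- Right multiplication by `U`. -/
def rightMul (U : Matrix (Fin N) (Fin N) ℂ) :
    (Fin N → Fin N → ℂ) →ₗ[ℝ] (Fin N → Fin N → ℂ) where
  toFun Φ := Matrix.of.symm (Matrix.of Φ * U)
  map_add' Φ Ψ := by
    rw [show Matrix.of (Φ + Ψ) = Matrix.of Φ + Matrix.of Ψ from rfl, Matrix.add_mul]; rfl
  map_smul' c Φ := by
    rw [show Matrix.of (c • Φ) = c • Matrix.of Φ from rfl, Matrix.smul_mul]; rfl

theorem of_rightMul (U : Matrix (Fin N) (Fin N) ℂ) (Φ : Fin N → Fin N → ℂ) :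
    Matrix.of (rightMul U Φ) = Matrix.of Φ * U := rfl

theorem hsNormSq_rightMul {U : Matrix (Fin N) (Fin N) ℂ} (hU : U * Uᴴ = 1)
    (Φ : Fin N → Fin N → ℂ) : hsNormSq (rightMul U Φ) = hsNormSq Φ := by
  have h : ((hsNormSq (rightMul U Φ) : ℝ) : ℂ) = (hsNormSq Φ : ℝ) := by
    rw [← trace_conjTranspose_mul, ← trace_conjTranspose_mul, of_rightMul,
      Matrix.conjTranspose_mul, Matrix.mul_assoc, Matrix.trace_mul_comm]
    simp only [Matrix.mul_assoc, hU, Matrix.mul_one]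
  exact_mod_cast h

/-- Multiplication by a unitary matrix preserves Lebesgue measure, since it preserves the unit
ball of the Hilbert-Schmidt norm. -/
theorem measurePreserving_rightMul {U : Matrix (Fin N) (Fin N) ℂ} (hU : U * Uᴴ = 1) :
    MeasurePreserving (rightMul U) (volume : Measure (Fin N → Fin N → ℂ)) volume := by
  have hU' : Uᴴ * U = 1 := mul_eq_one_comm.1 hU
  have hcomp : rightMul Uᴴ ∘ₗ rightMul U = LinearMap.id := by
    refine LinearMap.ext fun Φ => ?_
    change Matrix.of.symm (Matrix.of (rightMul U Φ) * Uᴴ) = Φ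
    rw [of_rightMul, Matrix.mul_assoc, hU, Matrix.mul_one]
    rfl
  have hdet : LinearMap.det (rightMul U) ≠ 0 := by
    intro h
    have := congrArg LinearMap.det hcomp
    rw [LinearMap.det_comp, h, mul_zero, LinearMap.det_id] at this
    exact zero_ne_one this
  have hv : (volume : Measure (Fin N → Fin N → ℂ)).IsAddHaarMeasure :=
    Measure.pi.isAddHaarMeasure fun _ => (volume : Measure (Fin N → ℂ))
  set s : Set (Fin N → Fin N → ℂ) := {Φ | hsNormSq Φ < 1} with hs
  have hso : IsOpen s := isOpen_lt continuous_hsNormSq continuous_const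
  have hs0 : volume s ≠ 0 := (hso.measure_pos _ ⟨0, by simp [hs, hsNormSq]⟩).ne'
  have hst : volume s ≠ ⊤ := by
    refine (Bornology.IsBounded.measure_lt_top ?_).ne
    refine (Metric.isBounded_closedBall (x := (0 : Fin N → Fin N → ℂ)) (r := 1)).subset
      fun Φ hΦ => ?_
    rw [mem_closedBall_zero_iff, pi_norm_le_iff_of_nonneg zero_le_one]
    refine fun i => (pi_norm_le_iff_of_nonneg zero_le_one).2 fun j => ?_
    have h1 : ‖Φ i j‖ ^ 2 ≤ hsNormSq Φ := by
      refine (Finset.single_le_sum (f := fun j => ‖Φ i j‖ ^ 2) (fun _ _ => by positivity)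
        (Finset.mem_univ j)).trans ?_
      exact Finset.single_le_sum (f := fun i => ∑ j, ‖Φ i j‖ ^ 2) (fun _ _ => by positivity)
        (Finset.mem_univ i)
    have h2 : hsNormSq Φ < 1 := hΦ
    nlinarith [norm_nonneg (Φ i j)]
  have hpre : rightMul U ⁻¹' s = s := by
    ext Φ
    simp [hs, hsNormSq_rightMul hU]
  have h1 := Measure.addHaar_preimage_linearMap (volume : Measure (Fin N → Fin N → ℂ)) hdet s
  rw [hpre] at h1
  have h2 : ENNReal.ofReal |(LinearMap.det (rightMul U))⁻¹| = 1 := by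
    have h3 : 1 * volume s = ENNReal.ofReal |(LinearMap.det (rightMul U))⁻¹| * volume s := by
      rw [one_mul]; exact h1
    exact ((ENNReal.mul_left_inj hs0 hst).1 h3).symm
  refine ⟨(LinearMap.continuous_of_finiteDimensional _).measurable, ?_⟩
  rw [Measure.map_linearMap_addHaar_eq_smul_addHaar _ hdet, h2, one_smul]

theorem integral_exp_neg_mul_normSq {b : ℂ} (hb : 0 < b.re) :
    Integrable (fun w : ℂ => Complex.exp (-b * ((‖w‖ ^ 2 : ℝ) : ℂ))) ∧
    ∫ w : ℂ, Complex.exp (-b * ((‖w‖ ^ 2 : ℝ) : ℂ)) = Real.pi / b := by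
  have h1 := GaussianFourier.integral_cexp_neg_mul_sq_norm (V := ℂ) hb
  have h2 := GaussianFourier.integrable_cexp_neg_mul_sq_norm_add (V := ℂ) hb 0 0
  simp only [inner_zero_left, Complex.ofReal_zero, mul_zero, add_zero] at h2
  rw [Complex.finrank_real_complex] at h1
  push_cast
  refine ⟨h2, h1.trans ?_⟩
  norm_num

/-- The Gaussian integral with a diagonal quadratic form that depends on the columns. -/
theorem integral_exp_neg_sum {b : Fin N → ℂ} (hb : ∀ j, 0 < (b j).re) :
    Integrable (fun Φ : Fin N → Fin N → ℂ =>
      Complex.exp (-∑ i, ∑ j, b j * ((‖Φ i j‖ ^ 2 : ℝ) : ℂ))) ∧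
    ∫ Φ : Fin N → Fin N → ℂ, Complex.exp (-∑ i, ∑ j, b j * ((‖Φ i j‖ ^ 2 : ℝ) : ℂ)) =
      (∏ j, (Real.pi / b j)) ^ N := by
  have h1 : ∀ Φ : Fin N → Fin N → ℂ, Complex.exp (-∑ i, ∑ j, b j * ((‖Φ i j‖ ^ 2 : ℝ) : ℂ)) =
      ∏ i, ∏ j, Complex.exp (-b j * ((‖Φ i j‖ ^ 2 : ℝ) : ℂ)) := by
    intro Φ
    rw [← Finset.sum_neg_distrib, Complex.exp_sum]
    refine Finset.prod_congr rfl fun i _ => ?_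
    rw [← Finset.sum_neg_distrib, Complex.exp_sum]
    refine Finset.prod_congr rfl fun j _ => ?_
    rw [neg_mul]
  simp_rw [h1]
  constructor
  · exact Integrable.fintype_prod (f := fun (_ : Fin N) (y : Fin N → ℂ) =>
      ∏ j, Complex.exp (-b j * ((‖y j‖ ^ 2 : ℝ) : ℂ))) fun i =>
      Integrable.fintype_prod (f := fun (j : Fin N) (w : ℂ) =>
        Complex.exp (-b j * ((‖w‖ ^ 2 : ℝ) : ℂ))) fun j => (integral_exp_neg_mul_normSq (hb j)).1
  · rw [integral_fintype_prod_volume_eq_prod (fun (_ : Fin N) (y : Fin N → ℂ) =>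
      ∏ j, Complex.exp (-b j * ((‖y j‖ ^ 2 : ℝ) : ℂ)))]
    rw [integral_fintype_prod_volume_eq_prod (fun (j : Fin N) (w : ℂ) =>
      Complex.exp (-b j * ((‖w‖ ^ 2 : ℝ) : ℂ)))]
    simp only [fun j => (integral_exp_neg_mul_normSq (hb j)).2, Finset.prod_const,
      Finset.card_univ, Fintype.card_fin]

/-- The Gaussian integral of `exp (-Tr (1 + i g σ) Φ* Φ)`, by diagonalization of `σ`. -/
theorem integral_exp_neg_trace (g : ℝ) {σ : Matrix (Fin N) (Fin N) ℂ} (hσ : σ.IsHermitian) :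
    ∫ Φ : Fin N → Fin N → ℂ, Complex.exp (-((1 + (Complex.I * g) • σ) *
      ((Matrix.of Φ)ᴴ * Matrix.of Φ)).trace) =
      (Real.pi : ℂ) ^ (N ^ 2) * ((1 + (Complex.I * g) • σ).det ^ N)⁻¹ := by
  set U : Matrix (Fin N) (Fin N) ℂ := (hσ.eigenvectorUnitary : Matrix (Fin N) (Fin N) ℂ) with hUdef
  have hU : U * Uᴴ = 1 := Unitary.mul_star_self_of_mem hσ.eigenvectorUnitary.2
  set d : Fin N → ℂ := fun j => (hσ.eigenvalues j : ℂ) with hd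
  have hspec : σ = U * Matrix.diagonal d * Uᴴ := by
    conv_lhs => rw [hσ.spectral_theorem, Unitary.conjStarAlgAut_apply]
    rfl
  set b : Fin N → ℂ := fun j => 1 + Complex.I * g * d j with hb
  have hM : 1 + (Complex.I * g) • σ = U * Matrix.diagonal b * Uᴴ := by
    have : Matrix.diagonal b = 1 + (Complex.I * g) • Matrix.diagonal d := by
      rw [← Matrix.diagonal_one, ← Matrix.diagonal_smul, Matrix.diagonal_add]
      rfl
    rw [this, Matrix.mul_add, Matrix.add_mul, Matrix.mul_one, hU, Matrix.mul_smul,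
      Matrix.smul_mul, ← hspec]
  have hdet : (1 + (Complex.I * g) • σ).det = ∏ j, b j := by
    rw [hM, Matrix.det_mul_comm, ← Matrix.mul_assoc, mul_eq_one_comm.1 hU, Matrix.one_mul,
      Matrix.det_diagonal]
  have hbre : ∀ j, 0 < (b j).re := fun j => by simp [hb, hd]
  have h1 : ∀ Φ : Fin N → Fin N → ℂ, Complex.exp (-((1 + (Complex.I * g) • σ) *
      ((Matrix.of Φ)ᴴ * Matrix.of Φ)).trace) =
      (fun Ψ : Fin N → Fin N → ℂ => Complex.exp (-∑ i, ∑ j, b j * ((‖Ψ i j‖ ^ 2 : ℝ) : ℂ)))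
        (rightMul U Φ) := by
    intro Φ
    simp only
    rw [← trace_conjTranspose_mul_diagonal, of_rightMul, hM, Matrix.conjTranspose_mul,
      Matrix.mul_assoc (U * Matrix.diagonal b), Matrix.mul_assoc U, Matrix.trace_mul_comm U]
    simp only [Matrix.mul_assoc]
  simp_rw [h1]
  have hemb : MeasurableEmbedding (rightMul U) := by
    have hinv : Function.LeftInverse (rightMul Uᴴ) (rightMul U) := fun Φ => by
      change Matrix.of.symm (Matrix.of (rightMul U Φ) * Uᴴ) = Φ
      rw [of_rightMul, Matrix.mul_assoc, hU, Matrix.mul_one]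
      rfl
    exact (LinearMap.continuous_of_finiteDimensional _).measurableEmbedding hinv.injective
  rw [(measurePreserving_rightMul hU).integral_comp hemb (fun Ψ : Fin N → Fin N → ℂ =>
    Complex.exp (-∑ i, ∑ j, b j * ((‖Ψ i j‖ ^ 2 : ℝ) : ℂ))), (integral_exp_neg_sum hbre).2, hdet,
    Finset.prod_div_distrib, Finset.prod_const, Finset.card_univ, Fintype.card_fin, div_pow,
    ← pow_mul, sq, div_eq_mul_inv]

theorem integral_complexMatrixGaussian (f : (Fin N → Fin N → ℂ) → ℂ) :
    ∫ Φ, f Φ ∂(complexMatrixGaussian N) =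
      ((Real.pi : ℂ) ^ (N ^ 2))⁻¹ * ∫ Φ, Complex.exp (-(hsNormSq Φ : ℂ)) * f Φ := by
  rw [complexMatrixGaussian, integral_withDensity_eq_integral_toReal_smul]
  · rw [← integral_const_mul]
    congr 1
    ext Φ
    rw [ENNReal.toReal_ofReal (by positivity), trace_conjTranspose_mul, Complex.ofReal_re,
      Complex.real_smul]
    push_cast
    ring
  · simp only [trace_conjTranspose_mul, Complex.ofReal_re]
    exact (continuous_const.mul (Real.continuous_exp.comp continuous_hsNormSq.neg)).measurable.ennreal_ofReal
  · exact Eventually.of_forall fun Φ => ENNReal.ofReal_lt_top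

theorem integrable_complexMatrixGaussian_iff {f : (Fin N → Fin N → ℂ) → ℝ} :
    Integrable f (complexMatrixGaussian N) ↔
      Integrable fun Φ => Real.exp (-hsNormSq Φ) * f Φ := by
  rw [complexMatrixGaussian, integrable_withDensity_iff_integrable_smul']
  · have h1 : (fun Φ : Fin N → Fin N → ℂ => (ENNReal.ofReal ((Real.pi ^ (N ^ 2))⁻¹ *
        Real.exp (-(Matrix.trace ((Matrix.of Φ)ᴴ * Matrix.of Φ)).re))).toReal • f Φ) =
        fun Φ => (Real.pi ^ (N ^ 2))⁻¹ * (Real.exp (-hsNormSq Φ) * f Φ) := by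
      ext Φ
      rw [ENNReal.toReal_ofReal (by positivity), trace_conjTranspose_mul, Complex.ofReal_re,
        smul_eq_mul]
      ring
    rw [h1]
    exact integrable_const_mul_iff (IsUnit.mk0 _ (by positivity)) _
  · simp only [trace_conjTranspose_mul, Complex.ofReal_re]
    exact (continuous_const.mul (Real.continuous_exp.comp continuous_hsNormSq.neg)).measurable.ennreal_ofReal
  · exact Eventually.of_forall fun Φ => ENNReal.ofReal_lt_top

theorem integrable_exp_hsNormSq {c : ℝ} (hc : c < 1) :
    Integrable (fun Φ : Fin N → Fin N → ℂ => Real.exp (c * hsNormSq Φ)) (complexMatrixGaussian N) := by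
  rw [integrable_complexMatrixGaussian_iff]
  have h := (integral_exp_neg_sum (N := N) (b := fun _ => ((1 - c : ℝ) : ℂ))
    fun j => by simpa using hc).1.re
  refine h.congr (Eventually.of_forall fun Φ => ?_)
  have : -∑ i, ∑ j, ((1 - c : ℝ) : ℂ) * ((‖Φ i j‖ ^ 2 : ℝ) : ℂ) = ((-((1 - c) * hsNormSq Φ) : ℝ) : ℂ) := by
    rw [hsNormSq]
    push_cast
    simp only [Finset.mul_sum]
  simp only
  rw [this, ← Complex.ofReal_exp, ← Real.exp_add]
  change Real.exp _ = Real.exp _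
  congr 1
  ring

instance : IsFiniteMeasure (complexMatrixGaussian N) := by
  have h := integrable_exp_hsNormSq (N := N) (c := 0) one_pos
  simp only [zero_mul, Real.exp_zero] at h
  exact (integrable_const_iff_isFiniteMeasure one_ne_zero).1 h

end IntermediateField

end

noncomputable section
open scoped ContDiff Matrix.Norms.L2Operator

/-! ### The coupling -/

/-- For `Re a > 0` the principal square root lies in the sector `|g| ≤ 2 Re g`. -/
theorem sqrt_mem_sector {a : ℂ} (ha : 0 < a.re) :
    Complex.sqrt a ^ 2 = a ∧ ‖Complex.sqrt a‖ ≤ 2 * (Complex.sqrt a).re := by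
  have h2 : Complex.sqrt a ^ 2 = a := by
    rw [Complex.sqrt]
    exact_mod_cast Complex.cpow_nat_inv_pow a two_ne_zero
  have h0 : 0 ≤ (Complex.sqrt a).re := by
    rw [Complex.sqrt, Complex.cpow_inv_two_re]
    positivity
  refine ⟨h2, ?_⟩
  set g := Complex.sqrt a with hg
  have h3 : 0 < g.re * g.re - g.im * g.im := by
    rw [← h2, sq, Complex.mul_re] at ha
    exact ha
  refine abs_le_of_sq_le_sq' ?_ (by positivity) |>.2
  rw [Complex.sq_norm, Complex.normSq_apply]
  nlinarith

theorem coupling_re_pos {N : ℕ} (hN : 1 ≤ N) {z : ℂ} (hz : 0 < z.re) : 0 < (2 * z / (N : ℂ)).re := by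
  have hN' : (0 : ℝ) < N := by exact_mod_cast hN
  rw [Complex.div_natCast_re, show (2 * z).re = 2 * z.re by simp]
  positivity

theorem differentiableAt_coupling {N : ℕ} (hN : 1 ≤ N) {z : ℂ} (hz : 0 < z.re) :
    DifferentiableAt ℂ (fun z : ℂ => Complex.sqrt (2 * z / (N : ℂ))) z := by
  have h1 : DifferentiableAt ℂ Complex.sqrt (2 * z / (N : ℂ)) :=
    Complex.differentiableAt_sqrt (Or.inl (coupling_re_pos hN hz))
  have h2 : DifferentiableAt ℂ (fun z : ℂ => 2 * z / (N : ℂ)) z := by fun_prop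
  exact h1.comp z h2

theorem norm_coupling {N : ℕ} {z : ℂ} (hN : 1 ≤ N) (hz : 0 < z.re) :
    ‖Complex.sqrt (2 * z / (N : ℂ))‖ ^ 2 = 2 * ‖z‖ / N := by
  rw [← norm_pow, (sqrt_mem_sector (coupling_re_pos hN hz)).1, norm_div, norm_mul,
    Complex.norm_natCast, Complex.norm_ofNat]

theorem isPreconnected_re_pos : IsPreconnected {z : ℂ | 0 < z.re} :=
  (convex_halfSpace_re_gt 0).isPreconnected

theorem isOpen_re_pos : IsOpen {z : ℂ | 0 < z.re} := isOpen_lt continuous_const Complex.continuous_re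

theorem differentiableOn_re_pos_of_bounded {f : ℂ → ℂ}
    (h : ∀ M : ℝ, DifferentiableOn ℂ f {z | 0 < z.re ∧ ‖z‖ < M}) :
    DifferentiableOn ℂ f {z | 0 < z.re} := by
  intro z hz
  have ho : IsOpen {w : ℂ | 0 < w.re ∧ ‖w‖ < ‖z‖ + 1} :=
    isOpen_re_pos.inter (isOpen_lt continuous_norm continuous_const)
  exact ((h (‖z‖ + 1)).differentiableAt (ho.mem_nhds ⟨hz, by linarith⟩)).differentiableWithinAt

theorem differentiableAt_vertex {N : ℕ} {g : ℂ} {σ : Matrix (Fin N) (Fin N) ℂ}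
    (h : (Complex.I * g) • σ ∈ logDomain (Fin N)) :
    DifferentiableAt ℂ (fun g => vertex N g σ) g := by
  have h1 : DifferentiableAt ℂ (fun g : ℂ => (Complex.I * g) • σ) g := by fun_prop
  exact (((hasFDerivAt_traceLog h).differentiableAt.comp g h1).const_mul (N : ℂ)).neg

section Partition

variable {N : ℕ}

/-- `Tr Φ* Φ Φ* Φ`. -/
def quarticTrace (Φ : Fin N → Fin N → ℂ) : ℝ := hsNormSq (Matrix.of.symm ((Matrix.of Φ)ᴴ * Matrix.of Φ))

theorem trace_quartic (Φ : Fin N → Fin N → ℂ) :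
    ((Matrix.of Φ)ᴴ * Matrix.of Φ * (Matrix.of Φ)ᴴ * Matrix.of Φ).trace = (quarticTrace Φ : ℂ) := by
  rw [quarticTrace, ← trace_conjTranspose_mul, Equiv.apply_symm_apply, Matrix.conjTranspose_mul,
    Matrix.conjTranspose_conjTranspose, Matrix.mul_assoc _ (Matrix.of Φ)ᴴ]

theorem quarticTrace_nonneg (Φ : Fin N → Fin N → ℂ) : 0 ≤ quarticTrace Φ := hsNormSq_nonneg _

theorem continuous_quarticTrace : Continuous (quarticTrace : (Fin N → Fin N → ℂ) → ℝ) := by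
  refine continuous_hsNormSq.comp ?_
  have h : Continuous fun Φ : Fin N → Fin N → ℂ => (Matrix.of Φ)ᴴ * Matrix.of Φ :=
    (continuous_id.matrix_conjTranspose).matrix_mul continuous_id
  exact h

theorem quarticTrace_le (Φ : Fin N → Fin N → ℂ) : quarticTrace Φ ≤ hsNormSq Φ ^ 2 := by
  have h1 : ∀ i j, ‖((Matrix.of Φ)ᴴ * Matrix.of Φ) i j‖ ^ 2 ≤
      (∑ k, ‖Φ k i‖ ^ 2) * ∑ k, ‖Φ k j‖ ^ 2 := by
    intro i j
    have h2 : ‖((Matrix.of Φ)ᴴ * Matrix.of Φ) i j‖ ≤ ∑ k, ‖Φ k i‖ * ‖Φ k j‖ := by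
      rw [Matrix.mul_apply]
      refine (norm_sum_le _ _).trans (Finset.sum_le_sum fun k _ => ?_)
      rw [norm_mul, Matrix.conjTranspose_apply, norm_star]
      rfl
    exact (pow_le_pow_left₀ (norm_nonneg _) h2 2).trans (Finset.sum_mul_sq_le_sq_mul_sq _ _ _)
  have h3 : hsNormSq Φ = ∑ i, ∑ k, ‖Φ k i‖ ^ 2 := Finset.sum_comm
  rw [h3, sq, Finset.sum_mul_sum]
  change ∑ i, ∑ j, ‖((Matrix.of Φ)ᴴ * Matrix.of Φ) i j‖ ^ 2 ≤ _
  exact Finset.sum_le_sum fun i _ => Finset.sum_le_sum fun j _ => h1 i j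

theorem partitionFunction_eq_integral (z : ℂ) : partitionFunction N z =
    ∫ Φ, Complex.exp (-(z / N) * (quarticTrace Φ : ℂ)) ∂(complexMatrixGaussian N) := by
  simp_rw [partitionFunction, trace_quartic]

theorem norm_exp_quarticTrace_le {z : ℂ} (hz : 0 ≤ z.re) (Φ : Fin N → Fin N → ℂ) :
    ‖Complex.exp (-(z / N) * (quarticTrace Φ : ℂ))‖ ≤ 1 := by
  rw [Complex.norm_exp, Real.exp_le_one_iff, neg_mul, Complex.neg_re, Complex.re_mul_ofReal,
    Complex.div_natCast_re, neg_nonpos]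
  exact mul_nonneg (div_nonneg hz N.cast_nonneg) (quarticTrace_nonneg Φ)

theorem continuous_exp_quarticTrace (z : ℂ) :
    Continuous fun Φ : Fin N → Fin N → ℂ => Complex.exp (-(z / N) * (quarticTrace Φ : ℂ)) :=
  Complex.continuous_exp.comp (continuous_const.mul
    (Complex.continuous_ofReal.comp continuous_quarticTrace))

/-- The integrand is bounded by `1` for `Re z > 0`. -/
theorem differentiableOn_partitionFunction :
    DifferentiableOn ℂ (partitionFunction N) {z | 0 < z.re} := by
  have h := differentiableOn_integral_of_dominated (μ := complexMatrixGaussian N) isOpen_re_pos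
    (F := fun z Φ => Complex.exp (-(z / N) * (quarticTrace Φ : ℂ))) (bound := fun _ => 1)
    (fun z _ => (continuous_exp_quarticTrace z).aestronglyMeasurable)
    (Eventually.of_forall fun Φ z hz => norm_exp_quarticTrace_le (le_of_lt hz) Φ)
    (integrable_const _) (Eventually.of_forall fun Φ => by fun_prop)
  exact h.congr fun z _ => partitionFunction_eq_integral z

/-- `exp V` is an inverse power of a determinant. -/
theorem exp_vertex {g : ℂ} {σ : Matrix (Fin N) (Fin N) ℂ} (h : IsUnit (1 + (Complex.I * g) • σ)) :
    Complex.exp (vertex N g σ) = ((1 + (Complex.I * g) • σ).det ^ N)⁻¹ := by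
  rw [vertex, Complex.exp_neg, Complex.exp_nat_mul, exp_traceLog h]

theorem trace_mul_im_eq_zero {A B : Matrix (Fin N) (Fin N) ℂ} (hA : A.IsHermitian)
    (hB : B.IsHermitian) : (A * B).trace.im = 0 := by
  rw [← Complex.conj_eq_iff_im]
  have := Matrix.trace_conjTranspose (A * B)
  rw [Matrix.conjTranspose_mul, hA.eq, hB.eq, Matrix.trace_mul_comm] at this
  exact this.symm

/-- The intermediate field representation at a real coupling, by exchanging the two Gaussian
integrals. -/
theorem partitionFunction_ofReal (hN : 1 ≤ N) {t : ℝ} (ht : 0 < t) :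
    partitionFunction N (t : ℂ) =
      ∫ x, Complex.exp (vertex N (Complex.sqrt (2 * (t : ℂ) / (N : ℂ))) (hermitianOfCoords x))
        ∂(stdGaussianPi (Fin N × Fin N)) := by
  have hN' : (0 : ℝ) < N := by exact_mod_cast hN
  have hpos : 0 ≤ 2 * t / N := by positivity
  set s := Real.sqrt (2 * t / N) with hs
  have hs0 : 0 ≤ s := Real.sqrt_nonneg _
  have hss : s ^ 2 = 2 * t / N := Real.sq_sqrt hpos
  have hgs : Complex.sqrt (2 * (t : ℂ) / (N : ℂ)) = (s : ℂ) := by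
    rw [show 2 * (t : ℂ) / (N : ℂ) = ((2 * t / N : ℝ) : ℂ) by push_cast; ring, Complex.sqrt,
      hs, Real.sqrt_eq_rpow, Complex.ofReal_cpow hpos]
    norm_num
  rw [hgs]
  have hsect : ‖(s : ℂ)‖ ≤ 2 * (s : ℂ).re := by
    rw [Complex.norm_real, Real.norm_of_nonneg hs0, Complex.ofReal_re]; linarith
  set f : (Fin N → Fin N → ℂ) → (Fin N × Fin N → ℝ) → ℂ := fun Φ x =>
    Complex.exp (-(Complex.I * s) * (hermitianOfCoords x * ((Matrix.of Φ)ᴴ * Matrix.of Φ)).trace)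
    with hf
  have hherm : ∀ Φ : Fin N → Fin N → ℂ, ((Matrix.of Φ)ᴴ * Matrix.of Φ).IsHermitian := fun Φ =>
    Matrix.isHermitian_conjTranspose_mul_self _
  have h1 : ∀ Φ : Fin N → Fin N → ℂ, ∫ x, f Φ x ∂(stdGaussianPi (Fin N × Fin N)) =
      Complex.exp (-((t : ℂ) / N) * (quarticTrace Φ : ℂ)) := by
    intro Φ
    rw [hf, integral_exp_trace_mul s (hherm Φ), ← trace_quartic, Matrix.mul_assoc _ _ (Matrix.of Φ)]
    congr 2
    have : ((s : ℂ)) ^ 2 = 2 * t / N := by exact_mod_cast hss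
    rw [this]
    ring
  have h2 : ∀ x : Fin N × Fin N → ℝ, ∫ Φ, f Φ x ∂(complexMatrixGaussian N) =
      Complex.exp (vertex N s (hermitianOfCoords x)) := by
    intro x
    have hx := isHermitian_hermitianOfCoords x
    rw [integral_complexMatrixGaussian, exp_vertex (norm_inv_one_add_le hsect hx).1]
    have h3 := integral_exp_neg_trace s hx
    have h4 : ∀ Φ : Fin N → Fin N → ℂ, Complex.exp (-(hsNormSq Φ : ℂ)) * f Φ x =
        Complex.exp (-((1 + (Complex.I * s) • hermitianOfCoords x) *
          ((Matrix.of Φ)ᴴ * Matrix.of Φ)).trace) := by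
      intro Φ
      rw [hf, ← Complex.exp_add, ← trace_conjTranspose_mul, Matrix.add_mul, Matrix.one_mul,
        Matrix.trace_add, Matrix.smul_mul, Matrix.trace_smul, smul_eq_mul]
      congr 1
      ring
    simp_rw [h4]
    rw [h3, ← mul_assoc, inv_mul_cancel₀ (pow_ne_zero _ (by exact_mod_cast Real.pi_ne_zero)),
      one_mul]
  rw [partitionFunction_eq_integral]
  simp_rw [← h1, ← h2]
  refine integral_integral_swap ?_
  have hcx : Continuous (hermitianOfCoords : (Fin N × Fin N → ℝ) → _) := by
    refine continuous_matrix fun i j => ?_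
    simp only [hermitianOfCoords, Matrix.of_apply]
    fun_prop
  have hc : Continuous (Function.uncurry f) := by
    refine Complex.continuous_exp.comp (continuous_const.mul ?_)
    refine Continuous.matrix_trace ?_
    refine (hcx.comp continuous_snd).matrix_mul ?_
    have h : Continuous fun Φ : Fin N → Fin N → ℂ => (Matrix.of Φ)ᴴ * Matrix.of Φ :=
      (continuous_id.matrix_conjTranspose).matrix_mul continuous_id
    exact h.comp continuous_fst
  refine Integrable.of_bound hc.aestronglyMeasurable 1 (Eventually.of_forall fun p => ?_)
  have him := trace_mul_im_eq_zero (isHermitian_hermitianOfCoords p.2) (hherm p.1)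
  rw [Function.uncurry, hf, Complex.norm_exp, Real.exp_le_one_iff]
  simp [him]

/-- The intermediate field representation of the partition function, by analytic continuation
from positive couplings. -/
theorem partitionFunction_eq (hN : 1 ≤ N) {z : ℂ} (hz : 0 < z.re) :
    partitionFunction N z =
      ∫ x, Complex.exp (vertex N (Complex.sqrt (2 * z / (N : ℂ))) (hermitianOfCoords x))
        ∂(stdGaussianPi (Fin N × Fin N)) := by
  have hsec : ∀ z : ℂ, 0 < z.re → ‖Complex.sqrt (2 * z / (N : ℂ))‖ ≤
      2 * (Complex.sqrt (2 * z / (N : ℂ))).re := fun z hz =>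
    (sqrt_mem_sector (coupling_re_pos hN hz)).2
  obtain ⟨C, hC0, hC⟩ := exists_norm_hermitianOfCoords_le N
  have hd : DifferentiableOn ℂ (fun z =>
      ∫ x, Complex.exp (vertex N (Complex.sqrt (2 * z / (N : ℂ))) (hermitianOfCoords x))
        ∂(stdGaussianPi (Fin N × Fin N))) {z | 0 < z.re} := by
    refine differentiableOn_re_pos_of_bounded fun M => ?_
    refine differentiableOn_integral_of_dominated
      (isOpen_re_pos.inter (isOpen_lt continuous_norm continuous_const))
      (bound := fun x => Real.exp ((2 * N ^ 2 * (1 + 2 * M / N) * C) * ‖x‖)) ?_ ?_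
      (integrable_exp_norm_stdGaussianPi _) ?_
    · intro z hz
      exact (Complex.continuous_exp.comp (continuous_fieldsCLM_vertex (hsec z hz.1))).aestronglyMeasurable
    · refine Eventually.of_forall fun x z hz => ?_
      refine (Complex.norm_exp_le_exp_norm _).trans (Real.exp_le_exp.2 ?_)
      refine (norm_vertex_le (hsec z hz.1) (isHermitian_hermitianOfCoords x)).trans ?_
      have h1 := norm_coupling hN hz.1
      have h2 : ‖z‖ ≤ M := le_of_lt hz.2
      -- `x ≤ 1 + x²` replaces the square root of `2 ‖z‖ / N` by a linear bound
      have h3 : ‖Complex.sqrt (2 * z / (N : ℂ))‖ ≤ 1 + 2 * M / N := by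
        have h4 : 2 * ‖z‖ / N ≤ 2 * M / N := by gcongr
        nlinarith [sq_nonneg (‖Complex.sqrt (2 * z / (N : ℂ))‖ - 1 / 2)]
      have h5 : 0 ≤ 1 + 2 * M / N := (norm_nonneg _).trans h3
      calc 2 * (N : ℝ) ^ 2 * (‖Complex.sqrt (2 * z / (N : ℂ))‖ * ‖hermitianOfCoords x‖)
          ≤ 2 * (N : ℝ) ^ 2 * ((1 + 2 * M / N) * (C * ‖x‖)) := by gcongr; exact hC x
        _ = _ := by ring
    · refine Eventually.of_forall fun x z hz => ?_
      refine DifferentiableAt.differentiableWithinAt ?_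
      have hmem : (Complex.I * Complex.sqrt (2 * z / (N : ℂ))) • hermitianOfCoords x ∈
          logDomain (Fin N) :=
        mem_logDomain_of_mem_tube (n := 1) (σ := fun _ => hermitianOfCoords x) (hsec z hz.1)
          (hermTuples_subset_tube _ _ _ fun _ => isHermitian_hermitianOfCoords x) 0
      exact ((differentiableAt_vertex hmem).comp z (differentiableAt_coupling hN hz.1)).cexp
  -- the two sides agree at the points `1 + 1 / (k + 1)`, which accumulate at `1`
  have h1 := differentiableOn_partitionFunction (N := N)
  refine (h1.analyticOnNhd isOpen_re_pos).eqOn_of_preconnected_of_frequently_eq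
    (hd.analyticOnNhd isOpen_re_pos) isPreconnected_re_pos (z₀ := 1) (by simp) ?_ hz
  have hlim : Tendsto (fun k : ℕ => ((1 + 1 / ((k : ℝ) + 1) : ℝ) : ℂ)) atTop (𝓝[≠] 1) := by
    refine tendsto_nhdsWithin_iff.2 ⟨?_, Eventually.of_forall fun k => ?_⟩
    · have h2 : Tendsto (fun k : ℕ => 1 + 1 / ((k : ℝ) + 1)) atTop (𝓝 (1 + 0)) :=
        tendsto_const_nhds.add tendsto_one_div_add_atTop_nhds_zero_nat
      have h3 := (Complex.continuous_ofReal.tendsto (1 + 0)).comp h2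
      rw [add_zero, Complex.ofReal_one] at h3
      exact h3
    · have : (0 : ℝ) < 1 / ((k : ℝ) + 1) := by positivity
      simp only [Set.mem_compl_iff, Set.mem_singleton_iff]
      rw [Complex.ofReal_eq_one]
      linarith
  refine hlim.frequently (Eventually.frequently (Eventually.of_forall fun k => ?_))
  exact partitionFunction_ofReal hN (by positivity)

end Partition

end

noncomputable section
open scoped ContDiff Matrix.Norms.L2Operator

/-! ### Integration of asymptotic expansions -/

section Asymptotic

/-- The coefficients of an asymptotic expansion are recovered from the function by successive
limits; in particular they obey the bounds of the remainders. -/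
theorem tendsto_asymptotic_coeff {S : Set ℂ} {t : ℕ → ℂ} (htS : ∀ k, t k ∈ S) (ht0 : ∀ k, t k ≠ 0)
    (ht : Tendsto t atTop (𝓝 0)) {f : ℂ → ℂ} {c : ℕ → ℂ} {b : ℕ → ℝ}
    (h : ∀ J, ∀ g ∈ S, ‖f g - ∑ j ∈ Finset.range J, c j * g ^ j‖ ≤ b J * ‖g‖ ^ J) (J : ℕ) :
    Tendsto (fun k => ((t k) ^ J)⁻¹ * (f (t k) - ∑ j ∈ Finset.range J, c j * t k ^ j)) atTop
      (𝓝 (c J)) ∧ ‖c J‖ ≤ b J := by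
  have h1 : Tendsto (fun k => ((t k) ^ J)⁻¹ * (f (t k) - ∑ j ∈ Finset.range J, c j * t k ^ j)) atTop
      (𝓝 (c J)) := by
    rw [tendsto_iff_norm_sub_tendsto_zero]
    have h2 : Tendsto (fun k => b (J + 1) * ‖t k‖) atTop (𝓝 0) := by
      have := ht.norm.const_mul (b (J + 1))
      rwa [norm_zero, mul_zero] at this
    refine squeeze_zero (fun _ => norm_nonneg _) (fun k => ?_) h2
    have hk : (t k) ^ J ≠ 0 := pow_ne_zero _ (ht0 k)
    have h3 := h (J + 1) (t k) (htS k)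
    rw [Finset.sum_range_succ] at h3
    have h4 : ((t k) ^ J)⁻¹ * (f (t k) - ∑ j ∈ Finset.range J, c j * t k ^ j) - c J =
        ((t k) ^ J)⁻¹ * (f (t k) - (∑ j ∈ Finset.range J, c j * t k ^ j + c J * t k ^ J)) := by
      field_simp
      ring
    rw [h4, norm_mul, norm_inv, norm_pow, inv_mul_le_iff₀ (by
      have := norm_pos_iff.2 (ht0 k); positivity)]
    calc _ ≤ _ := h3
      _ = _ := by ring
  refine ⟨h1, le_of_tendsto h1.norm (Eventually.of_forall fun k => ?_)⟩
  have := norm_pos_iff.2 (ht0 k)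
  rw [norm_mul, norm_inv, norm_pow, inv_mul_le_iff₀ (by positivity), mul_comm]
  exact h J (t k) (htS k)

theorem exists_tendsto_zero {S : Set ℂ} {δ : ℝ} (hδ : 0 < δ)
    (hS : ∀ s : ℝ, 0 < s → s < δ → (s : ℂ) ∈ S) :
    ∃ t : ℕ → ℂ, (∀ k, t k ∈ S) ∧ (∀ k, t k ≠ 0) ∧ Tendsto t atTop (𝓝 0) := by
  refine ⟨fun k => ((δ / (k + 2) : ℝ) : ℂ), fun k => hS _ (by positivity) ?_,
    fun k => Complex.ofReal_ne_zero.2 (by positivity), ?_⟩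
  · rw [div_lt_iff₀ (by positivity)]
    have : (0 : ℝ) ≤ k := k.cast_nonneg
    nlinarith
  · have h1 : Tendsto (fun k : ℕ => δ / ((k : ℝ) + 2)) atTop (𝓝 0) :=
      tendsto_const_nhds.div_atTop
        (tendsto_atTop_add_const_right _ _ tendsto_natCast_atTop_atTop)
    have h2 := (Complex.continuous_ofReal.tendsto 0).comp h1
    rw [Complex.ofReal_zero] at h2
    exact h2

/-- Asymptotic expansions with integrable remainder bounds may be integrated term by term. -/
theorem asymptotic_integral {α : Type*} [MeasurableSpace α] {μ : Measure α} {S : Set ℂ} {δ : ℝ}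
    (hδ : 0 < δ) (hS : ∀ s : ℝ, 0 < s → s < δ → (s : ℂ) ∈ S) {f : ℂ → α → ℂ} {c : ℕ → α → ℂ}
    {b : ℕ → α → ℝ} (hm : ∀ g ∈ S, AEStronglyMeasurable (f g) μ)
    (h : ∀ᵐ x ∂μ, ∀ J, ∀ g ∈ S,
      ‖f g x - ∑ j ∈ Finset.range J, c j x * g ^ j‖ ≤ b J x * ‖g‖ ^ J)
    (hb : ∀ J, Integrable (b J) μ) :
    (∀ j, Integrable (c j) μ) ∧ ∀ J, ∀ g ∈ S,
      ‖∫ x, f g x ∂μ - ∑ j ∈ Finset.range J, (∫ x, c j x ∂μ) * g ^ j‖ ≤ (∫ x, b J x ∂μ) * ‖g‖ ^ J := by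
  obtain ⟨t, htS, ht0, ht⟩ := exists_tendsto_zero hδ hS
  have hcm : ∀ J, AEStronglyMeasurable (c J) μ := by
    intro J
    induction J using Nat.strong_induction_on with
    | _ J ih =>
      refine aestronglyMeasurable_of_tendsto_ae atTop (f := fun k x =>
        ((t k) ^ J)⁻¹ * (f (t k) x - ∑ j ∈ Finset.range J, c j x * t k ^ j)) (fun k => ?_) ?_
      · refine ((hm _ (htS k)).sub ?_).const_mul _
        refine Finset.aestronglyMeasurable_fun_sum _ fun j hj => ?_
        exact (ih j (Finset.mem_range.1 hj)).mul_const _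
      · filter_upwards [h] with x hx
        exact (tendsto_asymptotic_coeff htS ht0 ht (f := fun g => f g x) (c := fun j => c j x)
          (b := fun j => b j x) hx J).1
  have hci : ∀ J, Integrable (c J) μ := fun J => by
    refine (hb J).mono' (hcm J) ?_
    filter_upwards [h] with x hx
    exact (tendsto_asymptotic_coeff htS ht0 ht (f := fun g => f g x) (c := fun j => c j x)
      (b := fun j => b j x) hx J).2
  refine ⟨hci, fun J g hg => ?_⟩
  have hfi : Integrable (f g) μ := by
    refine (hb 0).mono' (hm g hg) ?_
    filter_upwards [h] with x hx
    simpa using hx 0 g hg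
  have e : ∫ x, f g x ∂μ - ∑ j ∈ Finset.range J, (∫ x, c j x ∂μ) * g ^ j =
      ∫ x, (f g x - ∑ j ∈ Finset.range J, c j x * g ^ j) ∂μ := by
    rw [integral_sub hfi (integrable_finsetSum _ fun j _ => (hci j).mul_const _),
      integral_finsetSum _ fun j _ => (hci j).mul_const _]
    simp_rw [integral_mul_const]
  rw [e, ← integral_mul_const]
  refine norm_integral_le_of_norm_le ((hb J).mul_const _) ?_
  filter_upwards [h] with x hx using hx J g hg

end Asymptotic

/-! ### Borel summability of the partition function -/

/-- Taylor's formula for the exponential in the left half plane. -/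
theorem norm_exp_sub_sum_le_of_re_nonpos (r : ℕ) {w : ℂ} (hw : w.re ≤ 0) :
    ‖Complex.exp w - ∑ k ∈ Finset.range r, w ^ k / (k ! : ℂ)‖ ≤ ‖w‖ ^ r / (r ! : ℝ) := by
  induction r generalizing w with
  | zero => simpa [Complex.norm_exp] using hw
  | succ r ih =>
    have hd : ∀ t : ℝ, HasDerivAt (fun t : ℝ => Complex.exp (t * w) -
        ∑ k ∈ Finset.range (r + 1), (t * w) ^ k / (k ! : ℂ))
        (w * (Complex.exp (t * w) - ∑ k ∈ Finset.range r, (t * w) ^ k / (k ! : ℂ))) t := by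
      intro t
      have h0 : HasDerivAt (fun t : ℝ => (t : ℂ) * w) w t := by
        simpa using (Complex.ofRealCLM.hasDerivAt (x := t)).mul_const w
      have h1 : HasDerivAt (fun t : ℝ => ∑ k ∈ Finset.range (r + 1), ((t : ℂ) * w) ^ k / (k ! : ℂ))
          (∑ k ∈ Finset.range (r + 1), ((k : ℂ) * (t * w) ^ (k - 1) * w) / (k ! : ℂ)) t :=
        HasDerivAt.fun_sum fun k _ => (h0.pow k).div_const _
      convert! h0.cexp.sub h1 using 1
      rw [Finset.sum_range_succ']
      simp only [Nat.cast_zero, zero_mul, zero_div, add_zero, Nat.add_sub_cancel]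
      rw [mul_sub, mul_comm w, Finset.mul_sum]
      congr 1
      refine Finset.sum_congr rfl fun k _ => ?_
      have : (k ! : ℂ) ≠ 0 := by exact_mod_cast k.factorial_ne_zero
      have : (k : ℂ) + 1 ≠ 0 := by exact_mod_cast k.succ_ne_zero
      rw [Nat.factorial_succ]
      push_cast
      field_simp
    have hB : ∀ t : ℝ, HasDerivAt (fun t : ℝ => ‖w‖ ^ (r + 1) / (r + 1)! * t ^ (r + 1))
        (‖w‖ ^ (r + 1) / r ! * t ^ r) t := by
      intro t
      convert! (hasDerivAt_pow (r + 1) t).const_mul (‖w‖ ^ (r + 1) / (r + 1)!) using 1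
      have : (r ! : ℝ) ≠ 0 := by exact_mod_cast r.factorial_ne_zero
      rw [Nat.factorial_succ, Nat.add_sub_cancel]
      push_cast
      field_simp
    have key := image_norm_le_of_norm_deriv_right_le_deriv_boundary (a := (0 : ℝ)) (b := 1)
      (f := fun t : ℝ => Complex.exp (t * w) -
        ∑ k ∈ Finset.range (r + 1), (t * w) ^ k / (k ! : ℂ))
      (B := fun t : ℝ => ‖w‖ ^ (r + 1) / (r + 1)! * t ^ (r + 1))
      (fun t _ => (hd t).continuousAt.continuousWithinAt) (fun t _ => (hd t).hasDerivWithinAt)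
      (by simp [Finset.sum_range_succ']) hB ?_ (x := 1) (by simp)
    · simpa using key
    · intro t ht
      have h1 : ((t : ℂ) * w).re ≤ 0 := by
        rw [Complex.re_ofReal_mul]; exact mul_nonpos_of_nonneg_of_nonpos ht.1 hw
      rw [norm_mul]
      calc ‖w‖ * _ ≤ ‖w‖ * (‖(t : ℂ) * w‖ ^ r / r !) := by gcongr; exact ih h1
        _ = ‖w‖ ^ (r + 1) / r ! * t ^ r := by
          rw [norm_mul, Complex.norm_real, Real.norm_of_nonneg ht.1]; ring

theorem factorial_two_mul_le (r : ℕ) : ((2 * r)! : ℝ) ≤ 4 ^ r * (r ! : ℝ) ^ 2 := by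
  have h1 := Nat.choose_mul_factorial_mul_factorial (n := 2 * r) (k := r) (by omega)
  have h2 := Nat.choose_le_two_pow (2 * r) r
  rw [show 2 * r - r = r by omega] at h1
  have h3 : (2 * r)! ≤ 4 ^ r * (r !) ^ 2 := by
    rw [← h1, mul_assoc, ← sq, show 4 ^ r = 2 ^ (2 * r) by rw [pow_mul]; norm_num]
    gcongr
  exact_mod_cast h3

/-- The Borel disk is the disk that has the segment from `0` to `R` as a diameter. -/
theorem re_pos_of_mem_borelDisk {R : ℝ} (hR : 0 < R) {z : ℂ} (hz : z ∈ borelDisk R) :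
    0 < z.re ∧ ‖z‖ < R := by
  have h1 : 1 / R < (z⁻¹).re := hz
  have hz0 : z ≠ 0 := by
    rintro rfl
    rw [inv_zero, Complex.zero_re] at h1
    exact absurd h1 (not_lt.2 (by positivity))
  have hn : 0 < ‖z‖ := norm_pos_iff.2 hz0
  have h2 : 0 < (z⁻¹).re := lt_trans (by positivity) h1
  refine ⟨?_, ?_⟩
  · rw [Complex.inv_re] at h2
    exact (div_pos_iff_of_pos_right (Complex.normSq_pos.2 hz0)).1 h2
  · have h3 : 1 / R < 1 / ‖z‖ := by
      rw [one_div ‖z‖, ← norm_inv]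
      exact h1.trans_le (Complex.re_le_norm _)
    exact (one_div_lt_one_div hR hn).1 h3

theorem isOpen_borelDisk {R : ℝ} (hR : 0 < R) : IsOpen (borelDisk R) := by
  have h : borelDisk R = {z : ℂ | ‖z‖ ^ 2 < R * z.re} := by
    ext z
    simp only [borelDisk, Set.mem_ofPred_eq, Complex.inv_re]
    rcases eq_or_ne z 0 with rfl | hz
    · simp [hR.le]
    · have h0 : 0 < ‖z‖ ^ 2 := by have := norm_pos_iff.2 hz; positivity
      rw [Complex.normSq_eq_norm_sq, div_lt_div_iff₀ hR h0, one_mul, mul_comm z.re]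
  rw [h]
  exact isOpen_lt (by fun_prop) (by fun_prop)

/-- The remainder of order `r` is at most `‖z‖ ^ r ⟨T ^ r / r!⟩` with `T = Tr Φ* Φ Φ* Φ / N`, because
`-z T` has nonpositive real part. As `T ≤ ‖Φ‖⁴` and `‖Φ‖ ^ (4 r) / (2 r)!` is at most `4 ^ r exp (‖Φ‖² / 2)`,
the expectation is of order `(2 r)! / r!`, that is `r!` up to a geometric factor. -/
theorem hasBorelBounds_partitionFunction : UniformlyBorelSummable partitionFunction := by
  refine ⟨1, one_pos, 16, by norm_num,
    fun N => ∫ Φ, Real.exp (1 / 2 * hsNormSq Φ) ∂(complexMatrixGaussian N),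
    fun N => integral_nonneg fun Φ => (Real.exp_pos _).le, fun N hN => ⟨?_, ?_⟩⟩
  · exact (differentiableOn_partitionFunction.analyticOnNhd isOpen_re_pos).mono
      fun z hz => (re_pos_of_mem_borelDisk one_pos hz).1
  have hN' : (1 : ℝ) ≤ N := by exact_mod_cast hN
  have hint := integrable_exp_hsNormSq (N := N) (c := 1 / 2) (by norm_num)
  set b : ℕ → (Fin N → Fin N → ℂ) → ℝ := fun J Φ => (quarticTrace Φ / N) ^ J / J ! with hb
  have hble : ∀ J Φ, b J Φ ≤ 16 ^ J * J ! * Real.exp (1 / 2 * hsNormSq Φ) := by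
    intro J Φ
    have h0 := hsNormSq_nonneg Φ
    have hT := quarticTrace_nonneg Φ
    have h1 := Real.pow_div_factorial_le_exp (1 / 2 * hsNormSq Φ) (by positivity) (2 * J)
    rw [div_le_iff₀ (by positivity)] at h1
    have h2 := factorial_two_mul_le J
    have h3 : quarticTrace Φ / N ≤ hsNormSq Φ ^ 2 :=
      (div_le_self hT hN').trans (quarticTrace_le Φ)
    have hE := Real.exp_pos (1 / 2 * hsNormSq Φ)
    have hJ : (0 : ℝ) < J ! := by positivity
    rw [hb]
    simp only
    rw [div_le_iff₀ hJ]
    calc (quarticTrace Φ / N) ^ J ≤ (hsNormSq Φ ^ 2) ^ J := by gcongr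
      _ = 4 ^ J * (1 / 2 * hsNormSq Φ) ^ (2 * J) := by
        rw [mul_pow, pow_mul, pow_mul, ← mul_assoc, ← mul_pow]; norm_num
      _ ≤ 4 ^ J * (Real.exp (1 / 2 * hsNormSq Φ) * (4 ^ J * (J ! : ℝ) ^ 2)) := by
        gcongr
        exact h1.trans (by gcongr)
      _ = (4 * 4) ^ J * J ! * Real.exp (1 / 2 * hsNormSq Φ) * J ! := by rw [mul_pow]; ring
      _ = _ := by norm_num
  have hb0 : ∀ J Φ, 0 ≤ b J Φ := fun J Φ => by have := quarticTrace_nonneg Φ; simp only [hb]; positivity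
  have hbi : ∀ J, Integrable (b J) (complexMatrixGaussian N) := fun J => by
    refine (hint.const_mul (16 ^ J * (J ! : ℝ))).mono' ?_ (Eventually.of_forall fun Φ => ?_)
    · exact (((continuous_quarticTrace.div_const _).pow J).div_const _).aestronglyMeasurable
    · rw [Real.norm_of_nonneg (hb0 J Φ)]
      exact hble J Φ
  have key := asymptotic_integral (μ := complexMatrixGaussian N) (S := {z : ℂ | 0 < z.re}) one_pos
    (fun s hs _ => by simpa using hs)
    (f := fun z Φ => Complex.exp (-(z / N) * (quarticTrace Φ : ℂ)))
    (c := fun k Φ => (-((quarticTrace Φ / N : ℝ) : ℂ)) ^ k / k !) (b := b)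
    (fun z _ => (continuous_exp_quarticTrace z).aestronglyMeasurable) ?_ hbi
  · refine ⟨fun k => ∫ Φ, (-((quarticTrace Φ / N : ℝ) : ℂ)) ^ k / (k ! : ℂ) ∂(complexMatrixGaussian N),
      fun r z hz => ?_⟩
    obtain ⟨hz1, -⟩ := re_pos_of_mem_borelDisk one_pos hz
    rw [partitionFunction_eq_integral]
    refine (key.2 r z hz1).trans ?_
    gcongr
    rw [mul_assoc, ← integral_mul_const]
    refine integral_mono (hbi r) (hint.mul_const _) fun Φ => ?_
    exact (hble r Φ).trans_eq (mul_comm _ _)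
  · refine Eventually.of_forall fun Φ J z hz => ?_
    have hz' : 0 < z.re := hz
    have hT := quarticTrace_nonneg Φ
    have e : -(z / N) * (quarticTrace Φ : ℂ) = -((quarticTrace Φ / N : ℝ) : ℂ) * z := by
      push_cast; ring
    have h1 := norm_exp_sub_sum_le_of_re_nonpos J (w := -((quarticTrace Φ / N : ℝ) : ℂ) * z) (by
      rw [neg_mul, Complex.neg_re, Complex.re_ofReal_mul, neg_nonpos]
      positivity)
    rw [e]
    have h2 : ∑ k ∈ Finset.range J, (-((quarticTrace Φ / N : ℝ) : ℂ) * z) ^ k / (k ! : ℂ) =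
        ∑ k ∈ Finset.range J, (-((quarticTrace Φ / N : ℝ) : ℂ)) ^ k / k ! * z ^ k :=
      Finset.sum_congr rfl fun k _ => by rw [mul_pow]; ring
    rw [h2] at h1
    refine h1.trans_eq ?_
    rw [norm_mul, norm_neg, Complex.norm_real, Real.norm_of_nonneg (by positivity), mul_pow]
    simp only [hb]
    ring

end

noncomputable section
open scoped ContDiff Matrix.Norms.L2Operator

/-! ### The norm of a Gaussian Hermitian matrix -/

section GaussianNorm

variable {N : ℕ}

/-- The value is `(1 - 2 · 3 / 8) ^ (-1 / 2)`. -/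
theorem lintegral_exp_sq_gaussianReal :
    ∫⁻ t, ENNReal.ofReal (Real.exp (3 / 8 * t ^ 2)) ∂(gaussianReal 0 1) = 2 := by
  rw [gaussianReal_of_var_ne_zero _ one_ne_zero,
    lintegral_withDensity_eq_lintegral_mul _ (measurable_gaussianPDF 0 1) (by fun_prop)]
  have h1 : ∀ t : ℝ, (gaussianPDF 0 1 * fun t => ENNReal.ofReal (Real.exp (3 / 8 * t ^ 2))) t =
      ENNReal.ofReal ((√(2 * Real.pi))⁻¹ * Real.exp (-(1 / 8) * t ^ 2)) := by
    intro t
    rw [Pi.mul_apply, gaussianPDF, ← ENNReal.ofReal_mul (gaussianPDFReal_nonneg _ _ _),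
      gaussianPDFReal]
    congr 1
    rw [mul_assoc, ← Real.exp_add]
    congr 2
    · norm_num
    · norm_num
      ring
  simp_rw [h1]
  rw [← ofReal_integral_eq_lintegral_ofReal
    ((integrable_exp_neg_mul_sq (by norm_num)).const_mul _)
    (Eventually.of_forall fun t => by positivity), integral_const_mul, integral_gaussian,
    show Real.pi / (1 / 8) = 2 ^ 2 * (2 * Real.pi) by ring,
    Real.sqrt_mul (x := (2 : ℝ) ^ 2) (by norm_num), Real.sqrt_sq (by norm_num), mul_left_comm,
    inv_mul_cancel₀ (by positivity), mul_one]
  norm_num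

theorem lintegral_exp_sq_sum_le {κ : Type*} [Fintype κ] (a : κ → ℝ) {c : ℝ}
    (h : c * ∑ p, a p ^ 2 ≤ 3 / 8) :
    ∫⁻ x, ENNReal.ofReal (Real.exp (c * (∑ p, a p * x p) ^ 2)) ∂(stdGaussianPi κ) ≤ 2 := by
  set v := ∑ p, a p ^ 2 with hv
  have hv0 : 0 ≤ v := by positivity
  have h1 : gaussianReal 0 (Real.toNNReal v) = (gaussianReal 0 1).map (√v * ·) := by
    rw [gaussianReal_map_const_mul, mul_zero, mul_one]
    congr 1
    ext
    simp [Real.sq_sqrt hv0, hv0]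
  rw [← lintegral_map (f := fun y => ENNReal.ofReal (Real.exp (c * y ^ 2)))
    (g := fun x : κ → ℝ => ∑ p, a p * x p) (by fun_prop) (by fun_prop), map_sum_stdGaussianPi, h1,
    lintegral_map (by fun_prop) (by fun_prop), ← lintegral_exp_sq_gaussianReal]
  refine lintegral_mono fun t => ENNReal.ofReal_le_ofReal (Real.exp_le_exp.2 ?_)
  rw [mul_pow, Real.sq_sqrt hv0, ← mul_assoc]
  gcongr

/-- The operator norm of a Hermitian matrix is the modulus of an eigenvalue. -/
theorem exists_norm_le_quadratic (hN : 1 ≤ N) {σ : Matrix (Fin N) (Fin N) ℂ} (hσ : σ.IsHermitian) :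
    ∃ u : EuclideanSpace ℂ (Fin N), ‖u‖ = 1 ∧
      ‖σ‖ ≤ ‖inner ℂ u (Matrix.toEuclideanCLM (n := Fin N) (𝕜 := ℂ) σ u)‖ := by
  obtain ⟨j, -, hj⟩ := Finset.exists_max_image Finset.univ (fun j => ‖(hσ.eigenvalues j : ℂ)‖)
    ⟨⟨0, hN⟩, Finset.mem_univ _⟩
  have h1 : ‖σ‖ ≤ ‖(hσ.eigenvalues j : ℂ)‖ := by
    conv_lhs => rw [hσ.spectral_theorem, Unitary.conjStarAlgAut_apply]
    rw [CStarRing.norm_mul_mem_unitary _ (Unitary.star_mem hσ.eigenvectorUnitary.2),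
      CStarRing.norm_coe_unitary_mul, Matrix.l2_opNorm_diagonal]
    exact (pi_norm_le_iff_of_nonneg (norm_nonneg _)).2 fun k => hj k (Finset.mem_univ _)
  have hu : ‖hσ.eigenvectorBasis j‖ = 1 := hσ.eigenvectorBasis.orthonormal.1 j
  refine ⟨hσ.eigenvectorBasis j, hu, h1.trans_eq ?_⟩
  have h2 : Matrix.toEuclideanCLM (n := Fin N) (𝕜 := ℂ) σ (hσ.eigenvectorBasis j) =
      (hσ.eigenvalues j : ℂ) • hσ.eigenvectorBasis j := by
    refine (WithLp.ofLp_injective 2) ?_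
    rw [Matrix.ofLp_toEuclideanCLM, hσ.mulVec_eigenvectorBasis j]
    rfl
  rw [h2, inner_smul_right, inner_self_eq_norm_sq_to_K, hu]
  simp

/-- Near the eigenvector the quadratic form stays large. -/
theorem norm_le_quadratic_of_near {E : Type*} [NormedAddCommGroup E] [InnerProductSpace ℂ E]
    (L : E →L[ℂ] E) {u y : E} (hu : ‖u‖ = 1) (hL : ‖L‖ ≤ ‖inner ℂ u (L u)‖) (hy : ‖y - u‖ ≤ 1 / 4) :
    7 / 16 * ‖L‖ ≤ ‖inner ℂ y (L y)‖ ∧ ‖y‖ ≤ 5 / 4 := by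
  have hy1 : ‖y‖ ≤ 5 / 4 := by
    have := norm_add_le (y - u) u
    rw [sub_add_cancel] at this
    linarith
  refine ⟨?_, hy1⟩
  have h1 : inner ℂ u (L u) = inner ℂ y (L y) - inner ℂ (y - u) (L y) - inner ℂ u (L (y - u)) := by
    rw [map_sub, inner_sub_left, inner_sub_right]
    ring
  have h2 : ‖inner ℂ (y - u) (L y)‖ ≤ 1 / 4 * (‖L‖ * (5 / 4)) :=
    (norm_inner_le_norm _ _).trans (by
      gcongr
      exact (L.le_opNorm y).trans (by gcongr))
  have h3 : ‖inner ℂ u (L (y - u))‖ ≤ 1 * (‖L‖ * (1 / 4)) :=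
    (norm_inner_le_norm _ _).trans (by
      rw [hu]
      gcongr
      exact (L.le_opNorm _).trans (by gcongr))
  have h4 := norm_sub_le (inner ℂ y (L y) - inner ℂ (y - u) (L y)) (inner ℂ u (L (y - u)))
  have h5 := norm_sub_le (inner ℂ y (L y)) (inner ℂ (y - u) (L y))
  rw [← h1] at h4
  linarith

/-- The quadratic form of the field, as a trace. -/
def quadForm (x : Fin N × Fin N → ℝ) (y : EuclideanSpace ℂ (Fin N)) : ℂ :=
  (hermitianOfCoords x * Matrix.vecMulVec y.ofLp (star y.ofLp)).trace

theorem inner_eq_quadForm (x : Fin N × Fin N → ℝ) (y : EuclideanSpace ℂ (Fin N)) :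
    inner ℂ y (Matrix.toEuclideanCLM (n := Fin N) (𝕜 := ℂ) (hermitianOfCoords x) y) =
      quadForm x y := by
  rw [quadForm, Matrix.mul_vecMulVec, Matrix.trace_vecMulVec, EuclideanSpace.inner_eq_star_dotProduct,
    Matrix.ofLp_toEuclideanCLM]

theorem continuous_hermitianOfCoords :
    Continuous (hermitianOfCoords : (Fin N × Fin N → ℝ) → Matrix (Fin N) (Fin N) ℂ) := by
  refine continuous_matrix fun i j => ?_
  simp only [hermitianOfCoords, Matrix.of_apply]
  fun_prop

theorem measurable_exp_norm_sq : Measurable fun x : Fin N × Fin N → ℝ =>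
    ENNReal.ofReal (Real.exp (1 / 50 * ‖hermitianOfCoords x‖ ^ 2)) := by
  have h : Continuous fun x : Fin N × Fin N → ℝ =>
      Real.exp (1 / 50 * ‖hermitianOfCoords x‖ ^ 2) := by
    have := continuous_hermitianOfCoords (N := N)
    fun_prop
  exact h.measurable.ennreal_ofReal

theorem continuous_quadForm : Continuous fun p : (Fin N × Fin N → ℝ) × EuclideanSpace ℂ (Fin N) =>
    quadForm p.1 p.2 := by
  refine Continuous.matrix_trace ((continuous_hermitianOfCoords.comp continuous_fst).matrix_mul ?_)
  exact Continuous.matrix_vecMulVec (by fun_prop) (by fun_prop)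

/-- The quadratic form at `y` is Gaussian with variance `‖y‖⁴`, and `(5 / 4)⁴ / 8 ≤ 3 / 8`. -/
theorem lintegral_exp_quadForm_le {y : EuclideanSpace ℂ (Fin N)} (hy : ‖y‖ ≤ 5 / 4) :
    ∫⁻ x, ENNReal.ofReal (Real.exp (1 / 8 * ‖quadForm x y‖ ^ 2)) ∂(stdGaussianPi (Fin N × Fin N)) ≤
      2 := by
  have hA : (Matrix.vecMulVec y.ofLp (star y.ofLp)).IsHermitian := by
    rw [Matrix.IsHermitian, Matrix.conjTranspose_vecMulVec, star_star]
  obtain ⟨a, h1, h2⟩ := exists_trace_hermitianOfCoords_mul hA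
  have h3 : ∑ p, a p ^ 2 = ‖y‖ ^ 4 := by
    have h4 : star y.ofLp ⬝ᵥ y.ofLp = ((‖y‖ ^ 2 : ℝ) : ℂ) := by
      rw [dotProduct_comm, ← EuclideanSpace.inner_eq_star_dotProduct, inner_self_eq_norm_sq_to_K]
      push_cast; rfl
    rw [Matrix.vecMulVec_mul_vecMulVec, h4, Matrix.trace_vecMulVec, dotProduct_smul, dotProduct_comm,
      h4, smul_eq_mul, ← Complex.ofReal_mul] at h2
    rw [← Complex.ofReal_injective h2]
    ring
  have h5 : ∀ x, ‖quadForm x y‖ ^ 2 = (∑ p, a p * x p) ^ 2 := by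
    intro x
    rw [quadForm, h1, Complex.norm_real, Real.norm_eq_abs, sq_abs]
  simp_rw [h5]
  refine lintegral_exp_sq_sum_le a ?_
  rw [h3]
  have : ‖y‖ ^ 4 ≤ (5 / 4) ^ 4 := by gcongr
  norm_num at this ⊢
  linarith

/-- The exponential moment of the norm of the field: the quadratic form is large on a ball of
radius `1 / 4`, and the volumes of balls of radius `5 / 4` and `1 / 4` in dimension `2 N` have
ratio `25 ^ N`. -/
theorem lintegral_exp_norm_sq_le (hN : 1 ≤ N) :
    ∫⁻ x : Fin N × Fin N → ℝ, ENNReal.ofReal (Real.exp (1 / 50 * ‖hermitianOfCoords x‖ ^ 2))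
      ∂(stdGaussianPi (Fin N × Fin N)) ≤ 2 * 25 ^ N := by
  set ν : Measure (EuclideanSpace ℂ (Fin N)) := Measure.addHaar
  set f : (Fin N × Fin N → ℝ) → EuclideanSpace ℂ (Fin N) → ENNReal := fun x y =>
    ENNReal.ofReal (Real.exp (1 / 8 * ‖quadForm x y‖ ^ 2)) with hf
  set b := ν (Metric.ball (0 : EuclideanSpace ℂ (Fin N)) 1) with hb
  have hb0 : b ≠ 0 := (Metric.measure_ball_pos ν 0 one_pos).ne'
  have hbt : b ≠ ⊤ := measure_ball_lt_top.ne
  have hdim : Module.finrank ℝ (EuclideanSpace ℂ (Fin N)) = 2 * N := by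
    rw [finrank_real_of_complex, finrank_euclideanSpace_fin]
  have hvol : ∀ (y : EuclideanSpace ℂ (Fin N)) {r : ℝ}, 0 ≤ r →
      ν (Metric.closedBall y r) = ENNReal.ofReal (r ^ (2 * N)) * b := fun y r hr => by
    rw [Measure.addHaar_closedBall ν y hr, hdim]
  have hfc : Continuous (Function.uncurry f) := by
    refine ENNReal.continuous_ofReal.comp (Real.continuous_exp.comp ?_)
    exact continuous_const.mul (continuous_quadForm.norm.pow 2)
  have hlow : ∀ x, ENNReal.ofReal ((1 / 4) ^ (2 * N)) * b *
      ENNReal.ofReal (Real.exp (1 / 50 * ‖hermitianOfCoords x‖ ^ 2)) ≤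
      ∫⁻ y in Metric.closedBall 0 (5 / 4), f x y ∂ν := by
    intro x
    obtain ⟨u, hu, hL⟩ := exists_norm_le_quadratic hN (isHermitian_hermitianOfCoords x)
    have hnorm : ‖hermitianOfCoords x‖ =
        ‖Matrix.toEuclideanCLM (n := Fin N) (𝕜 := ℂ) (hermitianOfCoords x)‖ := Matrix.cstar_norm_def _
    rw [hnorm] at hL ⊢
    rw [← hvol u (by norm_num), mul_comm, ← setLIntegral_const]
    have hsub : Metric.closedBall u (1 / 4) ⊆ Metric.closedBall 0 (5 / 4) := by
      intro y hy
      rw [mem_closedBall_iff_norm] at hy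
      exact mem_closedBall_zero_iff.2 (norm_le_quadratic_of_near _ hu hL hy).2
    refine le_trans ?_ (lintegral_mono_set hsub)
    refine setLIntegral_mono' measurableSet_closedBall fun y hy => ?_
    rw [mem_closedBall_iff_norm] at hy
    have h1 := (norm_le_quadratic_of_near _ hu hL hy).1
    rw [inner_eq_quadForm] at h1
    refine ENNReal.ofReal_le_ofReal (Real.exp_le_exp.2 ?_)
    have h2 := pow_le_pow_left₀ (by positivity) h1 2
    nlinarith [sq_nonneg ‖Matrix.toEuclideanCLM (n := Fin N) (𝕜 := ℂ) (hermitianOfCoords x)‖]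
  have hup : ∫⁻ x, ∫⁻ y in Metric.closedBall 0 (5 / 4), f x y ∂ν ∂(stdGaussianPi (Fin N × Fin N)) ≤
      2 * (ENNReal.ofReal ((5 / 4) ^ (2 * N)) * b) := by
    rw [lintegral_lintegral_swap hfc.measurable.aemeasurable, ← hvol 0 (by norm_num),
      ← setLIntegral_const]
    refine setLIntegral_mono' measurableSet_closedBall fun y hy => ?_
    exact lintegral_exp_quadForm_le (mem_closedBall_zero_iff.1 hy)
  have hall := (lintegral_mono hlow).trans hup
  rw [lintegral_const_mul _ measurable_exp_norm_sq] at hall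
  have hc0 : ENNReal.ofReal ((1 / 4) ^ (2 * N)) * b ≠ 0 :=
    mul_ne_zero (ENNReal.ofReal_pos.2 (by positivity)).ne' hb0
  have hct : ENNReal.ofReal ((1 / 4) ^ (2 * N)) * b ≠ ⊤ := ENNReal.mul_ne_top ENNReal.ofReal_ne_top hbt
  refine (ENNReal.mul_le_mul_iff_right hc0 hct).1 (hall.trans_eq ?_)
  have h25 : ENNReal.ofReal ((5 / 4) ^ (2 * N)) = ENNReal.ofReal ((1 / 4) ^ (2 * N)) * 25 ^ N := by
    rw [show (25 : ENNReal) = ENNReal.ofReal 25 by norm_num, ← ENNReal.ofReal_pow (by norm_num),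
      ← ENNReal.ofReal_mul (by positivity), pow_mul, pow_mul, ← mul_pow]
    norm_num
  rw [h25]
  ring

/-- `‖σ‖` is of order `√N`. -/
theorem integral_exp_norm_sq_le (hN : 1 ≤ N) :
    Integrable (fun x : Fin N × Fin N → ℝ => Real.exp (‖hermitianOfCoords x‖ ^ 2 / (50 * N)))
      (stdGaussianPi (Fin N × Fin N)) ∧
    ∫ x : Fin N × Fin N → ℝ, Real.exp (‖hermitianOfCoords x‖ ^ 2 / (50 * N))
      ∂(stdGaussianPi (Fin N × Fin N)) ≤ 75 := by
  have hN' : (N : ℝ) ≠ 0 := by exact_mod_cast (by omega : N ≠ 0)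
  have hc := continuous_hermitianOfCoords (N := N)
  have hpt : ∀ x : Fin N × Fin N → ℝ,
      ENNReal.ofReal (Real.exp (‖hermitianOfCoords x‖ ^ 2 / (50 * N))) ≤
        25 + 25 * (25 ^ N)⁻¹ * ENNReal.ofReal (Real.exp (1 / 50 * ‖hermitianOfCoords x‖ ^ 2)) := by
    intro x
    set t := Real.exp (‖hermitianOfCoords x‖ ^ 2 / (50 * N)) with ht
    have h1 : Real.exp (1 / 50 * ‖hermitianOfCoords x‖ ^ 2) = t ^ N := by
      rw [ht, ← Real.exp_nat_mul]
      congr 1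
      field_simp
    have ht0 : 0 < t := Real.exp_pos _
    -- `t ≤ 1 + t ^ N`, applied to `t / 25`
    have h2 : t ≤ 25 + 25 * (25 ^ N)⁻¹ * t ^ N := by
      have h3 : t / 25 ≤ 1 + (t / 25) ^ N := by
        rcases le_total (t / 25) 1 with h | h
        · have : 0 ≤ (t / 25) ^ N := by positivity
          linarith
        · have := le_self_pow₀ h (by omega : N ≠ 0)
          linarith
      rw [div_pow] at h3
      calc t = 25 * (t / 25) := by ring
        _ ≤ 25 * (1 + t ^ N / 25 ^ N) := by gcongr
        _ = _ := by ring
    rw [h1]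
    refine (ENNReal.ofReal_le_ofReal h2).trans_eq ?_
    rw [ENNReal.ofReal_add (by norm_num) (by positivity), ENNReal.ofReal_mul (by positivity),
      ENNReal.ofReal_mul (by norm_num), ENNReal.ofReal_inv_of_pos (by positivity),
      ENNReal.ofReal_pow (by norm_num)]
    norm_num
  have hle : ∫⁻ x : Fin N × Fin N → ℝ,
      ENNReal.ofReal (Real.exp (‖hermitianOfCoords x‖ ^ 2 / (50 * N)))
        ∂(stdGaussianPi (Fin N × Fin N)) ≤ 75 := by
    refine (lintegral_mono hpt).trans ?_
    rw [lintegral_add_left measurable_const, lintegral_const, measure_univ, mul_one,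
      lintegral_const_mul _ measurable_exp_norm_sq]
    have h25 : (25 : ENNReal) ^ N ≠ 0 := by positivity
    have h25t : (25 : ENNReal) ^ N ≠ ⊤ := ENNReal.pow_ne_top (by norm_num)
    calc 25 + 25 * (25 ^ N)⁻¹ * _ ≤ 25 + 25 * (25 ^ N)⁻¹ * (2 * 25 ^ N : ENNReal) := by
          gcongr; exact lintegral_exp_norm_sq_le hN
      _ = 25 + 25 * 2 * ((25 ^ N)⁻¹ * 25 ^ N) := by ring
      _ = 75 := by rw [ENNReal.inv_mul_cancel h25 h25t]; norm_num
  have hint : Integrable (fun x : Fin N × Fin N → ℝ =>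
      Real.exp (‖hermitianOfCoords x‖ ^ 2 / (50 * N))) (stdGaussianPi (Fin N × Fin N)) := by
    refine ⟨Continuous.aestronglyMeasurable (by fun_prop), ?_⟩
    rw [hasFiniteIntegral_iff_ofReal (Eventually.of_forall fun x => (Real.exp_pos _).le)]
    exact hle.trans_lt (by norm_num)
  refine ⟨hint, ?_⟩
  rw [← ENNReal.ofReal_le_ofReal_iff (by norm_num),
    ofReal_integral_eq_lintegral_ofReal hint (Eventually.of_forall fun x => (Real.exp_pos _).le)]
  exact hle.trans_eq (by norm_num)

/-- The even moments of the norm are at most those of an exponential variable of mean `50 N`, up to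
a constant: the growth `m!` is independent of `N`. -/
theorem integral_norm_pow_le (hN : 1 ≤ N) (m : ℕ) :
    Integrable (fun x : Fin N × Fin N → ℝ => ‖hermitianOfCoords x‖ ^ (2 * m))
      (stdGaussianPi (Fin N × Fin N)) ∧
    ∫ x : Fin N × Fin N → ℝ, ‖hermitianOfCoords x‖ ^ (2 * m) ∂(stdGaussianPi (Fin N × Fin N)) ≤
      75 * (50 * N) ^ m * m ! := by
  have hN' : (0 : ℝ) < N := by exact_mod_cast hN
  have hc := continuous_hermitianOfCoords (N := N)
  obtain ⟨h1, h2⟩ := integral_exp_norm_sq_le hN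
  have hpt : ∀ x : Fin N × Fin N → ℝ, ‖hermitianOfCoords x‖ ^ (2 * m) ≤
      (50 * N) ^ m * m ! * Real.exp (‖hermitianOfCoords x‖ ^ 2 / (50 * N)) := by
    intro x
    have h3 := Real.pow_div_factorial_le_exp (‖hermitianOfCoords x‖ ^ 2 / (50 * N)) (by positivity) m
    rw [div_pow, div_div, div_le_iff₀ (by positivity), ← pow_mul] at h3
    exact h3.trans_eq (by ring)
  have hi : Integrable (fun x : Fin N × Fin N → ℝ => ‖hermitianOfCoords x‖ ^ (2 * m))
      (stdGaussianPi (Fin N × Fin N)) := by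
    refine (h1.const_mul ((50 * N : ℝ) ^ m * m !)).mono'
      (Continuous.aestronglyMeasurable (by fun_prop)) (Eventually.of_forall fun x => ?_)
    rw [Real.norm_of_nonneg (by positivity)]
    exact hpt x
  refine ⟨hi, (integral_mono hi (h1.const_mul _) hpt).trans ?_⟩
  rw [integral_const_mul]
  calc (50 * N : ℝ) ^ m * m ! * _ ≤ (50 * N : ℝ) ^ m * m ! * 75 := by gcongr
    _ = _ := by ring

end GaussianNorm

end

noncomputable section
open scoped ContDiff Matrix.Norms.L2Operator

/-! ### Taylor expansion in the coupling -/

/-- The Taylor coefficients at the origin. -/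
def taylorCoeff (f : ℂ → ℂ) (j : ℕ) : ℂ := (j ! : ℂ)⁻¹ * iteratedDeriv j f 0

theorem norm_taylorCoeff_le {f : ℂ → ℂ} {ρ B : ℝ} (hρ : 0 < ρ)
    (hf : ∀ w, ‖w‖ ≤ ρ → DifferentiableAt ℂ f w ∧ ‖f w‖ ≤ B) (j : ℕ) :
    ‖taylorCoeff f j‖ ≤ B / ρ ^ j := by
  have h1 : DiffContOnCl ℂ f (Metric.ball 0 ρ) := by
    refine DifferentiableOn.diffContOnCl fun w hw => ?_
    exact (hf w (mem_closedBall_zero_iff.1 (Metric.closure_ball_subset_closedBall hw))).1.differentiableWithinAt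
  have h2 := Complex.norm_iteratedDeriv_le_of_forall_mem_sphere_norm_le (c := 0) j hρ h1
    fun w hw => (hf w (mem_sphere_zero_iff_norm.1 hw).le).2
  have hj : (0 : ℝ) < (j ! : ℝ) := by positivity
  rw [taylorCoeff, norm_mul, norm_inv, Complex.norm_natCast, inv_mul_le_iff₀ hj]
  exact h2.trans_eq (by ring)

/-- A function which is holomorphic and bounded on a disk, and obeys the same bound at a further
point `g`, differs there from its Taylor polynomials by a power of `g`. -/
theorem norm_sub_taylor_le_of_pos {f : ℂ → ℂ} {ρ B : ℝ} (hρ : 0 < ρ)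
    (hf : ∀ w, ‖w‖ ≤ ρ → DifferentiableAt ℂ f w ∧ ‖f w‖ ≤ B) {g : ℂ} (hg : ‖f g‖ ≤ B) (J : ℕ) :
    ‖f g - ∑ j ∈ Finset.range J, taylorCoeff f j * g ^ j‖ ≤ 3 * B * (2 * (‖g‖ / ρ)) ^ J := by
  set q := ‖g‖ / ρ with hq
  have hq0 : 0 ≤ q := by positivity
  have hB : 0 ≤ B := (norm_nonneg _).trans hg
  have hterm : ∀ j, ‖taylorCoeff f j * g ^ j‖ ≤ B * q ^ j := by
    intro j
    rw [norm_mul, norm_pow]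
    calc ‖taylorCoeff f j‖ * ‖g‖ ^ j ≤ B / ρ ^ j * ‖g‖ ^ j := by
          gcongr; exact norm_taylorCoeff_le hρ hf j
      _ = B * q ^ j := by rw [hq, div_pow]; ring
  rcases le_or_gt q (1 / 2) with h | h
  · have hmem : g ∈ Metric.ball (0 : ℂ) ρ := by
      rw [mem_ball_zero_iff]
      rw [hq, div_le_iff₀ hρ] at h
      linarith
    have h1 : HasSum (fun j => taylorCoeff f j * g ^ j) (f g) := by
      have := Complex.hasSum_taylorSeries_on_ball (f := f) (c := 0) (r := ρ) (fun w hw =>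
        (hf w (mem_ball_zero_iff.1 hw).le).1.differentiableWithinAt) hmem
      refine this.congr_fun fun j => ?_
      simp only [taylorCoeff, smul_eq_mul, sub_zero]
      ring
    have h2 := (hasSum_nat_add_iff' J).2 h1
    have h3 : HasSum (fun j => B * q ^ J * q ^ j) (B * q ^ J * (1 - q)⁻¹) :=
      (hasSum_geometric_of_lt_one hq0 (by linarith)).mul_left _
    have h4 := h2.norm_le_of_bounded h3 fun j => (hterm (j + J)).trans_eq (by ring)
    refine h4.trans ?_
    have h5 : (1 - q)⁻¹ ≤ 2 := by
      rw [inv_le_comm₀ (by linarith) two_pos]; linarith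
    have h6 : 0 ≤ (1 - q)⁻¹ := inv_nonneg.2 (by linarith)
    calc B * q ^ J * (1 - q)⁻¹ ≤ B * (2 * q) ^ J * 3 := by gcongr <;> linarith
      _ = _ := by ring
  · have h1 : ‖∑ j ∈ Finset.range J, taylorCoeff f j * g ^ j‖ ≤ 2 * B * (2 * q) ^ J := by
      refine (norm_sum_le _ _).trans ?_
      calc ∑ j ∈ Finset.range J, ‖taylorCoeff f j * g ^ j‖
          ≤ ∑ j ∈ Finset.range J, B * (2 * q) ^ J * (1 / (2 : ℝ)) ^ j := by
            refine Finset.sum_le_sum fun j hj => (hterm j).trans ?_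
            have h2 : (2 * q) ^ j ≤ (2 * q) ^ J :=
              pow_le_pow_right₀ (by linarith) (Finset.mem_range.1 hj).le
            calc B * q ^ j = B * (2 * q) ^ j * (1 / 2) ^ j := by
                  rw [mul_assoc, ← mul_pow]; congr 2; ring
              _ ≤ _ := by gcongr
        _ = B * (2 * q) ^ J * ∑ j ∈ Finset.range J, (1 / (2 : ℝ)) ^ j := by rw [Finset.mul_sum]
        _ ≤ B * (2 * q) ^ J * 2 := by gcongr; exact sum_geometric_two_le J
        _ = _ := by ring
    have h2 : ‖f g‖ ≤ B * (2 * q) ^ J :=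
      hg.trans (le_mul_of_one_le_right hB (one_le_pow₀ (by linarith)))
    calc _ ≤ _ := norm_sub_le _ _
      _ ≤ B * (2 * q) ^ J + 2 * B * (2 * q) ^ J := add_le_add h2 h1
      _ = _ := by ring

/-- The Taylor remainder of a function whose domain of holomorphy has a radius of order `1 / X`, at
a point `g` that need not lie in that disk. -/
theorem norm_sub_taylor_le {f : ℂ → ℂ} {X B : ℝ} (hX : 0 ≤ X)
    (hf : ∀ w, ‖w‖ * X < 1 / 4 → DifferentiableAt ℂ f w ∧ ‖f w‖ ≤ B) {g : ℂ} (hg : ‖f g‖ ≤ B)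
    (J : ℕ) :
    ‖f g - ∑ j ∈ Finset.range J, taylorCoeff f j * g ^ j‖ ≤ 3 * B * (16 * X * ‖g‖) ^ J := by
  -- the disk of radius `1 / (8 (X + ε))`, and `ε → 0`, which includes the case `X = 0`
  have h1 : ∀ ε : ℝ, 0 < ε → ‖f g - ∑ j ∈ Finset.range J, taylorCoeff f j * g ^ j‖ ≤
      3 * B * (16 * (X + ε) * ‖g‖) ^ J := by
    intro ε hε
    have hp : 0 < X + ε := by linarith
    have := norm_sub_taylor_le_of_pos (ρ := 1 / (8 * (X + ε))) (by positivity) (fun w hw => hf w ?_)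
      hg J
    · refine this.trans_eq ?_
      congr 2
      field_simp
      ring
    · calc ‖w‖ * X ≤ 1 / (8 * (X + ε)) * (X + ε) := by gcongr; linarith
        _ = 1 / 8 := by field_simp
        _ < 1 / 4 := by norm_num
  have h2 : Tendsto (fun ε : ℝ => 3 * B * (16 * (X + ε) * ‖g‖) ^ J) (𝓝[>] 0)
      (𝓝 (3 * B * (16 * (X + 0) * ‖g‖) ^ J)) := by
    refine Tendsto.mono_left (Continuous.tendsto ?_ 0) nhdsWithin_le_nhds
    fun_prop
  rw [add_zero] at h2
  exact ge_of_tendsto h2 (eventually_nhdsWithin_of_forall h1)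

theorem taylorCoeff_comp_neg (f : ℂ → ℂ) (j : ℕ) :
    taylorCoeff (fun g => f (-g)) j = (-1) ^ j * taylorCoeff f j := by
  rw [taylorCoeff, iteratedDeriv_comp_neg, taylorCoeff, neg_zero, smul_eq_mul]
  ring

/-! ### Gaussian expectations of functions of the field and the coupling -/

section FieldFamily

variable {n N : ℕ}

/-- The joint law of the Hermitian fields with covariance `S`, in coordinates. -/
abbrev fieldGaussian (N : ℕ) (S : Matrix (Fin n) (Fin n) ℝ) :
    Measure (EuclideanSpace ℝ (Fin n × (Fin N × Fin N))) :=
  multivariateGaussian 0 (S ⊗ₖ (1 : Matrix (Fin N × Fin N) (Fin N × Fin N) ℝ))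

/-- Each single field has the standard law, whatever its covariances with the other fields. -/
theorem fieldGaussian_marginal {S : Matrix (Fin n) (Fin n) ℝ} (hS : S.PosSemidef)
    (v : Fin n) (hd : S v v = 1) {h : (Fin N × Fin N → ℝ) → ℂ} (hc : Continuous h) :
    ∫ x, h (fun ij => x.ofLp (v, ij)) ∂(fieldGaussian N S) =
      ∫ x, h x ∂(stdGaussianPi (Fin N × Fin N)) := by
  obtain ⟨A, hA⟩ := exists_eq_mul_transpose (posSemidef_kronecker_one (N := N) hS)
  set Av : Matrix (Fin N × Fin N) (Fin n × (Fin N × Fin N)) ℝ :=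
    A.submatrix (fun ij => (v, ij)) id with hAv
  have h1 : Av * Avᵀ = 1 := by
    have : Av * Avᵀ = (A * Aᵀ).submatrix (fun ij => (v, ij)) fun ij => (v, ij) := rfl
    rw [this, ← hA]
    ext a b
    simp [hd]
  have h2 := gaussianMean_mul_transpose A (f := fun x => h fun ij => x (v, ij)) (by fun_prop)
  have h3 := gaussianMean_mul_transpose Av hc
  have h4 := gaussianMean_mul_transpose (1 : Matrix (Fin N × Fin N) (Fin N × Fin N) ℝ) hc
  rw [Matrix.transpose_one, Matrix.mul_one] at h4
  simp only [Matrix.one_mulVec] at h4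
  rw [h1, h4] at h3
  rw [← hA] at h2
  exact h2.trans h3.symm

theorem measurePreserving_neg_fieldGaussian {S : Matrix (Fin n) (Fin n) ℝ} (hS : S.PosSemidef) :
    MeasurePreserving (fun x => -x) (fieldGaussian N S) (fieldGaussian N S) := by
  refine ⟨measurable_neg, ?_⟩
  obtain ⟨A, hA⟩ := exists_eq_mul_transpose (posSemidef_kronecker_one (N := N) hS)
  have h1 := map_mulVec_stdGaussianPi A
  have h2 := map_mulVec_stdGaussianPi (-A)
  rw [Matrix.transpose_neg, neg_mul_neg, ← hA] at h2
  rw [← hA] at h1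
  have hm : Measurable fun ξ : Fin n × (Fin N × Fin N) → ℝ =>
      (WithLp.toLp 2 (A *ᵥ ξ) : EuclideanSpace ℝ (Fin n × (Fin N × Fin N))) := by
    have : Continuous fun ξ : Fin n × (Fin N × Fin N) → ℝ => A *ᵥ ξ := by fun_prop
    fun_prop
  conv_lhs => rw [fieldGaussian, ← h1, Measure.map_map measurable_neg hm]
  rw [fieldGaussian, ← h2]
  congr 1
  ext ξ : 1
  simp only [Function.comp_apply, Matrix.neg_mulVec]
  rfl

theorem integral_eq_zero_of_odd {S : Matrix (Fin n) (Fin n) ℝ} (hS : S.PosSemidef)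
    {c : EuclideanSpace ℝ (Fin n × (Fin N × Fin N)) → ℂ} (hc : ∀ x, c (-x) = -c x) :
    ∫ x, c x ∂(fieldGaussian N S) = 0 := by
  have h1 := (measurePreserving_neg_fieldGaussian (N := N) hS).integral_comp
    (MeasurableEquiv.neg _).measurableEmbedding c
  simp only [hc, integral_neg] at h1
  exact self_eq_neg.1 h1.symm

theorem integrable_norm_fields_pow {S : Matrix (Fin n) (Fin n) ℝ} (hS : S.PosSemidef) (k : ℕ) :
    Integrable (fun x : EuclideanSpace ℝ (Fin n × (Fin N × Fin N)) => ‖fieldsCLM n N x.ofLp‖ ^ k)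
      (fieldGaussian N S) := by
  have h1 := integrable_multivariateGaussian (posSemidef_kronecker_one (N := N) hS)
    (f := fun x => ((‖fieldsCLM n N x‖ ^ k : ℝ) : ℂ)) (by fun_prop)
    ⟨‖fieldsCLM n N‖ ^ k, k, fun x => by
      rw [Complex.norm_real, Real.norm_of_nonneg (by positivity), ← mul_pow]
      gcongr
      exact ((fieldsCLM n N).le_opNorm x).trans (by gcongr; linarith [norm_nonneg x])⟩
  exact h1.re

/-- The moments of the largest norm of the fields are at most the sum of the moments of the norms. -/
theorem integral_norm_fields_pow_le (hn : 1 ≤ n) (hN : 1 ≤ N) {S : Matrix (Fin n) (Fin n) ℝ}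
    (hS : S.PosSemidef) (hd : ∀ v, S v v = 1) (m : ℕ) :
    ∫ x : EuclideanSpace ℝ (Fin n × (Fin N × Fin N)), ‖fieldsCLM n N x.ofLp‖ ^ (2 * m)
      ∂(fieldGaussian N S) ≤ n * (75 * (50 * N) ^ m * m !) := by
  have hN' : (0 : ℝ) < N := by exact_mod_cast hN
  have hc := continuous_hermitianOfCoords (N := N)
  have hmarg : ∀ v, ∫ x : EuclideanSpace ℝ (Fin n × (Fin N × Fin N)),
      ‖fieldsCLM n N x.ofLp v‖ ^ (2 * m) ∂(fieldGaussian N S) ≤ 75 * (50 * N) ^ m * m ! := by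
    intro v
    have h1 := fieldGaussian_marginal hS v (hd v)
      (h := fun x : Fin N × Fin N → ℝ => ((‖hermitianOfCoords x‖ ^ (2 * m) : ℝ) : ℂ)) (by fun_prop)
    rw [integral_complex_ofReal, integral_complex_ofReal, Complex.ofReal_inj] at h1
    exact h1.trans_le (integral_norm_pow_le hN m).2
  have hint : ∀ v, Integrable (fun x : EuclideanSpace ℝ (Fin n × (Fin N × Fin N)) =>
      ‖fieldsCLM n N x.ofLp v‖ ^ (2 * m)) (fieldGaussian N S) := fun v => by
    refine (integrable_norm_fields_pow hS (2 * m)).mono' (Continuous.aestronglyMeasurable ?_)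
      (Eventually.of_forall fun x => ?_)
    · fun_prop
    · rw [Real.norm_of_nonneg (by positivity)]
      gcongr
      exact norm_le_pi_norm _ v
  have hle : ∀ x : EuclideanSpace ℝ (Fin n × (Fin N × Fin N)), ‖fieldsCLM n N x.ofLp‖ ^ (2 * m) ≤
      ∑ v, ‖fieldsCLM n N x.ofLp v‖ ^ (2 * m) := by
    intro x
    obtain ⟨v, -, hv⟩ := Finset.exists_max_image Finset.univ (fun v => ‖fieldsCLM n N x.ofLp v‖)
      ⟨⟨0, hn⟩, Finset.mem_univ _⟩
    have h1 : ‖fieldsCLM n N x.ofLp‖ ≤ ‖fieldsCLM n N x.ofLp v‖ :=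
      (pi_norm_le_iff_of_nonneg (norm_nonneg _)).2 fun w => hv w (Finset.mem_univ _)
    refine le_trans (by gcongr) (Finset.single_le_sum
      (f := fun v => ‖fieldsCLM n N x.ofLp v‖ ^ (2 * m)) (fun _ _ => by positivity)
      (Finset.mem_univ v))
  refine (integral_mono (integrable_norm_fields_pow hS _) (integrable_finsetSum _ fun v _ => hint v)
    hle).trans ?_
  rw [integral_finsetSum _ fun v _ => hint v]
  refine (Finset.sum_le_sum fun v _ => hmarg v).trans_eq ?_
  simp

/-- A family of functions of Hermitian fields `σ` and of a coupling `g`, holomorphic in `g` where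
`log (1 + i g σ v)` is defined for all `v`, with a bound that is at most linear in `g σ`. -/
structure FieldFamily (n N : ℕ) (B : ℝ) (F : ℂ → (Fin n → Matrix (Fin N) (Fin N) ℂ) → ℂ) :
    Prop where
  differentiableAt : ∀ g σ, (∀ v, (Complex.I * g) • σ v ∈ logDomain (Fin N)) →
    DifferentiableAt ℂ (fun g => F g σ) g
  norm_le : ∀ g σ, (∀ v, (Complex.I * g) • σ v ∈ logDomain (Fin N)) →
    ‖F g σ‖ ≤ B * (1 + ‖g‖ * ‖σ‖)
  tame : ∀ g : ℂ, ‖g‖ ≤ 2 * g.re → Tame (hermTuples n N) (tubeRadius g) (F g)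
  neg : ∀ g σ, F (-g) σ = F g (-σ)
  nonneg : 0 ≤ B

theorem mem_logDomain_of_small {g : ℂ} {A : Matrix (Fin N) (Fin N) ℂ} (h : ‖g‖ * ‖A‖ < 1 / 4) :
    (Complex.I * g) • A ∈ logDomain (Fin N) := by
  have h0 : (0 : Matrix (Fin N) (Fin N) ℂ) ∈ resolventSet₂ (Fin N) := by
    have := mem_resolventSet₂ (N := N) (g := 0) (by simp) (σ := 0) (by simp [Matrix.IsHermitian])
    simpa using this
  refine Metric.mem_thickening_iff.2 ⟨0, h0, ?_⟩
  rw [dist_zero_right, norm_smul, norm_mul, Complex.norm_I, one_mul]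
  exact h

theorem mem_logDomain_of_hermitian {g : ℂ} (hg : ‖g‖ ≤ 2 * g.re)
    {σ : Fin n → Matrix (Fin N) (Fin N) ℂ} (hσ : σ ∈ hermTuples n N) (v : Fin n) :
    (Complex.I * g) • σ v ∈ logDomain (Fin N) :=
  mem_logDomain_of_mem_tube hg (hermTuples_subset_tube _ _ _ hσ) v

variable {B : ℝ} {F : ℂ → (Fin n → Matrix (Fin N) (Fin N) ℂ) → ℂ}

/-- For `N |g|² ≤ 1` the bound is uniform in `g`, at the price of a square of the field. -/
theorem FieldFamily.norm_le_of_sector (hF : FieldFamily n N B F) (hN : 1 ≤ N) {g : ℂ}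
    (hg : ‖g‖ ≤ 2 * g.re) (hgN : N * ‖g‖ ^ 2 ≤ 1) {σ : Fin n → Matrix (Fin N) (Fin N) ℂ}
    (hσ : σ ∈ hermTuples n N) : ‖F g σ‖ ≤ B * (2 + ‖σ‖ ^ 2 / N) := by
  have hN' : (0 : ℝ) < N := by exact_mod_cast hN
  refine (hF.norm_le g σ fun v => mem_logDomain_of_hermitian hg hσ v).trans ?_
  have h1 : ‖g‖ ^ 2 ≤ 1 / N := by rw [le_div_iff₀ hN']; linarith
  have h2 : (‖g‖ * ‖σ‖) ^ 2 ≤ ‖σ‖ ^ 2 / N := by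
    rw [mul_pow]
    calc ‖g‖ ^ 2 * ‖σ‖ ^ 2 ≤ 1 / N * ‖σ‖ ^ 2 := by gcongr
      _ = _ := by ring
  exact mul_le_mul_of_nonneg_left (by nlinarith [sq_nonneg (‖g‖ * ‖σ‖ - 1)]) hF.nonneg

/-- The Taylor remainder in the coupling at fixed fields. For small `‖g‖ ‖σ‖` the logarithm is
defined in a whole disk of couplings; at larger couplings the sector provides the bound. -/
theorem FieldFamily.norm_sub_taylor_le (hF : FieldFamily n N B F) (hN : 1 ≤ N) {g : ℂ}
    (hg : ‖g‖ ≤ 2 * g.re) (hgN : N * ‖g‖ ^ 2 ≤ 1) {σ : Fin n → Matrix (Fin N) (Fin N) ℂ}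
    (hσ : σ ∈ hermTuples n N) (J : ℕ) :
    ‖F g σ - ∑ j ∈ Finset.range J, taylorCoeff (fun g => F g σ) j * g ^ j‖ ≤
      3 * (B * (2 + ‖σ‖ ^ 2 / N)) * (16 * ‖σ‖) ^ J * ‖g‖ ^ J := by
  have h := _root_.norm_sub_taylor_le (f := fun g => F g σ) (X := ‖σ‖) (B := B * (2 + ‖σ‖ ^ 2 / N))
    (norm_nonneg _) (fun w hw => ?_) (hF.norm_le_of_sector hN hg hgN hσ) J
  · rwa [mul_pow, ← mul_assoc] at h
  · have hmem : ∀ v, (Complex.I * w) • σ v ∈ logDomain (Fin N) := fun v =>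
      mem_logDomain_of_small (lt_of_le_of_lt (by gcongr; exact norm_le_pi_norm σ v) hw)
    refine ⟨hF.differentiableAt w σ hmem, (hF.norm_le w σ hmem).trans ?_⟩
    have h0 : 0 ≤ ‖σ‖ ^ 2 / N := by positivity
    exact mul_le_mul_of_nonneg_left (by linarith) hF.nonneg

theorem sum_range_two_mul_of_odd {c : ℕ → ℂ} (hc : ∀ j, Odd j → c j = 0) (g : ℂ) (m : ℕ) :
    ∑ j ∈ Finset.range (2 * m), c j * g ^ j = ∑ k ∈ Finset.range m, c (2 * k) * (g ^ 2) ^ k := by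
  induction m with
  | zero => simp
  | succ m ih =>
    rw [show 2 * (m + 1) = 2 * m + 1 + 1 by ring, Finset.sum_range_succ, Finset.sum_range_succ, ih,
      Finset.sum_range_succ, hc (2 * m + 1) ⟨m, rfl⟩, ← pow_mul]
    ring

/-- The couplings `z` for which the expansions hold. -/
theorem coupling_mem {z : ℂ} (hN : 1 ≤ N) (hz : 0 < z.re) (hz' : ‖z‖ ≤ 1 / 2) :
    ‖Complex.sqrt (2 * z / (N : ℂ))‖ ≤ 2 * (Complex.sqrt (2 * z / (N : ℂ))).re ∧
      N * ‖Complex.sqrt (2 * z / (N : ℂ))‖ ^ 2 ≤ 1 := by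
  have hN' : (0 : ℝ) < N := by exact_mod_cast hN
  refine ⟨(sqrt_mem_sector (coupling_re_pos hN hz)).2, ?_⟩
  rw [norm_coupling hN hz, mul_div_cancel₀ _ hN'.ne']
  linarith

theorem FieldFamily.integrable_bound (B : ℝ) {S : Matrix (Fin n) (Fin n) ℝ}
    (hS : S.PosSemidef) (J : ℕ) :
    Integrable (fun x : EuclideanSpace ℝ (Fin n × (Fin N × Fin N)) =>
      3 * (B * (2 + ‖fieldsCLM n N x.ofLp‖ ^ 2 / N)) * (16 * ‖fieldsCLM n N x.ofLp‖) ^ J)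
      (fieldGaussian N S) := by
  have h1 := ((integrable_norm_fields_pow (N := N) hS J).const_mul (6 * B * 16 ^ J)).add
    ((integrable_norm_fields_pow (N := N) hS (J + 2)).const_mul (3 * B / N * 16 ^ J))
  refine h1.congr (Eventually.of_forall fun x => ?_)
  simp only [Pi.add_apply, mul_pow]
  ring

/-- The Gaussian expectation of a field family has a Borel summable expansion: its Taylor
remainder of order `2 m` in the coupling involves `⟨‖σ‖ ^ (2 m)⟩`, of order `N ^ m m!`, and the odd
orders vanish by the symmetry `σ → -σ`. -/
theorem FieldFamily.exists_expansion (hF : FieldFamily n N B F) (hn : 1 ≤ n) (hN : 1 ≤ N)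
    {S : Matrix (Fin n) (Fin n) ℝ} (hS : S.PosSemidef) (hd : ∀ v, S v v = 1) :
    ∃ C : ℕ → ℂ, ∀ m z, 0 < z.re → ‖z‖ ≤ 1 / 2 →
      ‖fieldMean N S (F (Complex.sqrt (2 * z / (N : ℂ)))) - ∑ k ∈ Finset.range m, C k * z ^ k‖ ≤
        11700 * B * n * m ! * 51200 ^ m * ‖z‖ ^ m := by
  have hN' : (0 : ℝ) < N := by exact_mod_cast hN
  have hB := hF.nonneg
  set c : ℕ → EuclideanSpace ℝ (Fin n × (Fin N × Fin N)) → ℂ := fun j x =>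
    taylorCoeff (fun g => F g (fieldsCLM n N x.ofLp)) j with hc
  set b : ℕ → EuclideanSpace ℝ (Fin n × (Fin N × Fin N)) → ℝ := fun J x =>
    3 * (B * (2 + ‖fieldsCLM n N x.ofLp‖ ^ 2 / N)) * (16 * ‖fieldsCLM n N x.ofLp‖) ^ J with hb
  have key := asymptotic_integral (μ := fieldGaussian N S)
    (S := {g : ℂ | ‖g‖ ≤ 2 * g.re ∧ N * ‖g‖ ^ 2 ≤ 1}) (δ := 1 / N) (by positivity) ?_
    (f := fun g x => F g (fieldsOfCoords x)) (c := c) (b := b)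
    (fun g hg => ((hF.tame g hg.1).integrable (tubeRadius_pos g) hS).aestronglyMeasurable)
    (Eventually.of_forall fun x J g hg =>
      hF.norm_sub_taylor_le hN hg.1 hg.2 (fieldsCLM_mem n N x.ofLp) J)
    (fun J => FieldFamily.integrable_bound B hS J)
  · have hodd : ∀ j, Odd j → ∫ x, c j x ∂(fieldGaussian N S) = 0 := by
      intro j hj
      refine integral_eq_zero_of_odd hS fun x => ?_
      have h1 : (fun g => F g (fieldsCLM n N (-x).ofLp)) =
          fun g => (fun g => F g (fieldsCLM n N x.ofLp)) (-g) := by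
        ext g
        change F g (fieldsCLM n N (-x).ofLp) = F (-g) (fieldsCLM n N x.ofLp)
        rw [hF.neg, ← map_neg]
        rfl
      simp only [hc]
      rw [h1, taylorCoeff_comp_neg (fun g => F g (fieldsCLM n N x.ofLp)), hj.neg_one_pow, neg_one_mul]
    refine ⟨fun k => (∫ x, c (2 * k) x ∂(fieldGaussian N S)) * (2 / N) ^ k, fun m z hz hz' => ?_⟩
    obtain ⟨h1, h2⟩ := coupling_mem hN hz hz'
    have h3 := key.2 (2 * m) _ ⟨h1, h2⟩
    rw [sum_range_two_mul_of_odd hodd, (sqrt_mem_sector (coupling_re_pos hN hz)).1, pow_mul,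
      norm_coupling hN hz] at h3
    have h4 : ∀ k, (2 * z / (N : ℂ)) ^ k = (2 / N) ^ k * z ^ k := fun k => by
      rw [← mul_pow]; congr 1; ring
    simp_rw [h4, ← mul_assoc] at h3
    refine h3.trans ?_
    have hm1 := integral_norm_fields_pow_le hn hN hS hd m
    have hm2 := integral_norm_fields_pow_le hn hN hS hd (m + 1)
    -- `11700 = 6 · 75 + 3 · 75 · 50` from the two terms of the bound, `25600 = 16² · 50 · 2`
    have hbint : ∫ x, b (2 * m) x ∂(fieldGaussian N S) ≤
        11700 * B * n * m ! * (25600 * N) ^ m := by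
      have e1 : ∀ x, b (2 * m) x = 6 * B * 256 ^ m * ‖fieldsCLM n N x.ofLp‖ ^ (2 * m) +
          3 * B / N * 256 ^ m * ‖fieldsCLM n N x.ofLp‖ ^ (2 * (m + 1)) := by
        intro x
        have : ((16 : ℝ) ^ (2 * m)) = 256 ^ m := by rw [pow_mul]; norm_num
        simp only [hb, mul_pow, this]
        ring
      simp_rw [e1]
      rw [integral_add ((integrable_norm_fields_pow hS _).const_mul _)
        ((integrable_norm_fields_pow hS _).const_mul _), integral_const_mul, integral_const_mul]
      have hfac : ((m + 1)! : ℝ) ≤ 2 ^ m * m ! := by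
        rw [Nat.factorial_succ]
        push_cast
        gcongr
        exact_mod_cast Nat.lt_two_pow_self (n := m)
      have h5 : (1 : ℝ) ≤ 2 ^ m := one_le_pow₀ (by norm_num)
      calc 6 * B * 256 ^ m * _ + 3 * B / N * 256 ^ m * _
          ≤ 6 * B * 256 ^ m * (n * (75 * (50 * N) ^ m * (2 ^ m * m !))) +
            3 * B / N * 256 ^ m * (n * (75 * (50 * N) ^ (m + 1) * (2 ^ m * m !))) := by
            gcongr
            · refine hm1.trans ?_
              gcongr
              exact le_mul_of_one_le_left (by positivity) h5
            · refine hm2.trans ?_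
              gcongr
        _ = 11700 * B * n * m ! * (256 ^ m * (50 * N) ^ m * 2 ^ m) := by
            field_simp
            ring
        _ = _ := by rw [← mul_pow, ← mul_pow]; congr 2; ring
    -- the power of `N` from the moments cancels against the one in the coupling
    calc _ ≤ 11700 * B * n * m ! * (25600 * N) ^ m * (2 * ‖z‖ / N) ^ m := by gcongr
      _ = 11700 * B * n * m ! * ((25600 * N) * (2 * ‖z‖ / N)) ^ m := by rw [mul_pow (25600 * (N : ℝ))]; ring
      _ = 11700 * B * n * m ! * (51200 * ‖z‖) ^ m := by congr 2; field_simp; ring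
      _ = _ := by rw [mul_pow]; ring
  · intro s hs hs'
    have h1 : (1 : ℝ) / N ≤ 1 := by
      rw [div_le_one hN']; exact_mod_cast hN
    rw [lt_div_iff₀ hN'] at hs'
    refine ⟨?_, ?_⟩
    · rw [Complex.norm_real, Real.norm_of_nonneg hs.le, Complex.ofReal_re]
      linarith
    · rw [Complex.norm_real, Real.norm_of_nonneg hs.le]
      have hs1 : s ≤ 1 := by
        have : (1 : ℝ) ≤ N := by exact_mod_cast hN
        nlinarith
      nlinarith

theorem FieldFamily.differentiableOn_fieldMean (hF : FieldFamily n N B F) (hN : 1 ≤ N)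
    {S : Matrix (Fin n) (Fin n) ℝ} (hS : S.PosSemidef) :
    DifferentiableOn ℂ (fun z : ℂ => fieldMean N S (F (Complex.sqrt (2 * z / (N : ℂ)))))
      {z : ℂ | 0 < z.re ∧ ‖z‖ < 1 / 2} := by
  refine differentiableOn_integral_of_dominated
    (isOpen_re_pos.inter (isOpen_lt continuous_norm continuous_const)) ?_
    (Eventually.of_forall fun x z hz => ?_) (FieldFamily.integrable_bound B hS 0)
    (Eventually.of_forall fun x z hz => ?_)
  · intro z hz
    obtain ⟨h1, -⟩ := coupling_mem hN hz.1 (le_of_lt hz.2)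
    exact ((hF.tame _ h1).integrable (tubeRadius_pos _) hS).aestronglyMeasurable
  · obtain ⟨h1, h2⟩ := coupling_mem hN hz.1 (le_of_lt hz.2)
    refine (hF.norm_le_of_sector hN h1 h2 (fieldsCLM_mem n N x.ofLp)).trans ?_
    have := hF.nonneg
    have h3 : 0 ≤ B * (2 + ‖fieldsCLM n N x.ofLp‖ ^ 2 / N) := by positivity
    rw [pow_zero, mul_one]
    linarith
  · obtain ⟨h1, -⟩ := coupling_mem hN hz.1 (le_of_lt hz.2)
    have h3 := hF.differentiableAt (Complex.sqrt (2 * z / (N : ℂ))) (fieldsOfCoords x)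
      fun v => mem_logDomain_of_hermitian h1 (fieldsCLM_mem n N x.ofLp) v
    exact (h3.comp z (differentiableAt_coupling hN hz.1)).differentiableWithinAt

/-- The same expansion after an average over covariances. -/
theorem FieldFamily.exists_expansion_average {W : Type*} [MeasurableSpace W] {ν : Measure W}
    [IsProbabilityMeasure ν] (hF : FieldFamily n N B F) (hn : 1 ≤ n) (hN : 1 ≤ N)
    {S : W → Matrix (Fin n) (Fin n) ℝ} (hS : ∀ᵐ w ∂ν, (S w).PosSemidef ∧ ∀ v, S w v v = 1)
    (hm : ∀ g : ℂ, ‖g‖ ≤ 2 * g.re → AEStronglyMeasurable (fun w => fieldMean N (S w) (F g)) ν) :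
    DifferentiableOn ℂ (fun z : ℂ => ∫ w, fieldMean N (S w) (F (Complex.sqrt (2 * z / (N : ℂ)))) ∂ν)
      {z : ℂ | 0 < z.re ∧ ‖z‖ < 1 / 2} ∧
    ∃ C : ℕ → ℂ, ∀ m z, 0 < z.re → ‖z‖ ≤ 1 / 2 →
      ‖∫ w, fieldMean N (S w) (F (Complex.sqrt (2 * z / (N : ℂ)))) ∂ν -
        ∑ k ∈ Finset.range m, C k * z ^ k‖ ≤ 11700 * B * n * m ! * 51200 ^ m * ‖z‖ ^ m := by
  have hexp : ∀ w, ∃ C : ℕ → ℂ, ((S w).PosSemidef ∧ ∀ v, S w v v = 1) → ∀ m z, 0 < z.re →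
      ‖z‖ ≤ 1 / 2 →
      ‖fieldMean N (S w) (F (Complex.sqrt (2 * z / (N : ℂ)))) - ∑ k ∈ Finset.range m, C k * z ^ k‖ ≤
        11700 * B * n * m ! * 51200 ^ m * ‖z‖ ^ m := by
    intro w
    by_cases h : (S w).PosSemidef ∧ ∀ v, S w v v = 1
    · obtain ⟨C, hC⟩ := hF.exists_expansion hn hN h.1 h.2
      exact ⟨C, fun _ => hC⟩
    · exact ⟨0, fun h' => absurd h' h⟩
  choose C hC using hexp
  have hmeas : ∀ z : ℂ, 0 < z.re → AEStronglyMeasurable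
      (fun w => fieldMean N (S w) (F (Complex.sqrt (2 * z / (N : ℂ))))) ν := fun z hz =>
    hm _ (sqrt_mem_sector (coupling_re_pos hN hz)).2
  constructor
  · refine differentiableOn_integral_of_dominated
      (isOpen_re_pos.inter (isOpen_lt continuous_norm continuous_const))
      (bound := fun _ => 11700 * B * n) (fun z hz => hmeas z hz.1) ?_ (integrable_const _) ?_
    · filter_upwards [hS] with w hw z hz
      simpa using hC w hw 0 z hz.1 (le_of_lt hz.2)
    · filter_upwards [hS] with w hw using hF.differentiableOn_fieldMean hN hw.1
  · have key := asymptotic_integral (μ := ν) (S := {z : ℂ | 0 < z.re ∧ ‖z‖ ≤ 1 / 2}) (δ := 1 / 2)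
      (by norm_num) (fun s hs hs' => ⟨by simpa using hs, by
        rw [Complex.norm_real, Real.norm_of_nonneg hs.le]; exact hs'.le⟩)
      (f := fun z w => fieldMean N (S w) (F (Complex.sqrt (2 * z / (N : ℂ)))))
      (c := fun k w => C w k) (b := fun m _ => 11700 * B * n * m ! * 51200 ^ m)
      (fun z hz => hmeas z hz.1) ?_ (fun m => integrable_const _)
    · refine ⟨fun k => ∫ w, C w k ∂ν, fun m z hz hz' => ?_⟩
      have := key.2 m z ⟨hz, hz'⟩
      simpa using this
    · filter_upwards [hS] with w hw m z hz using hC w hw m z hz.1 hz.2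

end FieldFamily

end

noncomputable section
open scoped ContDiff Matrix.Norms.L2Operator

/-! ### Words of a growing tree -/

section Words

variable {α : Type*} [DecidableEq α]

/-- The words obtained from a word by replacing one letter `p` by `p v p`. -/
def insertions (p v : α) : List α → List (List α)
  | [] => []
  | x :: xs => (if x = p then [p :: v :: p :: xs] else []) ++ (insertions p v xs).map (x :: ·)

theorem length_insertions (p v : α) (W : List α) : (insertions p v W).length = W.count p := by
  induction W with
  | nil => rfl
  | cons x xs ih =>
    rw [insertions, List.length_append, List.length_map, ih, List.count_cons]
    by_cases h : x = p <;> simp [h, add_comm]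

theorem length_of_mem_insertions {p v : α} {W W' : List α} (h : W' ∈ insertions p v W) :
    W'.length = W.length + 2 := by
  induction W generalizing W' with
  | nil => simp [insertions] at h
  | cons x xs ih =>
    rw [insertions, List.mem_append, List.mem_map] at h
    rcases h with h | ⟨W'', h, rfl⟩
    · split_ifs at h with hx
      · rw [List.mem_singleton.1 h]; simp
      · simp at h
    · simp [ih h]

theorem count_of_mem_insertions {p v : α} {W W' : List α} (h : W' ∈ insertions p v W) (x : α) :
    W'.count x = W.count x + (if p = x then 1 else 0) + (if v = x then 1 else 0) := by
  induction W generalizing W' with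
  | nil => simp [insertions] at h
  | cons y ys ih =>
    rw [insertions, List.mem_append, List.mem_map] at h
    rcases h with h | ⟨W'', h, rfl⟩
    · split_ifs at h with hy
      · rw [List.mem_singleton.1 h, hy]
        simp only [List.count_cons, beq_iff_eq]
        omega
      · simp at h
    · simp only [List.count_cons, ih h]
      omega

/-- `L` lists the lines of a tree that grows from the root `r`, the last grown line first: each
line `(p, v)` joins a vertex `p` of the tree to a new vertex `v`. -/
inductive IsGrowth (r : α) : List (α × α) → Prop
  | nil : IsGrowth r []
  | cons {p v : α} {L : List (α × α)} (h : IsGrowth r L) (hp : p ∈ r :: L.map Prod.snd)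
      (hv : v ∉ r :: L.map Prod.snd) : IsGrowth r ((p, v) :: L)

/-- The words of a growing tree with at least one line: closed walks around the tree. -/
def treeWords : List (α × α) → List (List α)
  | [] => []
  | [(p, v)] => [[p, v]]
  | (p, v) :: e :: L => (treeWords (e :: L)).flatMap (insertions p v)

theorem IsGrowth.length_of_mem {r : α} {L : List (α × α)} (h : IsGrowth r L) {W : List α}
    (hW : W ∈ treeWords L) : W.length = 2 * L.length := by
  induction h generalizing W with
  | nil => simp [treeWords] at hW
  | @cons p v L h hp hv ih =>
    cases L with
    | nil => simp only [treeWords, List.mem_singleton] at hW; simp [hW]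
    | cons e L =>
      obtain ⟨W', hW', h'⟩ := List.mem_flatMap.1 hW
      rw [length_of_mem_insertions h', ih hW', List.length_cons (a := (p, v))]
      ring

theorem IsGrowth.subset {r : α} {L : List (α × α)} (h : IsGrowth r L) {W : List α}
    (hW : W ∈ treeWords L) {x : α} (hx : x ∈ W) : x ∈ r :: L.map Prod.snd := by
  induction h generalizing W x with
  | nil => simp [treeWords] at hW
  | @cons p v L h hp hv ih =>
    have hsub : ∀ y, y ∈ r :: L.map Prod.snd → y ∈ r :: ((p, v) :: L).map Prod.snd := by
      intro y hy
      simp only [List.mem_cons, List.map_cons] at hy ⊢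
      tauto
    cases L with
    | nil =>
      simp only [treeWords, List.mem_singleton] at hW
      rw [hW] at hx
      simp only [List.mem_cons, List.not_mem_nil, or_false] at hx
      rcases hx with rfl | rfl
      · exact hsub _ hp
      · simp
    | cons e L =>
      obtain ⟨W', hW', h'⟩ := List.mem_flatMap.1 hW
      have h1 := count_of_mem_insertions h' x
      have h2 := List.count_pos_iff.2 hx
      by_cases hxp : p = x
      · exact hsub _ (hxp ▸ hp)
      by_cases hxv : v = x
      · simp [hxv]
      rw [if_neg hxp, if_neg hxv] at h1
      exact hsub _ (ih hW' (List.count_pos_iff.1 (by omega)))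

/-- A walk around the tree visits a vertex at most once more often than it has children. -/
theorem IsGrowth.count_le {r : α} {L : List (α × α)} (h : IsGrowth r L) {W : List α}
    (hW : W ∈ treeWords L) (x : α) : W.count x ≤ (L.map Prod.fst).count x + 1 := by
  induction h generalizing W with
  | nil => simp [treeWords] at hW
  | @cons p v L h hp hv ih =>
    cases L with
    | nil =>
      simp only [treeWords, List.mem_singleton] at hW
      rw [hW]
      have hpv : p ≠ v := by
        rintro rfl; exact hv hp
      simp only [List.count_cons, List.count_nil, List.map_cons, List.map_nil, beq_iff_eq]
      split_ifs <;> omega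
    | cons e L =>
      obtain ⟨W', hW', h'⟩ := List.mem_flatMap.1 hW
      rw [count_of_mem_insertions h' x, List.map_cons, List.count_cons]
      have h1 := ih hW'
      simp only [beq_iff_eq]
      by_cases hxv : v = x
      · have h2 : W'.count x = 0 := List.count_eq_zero.2 fun hx => hv (hxv ▸ h.subset hW' hx)
        split_ifs <;> omega
      · split_ifs <;> omega

/-- A tree has at most `∏ k_x!` words, with `k_x` the number of children of `x`. -/
theorem IsGrowth.length_treeWords_le [Fintype α] {r : α} {L : List (α × α)} (h : IsGrowth r L) :
    (treeWords L).length ≤ ∏ x, ((L.map Prod.fst).count x)! := by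
  induction h with
  | nil => simp [treeWords]
  | @cons p v L h hp hv ih =>
    cases L with
    | nil =>
      simp only [treeWords, List.length_singleton]
      exact Finset.one_le_prod' fun x _ => Nat.one_le_iff_ne_zero.2 (Nat.factorial_ne_zero _)
    | cons e L =>
      have h1 : (treeWords ((p, v) :: e :: L)).length ≤
          (treeWords (e :: L)).length * (((e :: L).map Prod.fst).count p + 1) := by
        rw [treeWords, List.length_flatMap]
        refine (List.sum_le_card_nsmul _ _ fun k hk => ?_).trans_eq (by
          rw [List.length_map, smul_eq_mul])
        obtain ⟨W, hW, rfl⟩ := List.mem_map.1 hk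
        rw [length_insertions]
        exact h.count_le hW p
      refine h1.trans ((Nat.mul_le_mul_right _ ih).trans_eq ?_)
      rw [← Finset.mul_prod_erase _ _ (Finset.mem_univ p),
        ← Finset.mul_prod_erase (s := Finset.univ)
          (f := fun x => ((((p, v) :: e :: L).map Prod.fst).count x)!) (a := p) (Finset.mem_univ p)]
      have h2 : ∀ x, (((p, v) :: e :: L).map Prod.fst).count x =
          ((e :: L).map Prod.fst).count x + if p = x then 1 else 0 := by
        intro x
        rw [List.map_cons, List.count_cons]
        simp
      simp only [h2, if_true]
      rw [Nat.factorial_succ]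
      have h3 : ∏ x ∈ Finset.univ.erase p, (((e :: L).map Prod.fst).count x + if p = x then 1 else 0)! =
          ∏ x ∈ Finset.univ.erase p, (((e :: L).map Prod.fst).count x)! :=
        Finset.prod_congr rfl fun x hx => by rw [if_neg (Finset.ne_of_mem_erase hx).symm, add_zero]
      rw [h3]
      ring

end Words

/-! ### Line operators acting on vertices -/

section WordDerivatives

variable {n N : ℕ} {g : ℂ}

/-- The product of the resolvents of the fields along a word. -/
def resolventWord (N : ℕ) (g : ℂ) (W : List (Fin n)) (σ : Fin n → Matrix (Fin N) (Fin N) ℂ) :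
    Matrix (Fin N) (Fin N) ℂ :=
  (W.map fun v => fieldResolvent N g (σ v)).prod

/-- The derivation replacing one factor `R p` of the product of the `R x` along a word by
`R p * M * R p`. -/
def wordDerivation (p : Fin n) (R : Fin n → Matrix (Fin N) (Fin N) ℂ) (M : Matrix (Fin N) (Fin N) ℂ) :
    List (Fin n) → Matrix (Fin N) (Fin N) ℂ
  | [] => 0
  | x :: xs => (if x = p then R x * M * R x * (xs.map R).prod else 0) + R x * wordDerivation p R M xs

theorem wordDerivation_sum_smul {ι : Type*} (s : Finset ι) (p : Fin n)
    (R : Fin n → Matrix (Fin N) (Fin N) ℂ) (c : ι → ℂ) (M : ι → Matrix (Fin N) (Fin N) ℂ)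
    (W : List (Fin n)) :
    wordDerivation p R (∑ i ∈ s, c i • M i) W = ∑ i ∈ s, c i • wordDerivation p R (M i) W := by
  induction W with
  | nil => simp [wordDerivation]
  | cons x xs ih =>
    simp only [wordDerivation, ih, smul_add, Finset.sum_add_distrib, Finset.mul_sum, mul_smul_comm]
    congr 1
    split_ifs
    · simp only [Finset.sum_mul, Matrix.smul_mul]
    · simp

theorem wordDerivation_eq_sum_insertions (p v : Fin n) (R : Fin n → Matrix (Fin N) (Fin N) ℂ)
    (W : List (Fin n)) :
    wordDerivation p R (R v) W = ((insertions p v W).map fun W' => (W'.map R).prod).sum := by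
  induction W with
  | nil => simp [wordDerivation, insertions]
  | cons x xs ih =>
    rw [wordDerivation, insertions, List.map_append, List.sum_append, List.map_map, ih,
      ← List.sum_map_mul_left]
    congr 1
    · split_ifs with h
      · simp [h, mul_assoc]
      · simp

theorem add_smul_single_apply (σ : Fin n → Matrix (Fin N) (Fin N) ℂ) (v : Fin n)
    (M : Matrix (Fin N) (Fin N) ℂ) (t : ℂ) (x : Fin n) :
    (σ + t • (Pi.single v M : Fin n → Matrix (Fin N) (Fin N) ℂ)) x =
      if x = v then σ x + t • M else σ x := by
  by_cases h : x = v
  · subst h; simp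
  · simp [h]

theorem hasDerivAt_fieldResolvent {A : Matrix (Fin N) (Fin N) ℂ}
    (hA : IsUnit (1 + (Complex.I * g) • A)) (M : Matrix (Fin N) (Fin N) ℂ) :
    HasDerivAt (fun t : ℂ => fieldResolvent N g (A + t • M))
      (-(Complex.I * g) • (fieldResolvent N g A * M * fieldResolvent N g A)) 0 := by
  have h1 : HasDerivAt (fun t : ℂ => A + t • M) M 0 := by
    simpa using ((hasDerivAt_id (0 : ℂ)).smul_const M).const_add A
  have h2 := hasFDerivAt_inv_one_add_smul hA
  have h3 : HasFDerivAt (fun A : Matrix (Fin N) (Fin N) ℂ => (1 + (Complex.I * g) • A)⁻¹)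
      (-((Complex.I * g) • ContinuousLinearMap.mulLeftRight ℂ (Matrix (Fin N) (Fin N) ℂ)
        (1 + (Complex.I * g) • A)⁻¹ (1 + (Complex.I * g) • A)⁻¹)) (A + (0 : ℂ) • M) := by
    rwa [zero_smul, add_zero]
  convert! h3.comp_hasDerivAt (0 : ℂ) h1 using 1
  simp [fieldResolvent]

theorem hasDerivAt_vertex {A : Matrix (Fin N) (Fin N) ℂ} (hA : (Complex.I * g) • A ∈ logDomain (Fin N))
    (M : Matrix (Fin N) (Fin N) ℂ) :
    HasDerivAt (fun t : ℂ => vertex N g (A + t • M))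
      (-(N * (Complex.I * g)) * (fieldResolvent N g A * M).trace) 0 := by
  have h1 : HasDerivAt (fun t : ℂ => (Complex.I * g) • (A + t • M)) ((Complex.I * g) • M) 0 := by
    have h0 : HasDerivAt (fun t : ℂ => A + t • M) M 0 := by
      simpa using ((hasDerivAt_id (0 : ℂ)).smul_const M).const_add A
    exact h0.const_smul (Complex.I * g)
  have h3 : HasFDerivAt (fun A : Matrix (Fin N) (Fin N) ℂ => traceLog (1 + A))
      (traceMul (1 + (Complex.I * g) • A)⁻¹) ((Complex.I * g) • (A + (0 : ℂ) • M)) := by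
    rw [zero_smul, add_zero]
    exact hasFDerivAt_traceLog hA
  convert! ((h3.comp_hasDerivAt (0 : ℂ) h1).const_mul (N : ℂ)).neg using 1
  rw [traceMul_apply, Matrix.mul_smul, Matrix.trace_smul, fieldResolvent, smul_eq_mul]
  ring

theorem hasDerivAt_resolventWord {σ : Fin n → Matrix (Fin N) (Fin N) ℂ} {p : Fin n}
    (hσ : IsUnit (1 + (Complex.I * g) • σ p)) (M : Matrix (Fin N) (Fin N) ℂ) (W : List (Fin n)) :
    HasDerivAt (fun t : ℂ => resolventWord N g W
        (σ + t • (Pi.single p M : Fin n → Matrix (Fin N) (Fin N) ℂ)))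
      (-(Complex.I * g) • wordDerivation p (fun x => fieldResolvent N g (σ x)) M W) 0 := by
  induction W with
  | nil => simpa [resolventWord, wordDerivation] using hasDerivAt_const (0 : ℂ) (1 : Matrix _ _ ℂ)
  | cons x xs ih =>
    have h1 : HasDerivAt (fun t : ℂ => fieldResolvent N g
        ((σ + t • (Pi.single p M : Fin n → Matrix (Fin N) (Fin N) ℂ)) x))
        (if x = p then -(Complex.I * g) •
          (fieldResolvent N g (σ x) * M * fieldResolvent N g (σ x)) else 0) 0 := by
      simp only [add_smul_single_apply]
      split_ifs with h
      · rw [h]; exact hasDerivAt_fieldResolvent hσ M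
      · exact hasDerivAt_const _ _
    have h2 := h1.mul ih
    simp only [zero_smul, add_zero] at h2
    convert! h2 using 1
    rw [wordDerivation, smul_add]
    congr 1
    · split_ifs
      · rw [Matrix.smul_mul]; rfl
      · simp
    · rw [Matrix.mul_smul]

theorem prod_vertex_congr {σ τ : Fin n → Matrix (Fin N) (Fin N) ℂ} {s : Finset (Fin n)}
    (h : ∀ x ∈ s, σ x = τ x) : ∏ x ∈ s, vertex N g (σ x) = ∏ x ∈ s, vertex N g (τ x) :=
  Finset.prod_congr rfl fun x hx => by rw [h x hx]

/-- The line operator that attaches a new vertex `v` to a tree. -/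
theorem lineOperator_attach (hg : ‖g‖ ≤ 2 * g.re) {s : Finset (Fin n)} {p v : Fin n} (hv : v ∈ s)
    (hp : p ∉ s) {G : (Fin n → Matrix (Fin N) (Fin N) ℂ) → ℂ}
    {D : Matrix (Fin N) (Fin N) ℂ → (Fin n → Matrix (Fin N) (Fin N) ℂ) → ℂ}
    (hGv : ∀ σ τ, (∀ x, x ≠ v → σ x = τ x) → G σ = G τ)
    (hG : ∀ σ ∈ tube n N g, ∀ M, HasDerivAt (fun t : ℂ => G
      (σ + t • (Pi.single p M : Fin n → Matrix (Fin N) (Fin N) ℂ))) (D M σ) 0)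
    {σ : Fin n → Matrix (Fin N) (Fin N) ℂ} (hσ : σ ∈ tube n N g) :
    lineOperator (p, v) (fun σ => G σ * ∏ x ∈ s, vertex N g (σ x)) σ =
      (-(N * (Complex.I * g)) * ∑ i, ∑ j, fieldResolvent N g (σ v) i j * D (Matrix.single i j 1) σ) *
        ∏ x ∈ s.erase v, vertex N g (σ x) := by
  have hpv : p ≠ v := by rintro rfl; exact hp hv
  have h1 : ∀ i j, Set.EqOn (fieldDeriv v j i fun σ => G σ * ∏ x ∈ s, vertex N g (σ x))
      (fun τ => G τ * (-(N * (Complex.I * g)) * fieldResolvent N g (τ v) i j *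
        ∏ x ∈ s.erase v, vertex N g (τ x))) (tube n N g) := by
    intro i j τ hτ
    refine HasLineDerivAt.lineDeriv ?_
    have h2 := hasDerivAt_vertex (mem_logDomain_of_mem_tube hg hτ v) (Matrix.single j i 1)
    rw [Matrix.trace_mul_single, MulOpposite.op_one, one_smul] at h2
    have h3 := (h2.mul_const (∏ x ∈ s.erase v, vertex N g (τ x))).const_mul (G τ)
    refine h3.congr_of_eventuallyEq (Eventually.of_forall fun t => ?_)
    have e1 : G (τ + t • (Pi.single v (Matrix.single j i 1) :
        Fin n → Matrix (Fin N) (Fin N) ℂ)) = G τ :=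
      hGv _ _ fun x hx => by rw [add_smul_single_apply, if_neg hx]
    simp only
    rw [e1, ← Finset.mul_prod_erase _ _ hv, add_smul_single_apply, if_pos rfl,
      prod_vertex_congr (τ := τ) fun x hx => by
        rw [add_smul_single_apply, if_neg (Finset.ne_of_mem_erase hx)]]
  have h4 : ∀ i j, fieldDeriv p i j (fieldDeriv v j i fun σ => G σ * ∏ x ∈ s, vertex N g (σ x)) σ =
      D (Matrix.single i j 1) σ * (-(N * (Complex.I * g)) * fieldResolvent N g (σ v) i j *
        ∏ x ∈ s.erase v, vertex N g (σ x)) := by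
    intro i j
    refine (lineDeriv_congr_on (isOpen_tube n N g) (h1 i j) _ hσ).trans ?_
    refine HasLineDerivAt.lineDeriv ?_
    refine ((hG σ hσ (Matrix.single i j 1)).mul_const _).congr_of_eventuallyEq
      (Eventually.of_forall fun t => ?_)
    simp only
    rw [add_smul_single_apply, if_neg hpv.symm, prod_vertex_congr (τ := σ) fun x hx => by
      rw [add_smul_single_apply, if_neg (by
        rintro rfl; exact hp (Finset.mem_of_mem_erase hx))]]
  rw [lineOperator]
  simp only [h4, Finset.mul_sum, Finset.sum_mul]
  refine Finset.sum_congr rfl fun i _ => Finset.sum_congr rfl fun j _ => ?_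
  ring

/-- The sum of the traces of resolvents along the words of a growing tree. -/
def wordSum (N : ℕ) (g : ℂ) (L : List (Fin n × Fin n)) (σ : Fin n → Matrix (Fin N) (Fin N) ℂ) : ℂ :=
  ((treeWords L).map fun W => (resolventWord N g W σ).trace).sum

theorem sum_smul_single (A : Matrix (Fin N) (Fin N) ℂ) :
    ∑ q : Fin N × Fin N, A q.1 q.2 • Matrix.single q.1 q.2 (1 : ℂ) = A := by
  rw [Fintype.sum_prod_type]
  conv_rhs => rw [Matrix.matrix_eq_sum_single A]
  simp

theorem trace_list_sum (l : List (Matrix (Fin N) (Fin N) ℂ)) :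
    l.sum.trace = (l.map Matrix.trace).sum :=
  map_list_sum (Matrix.traceAddMonoidHom (Fin N) ℂ) l

/-- Successive attachment of all vertices to the root. -/
theorem lineOperators_growth (hg : ‖g‖ ≤ 2 * g.re) {r : Fin n} {L : List (Fin n × Fin n)}
    (h : IsGrowth r L) (hL : L ≠ []) {σ : Fin n → Matrix (Fin N) (Fin N) ℂ} (hσ : σ ∈ tube n N g) :
    lineOperators L (fun σ => ∏ v, vertex N g (σ v)) σ =
      N * (-(N * g ^ 2)) ^ L.length * wordSum N g L σ *
        ∏ x ∈ Finset.univ.filter (fun x => x ∉ r :: L.map Prod.snd), vertex N g (σ x) := by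
  induction h generalizing σ with
  | nil => exact absurd rfl hL
  | @cons p v L h hp hv ih =>
    set s := Finset.univ.filter (fun x => x ∉ r :: L.map Prod.snd) with hs
    have hvs : v ∈ s := by simpa [hs] using hv
    have hps : p ∉ s := fun h' => (Finset.mem_filter.1 h').2 hp
    have herase : s.erase v =
        Finset.univ.filter (fun x => x ∉ r :: ((p, v) :: L).map Prod.snd) := by
      ext x
      simp only [hs, Finset.mem_erase, Finset.mem_filter, Finset.mem_univ, true_and,
        List.mem_cons, List.map_cons, not_or]
      tauto
    rw [lineOperators_cons]
    have hsum : ∀ f : Fin N → Fin N → ℂ, ∑ i, ∑ j, f i j = ∑ q : Fin N × Fin N, f q.1 q.2 :=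
      fun f => (Fintype.sum_prod_type fun q : Fin N × Fin N => f q.1 q.2).symm
    have hI : Complex.I * Complex.I = -1 := Complex.I_mul_I
    cases L with
    | nil =>
      -- the first line joins the root to its first child and differentiates both vertices once
      have hpr : p = r := by simpa using hp
      subst hpr
      have hpv : v ≠ p := by rintro rfl; exact hps hvs
      have e1 : (fun σ : Fin n → Matrix (Fin N) (Fin N) ℂ => ∏ v, vertex N g (σ v)) =
          fun σ => vertex N g (σ p) * ∏ x ∈ s, vertex N g (σ x) := by
        ext σ
        rw [← Finset.mul_prod_erase _ _ (Finset.mem_univ p)]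
        congr 2
        ext x
        simp [hs]
      rw [lineOperators_nil, e1, lineOperator_attach hg hvs hps
        (D := fun M σ => -(N * (Complex.I * g)) * (fieldResolvent N g (σ p) * M).trace)
        (fun σ τ h => by rw [h p hpv.symm]) (fun σ hσ M => ?_) hσ, ← herase]
      · congr 1
        rw [hsum]
        have e2 : (fieldResolvent N g (σ p) * fieldResolvent N g (σ v)).trace =
            ∑ q : Fin N × Fin N, fieldResolvent N g (σ v) q.1 q.2 *
              (fieldResolvent N g (σ p) * Matrix.single q.1 q.2 1).trace := by
          conv_lhs => rw [← sum_smul_single (fieldResolvent N g (σ v))]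
          rw [Finset.mul_sum, Matrix.trace_sum]
          simp only [Matrix.mul_smul, Matrix.trace_smul, smul_eq_mul]
        have e3 : wordSum N g [(p, v)] σ =
            (fieldResolvent N g (σ p) * fieldResolvent N g (σ v)).trace := by
          simp [wordSum, treeWords, resolventWord]
        rw [e3, e2, List.length_singleton, pow_one, Finset.mul_sum, Finset.mul_sum]
        refine Finset.sum_congr rfl fun q _ => ?_
        linear_combination (N * N * g ^ 2 * fieldResolvent N g (σ v) q.1 q.2 *
          (fieldResolvent N g (σ p) * Matrix.single q.1 q.2 1).trace) * hI
      · have := hasDerivAt_vertex (mem_logDomain_of_mem_tube hg hσ p) M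
        simpa [add_smul_single_apply] using this
    | cons e L =>
      -- a further line differentiates the new vertex once and, by the product rule, every resolvent
      -- of its parent in turn, which inserts the new letter into the words
      have hL' : e :: L ≠ [] := List.cons_ne_nil _ _
      rw [lineOperator_congr_on (fun τ hτ => ih hL' hτ) (p, v) hσ]
      rw [lineOperator_attach hg hvs hps
        (G := fun σ => N * (-(N * g ^ 2)) ^ (e :: L).length * wordSum N g (e :: L) σ)
        (D := fun M σ => N * (-(N * g ^ 2)) ^ (e :: L).length * ((treeWords (e :: L)).map fun W =>
          (-(Complex.I * g) • wordDerivation p (fun x => fieldResolvent N g (σ x)) M W).trace).sum)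
        (fun σ τ h' => ?_) (fun σ hσ M => ?_) hσ, ← herase]
      · congr 1
        rw [hsum]
        have e2 : wordSum N g ((p, v) :: e :: L) σ = ((treeWords (e :: L)).map fun W =>
            ∑ q : Fin N × Fin N, fieldResolvent N g (σ v) q.1 q.2 *
              (wordDerivation p (fun x => fieldResolvent N g (σ x))
                (Matrix.single q.1 q.2 1) W).trace).sum := by
          rw [wordSum, treeWords, List.map_flatMap, List.flatMap_def, List.sum_flatten, List.map_map]
          congr 1
          refine List.map_congr_left fun W _ => ?_
          have e4 := congrArg Matrix.trace (wordDerivation_eq_sum_insertions p v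
            (fun x => fieldResolvent N g (σ x)) W)
          rw [trace_list_sum, List.map_map] at e4
          refine e4.symm.trans ?_
          conv_lhs => rw [← sum_smul_single (fieldResolvent N g (σ v)), wordDerivation_sum_smul,
            Matrix.trace_sum]
          simp only [Matrix.trace_smul, smul_eq_mul]
        rw [e2, List.length_cons (a := (p, v)), pow_succ]
        have e5 : ∀ (l : List (List (Fin n))) (f : Fin N × Fin N → List (Fin n) → ℂ),
            (l.map fun W => ∑ q, f q W).sum = ∑ q, (l.map (f q)).sum := by
          intro l f
          induction l with
          | nil => simp
          | cons W l ih => simp [ih, Finset.sum_add_distrib]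
        rw [e5, Finset.mul_sum, Finset.mul_sum]
        refine Finset.sum_congr rfl fun q _ => ?_
        simp only [Matrix.trace_smul, smul_eq_mul, List.sum_map_mul_left]
        linear_combination (N * N * (-(N * g ^ 2)) ^ (e :: L).length * g ^ 2 *
          fieldResolvent N g (σ v) q.1 q.2 * ((treeWords (e :: L)).map fun W =>
            (wordDerivation p (fun x => fieldResolvent N g (σ x))
              (Matrix.single q.1 q.2 1) W).trace).sum) * hI
      · congr 1
        rw [wordSum, wordSum]
        congr 1
        refine List.map_congr_left fun W hW => ?_
        rw [resolventWord, resolventWord]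
        congr 2
        refine List.map_congr_left fun x hx => ?_
        rw [h' x]
        rintro rfl
        exact hv (h.subset hW hx)
      · refine HasDerivAt.const_mul _ ?_
        have hder : ∀ W, HasDerivAt (fun t : ℂ => (resolventWord N g W
            (σ + t • (Pi.single p M : Fin n → Matrix (Fin N) (Fin N) ℂ))).trace)
            (-(Complex.I * g) • wordDerivation p (fun x => fieldResolvent N g (σ x)) M W).trace 0 :=
          fun W => (traceCLM (Fin N)).hasFDerivAt.comp_hasDerivAt (0 : ℂ)
            (hasDerivAt_resolventWord (resolvent_bound hg hσ p).1 M W)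
        unfold wordSum
        induction treeWords (e :: L) with
        | nil => simpa using hasDerivAt_const (0 : ℂ) (0 : ℂ)
        | cons W l ih' =>
          simp only [List.map_cons, List.sum_cons]
          exact (hder W).add ih'

end WordDerivatives

end

noncomputable section
open scoped ContDiff Matrix.Norms.L2Operator

/-! ### The field families of trees -/

section Families

variable {n N : ℕ}

theorem smul_neg_coupling (g : ℂ) (A : Matrix (Fin N) (Fin N) ℂ) :
    (Complex.I * -g) • A = (Complex.I * g) • (-A) := by
  rw [mul_neg, neg_smul, smul_neg]

/-- The amplitude of the tree without lines is the expectation of a vertex. -/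
theorem fieldFamily_vertex (v : Fin n) :
    FieldFamily n N (4 * N ^ 2) fun g σ => vertex N g (σ v) where
  differentiableAt g σ h := differentiableAt_vertex (h v)
  norm_le g σ h := by
    have h1 := norm_traceLog_le fun s hs => norm_inv_le_of_mem_logDomain (h v) hs
    rw [Fintype.card_fin, norm_smul, norm_mul, Complex.norm_I, one_mul] at h1
    rw [vertex, norm_neg, norm_mul, Complex.norm_natCast]
    have h2 : ‖g‖ * ‖σ v‖ ≤ 1 + ‖g‖ * ‖σ‖ := by
      have := mul_le_mul_of_nonneg_left (norm_le_pi_norm σ v) (norm_nonneg g)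
      linarith
    calc (N : ℝ) * ‖traceLog (1 + (Complex.I * g) • σ v)‖
        ≤ N * (N * (4 * (1 + ‖g‖ * ‖σ‖))) := by gcongr; exact h1.trans (by gcongr)
      _ = _ := by ring
  tame g hg := tame_vertex hg v
  neg g σ := by rw [vertex, smul_neg_coupling]; rfl
  nonneg := by positivity

theorem norm_resolventWord_le {g : ℂ} {σ : Fin n → Matrix (Fin N) (Fin N) ℂ}
    (h : ∀ v, (Complex.I * g) • σ v ∈ logDomain (Fin N)) (W : List (Fin n)) :
    ‖resolventWord N g W σ‖ ≤ 4 ^ W.length := by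
  induction W with
  | nil =>
    rw [resolventWord, List.map_nil, List.prod_nil, List.length_nil, pow_zero]
    rw [← Matrix.diagonal_one, Matrix.l2_opNorm_diagonal]
    exact (pi_norm_le_iff_of_nonneg zero_le_one).2 fun _ => by simp
  | cons x xs ih =>
    have h1 := (norm_inv_le_of_mem_logDomain (h x) (s := 1) (by simp)).2
    rw [Complex.ofReal_one, one_smul] at h1
    rw [resolventWord, List.map_cons, List.prod_cons, List.length_cons, pow_succ']
    exact (norm_mul_le _ _).trans (mul_le_mul h1 ih (norm_nonneg _) (by norm_num))

theorem fieldFamily_word (W : List (Fin n)) :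
    FieldFamily n N (N * 4 ^ W.length) fun g σ => (resolventWord N g W σ).trace := by
  have hnorm : ∀ g σ, (∀ v, (Complex.I * g) • σ v ∈ logDomain (Fin N)) →
      ‖(resolventWord N g W σ).trace‖ ≤ N * 4 ^ W.length := by
    intro g σ h
    have h1 := norm_trace_le (resolventWord N g W σ)
    rw [Fintype.card_fin] at h1
    exact h1.trans (by gcongr; exact norm_resolventWord_le h W)
  refine ⟨fun g σ h => ?_, fun g σ h => ?_, fun g hg => ⟨?_, fun δ hδ => ?_⟩, fun g σ => ?_,
    by positivity⟩
  · have h1 : DifferentiableAt ℂ (fun g => resolventWord N g W σ) g := by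
      induction W with
      | nil => exact differentiableAt_const _
      | cons x xs ih =>
        have h2 : DifferentiableAt ℂ (fun g : ℂ => (Complex.I * g) • σ x) g := by fun_prop
        have h3 : DifferentiableAt ℂ (fun A : Matrix (Fin N) (Fin N) ℂ => (1 + A)⁻¹)
            ((Complex.I * g) • σ x) :=
          ((contDiffOn_inv_one_add.contDiffAt (isOpen_logDomain.mem_nhds (h x))).differentiableAt
            (by simp))
        exact (h3.comp g h2).mul (ih fun g σ h => by
          have h1 := norm_trace_le (resolventWord N g xs σ)
          rw [Fintype.card_fin] at h1
          exact h1.trans (by gcongr; exact norm_resolventWord_le h xs))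
    exact (traceCLM (Fin N)).differentiableAt.comp g h1
  · refine (hnorm g σ h).trans (le_mul_of_one_le_right (by positivity) ?_)
    have : 0 ≤ ‖g‖ * ‖σ‖ := by positivity
    linarith
  · have h1 : ContDiffOn ℂ ∞ (fun σ : Fin n → Matrix (Fin N) (Fin N) ℂ => resolventWord N g W σ)
        (tube n N g) := by
      clear hnorm
      induction W with
      | nil => exact contDiffOn_const
      | cons x xs ih => exact (contDiffOn_resolvent hg x).mul ih
    exact (traceCLM (Fin N)).contDiff.comp_contDiffOn h1
  · refine ⟨N * 4 ^ W.length, 0, fun σ hσ => ?_⟩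
    rw [pow_zero, mul_one]
    exact hnorm g σ fun v => mem_logDomain_of_mem_tube hg (Metric.thickening_mono hδ.le _ hσ) v
  · simp only [resolventWord, fieldResolvent, smul_neg_coupling]
    rfl

theorem FieldFamily.add {B B' : ℝ} {F F' : ℂ → (Fin n → Matrix (Fin N) (Fin N) ℂ) → ℂ}
    (h : FieldFamily n N B F) (h' : FieldFamily n N B' F') :
    FieldFamily n N (B + B') fun g σ => F g σ + F' g σ where
  differentiableAt g σ hσ := (h.differentiableAt g σ hσ).add (h'.differentiableAt g σ hσ)
  norm_le g σ hσ := (norm_add_le _ _).trans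
    ((add_le_add (h.norm_le g σ hσ) (h'.norm_le g σ hσ)).trans_eq (by ring))
  tame g hg := (h.tame g hg).add (h'.tame g hg)
  neg g σ := by rw [h.neg, h'.neg]
  nonneg := add_nonneg h.nonneg h'.nonneg

/-- The amplitude of a tree with lines is the expectation of a sum of words of resolvents, each of
which is bounded by `4` on the domain of the logarithm. -/
theorem fieldFamily_wordSum {r : Fin n} {L : List (Fin n × Fin n)} (h : IsGrowth r L) :
    FieldFamily n N ((treeWords L).length * (N * 4 ^ (2 * L.length))) fun g σ => wordSum N g L σ := by
  have key : ∀ (k : ℕ) (l : List (List (Fin n))), (∀ W ∈ l, W.length = k) →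
      FieldFamily n N (l.length * (N * 4 ^ k)) fun g σ =>
        (l.map fun W => (resolventWord N g W σ).trace).sum := by
    intro k l hl
    induction l with
    | nil =>
      simp only [List.length_nil, Nat.cast_zero, zero_mul, List.map_nil, List.sum_nil]
      exact ⟨fun _ _ _ => differentiableAt_const _, fun _ _ _ => by simp,
        fun _ _ => tame_const 0, fun _ _ => rfl, le_rfl⟩
    | cons W l ih =>
      have h1 := (fieldFamily_word (N := N) W).add (ih fun W' hW' => hl W' (List.mem_cons_of_mem _ hW'))
      rw [hl W List.mem_cons_self] at h1
      simp only [List.map_cons, List.sum_cons, List.length_cons]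
      convert! h1 using 1
      push_cast
      ring
  exact key _ _ fun W hW => h.length_of_mem hW

end Families

/-! ### Trees as growths -/

section Growth

theorem IsGrowth.nodup {α : Type*} [DecidableEq α] {r : α} {L : List (α × α)} (h : IsGrowth r L) :
    (r :: L.map Prod.snd).Nodup := by
  induction h with
  | nil => simp
  | @cons p v L h hp hv ih =>
    rw [List.map_cons]
    exact (List.Perm.swap _ _ _).nodup_iff.1 (List.nodup_cons.2 ⟨hv, ih⟩)

theorem IsGrowth.fst_mem {α : Type*} [DecidableEq α] {r : α} {L : List (α × α)} (h : IsGrowth r L)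
    {e : α × α} (he : e ∈ L) : e.1 ∈ r :: L.map Prod.snd := by
  induction h with
  | nil => simp at he
  | @cons p v L h hp hv ih =>
    have hsub : ∀ y, y ∈ r :: L.map Prod.snd → y ∈ r :: ((p, v) :: L).map Prod.snd := by
      intro y hy
      simp only [List.mem_cons, List.map_cons] at hy ⊢
      tauto
    rcases List.mem_cons.1 he with rfl | he
    · exact hsub _ hp
    · exact hsub _ (ih he)

variable {n : ℕ}

/-- The ordered pair of the endpoints of a line. -/
def sortLine (e : Fin n × Fin n) : Fin n × Fin n := if e.1 < e.2 then e else e.swap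

theorem sortLine_eq_or (e : Fin n × Fin n) : sortLine e = e ∨ sortLine e = e.swap := by
  unfold sortLine; split_ifs <;> simp

theorem IsGrowth.nodup_sortLine {r : Fin n} {L : List (Fin n × Fin n)} (h : IsGrowth r L) :
    (L.map sortLine).Nodup := by
  induction h with
  | nil => simp
  | @cons p v L h hp hv ih =>
    rw [List.map_cons, List.nodup_cons]
    refine ⟨fun hmem => hv ?_, ih⟩
    obtain ⟨e, he, heq⟩ := List.mem_map.1 hmem
    have h1 := h.fst_mem he
    have h2 : e.2 ∈ r :: L.map Prod.snd := List.mem_cons_of_mem _ (List.mem_map_of_mem he)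
    have h3 : v = e.1 ∨ v = e.2 := by
      rcases sortLine_eq_or e with h4 | h4 <;> rcases sortLine_eq_or (p, v) with h5 | h5 <;>
        rw [h4, h5] at heq <;> simp only [Prod.ext_iff, Prod.fst_swap, Prod.snd_swap] at heq
      · exact Or.inr heq.2.symm
      · exact Or.inl heq.1.symm
      · exact Or.inl heq.2.symm
      · exact Or.inr heq.1.symm
    rcases h3 with rfl | rfl
    · exact h1
    · exact h2

/-- A tree can be grown from any of its vertices. -/
theorem exists_growth {T : SimpleGraph (Fin n)} (hT : T.IsTree) (r : Fin n) (k : ℕ) (hk : k < n) :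
    ∃ L, IsGrowth r L ∧ L.length = k ∧ ∀ e ∈ L, T.Adj e.1 e.2 := by
  induction k with
  | zero => exact ⟨[], IsGrowth.nil, rfl, by simp⟩
  | succ k ih =>
    obtain ⟨L, hL, hlen, hadj⟩ := ih (by omega)
    have hex : ∃ u, u ∉ r :: L.map Prod.snd := by
      by_contra! hall
      have h1 := Finset.card_le_card (s := Finset.univ) (t := (r :: L.map Prod.snd).toFinset)
        fun u _ => List.mem_toFinset.2 (hall u)
      have h2 := List.toFinset_card_le (r :: L.map Prod.snd)
      rw [Finset.card_univ, Fintype.card_fin] at h1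
      rw [List.length_cons, List.length_map, hlen] at h2
      omega
    obtain ⟨u, hu⟩ := hex
    obtain ⟨w⟩ := hT.1.preconnected r u
    obtain ⟨d, -, hd1, hd2⟩ := w.exists_boundary_dart {x | x ∈ r :: L.map Prod.snd}
      List.mem_cons_self hu
    refine ⟨(d.fst, d.snd) :: L, hL.cons hd1 hd2, by simp [hlen], fun e he => ?_⟩
    rcases List.mem_cons.1 he with rfl | he
    · exact d.adj
    · exact hadj e he

theorem lineList_perm_of_growth {T : SimpleGraph (Fin n)} (hT : T.IsTree) {r : Fin n}
    {L : List (Fin n × Fin n)} (hL : IsGrowth r L) (hlen : L.length + 1 = n)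
    (hadj : ∀ e ∈ L, T.Adj e.1 e.2) : (lineList T).Perm (L.map sortLine) := by
  classical
  have hsub : (L.map sortLine).toFinset ⊆ lines T := by
    intro e he
    obtain ⟨e', he', rfl⟩ := List.mem_map.1 (List.mem_toFinset.1 he)
    rw [mem_lines, sortLine]
    split_ifs with h
    · exact ⟨h, hadj e' he'⟩
    · exact ⟨lt_of_le_of_ne (not_lt.1 h) (hadj e' he').ne.symm, (hadj e' he').symm⟩
  have hcard : (lines T).card ≤ L.length := by
    have h1 : (lines T).card ≤ T.edgeFinset.card := by
      refine Finset.card_le_card_of_injOn (fun e => s(e.1, e.2)) (fun e he => ?_) ?_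
      · have := mem_lines.1 he
        simpa using this.2
      · rintro ⟨a, b⟩ h1 ⟨c, d⟩ h2 h
        have h3 := (mem_lines.1 h1).1
        have h4 := (mem_lines.1 h2).1
        simp only at h3 h4
        rcases Sym2.eq_iff.1 h with ⟨rfl, rfl⟩ | ⟨rfl, rfl⟩
        · rfl
        · exact absurd h3 (not_lt.2 h4.le)
    have h2 := hT.card_edgeFinset
    rw [Fintype.card_fin] at h2
    omega
  have heq : (L.map sortLine).toFinset = lines T := by
    refine Finset.eq_of_subset_of_card_le hsub ?_
    rw [List.toFinset_card_of_nodup hL.nodup_sortLine, List.length_map]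
    exact hcard
  rw [lineList_eq, ← heq]
  exact List.toFinset_toList hL.nodup_sortLine

end Growth

/-! ### Counting trees with their words -/

section Counting

/-- A tree rooted at `0` is given by the parents of the other vertices. -/
def parentLines {m : ℕ} (p : Fin m → Fin (m + 1)) : List (Fin (m + 1) × Fin (m + 1)) :=
  List.ofFn fun i => (p i, i.succ)

/-- Growing a tree from the vertex `0` attaches every other vertex to exactly one parent. -/
theorem exists_parent {m : ℕ} {T : SimpleGraph (Fin (m + 1))} (hT : T.IsTree) :
    ∃ p : Fin m → Fin (m + 1), ∃ L, IsGrowth 0 L ∧ L.Perm (parentLines p) ∧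
      (lineList T).Perm (L.map sortLine) := by
  obtain ⟨L, hL, hlen, hadj⟩ := exists_growth hT 0 m (by omega)
  have hnd := hL.nodup
  have hmem : ∀ i : Fin m, ∃ a, (a, i.succ) ∈ L := by
    intro i
    have h1 : i.succ ∈ (0 : Fin (m + 1)) :: L.map Prod.snd := by
      have h2 : ((0 : Fin (m + 1)) :: L.map Prod.snd).toFinset = Finset.univ := by
        rw [← Finset.card_eq_iff_eq_univ, List.toFinset_card_of_nodup hnd]
        simp [hlen]
      rw [← List.mem_toFinset, h2]
      exact Finset.mem_univ _
    rcases List.mem_cons.1 h1 with h2 | h2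
    · exact absurd h2 (Fin.succ_ne_zero i)
    · obtain ⟨⟨a, b⟩, h3, rfl⟩ := List.mem_map.1 h2
      exact ⟨a, h3⟩
  choose p hp using hmem
  refine ⟨p, L, hL, ?_, lineList_perm_of_growth hT hL (by omega) hadj⟩
  have hnd' := List.nodup_cons.1 hnd
  refine (List.perm_ext_iff_of_nodup hnd'.2.of_map ?_).2 fun e => ⟨fun he => ?_, fun he => ?_⟩
  · refine List.nodup_ofFn.2 fun i j hij => ?_
    exact Fin.succ_injective _ (congrArg Prod.snd hij)
  · have h0 : e.2 ≠ 0 := fun h => hnd'.1 (h ▸ List.mem_map_of_mem he)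
    obtain ⟨i, hi⟩ := Fin.exists_succ_eq.2 h0
    have h1 := List.inj_on_of_nodup_map hnd'.2 he (hp i) (by simp [hi])
    rw [parentLines, List.mem_ofFn]
    exact ⟨i, h1.symm⟩
  · rw [parentLines, List.mem_ofFn] at he
    obtain ⟨i, rfl⟩ := he
    exact hp i

/-- The product of the factorials of the numbers of children. -/
def childWeight {β : Type*} [Fintype β] [DecidableEq β] {m : ℕ} (p : Fin m → β) : ℕ :=
  ∏ x, ((List.ofFn p).count x)!

/-- Adding a child to any of the vertices multiplies the weight by one more than the number of
children it already has; summed over the vertices this is `card β + m`. -/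
theorem sum_childWeight {β : Type*} [Fintype β] [DecidableEq β] (m : ℕ) :
    ∑ p : Fin m → β, childWeight p = (Fintype.card β).ascFactorial m := by
  induction m with
  | zero => simp [childWeight]
  | succ m ih =>
    rw [← (Fin.consEquiv fun _ => β).sum_comp, Fintype.sum_prod_type_right, Nat.ascFactorial_succ,
      ← ih, Finset.mul_sum]
    refine Finset.sum_congr rfl fun p _ => ?_
    have h1 : ∀ a : β, childWeight (Fin.cons a p : Fin (m + 1) → β) =
        ((List.ofFn p).count a + 1) * childWeight p := by
      intro a
      have h2 : ∀ x, (List.ofFn (Fin.cons a p : Fin (m + 1) → β)).count x =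
          (List.ofFn p).count x + if a = x then 1 else 0 := by
        intro x
        rw [List.ofFn_succ, List.count_cons]
        simp
      unfold childWeight
      simp only [h2]
      rw [← Finset.mul_prod_erase _ _ (Finset.mem_univ a),
        ← Finset.mul_prod_erase (s := Finset.univ) (f := fun x => ((List.ofFn p).count x)!) (a := a)
          (Finset.mem_univ a), if_pos rfl, Nat.factorial_succ, mul_assoc]
      congr 2
      exact Finset.prod_congr rfl fun x hx => by
        rw [if_neg (Finset.ne_of_mem_erase hx).symm, add_zero]
    have h3 : ∑ a : β, (List.ofFn p).count a = m := by
      have := Multiset.sum_count_eq_card (s := Finset.univ) (m := (List.ofFn p : Multiset β))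
        fun a _ => Finset.mem_univ a
      simpa using this
    change ∑ a : β, childWeight (Fin.cons a p : Fin (m + 1) → β) = _
    simp only [h1]
    rw [← Finset.sum_mul, Finset.sum_add_distrib, h3]
    simp [add_comm]

open Classical in
/-- A choice of the parents of the vertices of a tree. -/
def treeParent {m : ℕ} (T : SimpleGraph (Fin (m + 1))) : Fin m → Fin (m + 1) :=
  if hT : T.IsTree then (exists_parent hT).choose else 0

theorem treeParent_spec {m : ℕ} {T : SimpleGraph (Fin (m + 1))} (hT : T.IsTree) :
    ∃ L, IsGrowth 0 L ∧ L.Perm (parentLines (treeParent T)) ∧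
      (lineList T).Perm (L.map sortLine) := by
  rw [treeParent, dif_pos hT]
  exact (exists_parent hT).choose_spec

/-- A tree is determined by its parent function, which lists its lines. -/
theorem treeParent_injOn {m : ℕ} : Set.InjOn (treeParent (m := m)) (treesOn (m + 1)) := by
  classical
  intro T hT T' hT' h
  have hT1 : T.IsTree := by simpa [treesOn] using hT
  have hT1' : T'.IsTree := by simpa [treesOn] using hT'
  obtain ⟨L, -, hL, hl⟩ := treeParent_spec hT1
  obtain ⟨L', -, hL', hl'⟩ := treeParent_spec hT1'
  rw [h] at hL
  have h1 : (lineList T).Perm (lineList T') :=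
    hl.trans (((hL.trans hL'.symm).map sortLine).trans hl'.symm)
  have h2 : ∀ a b, a < b → (T.Adj a b ↔ T'.Adj a b) := by
    intro a b hab
    have h3 := h1.mem_iff (a := (a, b))
    rw [lineList_eq, lineList_eq, Finset.mem_toList, Finset.mem_toList, mem_lines, mem_lines] at h3
    simpa [hab] using h3
  ext a b
  rcases lt_trichotomy a b with hab | rfl | hab
  · exact h2 a b hab
  · simp
  · rw [T.adj_comm, T'.adj_comm]; exact h2 b a hab

/-- The sum over all parent functions is `(m + 1) ⋯ (2 m) = (2 m)! / m!`. -/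
theorem sum_childWeight_treeParent_le (m : ℕ) :
    (∑ T ∈ treesOn (m + 1), (childWeight (treeParent T) : ℝ)) ≤ 4 ^ m * m ! := by
  classical
  have h1 : ∑ T ∈ treesOn (m + 1), childWeight (treeParent T) ≤
      ∑ p : Fin m → Fin (m + 1), childWeight p := by
    rw [← Finset.sum_image (f := childWeight) treeParent_injOn]
    exact Finset.sum_le_sum_of_subset (Finset.subset_univ _)
  rw [sum_childWeight, Fintype.card_fin] at h1
  have h2 := Nat.factorial_mul_ascFactorial m m
  have h3 := factorial_two_mul_le m
  have hm : (0 : ℝ) < m ! := by positivity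
  have h4 : (m ! : ℝ) * ((m + 1).ascFactorial m : ℝ) = ((2 * m)! : ℝ) := by
    rw [two_mul]; exact_mod_cast h2
  have h5 : ((m + 1).ascFactorial m : ℝ) ≤ 4 ^ m * m ! := by
    refine le_of_mul_le_mul_left ?_ hm
    rw [h4]
    exact h3.trans_eq (by ring)
  refine le_trans ?_ h5
  exact_mod_cast h1

end Counting

end

noncomputable section
open scoped ContDiff Matrix.Norms.L2Operator

/-! ### Expansion of the tree amplitudes -/

section TreeExpansion

/-- Power series with coefficients `f m` that have themselves asymptotic expansions of factorial
type, the bounds growing geometrically in `m`. -/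
theorem exists_asymptotic_tsum {U : Set ℂ} (hU : IsOpen U) {A b s : ℝ} (hA : 0 ≤ A) (hb : 0 ≤ b)
    (hbs : b ≤ s) (hs : 1 ≤ s) (hUb : ∀ z ∈ U, b * ‖z‖ ≤ 1 / 2) {f : ℕ → ℂ → ℂ} {c : ℕ → ℕ → ℂ}
    (hd : ∀ m, DifferentiableOn ℂ (f m) U)
    (h : ∀ m r, ∀ z ∈ U, ‖f m z - ∑ k ∈ Finset.range r, c m k * z ^ k‖ ≤
      A * b ^ m * (s ^ r * (r ! : ℝ) * ‖z‖ ^ r)) :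
    DifferentiableOn ℂ (fun z => ∑' m, z ^ m * f m z) U ∧
    ∃ a : ℕ → ℂ, a 0 = c 0 0 ∧ ∀ r, ∀ z ∈ U, ‖∑' m, z ^ m * f m z - ∑ k ∈ Finset.range r, a k * z ^ k‖ ≤
      2 * A * (2 * s) ^ r * (r ! : ℝ) * ‖z‖ ^ r := by
  have h0 : ∀ m, ∀ z ∈ U, ‖z ^ m * f m z‖ ≤ A * (b * ‖z‖) ^ m := by
    intro m z hz
    have := h m 0 z hz
    simp only [Finset.range_zero, Finset.sum_empty, sub_zero, pow_zero, Nat.factorial_zero,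
      Nat.cast_one, mul_one] at this
    rw [norm_mul, norm_pow, mul_pow]
    calc ‖z‖ ^ m * ‖f m z‖ ≤ ‖z‖ ^ m * (A * b ^ m) := by gcongr
      _ = _ := by ring
  have h1 : ∀ m, ∀ z ∈ U, ‖z ^ m * f m z‖ ≤ A * (1 / 2) ^ m := fun m z hz =>
    (h0 m z hz).trans (by gcongr; exact hUb z hz)
  have hg : Summable fun m : ℕ => A * (1 / 2 : ℝ) ^ m :=
    (summable_geometric_of_lt_one (by norm_num) (by norm_num)).mul_left A
  refine ⟨Complex.differentiableOn_tsum_of_summable_norm hg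
    (fun m => (differentiableOn_id.pow m).mul (hd m)) hU h1, ?_⟩
  refine ⟨fun k => ∑ m ∈ Finset.range (k + 1), c m (k - m), by simp, fun r z hz => ?_⟩
  have hsum : Summable fun m => z ^ m * f m z := hg.of_norm_bounded fun m => h1 m z hz
  have hflip : ∑ k ∈ Finset.range r, (∑ m ∈ Finset.range (k + 1), c m (k - m)) * z ^ k =
      ∑ m ∈ Finset.range r, z ^ m * ∑ k ∈ Finset.range (r - m), c m k * z ^ k := by
    have := Finset.sum_range_diag_flip r fun m k => z ^ m * (c m k * z ^ k)
    simp only [← Finset.mul_sum] at this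
    rw [← this]
    refine Finset.sum_congr rfl fun k _ => ?_
    rw [Finset.sum_mul]
    refine Finset.sum_congr rfl fun m hm => ?_
    have hm' : m ≤ k := Nat.lt_succ_iff.1 (Finset.mem_range.1 hm)
    obtain ⟨j, rfl⟩ := Nat.exists_eq_add_of_le hm'
    rw [Nat.add_sub_cancel_left, pow_add]; ring
  rw [hflip, ← hsum.sum_add_tsum_nat_add r, add_sub_right_comm, ← Finset.sum_sub_distrib]
  have hfin : ‖∑ m ∈ Finset.range r,
      (z ^ m * f m z - z ^ m * ∑ k ∈ Finset.range (r - m), c m k * z ^ k)‖ ≤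
      r * (A * s ^ r * (r ! : ℝ) * ‖z‖ ^ r) := by
    refine (norm_sum_le_of_le _ (f := fun m => z ^ m * f m z -
      z ^ m * ∑ k ∈ Finset.range (r - m), c m k * z ^ k)
      (n := fun _ => A * s ^ r * (r ! : ℝ) * ‖z‖ ^ r) fun m hm => ?_).trans_eq (by simp)
    have hm' : m ≤ r := (Finset.mem_range.1 hm).le
    obtain ⟨j, rfl⟩ := Nat.exists_eq_add_of_le hm'
    rw [← mul_sub, norm_mul, norm_pow, Nat.add_sub_cancel_left]
    have hj : (j ! : ℝ) ≤ ((m + j)! : ℝ) := by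
      exact_mod_cast Nat.factorial_le (Nat.le_add_left j m)
    calc ‖z‖ ^ m * ‖f m z - ∑ k ∈ Finset.range j, c m k * z ^ k‖
        ≤ ‖z‖ ^ m * (A * s ^ m * (s ^ j * ((m + j)! : ℝ) * ‖z‖ ^ j)) := by
          have := h m j z hz
          gcongr
          refine this.trans ?_
          gcongr
      _ = _ := by ring
  have htail : ‖∑' m, z ^ (m + r) * f (m + r) z‖ ≤ 2 * (A * s ^ r * (r ! : ℝ) * ‖z‖ ^ r) := by
    have hg' : HasSum (fun m : ℕ => A * (b * ‖z‖) ^ r * (1 / 2 : ℝ) ^ m)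
        (A * (b * ‖z‖) ^ r * 2) := by
      have := (hasSum_geometric_of_lt_one (r := (1 / 2 : ℝ)) (by norm_num) (by norm_num)).mul_left
        (A * (b * ‖z‖) ^ r)
      norm_num at this ⊢
      exact this
    refine (tsum_of_norm_bounded hg' fun m => (h0 (m + r) z hz).trans ?_).trans ?_
    · rw [pow_add, mul_comm ((b * ‖z‖) ^ m), ← mul_assoc]
      gcongr
      exact hUb z hz
    · have h1r : (1 : ℝ) ≤ r ! := by exact_mod_cast Nat.one_le_iff_ne_zero.2 r.factorial_ne_zero
      have h2 : b ^ r * 1 ≤ s ^ r * r ! := by gcongr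
      rw [mul_pow]
      calc A * (b ^ r * ‖z‖ ^ r) * 2 = 2 * (A * (b ^ r * 1) * ‖z‖ ^ r) := by ring
        _ ≤ 2 * (A * (s ^ r * r !) * ‖z‖ ^ r) := by gcongr
        _ = _ := by ring
  refine (norm_add_le _ _).trans ((add_le_add hfin htail).trans ?_)
  have hr : (r : ℝ) + 2 ≤ 2 * 2 ^ r := by
    have : r + 1 ≤ 2 ^ r := Nat.lt_two_pow_self
    have h3 : (r : ℝ) + 1 ≤ 2 ^ r := by exact_mod_cast this
    have h4 : (1 : ℝ) ≤ 2 ^ r := one_le_pow₀ (by norm_num)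
    linarith
  have hs0 : 0 ≤ s := hb.trans hbs
  calc r * (A * s ^ r * (r ! : ℝ) * ‖z‖ ^ r) + 2 * (A * s ^ r * (r ! : ℝ) * ‖z‖ ^ r)
      = (r + 2) * (A * s ^ r * (r ! : ℝ) * ‖z‖ ^ r) := by ring
    _ ≤ (2 * 2 ^ r) * (A * s ^ r * (r ! : ℝ) * ‖z‖ ^ r) := by gcongr
    _ = _ := by rw [mul_pow]; ring

variable {N : ℕ}

theorem fieldMean_const_mul {n : ℕ} (S : Matrix (Fin n) (Fin n) ℝ) (a : ℂ)
    (F : (Fin n → Matrix (Fin N) (Fin N) ℂ) → ℂ) :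
    fieldMean N S (fun σ => a * F σ) = a * fieldMean N S F :=
  integral_const_mul _ _

/-- The derivatives along the lines of a tree leave a sum over the words of the tree. -/
theorem exists_words_of_tree {m : ℕ} {T : SimpleGraph (Fin (m + 1))} (hT : T.IsTree) (hm : m ≠ 0) :
    ∃ L : List (Fin (m + 1) × Fin (m + 1)), IsGrowth 0 L ∧ L.length = m ∧
      (treeWords L).length ≤ childWeight (treeParent T) ∧
      ∀ g : ℂ, ‖g‖ ≤ 2 * g.re → Set.EqOn
        (lineOperators (lineList T) fun σ => ∏ v, vertex N g (σ v))
        (fun σ => N * (-(N * g ^ 2)) ^ m * wordSum N g L σ) (hermTuples (m + 1) N) := by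
  obtain ⟨L, hL, hLp, hlT⟩ := treeParent_spec hT
  have hlen : L.length = m := by rw [hLp.length_eq]; simp [parentLines]
  refine ⟨L, hL, hlen, ?_, fun g hg σ hσ => ?_⟩
  · refine hL.length_treeWords_le.trans_eq (Finset.prod_congr rfl fun x _ => ?_)
    rw [(hLp.map Prod.fst).count_eq, parentLines, List.map_ofFn]
    rfl
  · have hσ' := hermTuples_subset_tube (m + 1) N g hσ
    have hL0 : L ≠ [] := by rintro rfl; exact hm hlen.symm
    rw [lineOperators_perm (tame_prod_vertex hg) hlT hσ',
      lineOperators_orient (tame_prod_vertex hg) L sortLine (fun e _ => sortLine_eq_or e) hσ',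
      lineOperators_growth hg hL hL0 hσ']
    have hall : ∀ x, x ∈ (0 : Fin (m + 1)) :: L.map Prod.snd := by
      have hcard : ((0 : Fin (m + 1)) :: L.map Prod.snd).toFinset = Finset.univ := by
        refine Finset.eq_univ_of_card _ ?_
        rw [List.toFinset_card_of_nodup hL.nodup]
        simp [hlen]
      intro x
      rw [← List.mem_toFinset, hcard]
      exact Finset.mem_univ x
    rw [Finset.filter_false_of_mem fun x _ => not_not.2 (hall x), Finset.prod_empty, mul_one, hlen]

/-- The amplitude of a tree with `m` lines is `z ^ m` times a function with an asymptotic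
expansion. -/
theorem exists_treeAmplitude_expansion (hN : 1 ≤ N) {m : ℕ} {T : SimpleGraph (Fin (m + 1))}
    (hT : T.IsTree) :
    ∃ (h : ℂ → ℂ) (C : ℕ → ℂ), DifferentiableOn ℂ h {z : ℂ | 0 < z.re ∧ ‖z‖ < 1 / 2} ∧
      (∀ z : ℂ, 0 < z.re → treeAmplitude N z T = z ^ m * h z) ∧
      ∀ r z, 0 < z.re → ‖z‖ ≤ 1 / 2 → ‖h z - ∑ k ∈ Finset.range r, C k * z ^ k‖ ≤
        46800 * N ^ 2 * (m + 1) * childWeight (treeParent T) * 32 ^ m *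
          (51200 ^ r * (r ! : ℝ) * ‖z‖ ^ r) := by
  have hcont : Continuous fun w : Sym2 (Fin (m + 1)) → ℝ => extendWeight T fun e => w e := by
    refine continuous_pi fun e => ?_
    simp only [extendWeight]
    split_ifs <;> fun_prop
  have hS : ∀ᵐ w ∂(unitCube (Sym2 (Fin (m + 1)))),
      (linkWeight (extendWeight T fun e => w e)).PosSemidef ∧
        ∀ v, linkWeight (extendWeight T fun e => w e) v v = 1 :=
    Eventually.of_forall fun w => ⟨posSemidef_linkWeight _, linkWeight_self _⟩
  have hmeas : ∀ {B : ℝ} {F : ℂ → (Fin (m + 1) → Matrix (Fin N) (Fin N) ℂ) → ℂ},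
      FieldFamily (m + 1) N B F → ∀ g : ℂ, ‖g‖ ≤ 2 * g.re → AEStronglyMeasurable
        (fun w => fieldMean N (linkWeight (extendWeight T fun e => w e)) (F g))
        (unitCube (Sym2 (Fin (m + 1)))) := fun hF g hg =>
    ((continuous_fieldMean_linkWeight (tubeRadius_pos g) (hF.tame g hg)).comp
      hcont).aestronglyMeasurable
  have hamp : ∀ z : ℂ, 0 < z.re → treeAmplitude N z T =
      forestAmplitude (fun σ => ∏ v, vertex N (Complex.sqrt (2 * z / (N : ℂ))) (σ v)) T :=
    fun z hz => treeAmplitude_eq (sqrt_mem_sector (coupling_re_pos hN hz)).2 rfl hT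
  -- `46800 = 4 · 11700`, the factor `4` being that of the bound of the vertex; for `m ≠ 0` each line
  -- contributes `2` from `g²` and `4²` from two resolvents
  rcases eq_or_ne m 0 with rfl | hm
  · have hF := fieldFamily_vertex (n := 0 + 1) (N := N) 0
    obtain ⟨h1, C, h2⟩ := hF.exists_expansion_average (by omega) hN hS (hmeas hF)
    refine ⟨_, C, h1, fun z hz => ?_, fun r z hz hz' => (h2 r z hz hz').trans ?_⟩
    · have hl : lineList T = [] := by
        refine List.eq_nil_iff_forall_not_mem.2 fun e he => ?_
        rw [lineList_eq, Finset.mem_toList, mem_lines] at he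
        have := he.1
        omega
      rw [hamp z hz, forestAmplitude, pow_zero, one_mul, hl]
      simp
    · have hw : (1 : ℝ) ≤ childWeight (treeParent T) := by
        exact_mod_cast Nat.one_le_iff_ne_zero.2
          (Finset.prod_ne_zero_iff.2 fun x _ => Nat.factorial_ne_zero _)
      have hpos : (0 : ℝ) ≤ 46800 * N ^ 2 * (51200 ^ r * (r ! : ℝ) * ‖z‖ ^ r) := by positivity
      have := mul_le_mul_of_nonneg_left hw hpos
      push_cast
      linarith
  · obtain ⟨L, hL, hlen, hwords, heq⟩ := exists_words_of_tree (N := N) hT hm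
    have hF := fieldFamily_wordSum (N := N) hL
    obtain ⟨h1, C, h2⟩ := hF.exists_expansion_average (by omega) hN hS (hmeas hF)
    refine ⟨_, fun k => N * (-2) ^ m * C k, h1.const_mul (N * (-2) ^ m), fun z hz => ?_,
      fun r z hz hz' => ?_⟩
    · obtain ⟨hsq, hsec⟩ := sqrt_mem_sector (coupling_re_pos hN hz)
      rw [hamp z hz, forestAmplitude]
      simp only [fieldMean_congr _ (heq _ hsec), fieldMean_const_mul, integral_const_mul]
      rw [hsq, mul_div_cancel₀ _ (by exact_mod_cast (by omega : N ≠ 0)),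
        show -(2 * z) = z * (-2) by ring, mul_pow]
      ring
    · have : ∀ I : ℂ, N * (-2) ^ m * I - ∑ k ∈ Finset.range r, N * (-2) ^ m * C k * z ^ k =
          N * (-2) ^ m * (I - ∑ k ∈ Finset.range r, C k * z ^ k) := fun I => by
        rw [mul_sub, Finset.mul_sum]
        simp only [mul_assoc]
      rw [this, norm_mul, norm_mul, norm_pow, norm_neg, Complex.norm_natCast, Complex.norm_ofNat]
      have hw : ((treeWords L).length : ℝ) ≤ childWeight (treeParent T) := by exact_mod_cast hwords
      calc (N : ℝ) * 2 ^ m * _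
          ≤ (N : ℝ) * 2 ^ m * (11700 * ((treeWords L).length * (N * 4 ^ (2 * L.length))) *
              ((m + 1 : ℕ) : ℝ) * (r ! : ℝ) * 51200 ^ r * ‖z‖ ^ r) := by
            gcongr
            exact h2 r z hz hz'
        _ ≤ (N : ℝ) * 2 ^ m * (11700 * (childWeight (treeParent T) * (N * 4 ^ (2 * L.length))) *
              ((m + 1 : ℕ) : ℝ) * (r ! : ℝ) * 51200 ^ r * ‖z‖ ^ r) := by gcongr
        _ = 11700 * (N ^ 2 * (m + 1) * childWeight (treeParent T) * 32 ^ m *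
              (51200 ^ r * (r ! : ℝ) * ‖z‖ ^ r)) := by
            rw [hlen, pow_mul, show (32 : ℝ) = 2 * 4 ^ 2 by norm_num, mul_pow]
            push_cast
            ring
        _ ≤ 46800 * (N ^ 2 * (m + 1) * childWeight (treeParent T) * 32 ^ m *
              (51200 ^ r * (r ! : ℝ) * ‖z‖ ^ r)) := by gcongr; norm_num
        _ = _ := by ring

end TreeExpansion

end

noncomputable section
open scoped ContDiff Matrix.Norms.L2Operator

/-! ### Borel summability of the tree series -/

section TreeSummability

variable {N : ℕ}

theorem isTree_of_mem_treesOn {n : ℕ} {T : SimpleGraph (Fin n)} (hT : T ∈ treesOn n) : T.IsTree := by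
  simpa [treesOn] using hT

/-- The contribution of the trees with `m` lines is `z ^ m` times a function with an asymptotic
expansion, and is bounded geometrically: the number of trees is compensated by the factorial. -/
theorem exists_treeTerm_expansion (hN : 1 ≤ N) (m : ℕ) :
    ∃ (f : ℂ → ℂ) (c : ℕ → ℂ), DifferentiableOn ℂ f {z : ℂ | 0 < z.re ∧ ‖z‖ < 1 / 2} ∧
      (∀ z : ℂ, 0 < z.re →
        (((m + 1)! : ℕ) : ℂ)⁻¹ * ∑ T ∈ treesOn (m + 1), treeAmplitude N z T = z ^ m * f z) ∧
      (∀ r z, 0 < z.re → ‖z‖ ≤ 1 / 2 → ‖f z - ∑ k ∈ Finset.range r, c k * z ^ k‖ ≤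
        46800 * N ^ 2 * 128 ^ m * (51200 ^ r * (r ! : ℝ) * ‖z‖ ^ r)) ∧
      ∀ z : ℂ, 0 < z.re → ‖z‖ ≤ 1 / 2 →
        (((m + 1)! : ℕ) : ℝ)⁻¹ * ∑ T ∈ treesOn (m + 1), ‖treeAmplitude N z T‖ ≤
          46800 * N ^ 2 * (128 * ‖z‖) ^ m := by
  have key : ∀ T : SimpleGraph (Fin (m + 1)), ∃ (h : ℂ → ℂ) (C : ℕ → ℂ), T ∈ treesOn (m + 1) →
      DifferentiableOn ℂ h {z : ℂ | 0 < z.re ∧ ‖z‖ < 1 / 2} ∧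
      (∀ z : ℂ, 0 < z.re → treeAmplitude N z T = z ^ m * h z) ∧
      ∀ r z, 0 < z.re → ‖z‖ ≤ 1 / 2 → ‖h z - ∑ k ∈ Finset.range r, C k * z ^ k‖ ≤
        46800 * N ^ 2 * (m + 1) * childWeight (treeParent T) * 32 ^ m *
          (51200 ^ r * (r ! : ℝ) * ‖z‖ ^ r) := by
    intro T
    by_cases hT : T ∈ treesOn (m + 1)
    · obtain ⟨h, C, h1⟩ := exists_treeAmplitude_expansion hN (isTree_of_mem_treesOn hT)
      exact ⟨h, C, fun _ => h1⟩
    · exact ⟨0, 0, fun h => absurd h hT⟩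
  choose h C hC using key
  have hfac : (0 : ℝ) < ((m + 1)! : ℕ) := by positivity
  have hcount : ∀ X : ℝ, 0 ≤ X → (((m + 1)! : ℕ) : ℝ)⁻¹ * ∑ T ∈ treesOn (m + 1),
      46800 * N ^ 2 * (m + 1) * childWeight (treeParent T) * 32 ^ m * X ≤
        46800 * N ^ 2 * 128 ^ m * X := by
    intro X hX
    rw [← Finset.sum_mul, ← Finset.sum_mul, ← Finset.mul_sum, inv_mul_le_iff₀ hfac]
    calc 46800 * (N : ℝ) ^ 2 * (m + 1) *
          (∑ T ∈ treesOn (m + 1), (childWeight (treeParent T) : ℝ)) * 32 ^ m * X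
        ≤ 46800 * (N : ℝ) ^ 2 * (m + 1) * (4 ^ m * m !) * 32 ^ m * X := by
          gcongr
          exact sum_childWeight_treeParent_le m
      _ = _ := by
          rw [Nat.factorial_succ, show (128 : ℝ) = 4 * 32 by norm_num, mul_pow]
          push_cast
          ring
  refine ⟨fun z => (((m + 1)! : ℕ) : ℂ)⁻¹ * ∑ T ∈ treesOn (m + 1), h T z,
    fun k => (((m + 1)! : ℕ) : ℂ)⁻¹ * ∑ T ∈ treesOn (m + 1), C T k, ?_, fun z hz => ?_,
    fun r z hz hz' => ?_, fun z hz hz' => ?_⟩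
  · exact (DifferentiableOn.fun_sum fun T hT => (hC T hT).1).const_mul _
  · rw [Finset.sum_congr rfl fun T hT => (hC T hT).2.1 z hz, ← Finset.mul_sum]
    ring
  · have h1 : (((m + 1)! : ℕ) : ℂ)⁻¹ * ∑ T ∈ treesOn (m + 1), h T z - ∑ k ∈ Finset.range r,
        ((((m + 1)! : ℕ) : ℂ)⁻¹ * ∑ T ∈ treesOn (m + 1), C T k) * z ^ k =
        (((m + 1)! : ℕ) : ℂ)⁻¹ * ∑ T ∈ treesOn (m + 1),
          (h T z - ∑ k ∈ Finset.range r, C T k * z ^ k) := by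
      rw [Finset.sum_sub_distrib, mul_sub, Finset.sum_comm, Finset.mul_sum (Finset.range r)]
      congr 1
      refine Finset.sum_congr rfl fun k _ => ?_
      rw [← Finset.sum_mul, mul_assoc]
    rw [h1, norm_mul, norm_inv, Complex.norm_natCast]
    refine (mul_le_mul_of_nonneg_left ?_ (by positivity)).trans (hcount _ (by positivity))
    exact norm_sum_le_of_le _ fun T hT => (hC T hT).2.2 r z hz hz'
  · refine (mul_le_mul_of_nonneg_left (Finset.sum_le_sum fun T hT => ?_) (by positivity)).trans
      ((hcount (‖z‖ ^ m) (by positivity)).trans_eq (by rw [mul_pow]; ring))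
    have h1 := (hC T hT).2.2 0 z hz hz'
    simp only [Finset.range_zero, Finset.sum_empty, sub_zero, pow_zero, Nat.factorial_zero,
      Nat.cast_one, mul_one] at h1
    rw [(hC T hT).2.1 z hz, norm_mul, norm_pow, mul_comm]
    gcongr

/-- The tree on a single vertex gives the average of the vertex function, which is of order
`√‖z‖`. -/
theorem norm_treeAmplitude_one_le (hN : 1 ≤ N) {T : SimpleGraph (Fin 1)} (hT : T.IsTree) {z : ℂ}
    (hz : 0 < z.re) : ‖treeAmplitude N z T‖ ≤
      2 * N ^ 2 * (1 + 3750 * N) * ‖Complex.sqrt (2 * z / (N : ℂ))‖ := by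
  set g := Complex.sqrt (2 * z / (N : ℂ)) with hgz
  have hg : ‖g‖ ≤ 2 * g.re := (sqrt_mem_sector (coupling_re_pos hN hz)).2
  have hl : lineList T = [] := by
    refine List.eq_nil_iff_forall_not_mem.2 fun e he => ?_
    rw [lineList_eq, Finset.mem_toList, mem_lines] at he
    have := he.1
    omega
  rw [treeAmplitude_eq hg hgz hT, forestAmplitude, hl]
  refine (norm_integral_le_of_norm_le_const (C := 2 * N ^ 2 * (1 + 3750 * N) * ‖g‖)
    (Eventually.of_forall fun w => ?_)).trans_eq (by simp)
  set S := linkWeight (extendWeight T fun e => w e) with hS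
  have hpos : S.PosSemidef := posSemidef_linkWeight _
  have hint := integrable_norm_fields_pow (N := N) hpos (2 * 1)
  have hle := integral_norm_fields_pow_le (N := N) le_rfl hN hpos (fun v => linkWeight_self _ v) 1
  have : IsProbabilityMeasure (fieldGaussian N S) := by unfold fieldGaussian; infer_instance
  refine (norm_integral_le_of_norm_le (μ := fieldGaussian N S)
    (((integrable_const (1 : ℝ)).add hint).const_mul (2 * N ^ 2 * ‖g‖))
    (Eventually.of_forall fun x => ?_)).trans ?_
  · have h1 := norm_vertex_le hg (fieldsCLM_mem 1 N x.ofLp 0)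
    have h2 : ‖fieldsCLM 1 N x.ofLp 0‖ ≤ ‖fieldsCLM 1 N x.ofLp‖ := norm_le_pi_norm _ 0
    have h3 : ‖fieldsCLM 1 N x.ofLp‖ ≤ 1 + ‖fieldsCLM 1 N x.ofLp‖ ^ (2 * 1) := by
      rw [mul_one]
      nlinarith [sq_nonneg (‖fieldsCLM 1 N x.ofLp‖ - 1)]
    rw [lineOperators_nil, fieldsOfCoords_eq, Fin.prod_univ_one]
    refine h1.trans ?_
    rw [mul_assoc (2 * (N : ℝ) ^ 2)]
    gcongr
    exact h2.trans h3
  · rw [integral_const_mul, integral_add' (integrable_const _) hint]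
    simp only [integral_const, probReal_univ, one_smul]
    have : (2 : ℝ) * N ^ 2 * (1 + 3750 * N) * ‖g‖ = 2 * N ^ 2 * ‖g‖ * (1 + 3750 * N) := by ring
    rw [this]
    gcongr
    refine hle.trans_eq ?_
    simp
    ring

/-- Everything that holds of the tree series at a fixed `N`, in the half-disk that contains the
Borel disk. -/
theorem treeSeries_expansion (hN : 1 ≤ N) :
    (∀ z : ℂ, 0 < z.re → ‖z‖ < 1 / 256 →
      TreeSeriesConverges N z ∧ Complex.exp (treeSeries N z) = partitionFunction N z) ∧
    Tendsto (treeSeries N) (𝓝[{z : ℂ | 0 < z.re ∧ ‖z‖ < 1 / 256}] 0) (𝓝 0) ∧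
    DifferentiableOn ℂ (treeSeries N) {z : ℂ | 0 < z.re ∧ ‖z‖ < 1 / 256} ∧
    ∃ a : ℕ → ℂ, ∀ r, ∀ z : ℂ, 0 < z.re → ‖z‖ < 1 / 256 →
      ‖treeSeries N z - ∑ k ∈ Finset.range r, a k * z ^ k‖ ≤
        93600 * N ^ 2 * 102400 ^ r * (r ! : ℝ) * ‖z‖ ^ r := by
  classical
  set U : Set ℂ := {z : ℂ | 0 < z.re ∧ ‖z‖ < 1 / 256} with hU
  have hUo : IsOpen U := isOpen_re_pos.inter (isOpen_lt continuous_norm continuous_const)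
  have hUhalf : ∀ z ∈ U, ‖z‖ ≤ 1 / 2 := fun z hz => hz.2.le.trans (by norm_num)
  -- the ratio `128 = 4 · 32`: `4` from the sum over trees, `32` from each line
  have hsmall : ∀ z ∈ U, 128 * ‖z‖ ≤ 1 / 2 := fun z hz => by linarith [hz.2]
  choose f c hd hf hexp habs using exists_treeTerm_expansion hN
  obtain ⟨hdiff, a, ha0, ha⟩ := exists_asymptotic_tsum (A := 46800 * N ^ 2) (b := 128) (s := 51200)
    hUo (by positivity) (by norm_num) (by norm_num) (by norm_num) hsmall
    (fun m => (hd m).mono fun z hz => ⟨hz.1, hz.2.trans (by norm_num)⟩)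
    (fun m r z hz => hexp m r z hz.1 (hUhalf z hz))
  have habs' : ∀ z ∈ U, ∀ n : ℕ, ((n ! : ℕ) : ℝ)⁻¹ * ∑ T ∈ treesOn n, ‖treeAmplitude N z T‖ ≤
      93600 * N ^ 2 * (1 / 2) ^ n := by
    intro z hz n
    rcases n with _ | m
    · simp only [treesOn_zero, Finset.sum_empty, mul_zero]
      positivity
    · refine (habs m z hz.1 (hUhalf z hz)).trans ?_
      calc 46800 * (N : ℝ) ^ 2 * (128 * ‖z‖) ^ m ≤ 46800 * (N : ℝ) ^ 2 * (1 / 2) ^ m := by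
            gcongr
            exact hsmall z hz
        _ = _ := by ring
  have hgeom : Summable fun n : ℕ => 93600 * (N : ℝ) ^ 2 * (1 / 2) ^ n :=
    (summable_geometric_of_lt_one (by norm_num) (by norm_num)).mul_left _
  have hnorm : ∀ z ∈ U, ∀ n : ℕ, ‖((n ! : ℕ) : ℂ)⁻¹ * ∑ T ∈ treesOn n, treeAmplitude N z T‖ ≤
      93600 * N ^ 2 * (1 / 2) ^ n := by
    intro z hz n
    rw [norm_mul, norm_inv, Complex.norm_natCast]
    exact (mul_le_mul_of_nonneg_left (norm_sum_le _ _) (by positivity)).trans (habs' z hz n)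
  have hseries : ∀ z ∈ U, treeSeries N z = ∑' m, z ^ m * f m z := by
    intro z hz
    rw [treeSeries, (hgeom.of_norm_bounded (hnorm z hz)).tsum_eq_zero_add]
    simp only [treesOn_zero, Finset.sum_empty, mul_zero, zero_add]
    exact tsum_congr fun m => hf m z hz.1
  refine ⟨fun z hz hz' => ⟨⟨fun n T hT => ?_, ?_⟩, ?_⟩, ?_, hdiff.congr hseries, a,
    fun r z hz hz' => ?_⟩
  · exact treeExpectation_integrable (sqrt_mem_sector (coupling_re_pos hN hz)).2 rfl
      (isTree_of_mem_treesOn hT)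
  · exact hgeom.of_nonneg_of_le (fun n => by positivity) (habs' z ⟨hz, hz'⟩)
  · rw [partitionFunction_eq hN hz]
    exact exp_treeSeries (sqrt_mem_sector (coupling_re_pos hN hz)).2 rfl (by norm_num) (by norm_num)
      (hnorm z ⟨hz, hz'⟩)
  · -- Up to `O(z)`, the tree series and its first term have the same limit `c 0 0`.
    set M : ℝ := ∑ T ∈ treesOn 1, 2 * N ^ 2 * (1 + 3750 * N) with hM
    set K : ℝ := 93600 * N ^ 2 * 102400 + 46800 * N ^ 2 * 51200 with hK
    refine squeeze_zero_norm' (a := fun z => M * √(2 * ‖z‖ / N) + K * ‖z‖) ?_ ?_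
    · filter_upwards [self_mem_nhdsWithin] with z hz
      have h1 := ha 1 z hz
      have h2 := hexp 0 1 z hz.1 (hUhalf z hz)
      simp only [Finset.sum_range_one, pow_zero, mul_one, pow_one, Nat.factorial_one, Nat.cast_one,
        ha0] at h1 h2
      rw [← hseries z hz] at h1
      have h3 : ‖f 0 z‖ ≤ M * √(2 * ‖z‖ / N) := by
        have h4 := hf 0 z hz.1
        simp only [zero_add, Nat.factorial_one, Nat.cast_one, inv_one, one_mul, pow_zero] at h4
        rw [← h4, hM, Finset.sum_mul, ← norm_coupling hN hz.1, Real.sqrt_sq (norm_nonneg _)]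
        exact norm_sum_le_of_le _ fun T hT =>
          norm_treeAmplitude_one_le hN (isTree_of_mem_treesOn hT) hz.1
      have h5 : treeSeries N z = (treeSeries N z - c 0 0) - (f 0 z - c 0 0) + f 0 z := by ring
      rw [h5]
      refine (norm_add_le _ _).trans ((add_le_add_left (norm_sub_le _ _) _).trans ?_)
      rw [hK]
      linarith
    · have h1 : Continuous fun z : ℂ => M * √(2 * ‖z‖ / N) + K * ‖z‖ := by fun_prop
      have h2 := h1.tendsto 0
      simp only [mul_zero, zero_div, norm_zero, add_zero, Real.sqrt_zero] at h2
      exact h2.mono_left nhdsWithin_le_nhds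
  · rw [hseries z ⟨hz, hz'⟩]
    refine (ha r z ⟨hz, hz'⟩).trans_eq ?_
    rw [show (2 : ℝ) * 51200 = 102400 by norm_num]
    ring

end TreeSummability

end

theorem mainTheorem3 :
    UniformlyBorelSummable partitionFunction ∧
    ∃ R : ℝ, 0 < R ∧ ∃ s : ℝ, 0 ≤ s ∧ ∃ K : ℝ, 0 ≤ K ∧
      (∀ N : ℕ, 1 ≤ N → ∀ z ∈ borelDisk R,
        TreeSeriesConverges N z ∧ Complex.exp (treeSeries N z) = partitionFunction N z) ∧
      (∀ N : ℕ, 1 ≤ N → Tendsto (treeSeries N) (𝓝[borelDisk R] 0) (𝓝 0)) ∧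
      HasBorelBounds treeSeries R s (fun N => K * (N : ℝ) ^ 2) := by
  have hR : (0 : ℝ) < 1 / 256 := by norm_num
  have hsub : borelDisk (1 / 256) ⊆ {z : ℂ | 0 < z.re ∧ ‖z‖ < 1 / 256} :=
    fun z hz => re_pos_of_mem_borelDisk hR hz
  refine ⟨hasBorelBounds_partitionFunction, 1 / 256, hR, 102400, by norm_num, 93600, by norm_num,
    fun N hN z hz => ?_, fun N hN => ?_, fun N hN => ?_⟩
  · exact (treeSeries_expansion hN).1 z (hsub hz).1 (hsub hz).2
  · exact (treeSeries_expansion hN).2.1.mono_left (nhdsWithin_mono 0 hsub)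
  · obtain ⟨-, -, hd, a, ha⟩ := treeSeries_expansion hN
    exact ⟨(hd.mono hsub).analyticOnNhd (isOpen_borelDisk hR), a,
      fun r z hz => ha r z (hsub hz).1 (hsub hz).2⟩
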